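/- Let $(M,g)$ be a smooth pseudo-Riemannian manifold of dimension $n$ and arbitrary signature, with Levi-Civita connection $\nabla$. Let $X_a$ be a local frame, $e^a$ its dual coframe, $X^a=g^{ab}X_b$, and write $\lrcorner$ for the inner derivative, $v\mapsto v^\flat$ for the metric isomorphism, and $\pi$ and $\eta$ for the degree and parity operators: $\pi\omega=p\,\omega$, $\eta\omega=(-1)^p\omega$ on $p$-forms. Let $S\to M$ be a bundle of spinors: a nonzero vector bundle with a Clifford multiplication satisfying $\gamma_a\gamma_b+\gamma_b\gamma_a=2g_{ab}$ and with the spin connection, so that locally there are an orthonormal frame of $TM$ and a frame of $S$ in which the $\gamma_a$ are constant matrices and $\nabla_a\psi=\partial_a\psi+\tfrac14\omega_{abc}\gamma^b\gamma^c\psi$, $\omega_{abc}=g(X_b,\nabla_{X_a}X_c)$. A $k$-form $\alpha$ acts on spinors as $\tfrac1{k!}\alpha_{a_1\dots a_k}\gamma^{a_1}\cdots\gamma^{a_k}$. A Killing-Yano (KY) $p$-form, $p\ge1$, is a smooth $p$-form $\omega$ with $$\nabla_v\omega-\tfrac1{p+1}\,v\lrcorner d\omega+\tfrac1{n-p+1}\,v^\flat\wedge\delta\omega=0\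 \text{ for all } v,\qquad \delta\omega=0,$$ where $d=e^a\wedge\nabla_{X_a}$ and $\delta=-X^a\lrcorner\nabla_{X_a}$. Its operator on spinor fields is $$K_\omega=(X^a\lrcorner\omega)\nabla_{X_a}+\tfrac{\pi-1}{2\pi}\,d\omega .$$ For a $p$-form $\kappa$ and a $q$-form $\lambda$ put $\{K_\kappa,K_\lambda\}=K_\kappa K_\lambda-(-1)^{(p-1)(q-1)}K_\lambda K_\kappa$. A graded KY bracket of $\kappa$ and $\lambda$ is a KY $(p+q-1)$-form $\omega$ such that $\{K_\kappa,K_\lambda\}=K_\omega$ on all smooth local spinor fields. Contracted exterior products are defined by $\alpha\wedge_0\beta=\alpha\wedge\beta$ and $\alpha\wedge_{m+1}\beta=(X_a\lrcorner\alpha)\wedge_m(X^a\lrcorner\beta)$. The Schouten-Nijenhuis bracket of a $p$-form $\alpha$ and a $q$-form $\beta$ is the $(p+q-1)$-form $$([\alpha,\beta]_{SN})_{a_1\dots a_{p+q-1}}=p\,\alpha^{b}{}_{[a_1\dots a_{p-1}}\nabla_{|b|}\beta_{a_p\dots a_{p+q-1}]}+(-1)^{pq}\,q\,\beta^{b}{}_{[a_1\dots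 a_{q-1}}\nabla_{|b|}\alpha_{a_q\dots a_{p+q-1}]},$$ where the brackets denote the average over all signed permutations. Let $p,q\ge1$, let $\kappa$ be a KY $p$-form and $\lambda$ a KY $q$-form satisfying the algebraic conditions $$(X^{(a}\lrcorner\kappa)\wedge_{2k+1}(X^{b)}\lrcorner\lambda)=0,\qquad k=0,1,2,\dots,$$ and put $$\nu=-\frac{(p+q-2)!}{(p-1)!\,(q-1)!}\,[\eta\kappa,\lambda]_{SN}.$$ Then: 1. The Schouten-Nijenhuis bracket $[\kappa,\lambda]_{SN}$ is again a KY form. 2. Unless $p=q$ with $p$ even, $\nu$ is a graded KY bracket of $\kappa$ and $\lambda$: it is a KY form and $\{K_\kappa,K_\lambda\}=K_\nu$. 3. In all cases there is a locally constant function $f$ on $M$ with $\{K_\kappa,K_\lambda\}\psi=K_\nu\psi+f\psi$ for all smooth local spinor fields $\psi$. 4. In all cases, every graded KY bracket of $\kappa$ and $\lambda$ is equal to $\nu$. -/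

import Mathlib

open Bundle Module
open scoped Manifold ContDiff Nat

noncomputable section

namespace KYForms

/-! ### Multilinear algebra on one vector space

A `k`-tensor on `V` is a function of `k` vectors. All tensors to which the operations below are
applied are alternating and multilinear. -/

section Algebra

variable {V : Type*}

/-- The inner derivative `v ⌟ α`: contraction of `v` with the first slot. -/
def hook {k : ℕ} (v : V) (α : (Fin (k + 1) → V) → ℝ) : (Fin k → V) → ℝ :=
  fun w => α (Fin.cons v w)

/-- The exterior product, in the convention
`(α ∧ β)_{a…b…} = ((r+s)!/(r! s!)) α_{[a…} β_{b…]}`. -/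
def wedge {r s : ℕ} (α : (Fin r → V) → ℝ) (β : (Fin s → V) → ℝ) : (Fin (r + s) → V) → ℝ :=
  fun w => (1 / ((r ! : ℝ) * (s ! : ℝ))) * ∑ σ : Equiv.Perm (Fin (r + s)),
    ((Equiv.Perm.sign σ : ℤ) : ℝ) *
      (α (fun i => w (σ (Fin.castAdd s i))) * β (fun j => w (σ (Fin.natAdd r j))))

/-- The contracted exterior product `α ∧ₘ β`, defined inductively by `α ∧₀ β = α ∧ β` and
`α ∧ₘ₊₁ β = ∑ₐ (Xₐ ⌟ α) ∧ₘ (Xᵃ ⌟ β)`; here `e` is a basis `Xₐ` and `e'` the dual basis `Xᵃ` with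
respect to the metric. -/
def cwedge {n : ℕ} (e e' : Fin n → V) : (m : ℕ) → {r s : ℕ} →
    ((Fin (r + m) → V) → ℝ) → ((Fin (s + m) → V) → ℝ) → ((Fin (r + s) → V) → ℝ)
  | 0, _, _, α, β => wedge α β
  | m + 1, _, _, α, β => ∑ a, cwedge e e' m (hook (e a) α) (hook (e' a) β)

/-- A `k`-tensor regarded as an `l`-tensor, where `k = l`. -/
def castDeg {k l : ℕ} (h : k = l) (α : (Fin k → V) → ℝ) : (Fin l → V) → ℝ :=
  fun w => α (fun i => w (Fin.cast h i))

/-- Total antisymmetrisation `t_{[a₁…aₘ]}` (the average over all permutations). -/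
def antisymmetrize {m : ℕ} (t : (Fin m → V) → ℝ) : (Fin m → V) → ℝ :=
  fun w => (1 / (m ! : ℝ)) * ∑ σ : Equiv.Perm (Fin m),
    ((Equiv.Perm.sign σ : ℤ) : ℝ) * t (fun i => w (σ i))

end Algebra

variable {n : ℕ} {M : Type*} [TopologicalSpace M] [ChartedSpace (EuclideanSpace ℝ (Fin n)) M]

/-! ### Pseudo-Riemannian manifolds -/

variable (n M) in
/-- A smooth pseudo-Riemannian metric (of arbitrary signature) on the `n`-manifold `M`. -/
structure PseudoMetric [IsManifold (𝓡 n) ∞ M] where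
  val : ∀ x : M, TangentSpace (𝓡 n) x →L[ℝ] TangentSpace (𝓡 n) x →L[ℝ] ℝ
  symm : ∀ (x : M) (v w : TangentSpace (𝓡 n) x), val x v w = val x w v
  nondegenerate : ∀ (x : M) (v : TangentSpace (𝓡 n) x), (∀ w, val x v w = 0) → v = 0
  smooth : ContMDiff (𝓡 n)
    ((𝓡 n).prod 𝓘(ℝ, EuclideanSpace ℝ (Fin n) →L[ℝ] EuclideanSpace ℝ (Fin n) →L[ℝ] ℝ)) ∞
    (fun x => TotalSpace.mk' (EuclideanSpace ℝ (Fin n) →L[ℝ] EuclideanSpace ℝ (Fin n) →L[ℝ] ℝ)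
      (E := fun x => TangentSpace (𝓡 n) x →L[ℝ] TangentSpace (𝓡 n) x →L[ℝ] ℝ) x (val x))

variable (n) in
/-- A basis `X_a` of the tangent space at `x`. Every use below is a contraction over `a` with the
dual basis `X^a`, which does not depend on the choice of the basis. -/
def frame (x : M) : Basis (Fin n) ℝ (TangentSpace (𝓡 n) x) :=
  (EuclideanSpace.basisFun (Fin n) ℝ).toBasis

variable [IsManifold (𝓡 n) ∞ M]

/-- The metric at a point as a bilinear form. -/
def PseudoMetric.bilin (g : PseudoMetric n M) (x : M) :
    LinearMap.BilinForm ℝ (TangentSpace (𝓡 n) x) :=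
  LinearMap.mk₂ ℝ (fun v w => g.val x v w) (by simp) (by simp) (by simp) (by simp)

theorem PseudoMetric.bilin_nondegenerate (g : PseudoMetric n M) (x : M) :
    (g.bilin x).Nondegenerate := by
  constructor
  · intro v hv
    exact g.nondegenerate x v hv
  · intro v hv
    exact g.nondegenerate x v (fun w => by rw [g.symm]; exact hv w)

/-- The dual basis `X^a = g^{ab} X_b` of the tangent space: `g (X^a) (X_b) = δ^a_b`. -/
def PseudoMetric.coframe (g : PseudoMetric n M) (x : M) :
    Basis (Fin n) ℝ (TangentSpace (𝓡 n) x) :=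
  (g.bilin x).dualBasis (g.bilin_nondegenerate x) (frame n x)

/-- `D` is the Levi-Civita connection of `g`: torsion free and metric.
(`D Y x v` is the covariant derivative of `Y` in the direction `v` at `x`.) -/
def IsLeviCivita (g : PseudoMetric n M)
    (D : CovariantDerivative (𝓡 n) (EuclideanSpace ℝ (Fin n)) (TangentSpace (𝓡 n) : M → Type _)) :
    Prop :=
  (∀ (X Y : ∀ x : M, TangentSpace (𝓡 n) x) (x : M),
    MDifferentiableAt (𝓡 n) (𝓡 n).tangent (fun y => (⟨y, X y⟩ : TangentBundle (𝓡 n) M)) x →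
    MDifferentiableAt (𝓡 n) (𝓡 n).tangent (fun y => (⟨y, Y y⟩ : TangentBundle (𝓡 n) M)) x →
      D Y x (X x) - D X x (Y x) = VectorField.mlieBracket (𝓡 n) X Y x) ∧
  (∀ (Y Z : ∀ x : M, TangentSpace (𝓡 n) x) (x : M) (v : TangentSpace (𝓡 n) x),
    MDifferentiableAt (𝓡 n) (𝓡 n).tangent (fun y => (⟨y, Y y⟩ : TangentBundle (𝓡 n) M)) x →
    MDifferentiableAt (𝓡 n) (𝓡 n).tangent (fun y => (⟨y, Z y⟩ : TangentBundle (𝓡 n) M)) x →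
      mvfderiv (𝓡 n) (fun y => g.val y (Y y) (Z y)) x v =
        g.val x (D Y x v) (Z x) + g.val x (Y x) (D Z x v))

/-! ### Differential forms -/

variable (n M) in
/-- Covariant tensor fields of degree `k`, as functions of `k` tangent vectors at each point. -/
abbrev TField (k : ℕ) : Type _ := ∀ x : M, (Fin k → TangentSpace (𝓡 n) x) → ℝ

/-- `θ` is a smooth differential `k`-form: alternating and multilinear at each point, and smooth
on all smooth local vector fields. -/
def IsDiffForm {k : ℕ} (θ : TField n M k) : Prop :=
  (∀ x : M, ∃ A : TangentSpace (𝓡 n) x [⋀^Fin k]→ₗ[ℝ] ℝ, ∀ w, θ x w = A w) ∧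
  (∀ (U : Set M) (X : Fin k → ∀ x : M, TangentSpace (𝓡 n) x), IsOpen U →
    (∀ i, ContMDiffOn (𝓡 n) (𝓡 n).tangent ∞ (fun x => (⟨x, X i x⟩ : TangentBundle (𝓡 n) M)) U) →
      ContMDiffOn (𝓡 n) 𝓘(ℝ, ℝ) ∞ (fun x => θ x (fun i => X i x)) U)

/-- The parity operator `η θ = (-1)^k θ` on `k`-forms. -/
def parity {k : ℕ} (θ : TField n M k) : TField n M k := fun x w => (-1) ^ k * θ x w

section Connection

variable (g : PseudoMetric n M)
  (D : CovariantDerivative (𝓡 n) (EuclideanSpace ℝ (Fin n)) (TangentSpace (𝓡 n) : M → Type _))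

/-- The covariant derivative `(∇_v θ)(w₁, …, w_k) = v(θ(W₁, …, W_k)) - ∑ᵢ θ(…, ∇_v Wᵢ, …)`, where
the `Wᵢ` are local vector fields extending the vectors `wᵢ`. -/
def covDeriv {k : ℕ} (θ : TField n M k) (x : M) (v : TangentSpace (𝓡 n) x) :
    (Fin k → TangentSpace (𝓡 n) x) → ℝ :=
  fun w =>
    mvfderiv (𝓡 n)
      (fun y => θ y (fun i => FiberBundle.extend (EuclideanSpace ℝ (Fin n)) (w i) y)) x v -
    ∑ i, θ x (Function.update w i (D (FiberBundle.extend (EuclideanSpace ℝ (Fin n)) (w i)) x v))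

/-- The exterior derivative `d θ = eᵃ ∧ ∇ₐ θ`. -/
def extD {k : ℕ} (θ : TField n M k) : TField n M (k + 1) :=
  fun x w => ∑ i : Fin (k + 1),
    (-1) ^ (i : ℕ) * covDeriv D θ x (w i) (fun j => w (i.succAbove j))

/-- The co-differential `δ θ = - Xᵃ ⌟ ∇ₐ θ`. -/
def codiff {k : ℕ} (θ : TField n M (k + 1)) : TField n M k :=
  fun x w => - ∑ a, hook (g.coframe x a) (covDeriv D θ x (frame n x a)) w

/-- Conformal Killing-Yano `p`-forms, `p = k + 1`: smooth forms in the kernel of the twistor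
operator, `∇_v θ - (1/(p+1)) v ⌟ dθ + (1/(n-p+1)) v♭ ∧ δθ = 0`. -/
def IsCKY {k : ℕ} (θ : TField n M (k + 1)) : Prop :=
  IsDiffForm θ ∧ ∀ (x : M) (v : TangentSpace (𝓡 n) x) (w : Fin (k + 1) → TangentSpace (𝓡 n) x),
    covDeriv D θ x v w - (1 / ((k : ℝ) + 1 + 1)) * hook v (extD D θ x) w
      + (1 / ((n : ℝ) - ((k : ℝ) + 1) + 1)) * ∑ i : Fin (k + 1),
          (-1) ^ (i : ℕ) * (g.val x v (w i) * codiff g D θ x (fun j => w (i.succAbove j))) = 0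

/-- Killing-Yano forms of positive degree: co-closed conformal Killing-Yano forms. -/
def IsKY {k : ℕ} (θ : TField n M (k + 1)) : Prop :=
  IsCKY g D θ ∧ ∀ x w, codiff g D θ x w = 0

/-- The Schouten-Nijenhuis bracket of a `P`-form `α` and a `Q`-form `β`, `P = p + 1`, `Q = q + 1`:
the `(P+Q-1)`-form with components
`P α^b_{[a₁…} ∇_{|b|} β_{…]} + (-1)^{PQ} Q β^b_{[a₁…} ∇_{|b|} α_{…]}`. -/
def snBracket {p q : ℕ} (α : TField n M (p + 1)) (β : TField n M (q + 1)) :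
    TField n M (p + q + 1) :=
  fun x => antisymmetrize (fun w =>
    ((p : ℝ) + 1) * ∑ a, hook (g.coframe x a) (α x) (fun i => w ⟨i, by omega⟩) *
        covDeriv D β x (frame n x a) (fun j => w ⟨p + j, by omega⟩)
    + (-1) ^ ((p + 1) * (q + 1)) * (((q : ℝ) + 1) *
        ∑ a, hook (g.coframe x a) (β x) (fun i => w ⟨i, by omega⟩) *
          covDeriv D α x (frame n x a) (fun j => w ⟨q + j, by omega⟩)))

/-- The algebraic conditions `(X^{(a} ⌟ κ) ∧_{2k+1} (X^{b)} ⌟ λ) = 0`, `k = 0, 1, …`, for forms of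
degrees `p + 1` and `q + 1`. A contracted product of order exceeding one of the degrees `p`, `q`
of `X^a ⌟ κ`, `X^b ⌟ λ` is zero, so only the orders `m = 2k + 1` with `p = r + m` and `q = s + m`
matter. -/
def AlgebraicConditions {p q : ℕ} (κ : TField n M (p + 1)) (μ : TField n M (q + 1)) : Prop :=
  ∀ (k r s : ℕ) (hp : p = r + (2 * k + 1)) (hq : q = s + (2 * k + 1)) (x : M)
    (u v : TangentSpace (𝓡 n) x),
    cwedge (frame n x) (g.coframe x) (2 * k + 1)
        (castDeg hp (hook u (κ x))) (castDeg hq (hook v (μ x))) +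
      cwedge (frame n x) (g.coframe x) (2 * k + 1)
        (castDeg hp (hook v (κ x))) (castDeg hq (hook u (μ x))) = 0

end Connection

/-! ### Spinors and first-order operators -/

section Spinors

variable {F : Type*} [NormedAddCommGroup F] [NormedSpace ℝ F] [FiniteDimensional ℝ F]
  {S : M → Type*} [TopologicalSpace (TotalSpace F S)]
  [∀ x, AddCommGroup (S x)] [∀ x, Module ℝ (S x)] [∀ x, TopologicalSpace (S x)]
  [∀ x, IsTopologicalAddGroup (S x)] [∀ x, ContinuousSMul ℝ (S x)]
  [FiberBundle F S] [VectorBundle ℝ F S]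

/-- `S`, with Clifford multiplication `c` and connection `DS`, is a bundle of spinors over the
pseudo-Riemannian manifold with metric `g` and Levi-Civita connection `D`: the Clifford relation
`c(v)² = g(v,v)` holds, and around each point there are an orthonormal frame `e` of `TM` and a
frame `s` of `S` in which the gamma matrices are constant and `DS` is the spin connection
`∇_v s = ¼ ω_{abc} v^a γ^b γ^c s`, `ω_{abc} v^a = g(e_b, ∇_v e_c)`. -/
structure IsSpinorBundle (g : PseudoMetric n M)
    (D : CovariantDerivative (𝓡 n) (EuclideanSpace ℝ (Fin n)) (TangentSpace (𝓡 n) : M → Type _))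
    (c : ∀ x : M, TangentSpace (𝓡 n) x →ₗ[ℝ] Module.End ℝ (S x))
    (DS : CovariantDerivative (𝓡 n) F S) : Prop where
  clifford : ∀ (x : M) (v : TangentSpace (𝓡 n) x),
    c x v * c x v = g.val x v v • (1 : Module.End ℝ (S x))
  spinFrame : ∀ x₀ : M, ∃ (U : Set M) (e : Fin n → ∀ x : M, TangentSpace (𝓡 n) x)
    (ε : Fin n → ℝ) (s : Fin (finrank ℝ F) → ∀ x : M, S x)
    (γ : Fin n → Matrix (Fin (finrank ℝ F)) (Fin (finrank ℝ F)) ℝ),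
    IsOpen U ∧ x₀ ∈ U ∧
    IsLocalFrameOn (𝓡 n) (EuclideanSpace ℝ (Fin n)) ∞ e U ∧
    IsLocalFrameOn (𝓡 n) F ∞ s U ∧
    (∀ a, ε a = 1 ∨ ε a = -1) ∧
    ∀ x ∈ U,
      (∀ a b, g.val x (e a x) (e b x) = if a = b then ε a else 0) ∧
      (∀ a B, c x (e a x) (s B x) = ∑ A, γ a A B • s A x) ∧
      (∀ (v : TangentSpace (𝓡 n) x) (B : Fin (finrank ℝ F)), DS (s B) x v =
        (1 / 4 : ℝ) • ∑ a, ∑ b, (ε a * ε b * g.val x (e a x) (D (e b) x v)) •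
          c x (e a x) (c x (e b x) (s B x)))

variable (g : PseudoMetric n M)
  (D : CovariantDerivative (𝓡 n) (EuclideanSpace ℝ (Fin n)) (TangentSpace (𝓡 n) : M → Type _))
  (c : ∀ x : M, TangentSpace (𝓡 n) x →ₗ[ℝ] Module.End ℝ (S x))
  (DS : CovariantDerivative (𝓡 n) F S)

/-- The Clifford action `(1/k!) θ_{a₁…a_k} γ^{a₁} ⋯ γ^{a_k}` of a `k`-form on spinors. -/
def slash {k : ℕ} (x : M) (θ : (Fin k → TangentSpace (𝓡 n) x) → ℝ) : Module.End ℝ (S x) :=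
  (1 / (k ! : ℝ)) • ∑ A : Fin k → Fin n,
    θ (fun i => frame n x (A i)) • (List.ofFn (fun i => c x (g.coframe x (A i)))).prod

/-- The operator `K_θ = (Xᵃ ⌟ θ) ∇ₐ + ((π-1)/(2π)) dθ` of a form `θ` of degree `k + 1`, acting on
spinor fields; on `dθ` the degree operator `π` is `k + 2`. -/
def opK {k : ℕ} (θ : TField n M (k + 1)) (ψ : ∀ x : M, S x) : ∀ x : M, S x :=
  fun x =>
    ∑ a, slash g c x (hook (g.coframe x a) (θ x)) (DS ψ x (frame n x a)) +
    (((k : ℝ) + 1) / (2 * ((k : ℝ) + 2))) • slash g c x (extD D θ x) (ψ x)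

/-- The graded commutator `K_κ K_μ - (-1)^{(P-1)(Q-1)} K_μ K_κ` for forms of degrees `P = p + 1`,
`Q = q + 1`: the operator of a `P`-form has the Clifford parity of `P - 1`. -/
def gradedComm {p q : ℕ} (κ : TField n M (p + 1)) (μ : TField n M (q + 1)) (ψ : ∀ x : M, S x) :
    ∀ x : M, S x :=
  fun x => opK g D c DS κ (opK g D c DS μ ψ) x
    - ((-1 : ℝ) ^ (p * q)) • opK g D c DS μ (opK g D c DS κ ψ) x

/-- The `(P+Q-1)`-form `θ` is a graded Killing-Yano bracket of the `P`-form `κ` and the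
`Q`-form `μ` (`P = p + 1`, `Q = q + 1`): it is Killing-Yano and the graded commutator of `K_κ` and
`K_μ` is `K_θ`, as operators on smooth local spinor fields. -/
def IsGradedKYBracket {p q : ℕ} (κ : TField n M (p + 1)) (μ : TField n M (q + 1))
    (θ : TField n M (p + q + 1)) : Prop :=
  IsKY g D θ ∧
  ∀ (U : Set M) (ψ : ∀ x : M, S x), IsOpen U →
    ContMDiffOn (𝓡 n) ((𝓡 n).prod 𝓘(ℝ, F)) ∞ (fun x => TotalSpace.mk' F x (ψ x)) U →
    ∀ x ∈ U, gradedComm g D c DS κ μ ψ x = opK g D c DS θ ψ x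

end Spinors

end KYForms

end

/-! Forms act on spinors through the Clifford algebra, and degrees can be recognised there without
faithfulness of the representation. Contraction with a frame vector is the graded commutator with a
gamma matrix (`hk`), the sum of the γ^a X_a⌟ is the degree operator (`pk`), and on words of a fixed
parity and length at most k its only eigenvalues are k, k - 2, … (`eq_zero_of_pk_eq`). Hence
products decompose uniquely into homogeneous parts, and the part of degree i + j - 2m of αβ is a
nonzero multiple of α ∧_m β (`sum_comp_hk`, `clf_acwedge`). Exchanging the factors multiplies this
part by (-1)^{ij+m} (`comp_swap`): graded commutators see the odd orders m, graded anticommutators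
the even ones.

A Killing-Yano form satisfies ∇_a κ = X_a ⌟ κ' with κ' a multiple of dκ. Its integrability condition
and the Bianchi identity show that K_κ graded commutes with the Dirac operator (`IsKY.dirac_kyOp`),
and therefore so does the graded commutator of K_κ and K_μ. The algebraic conditions reduce the
second-order part of this commutator to a curvature term (`kyComm_eq`), leaving a first-order
operator B^a ∇_a + C. Commuting with the Dirac operator forces X_a ⌟ B_b to be antisymmetric. Such a
symbol is determined by its trace γ^b B_b, because `pk` does not have the eigenvalue -1.

The conditions also make the graded anticommutator of κ and μ homogeneous. Differentiating it shows
that a combination of graded commutators of κ', μ and κ, μ' is homogeneous (`snElt_deg`); this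
combination is a multiple of the Schouten-Nijenhuis bracket, and the trace of the symbol is a
multiple of it (`symbol_trace_identity`). So B_b = X_b ⌟ β with β a multiple of the bracket. The
next symbol equation says that β is Killing-Yano and that C is the zeroth-order part of K_β plus a
function r (`exists_isKY_of_symbol`); commutation with the Dirac operator makes r constant. All this
is `exists_kyComm_eq`.

If the sum of the degrees is odd, parity excludes r. Otherwise the trace over spinors is used:
degrees are orthogonal, dκ' = 0, and the Bianchi identity holds, so C is traceless and r = 0, unless
the degrees are equal and even (`trace_commZero`). In that last case the argument gives only the
constancy of r. Uniqueness of the bracket holds in all cases because the symbol alone determines the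
form (`eq_of_arrOp`).

The algebra is carried out over the ring of smooth functions on an open set with an orthonormal
frame, a spin frame and coordinates (`SpinData`, `SpinChart`); multiplication by coordinates
extracts symbols of operators. The local scalars r are glued by uniqueness of the defect. -/

noncomputable section

set_option linter.unusedSectionVars false

namespace KYForms

/-! ### Contraction and degree operators on an algebra generated by gamma matrices -/

/-- The sign `(-1)^k`. -/
def sg (k : ℤ) : ℝ := (-1) ^ k

@[simp] theorem sg_zero : sg 0 = 1 := by simp [sg]

theorem sg_add (i j : ℤ) : sg (i + j) = sg i * sg j := zpow_add₀ (by norm_num) i j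

@[simp] theorem sg_one : sg 1 = -1 := by simp [sg]

@[simp] theorem sg_neg (i : ℤ) : sg (-i) = sg i := by
  rw [sg, sg, zpow_neg, ← inv_zpow]
  norm_num

theorem sg_sub (i j : ℤ) : sg (i - j) = sg i * sg j := by
  rw [sub_eq_add_neg, sg_add, sg_neg]

@[simp] theorem sg_two : sg 2 = 1 := by simp [sg]

@[simp] theorem sg_mul_self (i : ℤ) : sg i * sg i = 1 := by
  rw [← sg_add, sg, Even.neg_one_zpow ⟨i, rfl⟩]

theorem sg_natCast (k : ℕ) : sg k = (-1) ^ k := zpow_natCast _ _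

theorem sg_even {i : ℤ} (h : Even i) : sg i = 1 := Even.neg_one_zpow h

theorem sg_odd {i : ℤ} (h : Odd i) : sg i = -1 := Odd.neg_one_zpow h

theorem sg_eq_of_even_sub {i j : ℤ} (h : Even (i - j)) : sg i = sg j := by
  have := sg_even h
  rw [sg_sub] at this
  calc sg i = sg i * sg j * sg j := by rw [mul_assoc, sg_mul_self, mul_one]
    _ = sg j := by rw [this, one_mul]

/-- Gamma matrices of an orthonormal frame with `g(eₐ, eₐ) = εₐ`. -/
structure CliffordFrame {n : ℕ} {A : Type*} [Ring A] [Algebra ℝ A] (ε : Fin n → ℝ)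
    (γ : Fin n → A) : Prop where
  sq : ∀ a, ε a * ε a = 1
  rel : ∀ a b, γ a * γ b + γ b * γ a = (if a = b then 2 * ε a else 0) • (1 : A)

section PiCalculus

variable {n : ℕ} {A : Type*} [Ring A] [Algebra ℝ A] {ε : Fin n → ℝ} {γ : Fin n → A}

/-- The inner derivative `Xₐ ⌟ α` on elements of parity `k`. -/
def hk (γ : Fin n → A) (k : ℤ) (a : Fin n) (α : A) : A :=
  (1 / 2 : ℝ) • (γ a * α - sg k • (α * γ a))

/-- The degree operator on elements of parity `k`. -/
def pk (ε : Fin n → ℝ) (γ : Fin n → A) (k : ℤ) (α : A) : A :=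
  ∑ a, ε a • (γ a * hk γ k a α)

theorem hk_add (k : ℤ) (a : Fin n) (α β : A) : hk γ k a (α + β) = hk γ k a α + hk γ k a β := by
  simp only [hk, mul_add, add_mul]; module

theorem hk_smul (k : ℤ) (a : Fin n) (r : ℝ) (α : A) : hk γ k a (r • α) = r • hk γ k a α := by
  simp only [hk, mul_smul_comm, smul_mul_assoc]; module

@[simp] theorem hk_zero (k : ℤ) (a : Fin n) : hk γ k a 0 = 0 := by simp [hk]

theorem hk_neg (k : ℤ) (a : Fin n) (α : A) : hk γ k a (-α) = -hk γ k a α := by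
  simp only [hk, mul_neg, neg_mul]; module

theorem hk_sub (k : ℤ) (a : Fin n) (α β : A) : hk γ k a (α - β) = hk γ k a α - hk γ k a β := by
  simp only [hk, mul_sub, sub_mul]; module

theorem hk_sum {ι : Type*} (t : Finset ι) (k : ℤ) (a : Fin n) (α : ι → A) :
    hk γ k a (∑ i ∈ t, α i) = ∑ i ∈ t, hk γ k a (α i) :=
  map_sum (AddMonoidHom.mk' (hk γ k a) (hk_add k a)) α t

/-- Only the parity of the index matters; it is kept as an integer so that it can be compared with
the eigenvalue of `pk`. -/
theorem hk_congr {i j : ℤ} (h : Even (i - j)) (a : Fin n) (α : A) :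
    hk γ i a α = hk γ j a α := by rw [hk, hk, sg_eq_of_even_sub h]

theorem pk_congr {i j : ℤ} (h : Even (i - j)) (α : A) :
    pk ε γ i α = pk ε γ j α := by simp only [pk, hk_congr h]

theorem pk_add (k : ℤ) (α β : A) : pk ε γ k (α + β) = pk ε γ k α + pk ε γ k β := by
  simp only [pk, hk_add, mul_add, smul_add, Finset.sum_add_distrib]

theorem pk_smul (k : ℤ) (r : ℝ) (α : A) : pk ε γ k (r • α) = r • pk ε γ k α := by
  simp only [pk, hk_smul, mul_smul_comm, Finset.smul_sum]
  exact Finset.sum_congr rfl fun a _ => smul_comm _ _ _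

@[simp] theorem pk_zero (k : ℤ) : pk ε γ k 0 = 0 := by simp [pk]

theorem pk_neg (k : ℤ) (α : A) : pk ε γ k (-α) = -pk ε γ k α := by
  simpa using pk_smul (ε := ε) (γ := γ) k (-1) α

theorem pk_sub (k : ℤ) (α β : A) : pk ε γ k (α - β) = pk ε γ k α - pk ε γ k β := by
  rw [sub_eq_add_neg, pk_add, pk_neg, sub_eq_add_neg]

theorem pk_sum {ι : Type*} (t : Finset ι) (k : ℤ) (α : ι → A) :
    pk ε γ k (∑ i ∈ t, α i) = ∑ i ∈ t, pk ε γ k (α i) :=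
  map_sum (AddMonoidHom.mk' (pk ε γ k) (pk_add k)) α t

/-- The inner derivative is a graded derivation of the Clifford product. -/
theorem hk_mul (i j : ℤ) (a : Fin n) (α β : A) :
    hk γ (i + j) a (α * β) = hk γ i a α * β + sg i • (α * hk γ j a β) := by
  simp only [hk, sg_add, mul_sub, sub_mul, smul_sub, smul_mul_assoc, mul_smul_comm, mul_assoc]
  module

theorem gamma_mul (k : ℤ) (a : Fin n) (α : A) :
    γ a * α = sg k • (α * γ a) + (2 : ℝ) • hk γ k a α := by
  simp only [hk]; module

theorem mul_gamma (k : ℤ) (a : Fin n) (α : A) :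
    α * γ a = sg k • (γ a * α) - (2 * sg k) • hk γ k a α := by
  have := sg_mul_self k
  simp only [hk]
  match_scalars <;> linarith

variable (hC : CliffordFrame ε γ)
include hC

theorem hk_gamma {k : ℤ} (hk1 : Odd k) (a b : Fin n) :
    hk γ k a (γ b) = (if a = b then ε a else 0) • (1 : A) := by
  rw [hk, sg_odd hk1, neg_smul, one_smul, sub_neg_eq_add, hC.rel, smul_smul]
  congr 1; split_ifs <;> ring

omit hC in
theorem hk_one {k : ℤ} (hk1 : Even k) (a : Fin n) : hk γ k a (1 : A) = 0 := by
  simp [hk, sg_even hk1]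

/-- In the sum of the two double contractions the mixed terms cancel, and the remaining pairs
collapse to multiples of g_ab α with opposite signs. As exterior multiplication is `hk` of the other
parity, exterior multiplications anticommute by the same identity. -/
theorem hk_anticomm (i j : ℤ) (hij : Odd (i - j)) (a b : Fin n) (α : A) :
    hk γ j a (hk γ i b α) = - hk γ j b (hk γ i a α) := by
  have h1 : sg i = - sg j := by
    have : sg (i - 1) = sg j := sg_eq_of_even_sub (by
      obtain ⟨m, hm⟩ := hij; exact ⟨m, by omega⟩)
    rw [sg_sub, sg_one] at this; linarith
  have h2 := sg_mul_self j
  have e1 : γ a * (γ b * α) = (if a = b then 2 * ε a else 0) • α - γ b * (γ a * α) := by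
    rw [← mul_assoc, ← mul_assoc, eq_sub_iff_add_eq, ← add_mul, hC.rel, smul_mul_assoc, one_mul]
  have e2 : α * γ a * γ b = (if a = b then 2 * ε a else 0) • α - α * γ b * γ a := by
    rw [mul_assoc, mul_assoc, eq_sub_iff_add_eq, ← mul_add, hC.rel, mul_smul_comm, mul_one]
  simp only [hk, h1, mul_sub, sub_mul, smul_sub, smul_mul_assoc, mul_smul_comm]
  rw [e1, e2]
  simp only [mul_assoc]
  match_scalars <;> first | linarith | skip
  linear_combination (-1/4 * (if a = b then 2 * ε a else 0)) * h2

omit hC in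
-- The failure of the degree operator to be a derivation is the contracted product of the factors.
-- Read backwards (`sum_hk_mul_hk`), this expresses contractions between two factors through `pk`
-- alone.
theorem pk_mul (i j : ℤ) (α β : A) :
    pk ε γ (i + j) (α * β) = pk ε γ i α * β + α * pk ε γ j β
      + (2 * sg i) • ∑ a, ε a • (hk γ i a α * hk γ j a β) := by
  simp only [pk, hk_mul, Finset.sum_mul, Finset.mul_sum, Finset.smul_sum,
    ← Finset.sum_add_distrib]
  refine Finset.sum_congr rfl fun a _ => ?_
  have e : α * γ a = sg i • (γ a * α) - (2 * sg i) • hk γ i a α := mul_gamma i a α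
  have e' : α * (γ a * hk γ j a β) = (sg i • (γ a * α) - (2 * sg i) • hk γ i a α) * hk γ j a β := by
    rw [← e, mul_assoc]
  rw [mul_smul_comm, e']
  simp only [mul_add, sub_mul, smul_mul_assoc, mul_smul_comm, mul_assoc]
  module

omit hC in
theorem sum_hk_mul_hk (i j : ℤ) (α β : A) :
    ∑ a, ε a • (hk γ i a α * hk γ j a β) = (sg i / 2) • (pk ε γ (i + j) (α * β)
      - pk ε γ i α * β - α * pk ε γ j β) := by
  rw [pk_mul]
  have := sg_mul_self i
  match_scalars <;> linarith

theorem hk_gamma_mul (j : ℤ) (a b : Fin n) (β : A) :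
    hk γ (j + 1) a (γ b * β) = (if a = b then ε a else 0) • β - γ b * hk γ j a β := by
  rw [add_comm j 1, hk_mul, hk_gamma hC odd_one, smul_mul_assoc, one_mul, sg_one, neg_smul,
    one_smul, sub_eq_add_neg]

theorem sum_ite_smul (f : Fin n → A) (a : Fin n) :
    ∑ b, ε b • ((if a = b then ε a else 0) • f b) = f a := by
  rw [Finset.sum_eq_single a]
  · simp [smul_smul, hC.sq]
  · intro b _ hb; simp [Ne.symm hb]
  · simp

theorem sum_ite_smul' (f : Fin n → A) (a : Fin n) :
    ∑ b, ε b • ((if b = a then ε b else 0) • f b) = f a := by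
  rw [Finset.sum_eq_single a]
  · simp [smul_smul, hC.sq]
  · intro b _ hb; simp [hb]
  · simp

/-- Moving the contraction past γ^a leaves one metric term and otherwise anticommuting contractions.
Hence contraction lowers eigenvalues of the degree operator by one. -/
theorem hk_pk (k : ℤ) (c : Fin n) (α : A) :
    hk γ k c (pk ε γ k α) = hk γ k c α + pk ε γ (k - 1) (hk γ k c α) := by
  have h : ∀ a, hk γ k c (γ a * hk γ k a α) = (if c = a then ε c else 0) • hk γ k a α
      - γ a * hk γ (k - 1) c (hk γ k a α) := fun a => by
    have := hk_gamma_mul hC (k - 1) c a (hk γ k a α)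
    rwa [sub_add_cancel] at this
  simp only [pk, hk_sum, hk_smul, h, smul_sub, Finset.sum_sub_distrib, sum_ite_smul hC]
  rw [sub_eq_add_neg, ← Finset.sum_neg_distrib]
  congr 1
  refine Finset.sum_congr rfl fun a _ => ?_
  rw [hk_anticomm hC k (k - 1) (by simp) c a]
  simp

theorem pk_gamma_mul (k : ℤ) (a : Fin n) (α : A) :
    pk ε γ (k + 1) (γ a * α) = γ a * α + γ a * pk ε γ k α - (2 : ℝ) • hk γ k a α := by
  rw [add_comm k 1, pk_mul]
  simp only [pk, hk_gamma hC odd_one, smul_mul_assoc, one_mul, mul_smul_comm, mul_one,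
    sum_ite_smul' hC, sg_one]
  module

end PiCalculus


/-! ### Homogeneous elements of the algebra generated by the gamma matrices. -/

section Degrees

variable {n : ℕ} {R A : Type*} [CommRing R] [Algebra ℝ R] [Ring A] [Algebra ℝ A] [Algebra R A]
  [IsScalarTower ℝ R A] {ε : Fin n → ℝ} {γ : Fin n → A}

variable (R) in
/-- The span of the products of `l` gamma matrices with `l ≤ k` and `l ≡ k` modulo `2`. -/
def filt (γ : Fin n → A) (k : ℤ) : Submodule R A :=
  Submodule.span R {x | ∃ l : List (Fin n), (l.length : ℤ) ≤ k ∧ Even (k - l.length) ∧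
    x = (l.map γ).prod}

variable (R) in
/-- The elements of degree `k`: the image of the `k`-forms in the Clifford algebra. -/
def IsDeg (ε : Fin n → ℝ) (γ : Fin n → A) (k : ℤ) (α : A) : Prop :=
  α ∈ filt R γ k ∧ pk ε γ k α = (k : ℝ) • α

theorem word_mem_filt (l : List (Fin n)) : (l.map γ).prod ∈ filt R γ l.length :=
  Submodule.subset_span ⟨l, le_rfl, by simp, rfl⟩

theorem filt_mono {i j : ℤ} (h : i ≤ j) (he : Even (j - i)) : filt R γ i ≤ filt R γ j := by
  refine Submodule.span_mono ?_
  rintro x ⟨l, hl, hl', rfl⟩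
  refine ⟨l, hl.trans h, ?_, rfl⟩
  have := he.add hl'
  rwa [sub_add_sub_cancel] at this

theorem filt_le_add_two (k : ℤ) : filt R γ (k - 2) ≤ filt R γ k :=
  filt_mono (by omega) ⟨1, by ring⟩

/-- This terminates the descents of the filtration in steps of two. -/
theorem filt_neg {k : ℤ} (hk : k < 0) : filt R γ k = ⊥ := by
  rw [filt, Submodule.span_eq_bot]
  rintro x ⟨l, hl, -⟩
  omega

theorem one_mem_filt : (1 : A) ∈ filt R γ 0 := by
  simpa using word_mem_filt (R := R) (γ := γ) []

theorem gamma_mem_filt (a : Fin n) : γ a ∈ filt R γ 1 := by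
  simpa using word_mem_filt (R := R) (γ := γ) [a]

theorem real_smul_mem {V : Submodule R A} {x : A} (r : ℝ) (hx : x ∈ V) : r • x ∈ V := by
  rw [← algebraMap_smul R r x]
  exact V.smul_mem _ hx

theorem filt_mul {i j : ℤ} {α β : A} (hα : α ∈ filt R γ i) (hβ : β ∈ filt R γ j) :
    α * β ∈ filt R γ (i + j) := by
  induction hα using Submodule.span_induction with
  | mem x hx =>
    obtain ⟨l, hl, hl', rfl⟩ := hx
    induction hβ using Submodule.span_induction with
    | mem y hy =>
      obtain ⟨m, hm, hm', rfl⟩ := hy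
      refine Submodule.subset_span ⟨l ++ m, ?_, ?_, by simp⟩
      · push_cast [List.length_append]; omega
      · obtain ⟨u, hu⟩ := hl'
        obtain ⟨v, hv⟩ := hm'
        exact ⟨u + v, by push_cast [List.length_append]; omega⟩
    | zero => simp
    | add x y _ _ hx hy => rw [mul_add]; exact add_mem hx hy
    | smul r x _ hx => rw [mul_smul_comm]; exact Submodule.smul_mem _ _ hx
  | zero => simp
  | add x y _ _ hx hy => rw [add_mul]; exact add_mem hx hy
  | smul r x _ hx => rw [smul_mul_assoc]; exact Submodule.smul_mem _ _ hx

/-- A property of products of gamma matrices, compatible with linear combinations and stable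
under enlarging the degree by `2`, holds on `filt`. -/
theorem filt_induction (P : ℤ → A → Prop) (hzero : ∀ k, P k 0)
    (hadd : ∀ k x y, P k x → P k y → P k (x + y)) (hsmul : ∀ k (r : R) x, P k x → P k (r • x))
    (hup : ∀ k x, P k x → P (k + 2) x)
    (hone : P 0 1)
    (hcons : ∀ (k : ℤ) (a : Fin n) x, x ∈ filt R γ k → P k x → P (k + 1) (γ a * x))
    {k : ℤ} {α : A} (hα : α ∈ filt R γ k) : P k α := by
  have hw : ∀ l : List (Fin n), P l.length (l.map γ).prod := by
    intro l
    induction l with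
    | nil => simpa using hone
    | cons a l ih =>
      simpa using hcons l.length a _ (word_mem_filt l) ih
  have hup' : ∀ (m : ℕ) k x, P k x → P (k + 2 * m) x := by
    intro m
    induction m with
    | zero => intro k x h; simpa using h
    | succ m ih =>
      intro k x h
      have := hup _ _ (ih k x h)
      convert this using 1; push_cast; ring
  induction hα using Submodule.span_induction with
  | mem x hx =>
    obtain ⟨l, hl, hl', rfl⟩ := hx
    obtain ⟨m, hm⟩ := hl'
    have := hup' m.toNat _ _ (hw l)
    have h0 : 0 ≤ m := by omega
    have e : (l.length : ℤ) + 2 * m.toNat = k := by rw [Int.toNat_of_nonneg h0]; omega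
    rwa [e] at this
  | zero => exact hzero k
  | add x y _ _ hx hy => exact hadd _ _ _ hx hy
  | smul r x _ hx => exact hsmul _ _ _ hx

theorem hk_rsmul (k : ℤ) (a : Fin n) (r : R) (α : A) :
    hk γ k a (r • α) = r • hk γ k a α := by
  simp only [hk, mul_smul_comm, smul_mul_assoc, smul_sub, smul_comm _ r]

theorem pk_rsmul (k : ℤ) (r : R) (α : A) : pk ε γ k (r • α) = r • pk ε γ k α := by
  simp only [pk, hk_rsmul, mul_smul_comm, Finset.smul_sum]
  exact Finset.sum_congr rfl fun a _ => smul_comm _ _ _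

theorem pk_mem_filt' {k j : ℤ} {α : A} (h : pk ε γ k α - (k : ℝ) • α ∈ filt R γ (k - 2))
    (hα : α ∈ filt R γ k) (hj : Even (j - k)) : pk ε γ j α ∈ filt R γ k := by
  rw [pk_congr hj]
  have := add_mem (filt_le_add_two k h) (real_smul_mem (k : ℝ) hα)
  simpa using this

theorem IsDeg.zero (k : ℤ) : IsDeg R ε γ k (0 : A) := ⟨zero_mem _, by simp⟩

theorem IsDeg.add {k : ℤ} {α β : A} (hα : IsDeg R ε γ k α) (hβ : IsDeg R ε γ k β) :
    IsDeg R ε γ k (α + β) :=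
  ⟨add_mem hα.1 hβ.1, by rw [pk_add, hα.2, hβ.2, smul_add]⟩

theorem IsDeg.smul {k : ℤ} {α : A} (r : ℝ) (hα : IsDeg R ε γ k α) : IsDeg R ε γ k (r • α) :=
  ⟨real_smul_mem r hα.1, by rw [pk_smul, hα.2, smul_comm]⟩

theorem IsDeg.neg {k : ℤ} {α : A} (hα : IsDeg R ε γ k α) : IsDeg R ε γ k (-α) := by
  simpa using hα.smul (-1)

theorem IsDeg.sub {k : ℤ} {α β : A} (hα : IsDeg R ε γ k α) (hβ : IsDeg R ε γ k β) :
    IsDeg R ε γ k (α - β) := by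
  rw [sub_eq_add_neg]; exact hα.add hβ.neg

theorem IsDeg.sum {ι : Type*} {t : Finset ι} {k : ℤ} {α : ι → A}
    (h : ∀ i ∈ t, IsDeg R ε γ k (α i)) : IsDeg R ε γ k (∑ i ∈ t, α i) := by
  classical
  induction t using Finset.induction_on with
  | empty => simpa using IsDeg.zero k
  | insert i t hi ih =>
    rw [Finset.sum_insert hi]
    exact (h i (by simp)).add (ih fun j hj => h j (by simp [hj]))

theorem IsDeg.eq_zero {k : ℤ} {α : A} (hα : IsDeg R ε γ k α) (hk : k < 0) : α = 0 := by
  have := hα.1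
  rw [filt_neg hk] at this
  simpa using this

theorem IsDeg.pk_eq {k j : ℤ} {α : A} (hα : IsDeg R ε γ k α) (h : Even (j - k)) :
    pk ε γ j α = (k : ℝ) • α := by rw [pk_congr h, hα.2]

theorem IsDeg.eq_zero_of_hk {k : ℤ} {α : A} (hα : IsDeg R ε γ k α) (hk0 : k ≠ 0)
    (h : ∀ a, KYForms.hk γ k a α = 0) : α = 0 := by
  have h2 := hα.2
  have : pk ε γ k α = 0 := by simp [pk, h]
  rw [this] at h2
  have hk' : (k : ℝ) ≠ 0 := by exact_mod_cast hk0
  exact (smul_eq_zero.1 h2.symm).resolve_left hk'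

variable (hC : CliffordFrame ε γ)
include hC

theorem hk_mem_filt {k : ℤ} {α : A} (hα : α ∈ filt R γ k) (a : Fin n) :
    hk γ k a α ∈ filt R γ (k - 1) := by
  refine filt_induction (R := R) (γ := γ) (fun k α => hk γ k a α ∈ filt R γ (k - 1))
    ?_ ?_ ?_ ?_ ?_ ?_ hα
  · intro k; simp
  · intro k x y hx hy; rw [hk_add]; exact add_mem hx hy
  · intro k r x hx; rw [hk_rsmul]; exact Submodule.smul_mem _ _ hx
  · intro k x hx
    rw [hk_congr (i := k + 2) (j := k) ⟨1, by ring⟩]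
    exact filt_mono (by omega) ⟨1, by ring⟩ hx
  · rw [hk_one Even.zero]; simp
  · intro k b x hxk hx
    rw [hk_gamma_mul hC]
    refine sub_mem (real_smul_mem _ (by simpa using hxk)) ?_
    have := filt_mul (gamma_mem_filt (R := R) (γ := γ) b) hx
    convert this using 2; ring

/-- By `pk_gamma_mul`, prefixing a gamma matrix adds one to the leading eigenvalue and otherwise
produces shorter words. Thus `pk` is triangular for the filtration with diagonal entries k, k - 2,
…, and no basis of the Clifford algebra is needed. -/
theorem pk_sub_mem_filt {k : ℤ} {α : A} (hα : α ∈ filt R γ k) :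
    pk ε γ k α - (k : ℝ) • α ∈ filt R γ (k - 2) := by
  refine filt_induction (R := R) (γ := γ)
    (fun k α => pk ε γ k α - (k : ℝ) • α ∈ filt R γ (k - 2) ∧ α ∈ filt R γ k)
    ?_ ?_ ?_ ?_ ?_ ?_ hα |>.1
  · intro k; simp
  · intro k x y hx hy
    refine ⟨?_, add_mem hx.2 hy.2⟩
    have := add_mem hx.1 hy.1
    rw [pk_add]; convert this using 1; module
  · intro k r x hx
    refine ⟨?_, Submodule.smul_mem _ _ hx.2⟩
    have := Submodule.smul_mem _ r hx.1
    rw [pk_rsmul, smul_comm (k : ℝ) r x, ← smul_sub]; exact this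
  · intro k x hx
    refine ⟨?_, filt_mono (by omega) ⟨1, by ring⟩ hx.2⟩
    rw [pk_congr (i := k + 2) (j := k) ⟨1, by ring⟩]
    have h1 := filt_mono (i := k - 2) (j := k) (by omega) ⟨1, by ring⟩ hx.1
    have h2 := sub_mem h1 (real_smul_mem (2 : ℝ) hx.2)
    rw [show k + 2 - 2 = k by ring]
    convert h2 using 1
    push_cast; module
  · refine ⟨?_, one_mem_filt⟩
    simp [pk, hk_one Even.zero]
  · intro k a x hxk hx
    have hm := filt_mul (gamma_mem_filt (R := R) (γ := γ) a) hxk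
    refine ⟨?_, by rwa [add_comm]⟩
    rw [pk_gamma_mul hC]
    have h1 := filt_mul (gamma_mem_filt (R := R) (γ := γ) a) hx.1
    have h2 := real_smul_mem (2 : ℝ) (hk_mem_filt hC hxk a)
    have h3 : (1 : ℤ) + (k - 2) = k - 1 := by ring
    rw [h3] at h1
    have := sub_mem h1 h2
    rw [show k + 1 - 2 = k - 1 by ring]
    convert this using 1
    rw [mul_sub, mul_smul_comm]; push_cast; module

theorem pk_mem_filt {k j : ℤ} {α : A} (hα : α ∈ filt R γ k) (hj : Even (j - k)) :
    pk ε γ j α ∈ filt R γ k :=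
  pk_mem_filt' (pk_sub_mem_filt hC hα) hα hj

/-- The degree operator has only the eigenvalues `k, k - 2, …, 0 or 1` on `filt R γ k`. -/
theorem eq_zero_of_pk_eq {k j : ℤ} {α : A} (hα : α ∈ filt R γ k) (hj : Even (j - k)) (z : ℝ)
    (h : pk ε γ j α = z • α)
    (hz : ∀ i : ℤ, 0 ≤ i → i ≤ k → Even (k - i) → z ≠ i) : α = 0 := by
  rw [pk_congr hj] at h
  have key : ∀ m : ℕ, ∀ k : ℤ, k < m → ∀ α : A, α ∈ filt R γ k → pk ε γ k α = z • α →
      (∀ i : ℤ, 0 ≤ i → i ≤ k → Even (k - i) → z ≠ i) → α = 0 := by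
    intro m
    induction m with
    | zero =>
      intro k hk α hα _ _
      rw [filt_neg (by simpa using hk)] at hα
      simpa using hα
    | succ m ih =>
      intro k hk α hα h hz
      by_cases h0 : k < 0
      · rw [filt_neg h0] at hα; simpa using hα
      have h1 := pk_sub_mem_filt hC hα
      rw [h, ← sub_smul] at h1
      -- (z - k)α lies two steps lower; as z ≠ k, so does α, and the descent continues.
      have hne : z - k ≠ 0 := sub_ne_zero.2 (hz k (by omega) le_rfl (by simp))
      have h2 := real_smul_mem (R := R) (z - k)⁻¹ h1
      rw [smul_smul, inv_mul_cancel₀ hne, one_smul] at h2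
      refine ih (k - 2) (by push_cast at hk; omega) α h2 ?_ ?_
      · rw [pk_congr (i := k - 2) (j := k) ⟨-1, by ring⟩, h]
      · intro i hi0 hik hev
        obtain ⟨u, hu⟩ := hev
        exact hz i hi0 (by omega) ⟨u + 1, by omega⟩
  exact key (k.toNat + 1) k (by omega) α hα h hz

theorem eq_zero_of_pk_eq_of_neg {k j : ℤ} {α : A} (hα : α ∈ filt R γ k) (hj : Even (j - k))
    {z : ℝ} (hz : z < 0) (h : pk ε γ j α = z • α) : α = 0 :=
  eq_zero_of_pk_eq hC hα hj z h fun i hi _ _ => by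
    have : (0 : ℝ) ≤ i := by exact_mod_cast hi
    linarith

theorem IsDeg.hk {k : ℤ} {α : A} (hα : IsDeg R ε γ k α) (a : Fin n) :
    IsDeg R ε γ (k - 1) (hk γ k a α) := by
  refine ⟨hk_mem_filt hC hα.1 a, ?_⟩
  have := hk_pk hC k a α
  rw [hα.2, hk_smul] at this
  have h2 : pk ε γ (k - 1) (KYForms.hk γ k a α)
      = (k : ℝ) • KYForms.hk γ k a α - KYForms.hk γ k a α := by rw [this]; abel
  rw [h2]; push_cast; module

/-- An element of `filt R γ k` of degree `k` whose projection to the top degree vanishes is zero. -/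
theorem IsDeg.eq_zero_of_mem {k : ℤ} {α : A} (hα : IsDeg R ε γ k α)
    (h : α ∈ filt R γ (k - 2)) : α = 0 :=
  eq_zero_of_pk_eq hC (k := k - 2) (j := k) h ⟨1, by ring⟩ k hα.2 fun i _ hi _ => by
    have : i < k := by omega
    have : (i : ℝ) < k := by exact_mod_cast this
    exact this.ne'

/-- In odd parity zero is not an eigenvalue of the degree operator. -/
theorem eq_zero_of_hk {k : ℤ} {α : A} (hα : α ∈ filt R γ k) (hk0 : ¬ Even k)
    (h : ∀ a, KYForms.hk γ k a α = 0) : α = 0 :=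
  eq_zero_of_pk_eq hC hα (j := k) (by simp) 0 (by simp [pk, h]) fun i _ _ hi h0 => by
    have : i = 0 := by exact_mod_cast h0.symm
    subst this
    exact hk0 (by simpa using hi)

/-- The graded commutator lowers the degree by two. -/
theorem comm_mem_filt {i j : ℤ} {α β : A} (hα : α ∈ filt R γ i) (hβ : β ∈ filt R γ j) :
    α * β - sg (i * j) • (β * α) ∈ filt R γ (i + j - 2) := by
  refine (filt_induction (R := R) (γ := γ)
    (fun i α => α * β - sg (i * j) • (β * α) ∈ filt R γ (i + j - 2))
    ?_ ?_ ?_ ?_ ?_ ?_ hα)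
  · intro k; simp
  · intro k x y hx hy
    have := add_mem hx hy
    convert this using 1
    rw [add_mul, mul_add]; module
  · intro k r x hx
    have := Submodule.smul_mem _ r hx
    convert this using 1
    rw [smul_mul_assoc, mul_smul_comm, smul_sub, smul_comm r]
  · intro k x hx
    rw [sg_eq_of_even_sub (i := (k + 2) * j) (j := k * j) ⟨j, by ring⟩]
    exact filt_mono (by omega) ⟨1, by ring⟩ hx
  · simp
  · intro k a x hxk hx
    have h1 : sg ((k + 1) * j) = sg (k * j) * sg j := by rw [← sg_add]; congr 1; ring
    -- Moving γ_a past β costs a contraction of β, whose product with x already lies two degrees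
    -- lower.
    have h2 : γ a * x * β - sg ((k + 1) * j) • (β * (γ a * x))
        = γ a * (x * β - sg (k * j) • (β * x)) + (2 * sg (k * j)) • (hk γ j a β * x) := by
      rw [h1, ← mul_assoc β, mul_gamma j a β]
      have := sg_mul_self j
      simp only [mul_sub, sub_mul, smul_mul_assoc, mul_smul_comm, mul_assoc]
      match_scalars <;>
        first | ring1 | linear_combination (-sg (k * j)) * this |
          linear_combination (2 * sg (k * j)) * this
    rw [h2]
    refine add_mem ?_ (real_smul_mem _ ?_)
    · have := filt_mul (gamma_mem_filt (R := R) (γ := γ) a) hx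
      convert this using 2; ring
    · have := filt_mul (hk_mem_filt hC hβ a) hxk
      convert this using 2; ring

end Degrees


/-! ### Homogeneous components of elements and of Clifford products. -/

section Components

variable {n : ℕ} {R A : Type*} [CommRing R] [Algebra ℝ R] [Ring A] [Algebra ℝ A] [Algebra R A]
  [IsScalarTower ℝ R A] {ε : Fin n → ℝ} {γ : Fin n → A}

variable (R) in
/-- `P m` are the components of `α` of degrees `K - 2m`. -/
def IsDec (ε : Fin n → ℝ) (γ : Fin n → A) (K : ℤ) (α : A) (P : ℕ → A) : Prop :=
  (∀ m : ℕ, IsDeg R ε γ (K - 2 * m) (P m)) ∧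
    ∀ L : ℕ, K < 2 * L → α = ∑ m ∈ Finset.range L, P m

theorem IsDec.add {K : ℤ} {α β : A} {P Q : ℕ → A} (hP : IsDec R ε γ K α P)
    (hQ : IsDec R ε γ K β Q) : IsDec R ε γ K (α + β) (fun m => P m + Q m) :=
  ⟨fun m => (hP.1 m).add (hQ.1 m), fun L hL => by
    rw [Finset.sum_add_distrib, ← hP.2 L hL, ← hQ.2 L hL]⟩

theorem IsDec.smul {K : ℤ} {α : A} {P : ℕ → A} (r : ℝ) (hP : IsDec R ε γ K α P) :
    IsDec R ε γ K (r • α) (fun m => r • P m) :=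
  ⟨fun m => (hP.1 m).smul r, fun L hL => by rw [← Finset.smul_sum, ← hP.2 L hL]⟩

theorem IsDec.zero (K : ℤ) : IsDec R ε γ K 0 (fun _ => 0) :=
  ⟨fun _ => IsDeg.zero _, fun L _ => by simp⟩

theorem IsDec.sum {ι : Type*} {t : Finset ι} {K : ℤ} {α : ι → A} {P : ι → ℕ → A}
    (h : ∀ i ∈ t, IsDec R ε γ K (α i) (P i)) :
    IsDec R ε γ K (∑ i ∈ t, α i) (fun m => ∑ i ∈ t, P i m) := by
  refine ⟨fun m => IsDeg.sum fun i hi => (h i hi).1 m, fun L hL => ?_⟩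
  rw [Finset.sum_comm]
  exact Finset.sum_congr rfl fun i hi => (h i hi).2 L hL

theorem IsDec.pk {K : ℤ} {α : A} {P : ℕ → A} (hP : IsDec R ε γ K α P) :
    IsDec R ε γ K (pk ε γ K α) (fun m => ((K : ℝ) - 2 * m) • P m) := by
  refine ⟨fun m => (hP.1 m).smul _, fun L hL => ?_⟩
  rw [hP.2 L hL, pk_sum]
  refine Finset.sum_congr rfl fun m _ => ?_
  rw [(hP.1 m).pk_eq ⟨m, by ring⟩]; push_cast; rfl

theorem IsDec.shift {K : ℤ} {α : A} {P : ℕ → A} (hP : IsDec R ε γ K α P) (h0 : P 0 = 0) :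
    IsDec R ε γ (K - 2) α (fun m => P (m + 1)) := by
  refine ⟨fun m => ?_, fun L hL => ?_⟩
  · have := hP.1 (m + 1); convert this using 1; push_cast; ring
  · rw [hP.2 (L + 1) (by push_cast; omega), Finset.sum_range_succ', h0, add_zero]

theorem IsDec.unshift {K : ℤ} {α : A} {P : ℕ → A} (hP : IsDec R ε γ (K - 2) α P) :
    IsDec R ε γ K α (fun m => if m = 0 then 0 else P (m - 1)) := by
  refine ⟨fun m => ?_, fun L hL => ?_⟩
  · cases m with
    | zero => simpa using IsDeg.zero _
    | succ m =>
      have := hP.1 m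
      simp only [Nat.add_eq_zero_iff, one_ne_zero, and_false, if_false, Nat.add_sub_cancel]
      convert this using 1; push_cast; ring
  · cases L with
    | zero =>
      have := hP.2 0 (by push_cast at hL ⊢; omega)
      simpa using this
    | succ L =>
      rw [Finset.sum_range_succ', hP.2 L (by push_cast at hL; omega)]
      simp

theorem IsDec.of_deg {K : ℤ} {α : A} (h : IsDeg R ε γ K α) :
    IsDec R ε γ K α (fun m => if m = 0 then α else 0) := by
  refine ⟨fun m => ?_, fun L hL => ?_⟩
  · by_cases hm : m = 0
    · simpa [hm] using h
    · simpa [hm] using IsDeg.zero _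
  · cases L with
    | zero =>
      simpa using h.eq_zero (by simpa using hL)
    | succ L => rw [Finset.sum_range_succ']; simp

variable (hC : CliffordFrame ε γ)
include hC

/-- Induction on the degree: (pk - K)α lies in step K - 2 and is decomposed by hypothesis; dividing
its parts by the eigenvalues of pk - K recovers the lower parts of α. -/
theorem exists_isDec {K : ℤ} {α : A} (hα : α ∈ filt R γ K) : ∃ P, IsDec R ε γ K α P := by
  have key : ∀ m : ℕ, ∀ K : ℤ, K < m → ∀ α : A, α ∈ filt R γ K → ∃ P, IsDec R ε γ K α P := by
    intro m
    induction m with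
    | zero =>
      intro K hK α hα
      rw [filt_neg (by simpa using hK)] at hα
      have : α = 0 := by simpa using hα
      exact ⟨_, this ▸ IsDec.zero K⟩
    | succ m ih =>
      intro K hK α hα
      by_cases h0 : K < 0
      · rw [filt_neg h0] at hα
        have : α = 0 := by simpa using hα
        exact ⟨_, this ▸ IsDec.zero K⟩
      obtain ⟨Q, hQ⟩ := ih (K - 2) (by push_cast at hK; omega) _ (pk_sub_mem_filt hC hα)
      -- On degree K - 2(m + 1) the operator pk - K is multiplication by -2(m + 1), whence the
      -- coefficients. Parts beyond the chosen range have negative degree and vanish.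
      have hQ' : IsDec R ε γ (K - 2) (∑ m ∈ Finset.range K.toNat.succ,
          (-(2 * ((m : ℝ) + 1)))⁻¹ • Q m) (fun m => (-(2 * ((m : ℝ) + 1)))⁻¹ • Q m) := by
        refine ⟨fun m => (hQ.1 m).smul _, fun L hL => ?_⟩
        have hz : ∀ m : ℕ, K - 2 < 2 * m → Q m = 0 := fun m hm => (hQ.1 m).eq_zero (by omega)
        rcases le_total L K.toNat.succ with h | h
        · refine (Finset.sum_subset (by simpa using h) fun m _ hm => ?_).symm
          rw [hz m (by simp at hm; omega), smul_zero]
        · refine Finset.sum_subset (by simpa using h) fun m _ hm => ?_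
          rw [hz m (by simp at hm; omega), smul_zero]
      set σ := ∑ m ∈ Finset.range K.toNat.succ, (-(2 * ((m : ℝ) + 1)))⁻¹ • Q m with hσ
      have hσm : σ ∈ filt R γ K := by
        rw [hσ]
        refine sum_mem fun m _ => real_smul_mem _ ?_
        exact filt_mono (by omega) ⟨m + 1, by ring⟩ (hQ.1 m).1
      -- The remainder is annihilated by pk - K, so it is the part of top degree.
      have htop : IsDeg R ε γ K (α - σ) := by
        refine ⟨sub_mem hα hσm, ?_⟩
        have h1 := hQ.2 K.toNat.succ (by push_cast; omega)
        have h2 := hQ'.pk.2 K.toNat.succ (by push_cast; omega)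
        rw [pk_congr (i := K - 2) (j := K) ⟨-1, by ring⟩] at h2
        have h3 : KYForms.pk ε γ K σ - (K : ℝ) • σ = KYForms.pk ε γ K α - (K : ℝ) • α := by
          rw [h1, h2, hσ, Finset.smul_sum, ← Finset.sum_sub_distrib]
          refine Finset.sum_congr rfl fun m _ => ?_
          have hm : (m : ℝ) + 1 ≠ 0 := by positivity
          match_scalars
          field_simp
          ring
        rw [pk_sub, smul_sub, sub_eq_sub_iff_sub_eq_sub, h3]
      have := (IsDec.of_deg htop).add hQ'.unshift
      rw [sub_add_cancel] at this
      exact ⟨_, this⟩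
  exact key (K.toNat + 1) K (by omega) α hα

/-- Applying pk - (K - 2L) removes the last summand and rescales the others by the nonzero factors
2(L - m). -/
theorem IsDec.eq_zero {K : ℤ} {P : ℕ → A} (hP : IsDec R ε γ K 0 P) (m : ℕ) : P m = 0 := by
  have key : ∀ L : ℕ, ∀ Q : ℕ → A, (∀ m : ℕ, IsDeg R ε γ (K - 2 * m) (Q m)) →
      ∑ m ∈ Finset.range L, Q m = 0 → ∀ m < L, Q m = 0 := by
    intro L
    induction L with
    | zero => intro _ _ _ m hm; omega
    | succ L ih =>
      intro Q hQ hs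
      have h1 : ∑ m ∈ Finset.range L, (2 * ((L : ℝ) - m)) • Q m = 0 := by
        have h2 : KYForms.pk ε γ K (∑ m ∈ Finset.range (L + 1), Q m)
            - ((K : ℝ) - 2 * L) • ∑ m ∈ Finset.range (L + 1), Q m = 0 := by simp [hs]
        rw [pk_sum, Finset.smul_sum, ← Finset.sum_sub_distrib] at h2
        have h3 : ∀ m : ℕ, KYForms.pk ε γ K (Q m) - ((K : ℝ) - 2 * L) • Q m
            = (2 * ((L : ℝ) - m)) • Q m := fun m => by
          rw [(hQ m).pk_eq ⟨m, by ring⟩]; push_cast; module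
        simp only [h3] at h2
        rw [Finset.sum_range_succ] at h2
        simpa using h2
      have h4 := ih (fun m => (2 * ((L : ℝ) - m)) • Q m) (fun m => (hQ m).smul _) h1
      have h5 : ∀ m < L, Q m = 0 := fun m hm => by
        have hm' : (m : ℝ) < L := by exact_mod_cast hm
        exact (smul_eq_zero.1 (h4 m hm)).resolve_left (by
          intro h; linarith)
      intro m hm
      rcases Nat.lt_succ_iff_lt_or_eq.1 hm with h | rfl
      · exact h5 m h
      · rw [Finset.sum_range_succ, Finset.sum_eq_zero (fun i hi => h5 i (by simpa using hi)),
          zero_add] at hs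
        exact hs
  have h := hP.2 (m + 1 + K.toNat) (by push_cast; omega)
  exact key _ P hP.1 h.symm m (by omega)

theorem IsDec.unique {K : ℤ} {α : A} {P Q : ℕ → A} (hP : IsDec R ε γ K α P)
    (hQ : IsDec R ε γ K α Q) (m : ℕ) : P m = Q m := by
  have := (hP.add (hQ.smul (-1)))
  rw [neg_one_smul, add_neg_cancel] at this
  have := this.eq_zero hC m
  rwa [neg_one_smul, add_neg_eq_zero] at this

omit hC in
variable (R ε γ) in
/-- The component of degree `K - 2m` of an element of `filt R γ K`. -/
def comp (K : ℤ) (α : A) : ℕ → A :=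
  open Classical in if h : ∃ P, IsDec R ε γ K α P then h.choose else 0

theorem comp_isDec {K : ℤ} {α : A} (hα : α ∈ filt R γ K) :
    IsDec R ε γ K α (comp R ε γ K α) := by
  rw [comp, dif_pos (exists_isDec hC hα)]
  exact (exists_isDec hC hα).choose_spec

theorem IsDec.comp_eq {K : ℤ} {α : A} {P : ℕ → A} (hP : IsDec R ε γ K α P) (m : ℕ) :
    comp R ε γ K α m = P m := by
  rw [comp, dif_pos ⟨P, hP⟩]
  exact (⟨P, hP⟩ : ∃ P, IsDec R ε γ K α P).choose_spec.unique hC hP m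

/-- The component `α ∧ₘ β` of the Clifford product, up to a factor. -/
theorem prod_isDec {i j : ℤ} {α β : A} (hα : IsDeg R ε γ i α) (hβ : IsDeg R ε γ j β) :
    IsDec R ε γ (i + j) (α * β) (comp R ε γ (i + j) (α * β)) :=
  comp_isDec hC (filt_mul hα.1 hβ.1)

/-- The sum of products of contractions is (sg i / 2)(pk - (i + j)) applied to αβ, and pk - (i + j)
is -2(m + 1) on the part of degree i + j - 2(m + 1). This is the recursion that defines ∧_{m+1}, so
`comp` records contracted exterior products up to nonzero factors. -/
theorem sum_comp_hk {i j : ℤ} {α β : A} (hα : IsDeg R ε γ i α) (hβ : IsDeg R ε γ j β) (m : ℕ) :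
    ∑ a, ε a • comp R ε γ (i - 1 + (j - 1)) (hk γ i a α * hk γ j a β) m =
      (-(sg i * (m + 1))) • comp R ε γ (i + j) (α * β) (m + 1) := by
  have h1 := (prod_isDec hC hα hβ)
  have h2 := (h1.pk.add (h1.smul (-((i : ℝ) + j)))).smul (sg i / 2)
  have h3 : (sg i / 2) • (pk ε γ (i + j) (α * β) + (-((i : ℝ) + j)) • (α * β))
      = ∑ a, ε a • (hk γ i a α * hk γ j a β) := by
    rw [sum_hk_mul_hk, hα.2, hβ.2, smul_mul_assoc, mul_smul_comm]; module
  rw [h3] at h2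
  have h4 := h2.shift (by push_cast; module)
  have h5 : IsDec R ε γ (i - 1 + (j - 1)) (∑ a, ε a • (hk γ i a α * hk γ j a β))
      (fun m => ∑ a, ε a • comp R ε γ (i - 1 + (j - 1)) (hk γ i a α * hk γ j a β) m) :=
    IsDec.sum fun a _ => (prod_isDec hC (hα.hk hC a) (hβ.hk hC a)).smul (ε a)
  rw [show i + j - 2 = i - 1 + (j - 1) by ring] at h4
  rw [h5.unique hC h4 m]
  push_cast; module

/-- For m = 0 this is graded commutativity modulo lower degree; `sum_comp_hk` carries it from m to m
+ 1, the passage to degrees i - 1 and j - 1 producing the extra sign. -/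
theorem comp_swap {i j : ℤ} {α β : A} (hα : IsDeg R ε γ i α) (hβ : IsDeg R ε γ j β) (m : ℕ) :
    comp R ε γ (i + j) (β * α) m = sg (i * j + m) • comp R ε γ (i + j) (α * β) m := by
  induction m generalizing i j α β with
  | zero =>
    have h1 := comm_mem_filt hC hα.1 hβ.1
    have h2 := (prod_isDec hC hβ hα)
    rw [add_comm j i] at h2
    have h3 := (prod_isDec hC hα hβ).add (h2.smul (-sg (i * j)))
    have h4 : α * β + (-sg (i * j)) • (β * α) = α * β - sg (i * j) • (β * α) := by module
    rw [h4] at h3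
    -- The commutator lies in step i + j - 2, so its part of order 0 vanishes.
    have h5 := h3.unique hC (comp_isDec hC h1).unshift 0
    simp only [if_true] at h5
    rw [neg_smul, add_neg_eq_zero] at h5
    rw [h5, smul_smul]
    simp
  | succ m ih =>
    have h1 := sum_comp_hk hC hα hβ m
    have h2 := sum_comp_hk hC hβ hα m
    have h3 : ∑ a, ε a • comp R ε γ (j - 1 + (i - 1)) (hk γ j a β * hk γ i a α) m
        = sg ((i - 1) * (j - 1) + m) •
          ∑ a, ε a • comp R ε γ (i - 1 + (j - 1)) (hk γ i a α * hk γ j a β) m := by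
      rw [Finset.smul_sum]
      refine Finset.sum_congr rfl fun a _ => ?_
      rw [add_comm (j - 1), ih (hα.hk hC a) (hβ.hk hC a), smul_comm]
    rw [h1, h2, add_comm j i, smul_smul] at h3
    have hm : (m : ℝ) + 1 ≠ 0 := by positivity
    have h4 := congrArg (fun x => (-(sg j * ((m : ℝ) + 1)⁻¹)) • x) h3
    simp only [smul_smul] at h4
    have h5 : -(sg j * ((m : ℝ) + 1)⁻¹) * -(sg j * (m + 1)) = 1 := by
      have := sg_mul_self j
      field_simp
      linear_combination this
    have h6 : -(sg j * ((m : ℝ) + 1)⁻¹) * (sg ((i - 1) * (j - 1) + m) * -(sg i * (m + 1)))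
        = sg (i * j + (m + 1 : ℕ)) := by
      have e : sg (i * j + (m + 1 : ℕ)) = sg j * sg ((i - 1) * (j - 1) + m) * sg i := by
        rw [← sg_add, ← sg_add]
        exact sg_eq_of_even_sub ⟨0, by push_cast; ring⟩
      rw [e]; field_simp
    rw [h5, h6, one_smul] at h4
    exact h4

/-- A graded commutator vanishes if its contracted products of odd order vanish. -/
theorem comm_add_comm_eq_zero {i j : ℤ} {α β α' β' : A} (hα : IsDeg R ε γ i α)
    (hβ : IsDeg R ε γ j β) (hα' : IsDeg R ε γ i α') (hβ' : IsDeg R ε γ j β')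
    (h : ∀ m, Odd m → comp R ε γ (i + j) (α * β) m + comp R ε γ (i + j) (α' * β') m = 0) :
    α * β - sg (i * j) • (β * α) + (α' * β' - sg (i * j) • (β' * α')) = 0 := by
  have key : ∀ {α β : A}, IsDeg R ε γ i α → IsDeg R ε γ j β →
      IsDec R ε γ (i + j) (α * β - sg (i * j) • (β * α))
        (fun m => (1 - sg m) • comp R ε γ (i + j) (α * β) m) := by
    intro α β hα hβ
    have h2 := (prod_isDec hC hβ hα)
    rw [add_comm j i] at h2
    have h3 := (prod_isDec hC hα hβ).add (h2.smul (-sg (i * j)))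
    rw [neg_smul, ← sub_eq_add_neg] at h3
    convert h3 using 2 with m
    rw [comp_swap hC hα hβ, smul_smul, sg_add]
    have := sg_mul_self (i * j)
    match_scalars
    linear_combination (sg m) * this
  have h1 := (key hα hβ).add (key hα' hβ')
  rw [h1.2 ((i + j).toNat + 1) (by push_cast; omega)]
  refine Finset.sum_eq_zero fun m _ => ?_
  rw [← smul_add]
  rcases Nat.even_or_odd m with hm | hm
  · have : Even (m : ℤ) := by exact_mod_cast hm
    rw [sg_even this, sub_self, zero_smul]
  · rw [h m hm, smul_zero]

theorem anticomm_isDec {i j : ℤ} {α β : A} (hα : IsDeg R ε γ i α) (hβ : IsDeg R ε γ j β) :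
    IsDec R ε γ (i + j) (α * β + sg (i * j) • (β * α))
      (fun m => (1 + sg m) • comp R ε γ (i + j) (α * β) m) := by
  have h2 := (prod_isDec hC hβ hα)
  rw [add_comm j i] at h2
  have h3 := (prod_isDec hC hα hβ).add (h2.smul (sg (i * j)))
  convert h3 using 2 with m
  rw [comp_swap hC hα hβ, smul_smul, sg_add]
  have := sg_mul_self (i * j)
  match_scalars
  linear_combination (-sg m) * this

/-- A graded anticommutator is the exterior product if the contracted products of even positive
order vanish. -/
theorem anticomm_isDeg {i j : ℤ} {α β : A} (hα : IsDeg R ε γ i α) (hβ : IsDeg R ε γ j β)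
    (h : ∀ m, Even m → m ≠ 0 → comp R ε γ (i + j) (α * β) m = 0) :
    IsDeg R ε γ (i + j) (α * β + sg (i * j) • (β * α)) := by
  have h1 := anticomm_isDec hC hα hβ
  rw [h1.2 ((i + j).toNat + 1) (by push_cast; omega), Finset.sum_range_succ',
    Finset.sum_eq_zero, zero_add]
  · simpa using h1.1 0
  · intro m _
    rcases Nat.even_or_odd (m + 1) with hm | hm
    · rw [h _ hm (by omega), smul_zero]
    · have : Odd ((m + 1 : ℕ) : ℤ) := by exact_mod_cast hm
      rw [sg_odd this, add_neg_cancel, zero_smul]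

end Components


/-! ### First-order operators over a ring of functions -/

/-- Double sums over frame indices are compared through their symmetrised summands; this is how
antisymmetric second-order coefficients are traded for curvature. -/
theorem sum_sum_eq_of_symm {ι E : Type*} [Fintype ι] [AddCommGroup E] [Module ℝ E]
    {f g : ι → ι → E} (h : ∀ a b, f a b + f b a = g a b + g b a) :
    ∑ a, ∑ b, f a b = ∑ a, ∑ b, g a b := by
  have key : ∀ f : ι → ι → E, (2 : ℝ) • ∑ a, ∑ b, f a b = ∑ a, ∑ b, (f a b + f b a) := by
    intro f
    simp only [Finset.sum_add_distrib]
    rw [Finset.sum_comm (f := fun a b => f b a), two_smul]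
  have h2 : (2 : ℝ) • ∑ a, ∑ b, f a b = (2 : ℝ) • ∑ a, ∑ b, g a b := by
    rw [key, key]; simp only [h]
  exact smul_right_injective E two_ne_zero h2

theorem sum_sum_eq_zero_of_symm {ι E : Type*} [Fintype ι] [AddCommGroup E] [Module ℝ E]
    {f : ι → ι → E} (h : ∀ a b, f a b + f b a = 0) : ∑ a, ∑ b, f a b = 0 := by
  rw [sum_sum_eq_of_symm (g := fun _ _ => 0) (by simpa using h)]
  simp

/-- A spin geometry over a ring `R` of functions, with respect to an orthonormal frame `eₐ`:
`der a` differentiates functions along `eₐ`, `nab a` is the covariant derivative of spinors,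
`∇ₐ e_b = Γ a b c e_c`, `Rm a b` is the curvature of the spin connection. The functions `t i` are
coordinates, and `w` is the inverse of the matrix of their derivatives. -/
structure SpinData (n : ℕ) (R Ψ : Type*) [CommRing R] [Algebra ℝ R] [AddCommGroup Ψ] [Module ℝ Ψ]
    [Module R Ψ] [IsScalarTower ℝ R Ψ] where
  ε : Fin n → ℝ
  γ : Fin n → Module.End R Ψ
  cliff : CliffordFrame ε γ
  der : Fin n → R → R
  nab : Fin n → Ψ →ₗ[ℝ] Ψ
  nab_smul : ∀ a (r : R) (ψ : Ψ), nab a (r • ψ) = der a r • ψ + r • nab a ψ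
  Γ : Fin n → Fin n → Fin n → R
  skew : ∀ a b c, ε c • Γ a b c = -(ε b • Γ a c b)
  nab_gamma : ∀ a b (ψ : Ψ), nab a (γ b ψ) = ∑ c, Γ a b c • γ c ψ + γ b (nab a ψ)
  Rm : Fin n → Fin n → Module.End R Ψ
  curv : ∀ a b (ψ : Ψ), nab a (nab b ψ) - nab b (nab a ψ) =
    Rm a b ψ + ∑ c, (Γ a b c - Γ b a c) • nab c ψ
  Rm_deg : ∀ a b, IsDeg R ε γ 2 (Rm a b)
  bianchi : ∀ a b c, hk γ 2 a (Rm b c) + hk γ 2 b (Rm c a) + hk γ 2 c (Rm a b) = 0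
  t : Fin n → R
  w : Fin n → Fin n → R
  coord : ∀ a b, ∑ i, w i a * der b (t i) = if a = b then 1 else 0

namespace SpinData

variable {n : ℕ} {R Ψ : Type*} [CommRing R] [Algebra ℝ R] [AddCommGroup Ψ] [Module ℝ Ψ]
    [Module R Ψ] [IsScalarTower ℝ R Ψ] (S : SpinData n R Ψ)

/-- The covariant derivative of an endomorphism of the spinors. -/
def dA (a : Fin n) (α : Module.End R Ψ) : Module.End R Ψ where
  toFun ψ := S.nab a (α ψ) - α (S.nab a ψ)
  map_add' x y := by simp only [map_add]; abel
  map_smul' r x := by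
    simp only [map_smul, S.nab_smul, map_add, RingHom.id_apply, smul_sub]; abel

theorem dA_apply (a : Fin n) (α : Module.End R Ψ) (ψ : Ψ) :
    S.dA a α ψ = S.nab a (α ψ) - α (S.nab a ψ) := rfl

theorem nab_apply (a : Fin n) (α : Module.End R Ψ) (ψ : Ψ) :
    S.nab a (α ψ) = S.dA a α ψ + α (S.nab a ψ) := by rw [dA_apply]; abel

theorem real_smul_apply (r : ℝ) (α : Module.End R Ψ) (ψ : Ψ) : (r • α) ψ = r • α ψ := rfl

theorem map_real_smul (r : ℝ) (α : Module.End R Ψ) (ψ : Ψ) : α (r • ψ) = r • α ψ := by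
  rw [← algebraMap_smul R r ψ, map_smul, algebraMap_smul]

theorem dA_add (a : Fin n) (α β : Module.End R Ψ) : S.dA a (α + β) = S.dA a α + S.dA a β := by
  ext ψ; simp only [dA_apply, LinearMap.add_apply, map_add]; abel

theorem dA_smul (a : Fin n) (r : ℝ) (α : Module.End R Ψ) : S.dA a (r • α) = r • S.dA a α := by
  ext ψ; simp only [dA_apply, real_smul_apply, map_smul, smul_sub]

theorem dA_rsmul (a : Fin n) (r : R) (α : Module.End R Ψ) :
    S.dA a (r • α) = S.der a r • α + r • S.dA a α := by
  ext ψ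
  simp only [dA_apply, LinearMap.smul_apply, LinearMap.add_apply, S.nab_smul, smul_sub]; abel

@[simp] theorem dA_zero (a : Fin n) : S.dA a 0 = 0 := by ext ψ; simp [dA_apply]

theorem dA_sub (a : Fin n) (α β : Module.End R Ψ) : S.dA a (α - β) = S.dA a α - S.dA a β := by
  ext ψ; simp only [dA_apply, LinearMap.sub_apply, map_sub]; abel

theorem dA_sum {ι : Type*} (s : Finset ι) (a : Fin n) (α : ι → Module.End R Ψ) :
    S.dA a (∑ i ∈ s, α i) = ∑ i ∈ s, S.dA a (α i) :=
  map_sum (AddMonoidHom.mk' (S.dA a) (S.dA_add a)) α s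

theorem dA_one (a : Fin n) : S.dA a 1 = 0 := by ext ψ; simp [dA_apply]

theorem dA_mul (a : Fin n) (α β : Module.End R Ψ) :
    S.dA a (α * β) = S.dA a α * β + α * S.dA a β := by
  ext ψ; simp only [dA_apply, Module.End.mul_apply, LinearMap.add_apply, map_sub]; abel

theorem dA_gamma (a b : Fin n) : S.dA a (S.γ b) = ∑ c, S.Γ a b c • S.γ c := by
  ext ψ
  simp only [dA_apply, S.nab_gamma, LinearMap.sum_apply, LinearMap.smul_apply, add_sub_cancel_right]

theorem dA_hk (k : ℤ) (a b : Fin n) (α : Module.End R Ψ) :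
    S.dA a (hk S.γ k b α) = ∑ c, S.Γ a b c • hk S.γ k c α + hk S.γ k b (S.dA a α) := by
  simp only [hk, dA_smul, dA_sub, dA_mul, dA_gamma, Finset.sum_mul, Finset.mul_sum,
    smul_mul_assoc, mul_smul_comm]
  have : ∀ c, S.Γ a b c • (1 / 2 : ℝ) • (S.γ c * α - sg k • (α * S.γ c))
      = (1 / 2 : ℝ) • (S.Γ a b c • (S.γ c * α) - sg k • S.Γ a b c • (α * S.γ c)) := by
    intro c
    rw [smul_comm, smul_sub (S.Γ a b c), smul_comm (S.Γ a b c)]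
  simp only [this, ← Finset.smul_sum, Finset.sum_sub_distrib]
  module

theorem eps_smul_Gamma (a b c : Fin n) : S.ε b • S.Γ a b c = -(S.ε c • S.Γ a c b) := by
  have h := congrArg (fun x => (S.ε b * S.ε c) • x) (S.skew a b c)
  simp only [smul_neg, smul_smul] at h
  rw [mul_assoc, S.cliff.sq, mul_one, mul_right_comm, S.cliff.sq, one_mul] at h
  exact h

/-- The connection is metric. -/
theorem skew_sum {E : Type*} [AddCommGroup E] [Module ℝ E] [Module R E] [IsScalarTower ℝ R E]
    (a : Fin n) (F : Fin n → Fin n → E) :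
    ∑ b, ∑ c, S.ε b • S.Γ a b c • F b c = -∑ b, ∑ c, S.ε b • S.Γ a b c • F c b := by
  rw [eq_neg_iff_add_eq_zero, ← Finset.sum_add_distrib]
  simp only [← Finset.sum_add_distrib]
  refine sum_sum_eq_zero_of_symm fun b c => ?_
  simp only [← smul_assoc, ← smul_add]
  rw [S.eps_smul_Gamma a b c, neg_smul, add_comm (F c b)]
  exact neg_add_cancel _

/-- The Γ-terms from the gamma matrix and from the contraction cancel because the connection is
metric. Hence covariant differentiation preserves degree (`dA_deg`). -/
theorem dA_pk (k : ℤ) (a : Fin n) (α : Module.End R Ψ) :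
    S.dA a (pk S.ε S.γ k α) = pk S.ε S.γ k (S.dA a α) := by
  simp only [pk, dA_sum, dA_smul, dA_mul, dA_gamma, dA_hk, smul_add, mul_add, Finset.sum_mul,
    Finset.mul_sum, Finset.smul_sum, Finset.sum_add_distrib, smul_mul_assoc, mul_smul_comm]
  rw [S.skew_sum a (fun b c => S.γ c * hk S.γ k b α)]
  abel

theorem dA_mem_filt {k : ℤ} {α : Module.End R Ψ} (hα : α ∈ filt R S.γ k) (a : Fin n) :
    S.dA a α ∈ filt R S.γ k := by
  refine (filt_induction (R := R) (γ := S.γ)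
    (fun k α => S.dA a α ∈ filt R S.γ k ∧ α ∈ filt R S.γ k) ?_ ?_ ?_ ?_ ?_ ?_ hα).1
  · intro k; simp
  · intro k x y hx hy
    rw [dA_add]; exact ⟨add_mem hx.1 hy.1, add_mem hx.2 hy.2⟩
  · intro k r x hx
    rw [dA_rsmul]
    exact ⟨add_mem (Submodule.smul_mem _ _ hx.2) (Submodule.smul_mem _ _ hx.1),
      Submodule.smul_mem _ _ hx.2⟩
  · intro k x hx
    exact ⟨filt_mono (by omega) ⟨1, by ring⟩ hx.1, filt_mono (by omega) ⟨1, by ring⟩ hx.2⟩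
  · rw [dA_one]; exact ⟨zero_mem _, one_mem_filt⟩
  · intro k b x hxk hx
    have hg := gamma_mem_filt (R := R) (γ := S.γ)
    rw [dA_mul, dA_gamma, Finset.sum_mul, add_comm k 1]
    refine ⟨add_mem (sum_mem fun c _ => ?_) (filt_mul (hg b) hx.1), filt_mul (hg b) hxk⟩
    exact filt_mul (Submodule.smul_mem _ _ (hg c)) hxk

theorem dA_deg {k : ℤ} {α : Module.End R Ψ} (hα : IsDeg R S.ε S.γ k α) (a : Fin n) :
    IsDeg R S.ε S.γ k (S.dA a α) :=
  ⟨S.dA_mem_filt hα.1 a, by rw [← dA_pk, hα.2, dA_smul]⟩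

/-- The second covariant derivative of spinors. -/
def nab2 (a b : Fin n) (ψ : Ψ) : Ψ := S.nab a (S.nab b ψ) - ∑ c, S.Γ a b c • S.nab c ψ

theorem nab2_sub (a b : Fin n) (ψ : Ψ) : S.nab2 a b ψ - S.nab2 b a ψ = S.Rm a b ψ := by
  have h := S.curv a b ψ
  simp only [sub_smul, Finset.sum_sub_distrib] at h
  rw [nab2, nab2]
  rw [sub_eq_iff_eq_add] at h
  rw [h]; abel

theorem Rm_skew (a b : Fin n) : S.Rm b a = -S.Rm a b := by
  ext ψ; rw [LinearMap.neg_apply, ← nab2_sub, ← nab2_sub]; abel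

theorem dA_dA (a b : Fin n) (α : Module.End R Ψ) :
    S.dA a (S.dA b α) - S.dA b (S.dA a α) =
      S.Rm a b * α - α * S.Rm a b + ∑ c, (S.Γ a b c - S.Γ b a c) • S.dA c α := by
  ext ψ
  have h1 := S.curv a b (α ψ)
  have h2 := congrArg α (S.curv a b ψ)
  simp only [map_sub, map_add, map_sum, map_smul] at h2
  simp only [LinearMap.sub_apply, LinearMap.add_apply, LinearMap.sum_apply, LinearMap.smul_apply,
    dA_apply, map_sub, Module.End.mul_apply, smul_sub, Finset.sum_sub_distrib]
  rw [sub_eq_iff_eq_add] at h1 h2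
  rw [h1, h2]; abel

/-- The first-order operator `Bᵃ ∇ₐ + C`. -/
def op (B : Fin n → Module.End R Ψ) (C : Module.End R Ψ) (ψ : Ψ) : Ψ :=
  ∑ a, S.ε a • B a (S.nab a ψ) + C ψ

/-- The covariant derivative of a family of endomorphisms with one frame index. -/
def dF (a : Fin n) (B : Fin n → Module.End R Ψ) (b : Fin n) : Module.End R Ψ :=
  S.dA a (B b) - ∑ c, S.Γ a b c • B c

theorem op_op (A B : Fin n → Module.End R Ψ) (C E : Module.End R Ψ) (ψ : Ψ) :
    S.op A C (S.op B E ψ) =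
      ∑ a, ∑ b, (S.ε a * S.ε b) • (A a * B b) (S.nab2 a b ψ) +
      ∑ b, S.ε b • (∑ a, S.ε a • (A a * S.dF a B b) + A b * E + C * B b) (S.nab b ψ) +
      (∑ a, S.ε a • (A a * S.dA a E) + C * E) ψ := by
  have h1 : ∀ a, A a (S.nab a (S.op B E ψ)) =
      ∑ b, S.ε b • A a (S.dA a (B b) (S.nab b ψ)) + ∑ b, S.ε b • A a (B b (S.nab a (S.nab b ψ)))
      + A a (S.dA a E ψ) + A a (E (S.nab a ψ)) := by
    intro a
    simp only [op, map_add, map_sum, map_smul, map_real_smul, nab_apply, smul_add,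
      Finset.sum_add_distrib]
    abel
  -- Replacing plain by covariant derivatives adds a Γ-term to each of the two sums; the two cancel
  -- since the connection is metric.
  have h2 : ∀ a, ∑ b, S.ε b • A a (B b (S.nab2 a b ψ)) +
      ∑ b, S.ε b • A a (S.dF a B b (S.nab b ψ)) =
      ∑ b, S.ε b • A a (S.dA a (B b) (S.nab b ψ)) +
      ∑ b, S.ε b • A a (B b (S.nab a (S.nab b ψ))) := by
    intro a
    simp only [nab2, dF, map_sub, map_sum, map_smul, LinearMap.sub_apply, LinearMap.sum_apply,
      LinearMap.smul_apply, smul_sub, Finset.smul_sum, Finset.sum_sub_distrib]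
    rw [S.skew_sum a (fun b c => A a (B b (S.nab c ψ)))]
    abel
  rw [op]
  simp only [h1, ← h2]
  simp only [op, map_add, map_sum, map_real_smul, LinearMap.add_apply, LinearMap.sum_apply,
    real_smul_apply, Module.End.mul_apply, smul_add, Finset.smul_sum, Finset.sum_add_distrib,
    mul_smul]
  rw [Finset.sum_comm (f := fun a b => S.ε a • S.ε b • A a (S.dF a B b (S.nab b ψ)))]
  have h3 : ∀ a b, S.ε a • S.ε b • A a (S.dF a B b (S.nab b ψ))
      = S.ε b • S.ε a • A a (S.dF a B b (S.nab b ψ)) := fun a b => smul_comm _ _ _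
  simp only [h3]
  abel

/-- The matrix `w` inverts the differentials of the coordinates, so a family indexed by the frame is
determined by its pairings with them. -/
theorem eq_zero_of_coord {E : Type*} [AddCommGroup E] [Module R E] (F : Fin n → E)
    (h : ∀ i, ∑ b, S.der b (S.t i) • F b = 0) (a : Fin n) : F a = 0 := by
  have h1 : ∑ i, S.w i a • ∑ b, S.der b (S.t i) • F b = 0 := by simp [h]
  simp only [Finset.smul_sum, smul_smul] at h1
  rw [Finset.sum_comm] at h1
  simp only [← Finset.sum_smul, S.coord] at h1
  simpa using h1

theorem nab2_smul (a b : Fin n) (r : R) (ψ : Ψ) :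
    S.nab2 a b (r • ψ) = r • S.nab2 a b ψ + S.der a r • S.nab b ψ + S.der b r • S.nab a ψ
      + (S.der a (S.der b r) - ∑ c, S.Γ a b c * S.der c r) • ψ := by
  simp only [nab2, S.nab_smul, map_add, smul_add, Finset.sum_add_distrib, smul_sub, sub_smul,
    Finset.sum_smul, Finset.smul_sum, smul_smul, mul_comm r]
  abel

/-- A first-order operator that vanishes has vanishing coefficients. -/
theorem op_eq_zero {Q : Fin n → Module.End R Ψ} {C : Module.End R Ψ}
    (h : ∀ ψ, ∑ b, Q b (S.nab b ψ) + C ψ = 0) : (∀ b, Q b = 0) ∧ C = 0 := by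
  have h1 : ∀ b, Q b = 0 := by
    refine S.eq_zero_of_coord Q fun i => ?_
    ext ψ
    -- Commuting the operator with multiplication by a coordinate leaves the symbol evaluated on its
    -- differential.
    have h2 := h (S.t i • ψ)
    have h3 := congrArg (S.t i • ·) (h ψ)
    simp only [S.nab_smul, map_add, map_smul, Finset.sum_add_distrib, ← Finset.smul_sum] at h2
    simp only [smul_add, smul_zero] at h3
    rw [add_assoc, h3, add_zero] at h2
    simpa [LinearMap.sum_apply] using h2
  refine ⟨h1, ?_⟩
  ext ψ
  simpa [h1] using h ψ

/-- A second-order operator that vanishes has vanishing coefficients. -/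
theorem op2_eq_zero {P : Fin n → Fin n → Module.End R Ψ} {Q : Fin n → Module.End R Ψ}
    {C : Module.End R Ψ}
    (h : ∀ ψ, ∑ a, ∑ b, P a b (S.nab2 a b ψ) + ∑ b, Q b (S.nab b ψ) + C ψ = 0) :
    (∀ a b, P a b + P b a = 0) ∧ (∀ b, Q b = 0) := by
  have hP : ∀ a b, P a b + P b a = 0 := by
    -- The commutator with a function r is a first-order operator whose symbol is dr contracted with
    -- the symmetrised P, so `op_eq_zero` applies to it.
    have h1 : ∀ (r : R) (ψ : Ψ), ∑ a, ∑ b, S.der a r • (P a b + P b a) (S.nab b ψ)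
        + (∑ a, ∑ b, (S.der a (S.der b r) - ∑ c, S.Γ a b c * S.der c r) • P a b
          + ∑ b, S.der b r • Q b) ψ = 0 := by
      intro r ψ
      have h2 := h (r • ψ)
      have h3 := congrArg (r • ·) (h ψ)
      simp only [nab2_smul, S.nab_smul, map_add, map_smul, Finset.sum_add_distrib] at h2
      simp only [smul_add, smul_zero, Finset.smul_sum] at h3
      simp only [LinearMap.add_apply, LinearMap.sum_apply, LinearMap.smul_apply, smul_add,
        Finset.sum_add_distrib]
      rw [Finset.sum_comm (f := fun a b => S.der a r • P b a (S.nab b ψ))]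
      refine Eq.trans ?_ ((congrArg₂ (· - ·) h2 h3).trans (sub_zero 0))
      abel
    intro a b
    have h2 : ∀ r b, ∑ a, S.der a r • (P a b + P b a) = 0 := by
      intro r
      refine (S.op_eq_zero (Q := fun b => ∑ a, S.der a r • (P a b + P b a))
        (C := ∑ a, ∑ b, (S.der a (S.der b r) - ∑ c, S.Γ a b c * S.der c r) • P a b
          + ∑ b, S.der b r • Q b) fun ψ => ?_).1
      rw [← h1 r ψ]
      congr 1
      simp only [LinearMap.sum_apply, LinearMap.smul_apply]
      exact Finset.sum_comm
    exact S.eq_zero_of_coord (fun a => P a b + P b a) (fun i => h2 (S.t i) b) a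
  refine ⟨hP, ?_⟩
  -- For antisymmetric P only the antisymmetrised second derivative enters, which is a curvature of
  -- order zero.
  have h4 : ∀ ψ, ∑ a, ∑ b, P a b (S.nab2 a b ψ) =
      ((1 / 2 : ℝ) • ∑ a, ∑ b, P a b * S.Rm a b) ψ := by
    intro ψ
    simp only [real_smul_apply, LinearMap.sum_apply, Finset.smul_sum, Module.End.mul_apply]
    refine sum_sum_eq_of_symm fun a b => ?_
    have e1 : P b a = -P a b := eq_neg_of_add_eq_zero_right (hP a b)
    rw [e1, S.Rm_skew a b]
    simp only [LinearMap.neg_apply, map_neg, neg_neg]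
    rw [← sub_eq_add_neg, ← map_sub, nab2_sub]
    module
  refine (S.op_eq_zero (C := (1 / 2 : ℝ) • ∑ a, ∑ b, P a b * S.Rm a b + C) fun ψ => ?_).1
  have := h ψ
  rw [h4] at this
  rw [← this, LinearMap.add_apply]; abel

end SpinData


/-! ### Exterior multiplication as the complement of contraction in multiplication by a gamma
matrix. -/

section Exterior

variable {n : ℕ} {R A : Type*} [CommRing R] [Algebra ℝ R] [Ring A] [Algebra ℝ A] [Algebra R A]
  [IsScalarTower ℝ R A] {ε : Fin n → ℝ} {γ : Fin n → A}

/-- The exterior multiplication `eₐ ∧ α` on elements of parity `k`. -/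
def ew (γ : Fin n → A) (k : ℤ) (a : Fin n) (α : A) : A := hk γ (k + 1) a α

theorem gamma_mul_eq (k : ℤ) (a : Fin n) (α : A) : γ a * α = ew γ k a α + hk γ k a α := by
  simp only [ew, hk, sg_add, sg_one]; module

theorem ew_add (k : ℤ) (a : Fin n) (α β : A) : ew γ k a (α + β) = ew γ k a α + ew γ k a β :=
  hk_add _ _ _ _

theorem ew_smul (k : ℤ) (a : Fin n) (r : ℝ) (α : A) : ew γ k a (r • α) = r • ew γ k a α :=
  hk_smul _ _ _ _

theorem ew_neg (k : ℤ) (a : Fin n) (α : A) : ew γ k a (-α) = -ew γ k a α := hk_neg _ _ _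

theorem ew_sub (k : ℤ) (a : Fin n) (α β : A) : ew γ k a (α - β) = ew γ k a α - ew γ k a β :=
  hk_sub _ _ _ _

theorem ew_sum {ι : Type*} (t : Finset ι) (k : ℤ) (a : Fin n) (α : ι → A) :
    ew γ k a (∑ i ∈ t, α i) = ∑ i ∈ t, ew γ k a (α i) := hk_sum _ _ _ _

variable (hC : CliffordFrame ε γ)
include hC

theorem ew_anticomm {i j : ℤ} (hij : Odd (i - j)) (a b : Fin n) (α : A) :
    ew γ j a (ew γ i b α) = -ew γ j b (ew γ i a α) :=
  hk_anticomm hC (i + 1) (j + 1) (by convert hij using 1; ring) a b α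

theorem hk_ew (k : ℤ) (a b : Fin n) (α : A) :
    hk γ (k + 1) a (ew γ k b α) =
      (if a = b then ε a else 0) • α - ew γ (k - 1) b (hk γ k a α) := by
  have h1 := hk_gamma_mul hC k a b α
  have h2 := hk_anticomm hC k (k - 1) (by simp) a b α
  rw [gamma_mul_eq k b α, hk_add, hk_congr (i := k + 1) (j := k - 1) (α := hk γ k b α)
    ⟨1, by ring⟩, h2] at h1
  rw [gamma_mul_eq (k - 1) b (hk γ k a α)] at h1
  rw [← sub_eq_add_neg, sub_eq_iff_eq_add] at h1
  rw [h1]; abel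

theorem sum_hk_hk (i j : ℤ) (hij : Odd (i - j)) (α : A) :
    ∑ a, ε a • hk γ j a (hk γ i a α) = 0 := by
  refine Finset.sum_eq_zero fun a _ => ?_
  have h := hk_anticomm hC i j hij a a α
  have h2 : (2 : ℝ) • hk γ j a (hk γ i a α) = 0 := by
    rw [two_smul]; nth_rewrite 1 [h]; abel
  rw [(smul_eq_zero.1 h2).resolve_left two_ne_zero, smul_zero]

/-- γ^a splits into exterior multiplication and contraction, and the double contraction X^a ⌟ X_a ⌟
vanishes by anticommutativity. -/
theorem sum_ew_hk (k : ℤ) (α : A) :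
    ∑ a, ε a • ew γ (k - 1) a (hk γ k a α) = pk ε γ k α := by
  have h := sum_hk_hk hC k (k - 1) (by simp) α
  rw [← add_zero (∑ a, ε a • ew γ (k - 1) a (hk γ k a α)), ← h, ← Finset.sum_add_distrib, pk]
  refine Finset.sum_congr rfl fun a _ => ?_
  rw [gamma_mul_eq (k - 1), smul_add]

theorem IsDeg.ew {k : ℤ} {α : A} (hα : IsDeg R ε γ k α) (a : Fin n) :
    IsDeg R ε γ (k + 1) (ew γ k a α) := by
  have e : KYForms.ew γ k a α = γ a * α - KYForms.hk γ k a α := by rw [gamma_mul_eq k a α]; abel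
  refine ⟨?_, ?_⟩
  · rw [e]
    refine sub_mem ?_ ?_
    · rw [add_comm]; exact filt_mul (gamma_mem_filt a) hα.1
    · exact filt_mono (by omega) ⟨1, by ring⟩ (hk_mem_filt hC hα.1 a)
  · have h1 := pk_gamma_mul hC k a α
    have h2 := (hα.hk hC a).pk_eq (j := k + 1) ⟨1, by ring⟩
    rw [e, pk_sub, h1, h2, hα.2, mul_smul_comm]
    push_cast; module

omit hC in
theorem filt_zero_comm {α : A} (hα : α ∈ filt R γ 0) (β : A) : α * β = β * α := by
  induction hα using Submodule.span_induction with
  | mem x hx =>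
    obtain ⟨l, hl, -, rfl⟩ := hx
    have : l = [] := List.eq_nil_of_length_eq_zero (by omega)
    simp [this]
  | zero => simp
  | add x y _ _ hx hy => rw [add_mul, mul_add, hx, hy]
  | smul r x _ hx => rw [smul_mul_assoc, mul_smul_comm, hx]

end Exterior

/-! ### The Bianchi identity, the Ricci form and integrability of the Killing-Yano equation. -/

namespace SpinData

variable {n : ℕ} {R Ψ : Type*} [CommRing R] [Algebra ℝ R] [AddCommGroup Ψ] [Module ℝ Ψ]
    [Module R Ψ] [IsScalarTower ℝ R Ψ] (S : SpinData n R Ψ)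

theorem hk_Rm_cyc (a b c : Fin n) : hk S.γ 2 c (S.Rm a b) - hk S.γ 2 b (S.Rm a c)
    = -hk S.γ 2 a (S.Rm b c) := by
  have h := S.bianchi a b c
  rw [S.Rm_skew a c, hk_neg] at h
  rw [← add_zero (-hk S.γ 2 a (S.Rm b c)), ← h]; abel

theorem smul_mul_smul_comm' (a b : Fin n) {E : Type*} [AddCommGroup E] [Module ℝ E] (x : E) :
    S.ε b • S.ε a • x = S.ε a • S.ε b • x := smul_comm _ _ _

/-- The first Bianchi identity: `e_b ∧ Rᵇₐ = 0`. -/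
theorem sum_ew_Rm (a : Fin n) : ∑ b, S.ε b • ew S.γ 2 b (S.Rm a b) = 0 := by
  -- The given cyclic identity mixes two frame indices with one Clifford index. It yields 4V_a =
  -- -e_b ∧ e_c ∧ (X_a ⌟ R^{bc}), from which X_a ⌟ W = -2V_a. Since e^a ∧ V_a = W has degree 4, this
  -- forces 4W = -2W, so W vanishes and V with it.
  set V : Fin n → Module.End R Ψ := fun a => ∑ b, S.ε b • ew S.γ 2 b (S.Rm a b) with hV
  set W : Module.End R Ψ := ∑ b, ∑ c, S.ε b • S.ε c • ew S.γ 3 b (ew S.γ 2 c (S.Rm b c)) with hW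
  have h1 : ∀ a b, (2 : ℝ) • S.Rm a b = ∑ c, S.ε c • ew S.γ 1 c (hk S.γ 2 c (S.Rm a b)) := by
    intro a b
    have := sum_ew_hk S.cliff 2 (S.Rm a b)
    rw [(S.Rm_deg a b).2] at this
    rw [show (2 : ℤ) - 1 = 1 by norm_num] at this
    rw [this]; norm_num
  have h2 : ∀ a, (4 : ℝ) • V a =
      -∑ b, ∑ c, S.ε b • S.ε c • ew S.γ 2 b (ew S.γ 1 c (hk S.γ 2 a (S.Rm b c))) := by
    intro a
    have e : (4 : ℝ) • V a = ∑ b, ∑ c, (2 : ℝ) • S.ε b • S.ε c •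
        ew S.γ 2 b (ew S.γ 1 c (hk S.γ 2 c (S.Rm a b))) := by
      have : (4 : ℝ) • V a = (2 : ℝ) • ∑ b, S.ε b • ew S.γ 2 b ((2 : ℝ) • S.Rm a b) := by
        simp only [hV, ew_smul, Finset.smul_sum]
        exact Finset.sum_congr rfl fun b _ => by module
      rw [this]
      simp only [h1, ew_sum, ew_smul, Finset.smul_sum]
    rw [e, ← Finset.sum_neg_distrib]
    simp only [← Finset.sum_neg_distrib]
    refine sum_sum_eq_of_symm fun b c => ?_
    rw [ew_anticomm S.cliff (i := 1) (j := 2) (by decide) c b,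
      ew_anticomm S.cliff (i := 1) (j := 2) (by decide) c b, S.smul_mul_smul_comm' b c,
      S.smul_mul_smul_comm' b c, S.Rm_skew b c, hk_neg, ew_neg, ew_neg]
    have := S.hk_Rm_cyc a b c
    rw [sub_eq_iff_eq_add] at this
    rw [this]
    simp only [ew_add, ew_neg]
    module
  have h3 : ∀ a, hk S.γ 4 a W = (-2 : ℝ) • V a := by
    intro a
    have e : ∀ b c, hk S.γ 4 a (ew S.γ 3 b (ew S.γ 2 c (S.Rm b c))) =
        (if a = b then S.ε a else 0) • ew S.γ 2 c (S.Rm b c)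
        - (if a = c then S.ε a else 0) • ew S.γ 2 b (S.Rm b c)
        + ew S.γ 2 b (ew S.γ 1 c (hk S.γ 2 a (S.Rm b c))) := by
      intro b c
      have e1 : hk S.γ 4 a (ew S.γ 3 b (ew S.γ 2 c (S.Rm b c))) = _ :=
        hk_ew S.cliff 3 a b (ew S.γ 2 c (S.Rm b c))
      have e2 : hk S.γ (3 - 1 + 1) a (ew S.γ 2 c (S.Rm b c)) = _ :=
        hk_ew S.cliff 2 a c (S.Rm b c)
      rw [show (3 : ℤ) - 1 = 2 by norm_num] at e1
      rw [show (3 : ℤ) - 1 + 1 = 3 by norm_num, show (2 : ℤ) - 1 = 1 by norm_num] at e2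
      rw [e1, e2, ew_sub, ew_smul]; abel
    have e1 : ∑ b, ∑ c, S.ε b • S.ε c • (if a = b then S.ε a else 0) • ew S.γ 2 c (S.Rm b c)
        = V a := by
      rw [Finset.sum_comm]
      refine Finset.sum_congr rfl fun c _ => ?_
      simp only [S.smul_mul_smul_comm' c, ← Finset.smul_sum]
      rw [sum_ite_smul S.cliff (fun b => ew S.γ 2 c (S.Rm b c)) a]
    have e2 : ∑ b, ∑ c, S.ε b • S.ε c • (if a = c then S.ε a else 0) • ew S.γ 2 b (S.Rm b c)
        = -V a := by
      rw [hV, ← Finset.sum_neg_distrib]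
      refine Finset.sum_congr rfl fun b _ => ?_
      rw [← Finset.smul_sum, sum_ite_smul S.cliff (fun c => ew S.γ 2 b (S.Rm b c)) a,
        S.Rm_skew a b, ew_neg, smul_neg]
    rw [hW]
    simp only [hk_sum, hk_smul, e, smul_add, smul_sub, Finset.sum_add_distrib,
      Finset.sum_sub_distrib]
    rw [e1, e2]
    have := h2 a
    rw [eq_comm, neg_eq_iff_eq_neg] at this
    rw [this]; module
  have hWd : IsDeg R S.ε S.γ 4 W := by
    refine IsDeg.sum fun b _ => IsDeg.sum fun c _ => ?_
    exact ((((S.Rm_deg b c).ew S.cliff c).ew S.cliff b).smul _).smul _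
  have h4 : W = 0 := by
    have e1 : ∑ a, S.ε a • (S.γ a * V a) = W := by
      have e2 : ∑ a, S.ε a • hk S.γ 3 a (V a) = 0 := by
        have := sum_hk_hk S.cliff 4 3 (by decide) W
        simp only [h3, hk_smul, smul_comm _ (-2 : ℝ), ← Finset.smul_sum] at this
        exact (smul_eq_zero.1 this).resolve_left (by norm_num)
      simp only [gamma_mul_eq 3, smul_add, Finset.sum_add_distrib]
      rw [e2, add_zero, hW, hV]
      simp only [ew_sum, ew_smul, Finset.smul_sum]
    have e3 := hWd.2
    rw [pk] at e3
    simp only [h3, mul_smul_comm, smul_comm _ (-2 : ℝ), ← Finset.smul_sum] at e3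
    rw [e1] at e3
    have e4 : (6 : ℝ) • W = 0 := by
      push_cast at e3
      have : (6 : ℝ) • W = (4 : ℝ) • W - (-2 : ℝ) • W := by module
      rw [this, e3, sub_self]
    exact (smul_eq_zero.1 e4).resolve_left (by norm_num)
  have h5 := h3 a
  rw [h4, hk_zero] at h5
  exact (smul_eq_zero.1 h5.symm).resolve_left (by norm_num)

/-- The Ricci form `γᵇ R_{ab}`. -/
def ric (a : Fin n) : Module.End R Ψ := ∑ b, S.ε b • (S.γ b * S.Rm a b)

/-- The Bianchi identity removes the exterior part of γ^b R_{ab}, so the Ricci form has degree one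
instead of three. -/
theorem ric_eq (a : Fin n) : S.ric a = ∑ b, S.ε b • hk S.γ 2 b (S.Rm a b) := by
  simp only [ric, gamma_mul_eq 2, smul_add, Finset.sum_add_distrib]
  rw [S.sum_ew_Rm, zero_add]

theorem ric_deg (a : Fin n) : IsDeg R S.ε S.γ 1 (S.ric a) := by
  rw [ric_eq]
  exact IsDeg.sum fun b _ => ((S.Rm_deg a b).hk S.cliff b).smul _

/-- The exterior part of γ^a Ric_a is a contraction of the Bianchi identity (symmetry of the Ricci
tensor). The scalar curvature is left, which commutes with everything by `filt_zero_comm`. -/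
theorem sum_gamma_ric_mem : ∑ a, S.ε a • (S.γ a * S.ric a) ∈ filt R S.γ 0 := by
  have h1 : ∑ a, S.ε a • ew S.γ 1 a (S.ric a) = 0 := by
    have e : ∀ a b, ew S.γ 1 a (hk S.γ 2 b (S.Rm a b)) =
        (if b = a then S.ε b else 0) • S.Rm a b - hk S.γ 3 b (ew S.γ 2 a (S.Rm a b)) := by
      intro a b
      have : hk S.γ 3 b (ew S.γ 2 a (S.Rm a b)) = _ := hk_ew S.cliff 2 b a (S.Rm a b)
      rw [show (2 : ℤ) - 1 = 1 by norm_num] at this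
      rw [this]; abel
    simp only [ric_eq, ew_sum, ew_smul, e, smul_sub, Finset.smul_sum, Finset.sum_sub_distrib]
    have e1 : ∀ a, S.Rm a a = 0 := fun a => by
      have h := S.Rm_skew a a
      have h2 : (2 : ℝ) • S.Rm a a = 0 := by rw [two_smul]; nth_rewrite 1 [h]; abel
      exact (smul_eq_zero.1 h2).resolve_left two_ne_zero
    have e2 : ∑ a, ∑ b, S.ε a • S.ε b • (if b = a then S.ε b else 0) • S.Rm a b = 0 := by
      refine Finset.sum_eq_zero fun a _ => ?_
      rw [← Finset.smul_sum, sum_ite_smul' S.cliff (fun b => S.Rm a b) a, e1, smul_zero]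
    rw [e2, zero_sub, neg_eq_zero, Finset.sum_comm]
    refine Finset.sum_eq_zero fun b _ => ?_
    have e3 := S.sum_ew_Rm b
    have e4 : ∑ a, S.ε a • S.ε b • hk S.γ 3 b (ew S.γ 2 a (S.Rm a b))
        = -(S.ε b • hk S.γ 3 b (∑ a, S.ε a • ew S.γ 2 a (S.Rm b a))) := by
      simp only [hk_sum, Finset.smul_sum, ← Finset.sum_neg_distrib]
      refine Finset.sum_congr rfl fun a _ => ?_
      rw [S.Rm_skew b a, ew_neg, hk_neg, hk_smul, smul_neg, smul_neg, S.smul_mul_smul_comm']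
    rw [e4, e3]; simp
  simp only [gamma_mul_eq 1, smul_add, Finset.sum_add_distrib]
  rw [h1, zero_add]
  exact sum_mem fun a _ => real_smul_mem _ ((S.ric_deg a).hk S.cliff a).1

/-- A Killing-Yano form of degree `k` with `∇ₐκ = Xₐ ⌟ κ'`. -/
structure IsKY (k : ℤ) (κ κ' : Module.End R Ψ) : Prop where
  deg : IsDeg R S.ε S.γ k κ
  deg' : IsDeg R S.ε S.γ (k + 1) κ'
  eq : ∀ a, S.dA a κ = hk S.γ (k + 1) a κ'

variable {S} in
-- The integrability condition: the second covariant derivatives of κ are commuted, and the Γ-terms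
-- of the contraction cancel those of the commutator.
theorem IsKY.curv {k : ℤ} {κ κ' : Module.End R Ψ} (h : S.IsKY k κ κ') (a b : Fin n) :
    S.Rm a b * κ - κ * S.Rm a b =
      hk S.γ (k + 1) b (S.dA a κ') - hk S.γ (k + 1) a (S.dA b κ') := by
  have h1 := S.dA_dA a b κ
  simp only [h.eq, dA_hk] at h1
  rw [eq_comm, ← eq_sub_iff_add_eq] at h1
  rw [h1]
  simp only [sub_smul, Finset.sum_sub_distrib]
  abel

variable {S} in
theorem IsKY.dF_eq {k : ℤ} {κ κ' : Module.End R Ψ} (h : S.IsKY k κ κ') (a b : Fin n) :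
    S.dF a (fun c => hk S.γ k c κ) b = hk S.γ k b (hk S.γ (k + 1) a κ') := by
  rw [dF, dA_hk, h.eq, add_sub_cancel_left]

theorem dF_gamma (a b : Fin n) : S.dF a S.γ b = 0 := by rw [dF, dA_gamma, sub_self]

/-- The operator of a Killing-Yano form. -/
def kyOp (k : ℤ) (κ κ' : Module.End R Ψ) : Ψ → Ψ :=
  S.op (fun a => hk S.γ k a κ) (((k : ℝ) / 2) • κ')

/-- The Dirac operator. -/
def dirac : Ψ → Ψ := S.op S.γ 0

/-- `γᵃ γᵇ [R_{ab}, κ]`. -/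
theorem sum_gamma_gamma_comm (k : ℤ) (κ : Module.End R Ψ) :
    ∑ a, ∑ b, S.ε a • S.ε b • (S.γ a * (S.γ b * (S.Rm a b * κ - κ * S.Rm a b))) =
      (-4 : ℝ) • (∑ a, ∑ b, S.ε a • S.ε b • (hk S.γ (k - 1) a (hk S.γ k b κ) * S.Rm a b) +
        sg (k - 1) • ∑ a, ∑ b, S.ε a • S.ε b • (hk S.γ k b κ * S.γ a * S.Rm a b)) := by
  -- The sum of γ^a γ^b R_{ab} is the scalar curvature term, so κ can be moved across it.
  have h1 : ∑ a, ∑ b, S.ε a • S.ε b • (S.γ a * (S.γ b * (S.Rm a b * κ))) =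
      ∑ a, ∑ b, S.ε a • S.ε b • (κ * (S.γ a * (S.γ b * S.Rm a b))) := by
    have e := filt_zero_comm S.sum_gamma_ric_mem κ
    simp only [ric, Finset.mul_sum, Finset.sum_mul, Finset.smul_sum, smul_mul_assoc,
      mul_smul_comm, mul_assoc] at e
    exact e
  simp only [mul_sub, smul_sub, Finset.sum_sub_distrib]
  rw [h1, ← Finset.sum_sub_distrib, Finset.smul_sum, ← Finset.sum_add_distrib, Finset.smul_sum]
  simp only [← Finset.sum_sub_distrib, Finset.smul_sum, ← Finset.sum_add_distrib]
  refine sum_sum_eq_of_symm fun a b => ?_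
  have e : ∀ a b, S.γ a * (S.γ b * (κ * S.Rm a b)) = κ * (S.γ a * (S.γ b * S.Rm a b))
      + (2 * sg k) • (hk S.γ k a κ * (S.γ b * S.Rm a b))
      - (2 * sg k) • (hk S.γ k b κ * (S.γ a * S.Rm a b))
      + (4 : ℝ) • (hk S.γ (k - 1) a (hk S.γ k b κ) * S.Rm a b) := by
    intro a b
    have e1 : S.γ a * (S.γ b * κ) = κ * (S.γ a * S.γ b) + (2 * sg k) • (hk S.γ k a κ * S.γ b)
        - (2 * sg k) • (hk S.γ k b κ * S.γ a) + (4 : ℝ) • hk S.γ (k - 1) a (hk S.γ k b κ) := by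
      rw [gamma_mul k b κ, mul_add, mul_smul_comm, mul_smul_comm, ← mul_assoc, gamma_mul k a κ,
        gamma_mul (k - 1) a (hk S.γ k b κ), sg_sub, sg_one, add_mul, smul_mul_assoc,
        smul_mul_assoc, mul_assoc]
      have := sg_mul_self k
      match_scalars <;> linarith
    have := congrArg (· * S.Rm a b) e1
    simpa only [add_mul, sub_mul, smul_mul_assoc, mul_assoc] using this
  rw [e a b, e b a, S.Rm_skew a b, S.smul_mul_smul_comm' a b, sg_sub, sg_one]
  simp only [mul_neg, smul_neg, mul_assoc]
  module

end SpinData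

/-! ### Killing-Yano operators graded commute with the Dirac operator. -/

namespace SpinData

variable {n : ℕ} {R Ψ : Type*} [CommRing R] [Algebra ℝ R] [AddCommGroup Ψ] [Module ℝ Ψ]
    [Module R Ψ] [IsScalarTower ℝ R Ψ] (S : SpinData n R Ψ)

theorem op_smul (B : Fin n → Module.End R Ψ) (C : Module.End R Ψ) (r : ℝ) (ψ : Ψ) :
    S.op B C (r • ψ) = r • S.op B C ψ := by
  simp only [op, map_smul, map_real_smul, smul_add, Finset.smul_sum, smul_comm _ r]

theorem op_sub (B : Fin n → Module.End R Ψ) (C : Module.End R Ψ) (ψ χ : Ψ) :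
    S.op B C (ψ - χ) = S.op B C ψ - S.op B C χ := by
  simp only [op, map_sub, smul_sub, Finset.sum_sub_distrib]; abel

/-- The zeroth-order part of the graded commutator of the Dirac operator with `Bᵃ ∇ₐ`. -/
def curvTerm (k : ℤ) (κ : Module.End R Ψ) : Module.End R Ψ :=
  ∑ a, ∑ b, S.ε a • S.ε b • (hk S.γ (k - 1) a (hk S.γ k b κ) * S.Rm a b) +
    sg (k - 1) • ∑ a, ∑ b, S.ε a • S.ε b • (hk S.γ k b κ * S.γ a * S.Rm a b)

variable {S}

/-- Word length alone would allow degree k + 2 in the second sum; there γ^a R_{ab} reduces to the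
Ricci form, of degree one, which brings the bound down to k. This bound isolates the top part in
`IsKY.dirac_eq`. -/
theorem curvTerm_mem {k : ℤ} {κ : Module.End R Ψ} (hκ : IsDeg R S.ε S.γ k κ) :
    S.curvTerm k κ ∈ filt R S.γ k := by
  refine add_mem ?_ (real_smul_mem _ ?_)
  · refine sum_mem fun a _ => sum_mem fun b _ => real_smul_mem _ (real_smul_mem _ ?_)
    have := filt_mul ((hκ.hk S.cliff b).hk S.cliff a).1 (S.Rm_deg a b).1
    convert this using 1; ring_nf
  · have e : ∑ a, ∑ b, S.ε a • S.ε b • (hk S.γ k b κ * S.γ a * S.Rm a b)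
        = -∑ b, S.ε b • (hk S.γ k b κ * S.ric b) := by
      simp only [ric, Finset.mul_sum, Finset.smul_sum, mul_smul_comm]
      rw [Finset.sum_comm, ← Finset.sum_neg_distrib]
      refine Finset.sum_congr rfl fun b _ => ?_
      rw [← Finset.sum_neg_distrib]
      refine Finset.sum_congr rfl fun a _ => ?_
      rw [S.Rm_skew b a, S.smul_mul_smul_comm', mul_assoc]
      simp only [mul_neg, smul_neg]
    rw [e]
    refine neg_mem (sum_mem fun b _ => real_smul_mem _ ?_)
    have := filt_mul (hκ.hk S.cliff b).1 (S.ric_deg b).1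
    convert this using 1; ring_nf

/-- With Z = γ^a ∇_a κ', contracting the integrability condition twice with gamma matrices gives (k
+ pk)Z = -4 `curvTerm`. The right side has no part of degree k + 2, where k + pk is 2k + 2; so e^a ∧
∇_a κ' = 0 for k ≥ 0, and the part of degree k gives the second equation. -/
theorem IsKY.dirac_eq {k : ℤ} {κ κ' : Module.End R Ψ} (h : S.IsKY k κ κ') :
    (∑ a, S.ε a • ew S.γ (k + 1) a (S.dA a κ') = 0 ∨ k < 0) ∧ (0 ≤ k →
    ((k : ℝ) / 2) • ∑ a, S.ε a • (S.γ a * S.dA a κ') + S.curvTerm k κ = 0) := by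
  set Y := fun a => S.dA a κ' with hY
  set Z := ∑ a, S.ε a • (S.γ a * Y a) with hZ
  have hYd : ∀ a, IsDeg R S.ε S.γ (k + 1) (Y a) := fun a => S.dA_deg h.deg' a
  have h1 : ∀ a, ∑ b, S.ε b • (S.γ b * (S.Rm a b * κ - κ * S.Rm a b)) =
      (k : ℝ) • Y a + hk S.γ (k + 1 + 1) a Z := by
    intro a
    have e1 : ∑ b, S.ε b • (S.γ b * hk S.γ (k + 1) b (Y a)) = ((k : ℝ) + 1) • Y a := by
      have := (hYd a).2
      rw [pk] at this; rw [this]; push_cast; rfl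
    have e2 : hk S.γ (k + 1 + 1) a Z = Y a - ∑ b, S.ε b • (S.γ b * hk S.γ (k + 1) a (Y b)) := by
      rw [hZ]
      simp only [hk_sum, hk_smul, hk_gamma_mul S.cliff, smul_sub, Finset.sum_sub_distrib]
      rw [sum_ite_smul S.cliff Y a]
    simp only [h.curv, mul_sub, smul_sub, Finset.sum_sub_distrib]
    rw [e1, e2]; module
  have h2 : (k : ℝ) • Z + pk S.ε S.γ k Z = (-4 : ℝ) • S.curvTerm k κ := by
    rw [curvTerm, ← S.sum_gamma_gamma_comm k κ]
    have e : ∀ a, ∑ b, S.ε a • S.ε b • (S.γ a * (S.γ b * (S.Rm a b * κ - κ * S.Rm a b)))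
        = S.ε a • (S.γ a * ((k : ℝ) • Y a + hk S.γ k a Z)) := by
      intro a
      rw [← hk_congr (i := k + 1 + 1) (j := k) ⟨1, by ring⟩, ← h1]
      simp only [Finset.mul_sum, Finset.smul_sum, mul_smul_comm]
    simp only [e, mul_add, smul_add, Finset.sum_add_distrib, mul_smul_comm]
    rw [hZ, Finset.smul_sum, pk]
    simp only [smul_comm (k : ℝ)]
  set Zp := ∑ a, S.ε a • ew S.γ (k + 1) a (Y a) with hZp
  set Zm := ∑ a, S.ε a • hk S.γ (k + 1) a (Y a) with hZm
  have hZe : Z = Zp + Zm := by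
    rw [hZ, hZp, hZm, ← Finset.sum_add_distrib]
    refine Finset.sum_congr rfl fun a _ => ?_
    rw [gamma_mul_eq (k + 1), smul_add]
  have hp : IsDeg R S.ε S.γ (k + 2) Zp := IsDeg.sum fun a _ => by
    have := ((hYd a).ew S.cliff a).smul (S.ε a)
    convert this using 1; ring
  have hm : IsDeg R S.ε S.γ k Zm := IsDeg.sum fun a _ => by
    have := ((hYd a).hk S.cliff a).smul (S.ε a)
    convert this using 1; ring
  have h3 : pk S.ε S.γ k Z = ((k : ℝ) + 2) • Zp + (k : ℝ) • Zm := by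
    rw [hZe, pk_add, hm.2, hp.pk_eq ⟨-1, by ring⟩]; push_cast; rfl
  rw [h3] at h2
  have hz : 0 ≤ k → Zp = 0 := by
    intro hk
    have hk' : (0 : ℝ) ≤ k := by exact_mod_cast hk
    refine hp.eq_zero_of_mem S.cliff ?_
    have e : Zp = (2 * (k : ℝ) + 2)⁻¹ • ((-4 : ℝ) • S.curvTerm k κ - (2 * (k : ℝ)) • Zm) := by
      rw [← h2, hZe]
      have : 2 * (k : ℝ) + 2 ≠ 0 := by positivity
      have e' : (k : ℝ) • (Zp + Zm) + (((k : ℝ) + 2) • Zp + (k : ℝ) • Zm) - (2 * (k : ℝ)) • Zm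
        = (2 * (k : ℝ) + 2) • Zp := by module
      rw [e', smul_smul, inv_mul_cancel₀ this, one_smul]
    rw [e]
    refine real_smul_mem _ (sub_mem (real_smul_mem _ ?_) (real_smul_mem _ ?_))
    · convert curvTerm_mem h.deg using 1; ring_nf
    · convert hm.1 using 1; ring_nf
  refine ⟨?_, fun hk => ?_⟩
  · rcases lt_or_ge k 0 with hk | hk
    · exact Or.inr hk
    · exact Or.inl (hz hk)
  · rw [hz hk] at h2 hZe
    rw [hZe] at h2 ⊢
    have : ((k : ℝ) / 2) • (0 + Zm) + S.curvTerm k κ = (1 / 4 : ℝ) • ((k : ℝ) • (0 + Zm) +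
      (((k : ℝ) + 2) • (0 : Module.End R Ψ) + (k : ℝ) • Zm) - (-4 : ℝ) • S.curvTerm k κ) := by module
    rw [this, h2, sub_self, smul_zero]

/-- The operator of a Killing-Yano form graded commutes with the Dirac operator. -/
theorem IsKY.dirac_kyOp {k : ℤ} {κ κ' : Module.End R Ψ} (h : S.IsKY k κ κ') (hk0 : 0 ≤ k)
    (ψ : Ψ) : S.dirac (S.kyOp k κ κ' ψ) = sg (k - 1) • S.kyOp k κ κ' (S.dirac ψ) := by
  rw [← sub_eq_zero]
  set B := fun a => hk S.γ k a κ with hB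
  set s := sg (k - 1) with hs
  have hBg : ∀ a b, S.γ a * B b = s • (B b * S.γ a) + (2 : ℝ) • hk S.γ (k - 1) a (B b) :=
    fun a b => gamma_mul (k - 1) a (B b)
  have hanti : ∀ a b, hk S.γ (k - 1) b (B a) = -hk S.γ (k - 1) a (B b) :=
    fun a b => hk_anticomm S.cliff k (k - 1) (by simp) b a κ
  -- The symmetrised second-order coefficients cancel since X_a ⌟ X_b ⌟ κ is antisymmetric; what
  -- remains is a curvature term.
  have e2 : ∑ a, ∑ b, (S.ε a * S.ε b) • (S.γ a * B b) (S.nab2 a b ψ)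
      - s • ∑ a, ∑ b, (S.ε a * S.ε b) • (B a * S.γ b) (S.nab2 a b ψ) = S.curvTerm k κ ψ := by
    rw [curvTerm]
    simp only [LinearMap.add_apply, LinearMap.sum_apply, real_smul_apply, Finset.smul_sum,
      ← Finset.sum_sub_distrib, ← Finset.sum_add_distrib]
    change _ = ∑ a, ∑ b, (S.ε a • S.ε b • (hk S.γ (k - 1) a (B b) * S.Rm a b) ψ +
      s • S.ε a • S.ε b • (B b * S.γ a * S.Rm a b) ψ)
    refine sum_sum_eq_of_symm fun a b => ?_
    have e : S.nab2 b a ψ = S.nab2 a b ψ - S.Rm a b ψ := by rw [← S.nab2_sub]; abel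
    rw [e, hBg a b, hBg b a, S.Rm_skew a b, hanti a b]
    simp only [LinearMap.add_apply, real_smul_apply, LinearMap.neg_apply, map_sub,
      Module.End.mul_apply, map_neg, smul_neg, smul_sub, smul_add, neg_neg]
    module
  -- The derivative of the symbol contributes -k X_b ⌟ κ' and the zeroth-order term 2(k/2) X_b ⌟ κ'.
  -- This fixes the coefficient k/2 in `kyOp`.
  have e1 : ∀ b, ∑ a, S.ε a • (S.γ a * S.dF a B b) + S.γ b * (((k : ℝ) / 2) • κ')
      - s • ((((k : ℝ) / 2) • κ') * S.γ b) = 0 := by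
    intro b
    have h1 : ∑ a, S.ε a • (S.γ a * S.dF a B b) = -((k : ℝ) • hk S.γ (k + 1) b κ') := by
      have h2 := (h.deg'.hk S.cliff b).pk_eq (j := k) ⟨0, by ring⟩
      rw [pk] at h2
      have h3 : ∀ a, S.dF a B b = -hk S.γ k a (hk S.γ (k + 1) b κ') := fun a => by
        rw [hB, h.dF_eq, hk_anticomm S.cliff (k + 1) k (by simp)]
      simp only [h3, mul_neg, smul_neg, Finset.sum_neg_distrib]
      rw [h2]; push_cast; module
    have h4 := gamma_mul (γ := S.γ) (k + 1) b κ'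
    have h5 : sg (k + 1) = s := sg_eq_of_even_sub ⟨1, by ring⟩
    rw [h1, mul_smul_comm, h4, h5, smul_mul_assoc]; module
  have e0 := h.dirac_eq.2 hk0
  have e0' := congrArg (fun α => α ψ) e0
  simp only [LinearMap.add_apply, LinearMap.zero_apply] at e0'
  rw [dirac, kyOp, op_op, op_op]
  simp only [dF_gamma, mul_zero, smul_zero, zero_mul, add_zero, Finset.sum_const_zero, zero_add,
    dA_zero, LinearMap.zero_apply, dA_smul, mul_smul_comm]
  have e1' : ∑ b, S.ε b • (∑ a, S.ε a • (S.γ a * S.dF a B b) + ((k : ℝ) / 2) • (S.γ b * κ'))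
      (S.nab b ψ) - s • ∑ b, S.ε b • (((k : ℝ) / 2) • κ' * S.γ b) (S.nab b ψ) = 0 := by
    rw [Finset.smul_sum, ← Finset.sum_sub_distrib]
    refine Finset.sum_eq_zero fun b _ => ?_
    have := congrArg (fun α => S.ε b • α (S.nab b ψ)) (e1 b)
    simp only [LinearMap.sub_apply, real_smul_apply, LinearMap.zero_apply, smul_zero,
      smul_sub, mul_smul_comm] at this
    rw [smul_comm s]; exact this
  have e6 : (∑ a, S.ε a • ((k : ℝ) / 2) • (S.γ a * S.dA a κ')) ψ
      = (((k : ℝ) / 2) • ∑ a, S.ε a • (S.γ a * S.dA a κ')) ψ := by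
    rw [Finset.smul_sum]; congr 1
    exact Finset.sum_congr rfl fun a _ => smul_comm _ _ _
  rw [e6]
  rw [sub_eq_iff_eq_add] at e2 e1'
  rw [add_eq_zero_iff_eq_neg] at e0'
  simp only [hB] at e2 e1'
  rw [e2, e1', e0']
  module

/-- The graded commutator of the operators of two Killing-Yano forms. -/
def kyComm (S : SpinData n R Ψ) (k l : ℤ) (κ κ' μ μ' : Module.End R Ψ) (ψ : Ψ) : Ψ :=
  S.kyOp k κ κ' (S.kyOp l μ μ' ψ) - sg ((k - 1) * (l - 1)) • S.kyOp l μ μ' (S.kyOp k κ κ' ψ)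

/-- The Dirac operator passes the two factors with the same total sign in either order. -/
theorem dirac_kyComm {k l : ℤ} {κ κ' μ μ' : Module.End R Ψ} (hκ : S.IsKY k κ κ')
    (hμ : S.IsKY l μ μ') (hk0 : 0 ≤ k) (hl0 : 0 ≤ l) (ψ : Ψ) :
    S.dirac (S.kyComm k l κ κ' μ μ' ψ) = sg (k + l) • S.kyComm k l κ κ' μ μ' (S.dirac ψ) := by
  have h1 : S.dirac (S.kyOp k κ κ' (S.kyOp l μ μ' ψ))
      = (sg (k - 1) * sg (l - 1)) • S.kyOp k κ κ' (S.kyOp l μ μ' (S.dirac ψ)) := by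
    rw [hκ.dirac_kyOp hk0, hμ.dirac_kyOp hl0, kyOp, op_smul, smul_smul]
  have h2 : S.dirac (S.kyOp l μ μ' (S.kyOp k κ κ' ψ))
      = (sg (l - 1) * sg (k - 1)) • S.kyOp l μ μ' (S.kyOp k κ κ' (S.dirac ψ)) := by
    rw [hμ.dirac_kyOp hl0, hκ.dirac_kyOp hk0, kyOp, op_smul, smul_smul]
  have h3 : sg (k + l) = sg (k - 1) * sg (l - 1) := by
    rw [← sg_add]; exact sg_eq_of_even_sub ⟨1, by ring⟩
  simp only [dirac, kyComm] at h1 h2 ⊢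
  rw [op_sub, op_smul, h1, h2, h3]
  module

end SpinData

/-! ### Contractions of products in terms of the degree operator. -/

section Products

variable {n : ℕ} {R A : Type*} [CommRing R] [Algebra ℝ R] [Ring A] [Algebra ℝ A] [Algebra R A]
  [IsScalarTower ℝ R A] {ε : Fin n → ℝ} {γ : Fin n → A} {i j : ℤ} {α β : A}

theorem sum_hk_mul_hk_of_deg (hα : IsDeg R ε γ i α) (hβ : IsDeg R ε γ j β) :
    ∑ a, ε a • (hk γ i a α * hk γ j a β) =
      (sg i / 2) • (pk ε γ (i + j) (α * β) - ((i : ℝ) + j) • (α * β)) := by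
  rw [sum_hk_mul_hk, hα.2, hβ.2, smul_mul_assoc, mul_smul_comm]; module

theorem sum_gamma_hk_mul_of_deg (hα : IsDeg R ε γ i α) (β : A) :
    ∑ a, ε a • (γ a * (hk γ i a α * β)) = (i : ℝ) • (α * β) := by
  have := congrArg (· * β) hα.2
  simp only [pk, Finset.sum_mul, smul_mul_assoc, mul_assoc] at this
  exact this

theorem sum_gamma_mul_hk_of_deg (hα : IsDeg R ε γ i α) (hβ : IsDeg R ε γ j β) :
    ∑ a, ε a • (γ a * (α * hk γ j a β)) =
      sg i • (pk ε γ (i + j) (α * β) - (i : ℝ) • (α * β)) := by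
  have h1 : ∀ a, ε a • (γ a * (α * hk γ j a β)) = sg i • (α * (ε a • (γ a * hk γ j a β))) +
      (2 : ℝ) • (ε a • (hk γ i a α * hk γ j a β)) := by
    intro a
    rw [← mul_assoc, gamma_mul i a α, add_mul, smul_mul_assoc, smul_mul_assoc, mul_assoc,
      mul_smul_comm]
    module
  simp only [h1, Finset.sum_add_distrib, ← Finset.smul_sum, ← Finset.mul_sum]
  have h2 := hβ.2
  rw [pk] at h2
  rw [h2, sum_hk_mul_hk_of_deg hα hβ, mul_smul_comm]
  module

/-- Contracting α twice with the same vector gives zero, so only the other factor is hit. -/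
theorem sum_hk_mul_left (i j : ℤ) (hC : CliffordFrame ε γ) (α β : A) :
    ∑ a, ε a • hk γ (i - 1 + j) a (hk γ i a α * β) =
      (-sg i) • ∑ a, ε a • (hk γ i a α * hk γ j a β) := by
  rw [Finset.smul_sum]
  refine Finset.sum_congr rfl fun a _ => ?_
  have h := hk_anticomm hC i (i - 1) (by simp) a a α
  have h2 : (2 : ℝ) • hk γ (i - 1) a (hk γ i a α) = 0 := by
    rw [two_smul]; nth_rewrite 1 [h]; abel
  rw [hk_mul, (smul_eq_zero.1 h2).resolve_left two_ne_zero, zero_mul, zero_add, sg_sub, sg_one]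
  module

theorem sum_hk_mul_right (i j : ℤ) (hC : CliffordFrame ε γ) (α β : A) :
    ∑ a, ε a • hk γ (i + (j - 1)) a (α * hk γ j a β) =
      ∑ a, ε a • (hk γ i a α * hk γ j a β) := by
  refine Finset.sum_congr rfl fun a _ => ?_
  have h := hk_anticomm hC j (j - 1) (by simp) a a β
  have h2 : (2 : ℝ) • hk γ (j - 1) a (hk γ j a β) = 0 := by
    rw [two_smul]; nth_rewrite 1 [h]; abel
  rw [hk_mul, (smul_eq_zero.1 h2).resolve_left two_ne_zero, mul_zero, smul_zero, add_zero]

/-- Each of the two sums is eliminated by comparing degree operators on a product, which leaves a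
quadratic polynomial in `pk`. -/
theorem sum_gamma_hk_hk_hk_of_deg (hC : CliffordFrame ε γ) (hα : IsDeg R ε γ i α)
    (hβ : IsDeg R ε γ j β) :
    ∑ b, ε b • (γ b * ∑ a, ε a • (hk γ i a α * hk γ (j - 1) b (hk γ j a β))) =
      (-1 / 2 : ℝ) • (pk ε γ (i + j) (pk ε γ (i + j) (α * β)) -
        (2 * (i : ℝ) + j - 1) • pk ε γ (i + j) (α * β) +
        (((i : ℝ) - 1) * (i + j)) • (α * β)) := by
  have h1 : ∀ a, ∑ b, ε b • (γ b * (hk γ i a α * hk γ (j - 1) b (hk γ j a β))) =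
      (-sg i) • (pk ε γ (i + j) (hk γ i a α * hk γ j a β) - ((i : ℝ) - 1) •
        (hk γ i a α * hk γ j a β)) := by
    intro a
    have h := sum_gamma_mul_hk_of_deg (hα.hk hC a) (hβ.hk hC a)
    rw [h, pk_congr (i := i - 1 + (j - 1)) (j := i + j) ⟨-1, by ring⟩, sg_sub, sg_one]
    push_cast; module
  have h2 : ∑ b, ε b • (γ b * ∑ a, ε a • (hk γ i a α * hk γ (j - 1) b (hk γ j a β))) =
      ∑ a, ε a • ∑ b, ε b • (γ b * (hk γ i a α * hk γ (j - 1) b (hk γ j a β))) := by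
    simp only [Finset.mul_sum, Finset.smul_sum, mul_smul_comm]
    rw [Finset.sum_comm]
    exact Finset.sum_congr rfl fun a _ => Finset.sum_congr rfl fun b _ => smul_comm _ _ _
  have h3 : ∑ a, ε a • (pk ε γ (i + j) (hk γ i a α * hk γ j a β)) =
      pk ε γ (i + j) (∑ a, ε a • (hk γ i a α * hk γ j a β)) := by
    simp only [pk_sum, pk_smul]
  rw [h2]
  have h4 : ∀ (e : ℝ) (P Q : A), e • (-sg i) • (P - ((i : ℝ) - 1) • Q) =
      (-sg i) • (e • P - ((i : ℝ) - 1) • e • Q) := fun e P Q => by module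
  simp only [h1, h4]
  rw [← Finset.smul_sum, Finset.sum_sub_distrib, ← Finset.smul_sum]
  rw [h3, sum_hk_mul_hk_of_deg hα hβ]
  simp only [pk_smul, pk_sub]
  have := sg_mul_self i
  match_scalars <;> [linear_combination (-1 / 2 : ℝ) * this;
    linear_combination ((i : ℝ) + (j - 1) / 2) * this;
    linear_combination (-((i : ℝ) - 1) * (i + j) / 2) * this]

/-- Vanishing of all contractions gives pk α = 0, while pk is multiplication by the degree modulo
lower words. So α descends to degree zero, where only scalars are left, and vanishes in odd parity.
-/
theorem eq_smul_one_of_hk {k : ℤ} (hC : CliffordFrame ε γ) (hα : α ∈ filt R γ k)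
    (h : ∀ a, hk γ k a α = 0) : ∃ r : R, α = r • (1 : A) ∧ (Odd k → α = 0) := by
  rcases Int.even_or_odd k with hk | hk
  · have key : ∀ m : ℕ, α ∈ filt R γ (2 * m) → α ∈ filt R γ 0 := by
      intro m
      induction m with
      | zero => intro h; simpa using h
      | succ m ih =>
        intro h1
        have h2 := pk_sub_mem_filt hC h1
        have h3 : pk ε γ (2 * (m + 1 : ℕ)) α = 0 := by
          rw [pk_congr (j := k) (by
            rw [Int.even_sub]; exact ⟨fun _ => hk, fun _ => ⟨_, two_mul _⟩⟩)]
          simp [pk, h]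
        rw [h3, zero_sub] at h2
        refine ih ?_
        have h4 := real_smul_mem (R := R) (2 * ((m : ℝ) + 1))⁻¹ (neg_mem h2)
        rw [neg_neg, smul_smul] at h4
        have h5 : (2 * ((m : ℝ) + 1))⁻¹ * ((2 * (m + 1 : ℕ) : ℤ) : ℝ) = 1 := by
          push_cast
          have : (m : ℝ) + 1 ≠ 0 := by positivity
          field_simp
        rw [h5, one_smul] at h4
        convert h4 using 1; push_cast; ring_nf
    have h0 : α ∈ filt R γ 0 := by
      rcases lt_or_ge k 0 with hk0 | hk0
      · rw [filt_neg hk0] at hα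
        have : α = 0 := by simpa using hα
        rw [this]; exact zero_mem _
      · obtain ⟨m, hm⟩ := hk
        refine key m.toNat ?_
        convert hα using 1
        rw [show (2 * (m.toNat : ℤ)) = k by omega]
    have h1 : filt R γ 0 ≤ Submodule.span R {(1 : A)} := by
      refine Submodule.span_le.2 ?_
      rintro x ⟨l, hl, -, rfl⟩
      have : l = [] := List.eq_nil_of_length_eq_zero (by omega)
      rw [this]
      exact Submodule.subset_span (by simp)
    obtain ⟨r, hr⟩ := Submodule.mem_span_singleton.1 (h1 h0)
    exact ⟨r, hr.symm, fun ho => absurd hk (Int.not_even_iff_odd.2 ho)⟩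
  · have : α = 0 := eq_zero_of_hk hC hα (Int.not_even_iff_odd.2 hk) h
    exact ⟨0, by simp [this], fun _ => this⟩

end Products

/-! ### First-order operators that graded commute with the Dirac operator. -/

namespace SpinData

variable {n : ℕ} {R Ψ : Type*} [CommRing R] [Algebra ℝ R] [AddCommGroup Ψ] [Module ℝ Ψ]
    [Module R Ψ] [IsScalarTower ℝ R Ψ] {S : SpinData n R Ψ}

/-- The symbol equations of an operator that graded commutes with the Dirac operator. -/
theorem symbol_of_dirac_comm {j : ℤ} {B : Fin n → Module.End R Ψ} {C : Module.End R Ψ}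
    (h : ∀ ψ, S.dirac (S.op B C ψ) = sg j • S.op B C (S.dirac ψ)) :
    (∀ a b, hk S.γ j a (B b) + hk S.γ j b (B a) = 0) ∧
    ∀ b, ∑ a, S.ε a • (S.γ a * S.dF a B b) + (2 : ℝ) • hk S.γ j b C = 0 := by
  have hε : ∀ a, S.ε a ≠ 0 := fun a h0 => by simpa [h0] using S.cliff.sq a
  have h1 := S.op2_eq_zero
    (P := fun a b => (S.ε a * S.ε b) • (S.γ a * B b - sg j • (B a * S.γ b)))
    (Q := fun b => S.ε b • (∑ a, S.ε a • (S.γ a * S.dF a B b) + S.γ b * C - sg j • (C * S.γ b)))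
    (C := ∑ a, S.ε a • (S.γ a * S.dA a C)) (by
      intro ψ
      have h2 := h ψ
      rw [dirac, op_op, op_op, ← sub_eq_zero] at h2
      simp only [dF_gamma, mul_zero, smul_zero, zero_mul, add_zero, Finset.sum_const_zero,
        zero_add, dA_zero, LinearMap.zero_apply] at h2
      rw [← h2]
      simp only [real_smul_apply, LinearMap.sub_apply, LinearMap.add_apply, smul_sub, smul_add,
        Finset.sum_sub_distrib, Finset.sum_add_distrib, Finset.smul_sum, smul_comm _ (sg j),
        LinearMap.sum_apply]
      abel)
  refine ⟨fun a b => ?_, fun b => ?_⟩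
  · have h3 := h1.1 a b
    rw [mul_comm (S.ε b), ← smul_add] at h3
    have h4 := (smul_eq_zero.1 h3).resolve_left (mul_ne_zero (hε a) (hε b))
    simp only [hk]
    rw [← smul_add]
    rw [show S.γ a * B b - sg j • (B b * S.γ a) + (S.γ b * B a - sg j • (B a * S.γ b)) = 0 by
      rw [← h4]; abel, smul_zero]
  · have h3 := (smul_eq_zero.1 (h1.2 b)).resolve_left (hε b)
    rw [← h3]
    simp only [hk]
    module

/-- An operator with symbol `X ⌟ β` that graded commutes with the Dirac operator is the operator
of a Killing-Yano form plus a function. -/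
theorem exists_isKY_of_symbol {m : ℤ} (hm : 0 ≤ m) {β C : Module.End R Ψ} {j : ℤ}
    (hj : Even (j - (m + 1))) (hβ : IsDeg R S.ε S.γ m β) (hC : C ∈ filt R S.γ j)
    (hjm : m + 1 ≤ j)
    (h : ∀ b, ∑ a, S.ε a • (S.γ a * S.dF a (fun c => hk S.γ m c β) b)
      + (2 : ℝ) • hk S.γ j b C = 0) :
    ∃ (β' : Module.End R Ψ) (r : R), S.IsKY m β β' ∧
      C = ((m : ℝ) / 2) • β' + r • (1 : Module.End R Ψ) ∧
      (Odd j → r • (1 : Module.End R Ψ) = 0) := by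
  have hm' : (m : ℝ) + 1 ≠ 0 := by
    have : (0 : ℝ) ≤ m := by exact_mod_cast hm
    positivity
  set Y := fun a => S.dA a β with hY
  have hYd : ∀ a, IsDeg R S.ε S.γ m (Y a) := S.dA_deg hβ
  set Z := ∑ a, S.ε a • (S.γ a * Y a) with hZ
  -- Contracting Z with X_b turns the symbol equation into ∇_b β = X_b ⌟ (Z - 2C), a Killing-Yano
  -- equation except that Z - 2C need not be homogeneous.
  have h1 : ∀ b, Y b = hk S.γ (m + 1) b (Z - (2 : ℝ) • C) := by
    intro b
    have e1 : ∀ a, S.dF a (fun c => hk S.γ m c β) b = hk S.γ m b (Y a) := fun a => by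
      rw [dF, dA_hk, add_sub_cancel_left]
    have e2 : hk S.γ (m + 1) b Z = Y b - ∑ a, S.ε a • (S.γ a * hk S.γ m b (Y a)) := by
      rw [hZ]
      simp only [hk_sum, hk_smul, hk_gamma_mul S.cliff, smul_sub, Finset.sum_sub_distrib]
      rw [sum_ite_smul S.cliff Y b]
    have h2 := h b
    simp only [e1] at h2
    rw [hk_congr hj] at h2
    rw [hk_sub, hk_smul, e2]
    rw [eq_sub_iff_add_eq, eq_sub_iff_add_eq, add_assoc, add_comm _ (∑ a, _), h2, add_zero]
  have h2 : Z = pk S.ε S.γ (m + 1) (Z - (2 : ℝ) • C) := by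
    rw [pk]; simp only [← h1]; exact hZ
  -- Since Z = pk(Z - 2C), contraction gives X_c ⌟ Z = (1 + pk)∇_c β, and ∇_c β has degree m. Hence
  -- β' = Z/(m + 1) below.
  have h3 : ∀ c, hk S.γ (m + 1) c Z = ((m : ℝ) + 1) • Y c := by
    intro c
    have := hk_pk S.cliff (m + 1) c (Z - (2 : ℝ) • C)
    rw [← h2, ← h1, add_sub_cancel_right, (hYd c).2] at this
    rw [this]; module
  set β' := ((m : ℝ) + 1)⁻¹ • Z with hβ'
  have h4 : ∀ c, hk S.γ (m + 1) c β' = Y c := fun c => by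
    rw [hβ', hk_smul, h3, smul_smul, inv_mul_cancel₀ hm', one_smul]
  have hKY : S.IsKY m β β' := by
    refine ⟨hβ, ⟨?_, ?_⟩, fun a => (h4 a).symm⟩
    · refine real_smul_mem _ (sum_mem fun a _ => real_smul_mem _ ?_)
      rw [add_comm]
      exact filt_mul (gamma_mem_filt a) (hYd a).1
    · rw [pk]; simp only [h4]
      rw [← hZ, hβ', smul_smul]; push_cast
      rw [mul_inv_cancel₀ hm', one_smul]
  -- From 2 X_b ⌟ C = m ∇_b β, the difference C - (m/2)β' has no contractions and is a scalar.
  obtain ⟨r, hr, hr'⟩ := eq_smul_one_of_hk S.cliff (k := j) (α := C - ((m : ℝ) / 2) • β')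
    (sub_mem hC (real_smul_mem _ (filt_mono hjm hj hKY.deg'.1))) (fun b => by
      rw [hk_congr hj, hk_sub, hk_smul, h4]
      have e := h1 b
      rw [hk_sub, h3, hk_smul] at e
      have e' : hk S.γ (m + 1) b C = ((m : ℝ) / 2) • Y b := by
        have : (2 : ℝ) • hk S.γ (m + 1) b C = (m : ℝ) • Y b := by
          rw [eq_sub_iff_add_eq] at e
          have : (m : ℝ) • Y b = ((m : ℝ) + 1) • Y b - Y b := by module
          rw [this, ← e]; abel
        have h5 := congrArg (fun x => (1 / 2 : ℝ) • x) this
        simp only [smul_smul] at h5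
        rw [show (1 / 2 : ℝ) * 2 = 1 by norm_num, one_smul] at h5
        rw [h5]; congr 1; ring
      rw [e', sub_self])
  refine ⟨β', r, hKY, ?_, fun ho => ?_⟩
  · rw [← hr]; abel
  · rw [← hr]; exact hr' ho

/-- The function by which an operator graded commuting with the Dirac operator differs from
the operator of a Killing-Yano form is constant. -/
theorem der_eq_zero_of_dirac_comm {r : R}
    (h : ∀ ψ, S.dirac (r • ψ) = r • S.dirac ψ) (a : Fin n) :
    S.der a r • (1 : Module.End R Ψ) = 0 := by
  have h1 : ∑ b, S.ε b • S.der b r • S.γ b = 0 := by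
    ext ψ
    have h2 := h ψ
    rw [dirac, op, op, ← sub_eq_zero] at h2
    simp only [S.nab_smul, map_add, map_smul, LinearMap.zero_apply, add_zero, smul_add, smul_zero,
      Finset.sum_add_distrib, Finset.smul_sum] at h2
    simp only [LinearMap.zero_apply, LinearMap.sum_apply, LinearMap.smul_apply]
    rw [← h2]
    simp only [smul_comm r]
    abel
  have h2 := congrArg (hk S.γ 1 a) h1
  simp only [hk_sum, hk_rsmul, hk_gamma S.cliff odd_one, hk_zero] at h2
  rw [← h2]
  have := sum_ite_smul S.cliff (fun b => S.der b r • (1 : Module.End R Ψ)) a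
  rw [← this]
  exact Finset.sum_congr rfl fun b _ => by rw [smul_comm (S.der b r)]

end SpinData

/-! ### Linear algebra for the trace of the symbol of a graded commutator. -/

theorem sg_eq_or (k : ℤ) : sg k = 1 ∨ sg k = -1 := by
  rcases mul_self_eq_one_iff.1 (sg_mul_self k) with h | h
  · exact Or.inl h
  · exact Or.inr h

/-- `pk` as a linear map. -/
def pkL {n : ℕ} {A : Type*} [Ring A] [Algebra ℝ A] (ε : Fin n → ℝ) (γ : Fin n → A) (k : ℤ) :
    A →ₗ[ℝ] A where
  toFun := pk ε γ k
  map_add' := pk_add _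
  map_smul' := pk_smul _

theorem pkL_apply {n : ℕ} {A : Type*} [Ring A] [Algebra ℝ A] (ε : Fin n → ℝ) (γ : Fin n → A)
    (k : ℤ) (α : A) : pkL ε γ k α = pk ε γ k α := rfl

/-- The two graded combinations of the products `x`, `y`, `u`, `v` determine the trace
of the symbol. -/
theorem symbol_trace_identity {A : Type*} [AddCommGroup A] [Module ℝ A] (T : A →ₗ[ℝ] A)
    {x y u v Θ G : A} {k l a b c s : ℝ} (ha : a = 1 ∨ a = -1) (hb : b = 1 ∨ b = -1)
    (hc : c = 1 ∨ c = -1) (hs : s = -(c * a * b))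
    (hΘ : Θ = x - (c * b) • u - a • (y - (c * a) • v))
    (hG : G = (1 / 2 : ℝ) • (T (x + (c * b) • u) + (k - l + 1) • (x + (c * b) • u) +
      a • (T (y + (c * a) • v) + (l - k + 1) • (y + (c * a) • v))))
    (h1 : T Θ = (k + l - 1) • Θ) (h2 : T G = (k + l + 1) • G) :
    (-1 / 2 : ℝ) • (T (T y) - (2 * k + (l + 1) - 1) • T y + ((k - 1) * (k + (l + 1))) • y)
      + (l / 2) • k • y + (k / 2) • (-a) • (T x - (k + 1) • x)
      - s • ((-1 / 2 : ℝ) • (T (T u) - (2 * l + (k + 1) - 1) • T u + ((l - 1) * (l + (k + 1))) • u)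
        + (k / 2) • l • u + (l / 2) • (-b) • (T v - (l + 1) • v)) =
      (-(k * l / 2 * a)) • Θ := by
  -- Θ collects the graded commutators and G the graded anticommutators. As T - (k + l) squares to
  -- one on Θ, the first bracket reduces to 2klΘ, and the term in G vanishes by `h2`.
  have key : (-1 / 2 : ℝ) • (T (T y) - (2 * k + (l + 1) - 1) • T y + ((k - 1) * (k + (l + 1))) • y)
      + (l / 2) • k • y + (k / 2) • (-a) • (T x - (k + 1) • x)
      - s • ((-1 / 2 : ℝ) • (T (T u) - (2 * l + (k + 1) - 1) • T u + ((l - 1) * (l + (k + 1))) • u)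
        + (k / 2) • l • u + (l / 2) • (-b) • (T v - (l + 1) • v)) =
      (-a / 4) • (-(T (T Θ) - (2 * (k + l)) • T Θ + ((k + l) * (k + l)) • Θ) + (2 * k * l + 1) • Θ)
        - (a / 2) • (T G - (k + l + 1) • G) := by
    rw [hΘ, hG, hs]
    rcases ha with rfl | rfl <;> rcases hb with rfl | rfl <;> rcases hc with rfl | rfl <;>
    · simp only [map_add, map_sub, map_smul]; module
  rw [key, h1, h2, map_smul, h1]
  module

/-! ### The graded commutator of two Killing-Yano operators. -/

namespace SpinData

variable {n : ℕ} {R Ψ : Type*} [CommRing R] [Algebra ℝ R] [AddCommGroup Ψ] [Module ℝ Ψ]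
    [Module R Ψ] [IsScalarTower ℝ R Ψ] {S : SpinData n R Ψ}

/-- A second-order operator with antisymmetric coefficients is an operator of order zero. -/
theorem nab2_skew {P : Fin n → Fin n → Module.End R Ψ} (hP : ∀ a b, P a b + P b a = 0) (ψ : Ψ) :
    ∑ a, ∑ b, (S.ε a * S.ε b) • P a b (S.nab2 a b ψ) =
      ((1 / 2 : ℝ) • ∑ a, ∑ b, (S.ε a * S.ε b) • (P a b * S.Rm a b)) ψ := by
  simp only [real_smul_apply, LinearMap.sum_apply, Finset.smul_sum, Module.End.mul_apply]
  refine sum_sum_eq_of_symm fun a b => ?_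
  have e1 : P b a = -P a b := eq_neg_of_add_eq_zero_right (hP a b)
  rw [e1, S.Rm_skew a b, mul_comm (S.ε b), ← S.nab2_sub a b ψ]
  simp only [LinearMap.neg_apply, map_neg, ← S.nab2_sub a b ψ, map_sub]
  module

/-- The symbol of the product of two Killing-Yano operators, up to second order terms. -/
def prodSymbol (S : SpinData n R Ψ) (k l : ℤ) (κ κ' μ μ' : Module.End R Ψ) (b : Fin n) :
    Module.End R Ψ :=
  ∑ a, S.ε a • (hk S.γ k a κ * hk S.γ l b (hk S.γ (l + 1) a μ')) +
    ((l : ℝ) / 2) • (hk S.γ k b κ * μ') + ((k : ℝ) / 2) • (κ' * hk S.γ l b μ)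

/-- The zeroth-order part of the product of two Killing-Yano operators. -/
def prodZero (S : SpinData n R Ψ) (k l : ℤ) (κ κ' μ' : Module.End R Ψ) : Module.End R Ψ :=
  ((l : ℝ) / 2) • ∑ a, S.ε a • (hk S.γ k a κ * S.dA a μ') + ((k : ℝ) * l / 4) • (κ' * μ')

theorem kyOp_kyOp {k l : ℤ} {κ κ' μ μ' : Module.End R Ψ} (hμ : S.IsKY l μ μ') (ψ : Ψ) :
    S.kyOp k κ κ' (S.kyOp l μ μ' ψ) =
      ∑ a, ∑ b, (S.ε a * S.ε b) • (hk S.γ k a κ * hk S.γ l b μ) (S.nab2 a b ψ) +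
      S.op (S.prodSymbol k l κ κ' μ μ') (S.prodZero k l κ κ' μ') ψ := by
  rw [kyOp, kyOp, op_op, op, add_assoc]
  congr 1
  congr 1
  · refine Finset.sum_congr rfl fun b _ => ?_
    simp only [hμ.dF_eq, prodSymbol, mul_smul_comm, smul_mul_assoc]
  · congr 1
    simp only [prodZero, dA_smul, mul_smul_comm, smul_mul_assoc, Finset.smul_sum]
    congr 1
    · exact Finset.sum_congr rfl fun a _ => smul_comm _ _ _
    · module

/-- The symbol of the graded commutator of two Killing-Yano operators. -/
def commSymbol (S : SpinData n R Ψ) (k l : ℤ) (κ κ' μ μ' : Module.End R Ψ) (b : Fin n) :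
    Module.End R Ψ :=
  S.prodSymbol k l κ κ' μ μ' b - sg ((k - 1) * (l - 1)) • S.prodSymbol l k μ μ' κ κ' b

/-- The zeroth-order part of the graded commutator of two Killing-Yano operators. -/
def commZero (S : SpinData n R Ψ) (k l : ℤ) (κ κ' μ μ' : Module.End R Ψ) : Module.End R Ψ :=
  (1 / 2 : ℝ) • ∑ a, ∑ b, (S.ε a * S.ε b) • ((hk S.γ k a κ * hk S.γ l b μ -
    sg ((k - 1) * (l - 1)) • (hk S.γ l a μ * hk S.γ k b κ)) * S.Rm a b) +
  (S.prodZero k l κ κ' μ' - sg ((k - 1) * (l - 1)) • S.prodZero l k μ μ' κ')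

/-- The hypothesis `hcomm` makes the second-order coefficients antisymmetric, so the second-order
part becomes the curvature sum in `commZero`. -/
theorem kyComm_eq {k l : ℤ} {κ κ' μ μ' : Module.End R Ψ} (hκ : S.IsKY k κ κ') (hμ : S.IsKY l μ μ')
    (hcomm : ∀ a b, (hk S.γ k a κ * hk S.γ l b μ -
        sg ((k - 1) * (l - 1)) • (hk S.γ l b μ * hk S.γ k a κ)) +
      (hk S.γ k b κ * hk S.γ l a μ -
        sg ((k - 1) * (l - 1)) • (hk S.γ l a μ * hk S.γ k b κ)) = 0) (ψ : Ψ) :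
    S.kyComm k l κ κ' μ μ' ψ =
      S.op (S.commSymbol k l κ κ' μ μ') (S.commZero k l κ κ' μ μ') ψ := by
  have h1 := nab2_skew (S := S) (P := fun a b => hk S.γ k a κ * hk S.γ l b μ -
    sg ((k - 1) * (l - 1)) • (hk S.γ l a μ * hk S.γ k b κ)) (fun a b => by
      rw [← hcomm a b]; abel) ψ
  have h2 : S.op (S.commSymbol k l κ κ' μ μ') (S.commZero k l κ κ' μ μ') ψ =
      ((1 / 2 : ℝ) • ∑ a, ∑ b, (S.ε a * S.ε b) • ((hk S.γ k a κ * hk S.γ l b μ -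
      sg ((k - 1) * (l - 1)) • (hk S.γ l a μ * hk S.γ k b κ)) * S.Rm a b)) ψ +
      (S.op (S.prodSymbol k l κ κ' μ μ') (S.prodZero k l κ κ' μ') ψ -
        sg ((k - 1) * (l - 1)) • S.op (S.prodSymbol l k μ μ' κ κ') (S.prodZero l k μ μ' κ') ψ) := by
    simp only [op, commSymbol, commZero, LinearMap.add_apply, LinearMap.sub_apply,
      real_smul_apply, smul_sub, smul_add, Finset.sum_sub_distrib, Finset.smul_sum,
      smul_comm _ (sg ((k - 1) * (l - 1)))]
    abel
  rw [h2, ← h1, kyComm, kyOp_kyOp hμ, kyOp_kyOp hκ]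
  simp only [LinearMap.sub_apply, real_smul_apply, smul_sub, smul_add, Finset.sum_sub_distrib,
    Finset.smul_sum, smul_comm _ (sg ((k - 1) * (l - 1)))]
  abel

theorem prodSymbol_mem {k l : ℤ} {κ κ' μ μ' : Module.End R Ψ} (hκ : S.IsKY k κ κ')
    (hμ : S.IsKY l μ μ') (b : Fin n) : S.prodSymbol k l κ κ' μ μ' b ∈ filt R S.γ (k + l) := by
  refine add_mem (add_mem (sum_mem fun a _ => real_smul_mem _ ?_) (real_smul_mem _ ?_))
    (real_smul_mem _ ?_)
  · refine filt_mono (i := k - 1 + (l + 1 - 1 - 1)) (by omega) ⟨1, by ring⟩ (filt_mul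
      (hκ.deg.hk S.cliff a).1 ?_)
    have := (hμ.deg'.hk S.cliff a).1
    convert hk_mem_filt S.cliff this b using 2
    ring
  · have := filt_mul (hκ.deg.hk S.cliff b).1 hμ.deg'.1
    convert this using 1; ring_nf
  · have := filt_mul hκ.deg'.1 (hμ.deg.hk S.cliff b).1
    convert this using 1; ring_nf

theorem prodZero_mem {k l : ℤ} {κ κ' μ μ' : Module.End R Ψ} (hκ : S.IsKY k κ κ')
    (hμ : S.IsKY l μ μ') : S.prodZero k l κ κ' μ' ∈ filt R S.γ (k + l + 2) := by
  refine add_mem (real_smul_mem _ (sum_mem fun a _ => real_smul_mem _ ?_)) (real_smul_mem _ ?_)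
  · exact filt_mono (i := k - 1 + (l + 1)) (by omega) ⟨1, by ring⟩
      (filt_mul (hκ.deg.hk S.cliff a).1 (S.dA_deg hμ.deg' a).1)
  · have := filt_mul hκ.deg'.1 hμ.deg'.1
    convert this using 1; ring_nf

theorem commSymbol_mem {k l : ℤ} {κ κ' μ μ' : Module.End R Ψ} (hκ : S.IsKY k κ κ')
    (hμ : S.IsKY l μ μ') (b : Fin n) : S.commSymbol k l κ κ' μ μ' b ∈ filt R S.γ (k + l) :=
  sub_mem (prodSymbol_mem hκ hμ b) (real_smul_mem _ (add_comm l k ▸ prodSymbol_mem hμ hκ b))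

theorem commZero_mem {k l : ℤ} {κ κ' μ μ' : Module.End R Ψ} (hκ : S.IsKY k κ κ')
    (hμ : S.IsKY l μ μ') : S.commZero k l κ κ' μ μ' ∈ filt R S.γ (k + l + 2) := by
  refine add_mem (real_smul_mem _ (sum_mem fun a _ => sum_mem fun b _ => real_smul_mem _ ?_))
    (sub_mem (prodZero_mem hκ hμ) (real_smul_mem _ (add_comm l k ▸ prodZero_mem hμ hκ)))
  have e : k + l + 2 = k + l + 0 + 2 := by ring
  rw [e]
  refine filt_mul (sub_mem ?_ (real_smul_mem _ ?_)) (S.Rm_deg a b).1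
  · exact filt_mono (i := k - 1 + (l - 1)) (by omega) ⟨1, by ring⟩
      (filt_mul (hκ.deg.hk S.cliff a).1 (hμ.deg.hk S.cliff b).1)
  · exact filt_mono (i := l - 1 + (k - 1)) (by omega) ⟨1, by ring⟩
      (filt_mul (hμ.deg.hk S.cliff a).1 (hκ.deg.hk S.cliff b).1)

/-- The graded commutator `κ' μ ∓ μ κ' ± (κ μ' ∓ μ' κ)`, proportional to the Clifford element of
the Schouten-Nijenhuis bracket. -/
def snElt (k l : ℤ) (κ κ' μ μ' : Module.End R Ψ) : Module.End R Ψ :=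
  κ' * μ - sg ((k + 1) * l) • (μ * κ') + sg (k - 1) • (κ * μ' - sg (k * (l + 1)) • (μ' * κ))

/-- After tracing with γ^b only κμ', κ'μ and the degree operator remain, which reduces the
comparison with the bracket to linear algebra in `pk`. -/
theorem sum_gamma_prodSymbol {k l : ℤ} {κ κ' μ μ' : Module.End R Ψ} (hκ : S.IsKY k κ κ')
    (hμ : S.IsKY l μ μ') : ∑ b, S.ε b • (S.γ b * S.prodSymbol k l κ κ' μ μ' b) =
    (-1 / 2 : ℝ) • (pk S.ε S.γ (k + l + 1) (pk S.ε S.γ (k + l + 1) (κ * μ')) -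
        (2 * (k : ℝ) + ((l : ℝ) + 1) - 1) • pk S.ε S.γ (k + l + 1) (κ * μ') +
        (((k : ℝ) - 1) * (k + (l + 1))) • (κ * μ')) +
      ((l : ℝ) / 2) • (k : ℝ) • (κ * μ') +
      ((k : ℝ) / 2) • (-sg k) • (pk S.ε S.γ (k + l + 1) (κ' * μ) - ((k : ℝ) + 1) • (κ' * μ)) := by
  have h1 := sum_gamma_hk_hk_hk_of_deg S.cliff hκ.deg hμ.deg'
  have h2 := sum_gamma_hk_mul_of_deg hκ.deg μ'
  have h3 := sum_gamma_mul_hk_of_deg hκ.deg' hμ.deg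
  rw [add_sub_cancel_right, ← add_assoc] at h1
  rw [add_right_comm, sg_add, sg_one] at h3
  simp only [prodSymbol, mul_add, smul_add, Finset.sum_add_distrib, mul_smul_comm,
    smul_comm _ ((l : ℝ) / 2), smul_comm _ ((k : ℝ) / 2)]
  rw [h1, ← Finset.smul_sum, h2, ← Finset.smul_sum, h3]
  push_cast
  module

/-- If the graded anticommutator of two Killing-Yano forms has no lower-degree part, then the
commutators with the derivatives are homogeneous. -/
theorem snElt_deg {k l : ℤ} {κ κ' μ μ' : Module.End R Ψ} (hκ : S.IsKY k κ κ')
    (hμ : S.IsKY l μ μ') (hdeg : IsDeg R S.ε S.γ (k + l) (κ * μ + sg (k * l) • (μ * κ))) :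
    IsDeg R S.ε S.γ (k + l - 1) (snElt k l κ κ' μ μ') ∧
    ∀ G, G = (1 / 2 : ℝ) • (pkL S.ε S.γ (k + l + 1) (κ' * μ + (sg (k * l) * sg l) • (μ * κ')) +
      ((k : ℝ) - l + 1) • (κ' * μ + (sg (k * l) * sg l) • (μ * κ')) +
      sg k • (pkL S.ε S.γ (k + l + 1) (κ * μ' + (sg (k * l) * sg k) • (μ' * κ)) +
        ((l : ℝ) - k + 1) • (κ * μ' + (sg (k * l) * sg k) • (μ' * κ)))) →
      pkL S.ε S.γ (k + l + 1) G = ((k : ℝ) + l + 1) • G := by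
  set T := pkL S.ε S.γ (k + l + 1) with hT
  -- E is homogeneous, hence so are its covariant derivatives. Their contraction Dm has degree k + l
  -- - 1 and turns out to be Θ; their exterior product Dp has degree k + l + 1 and turns out to be
  -- G.
  set E := κ * μ + sg (k * l) • (μ * κ) with hE
  set Dm := ∑ c, S.ε c • hk S.γ (k + l) c (S.dA c E) with hDm
  set Dp := ∑ c, S.ε c • ew S.γ (k + l) c (S.dA c E) with hDp
  have hEd := S.dA_deg hdeg
  have hEc : ∀ c, S.dA c E = hk S.γ (k + 1) c κ' * μ + κ * hk S.γ (l + 1) c μ' +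
      sg (k * l) • (hk S.γ (l + 1) c μ' * κ + μ * hk S.γ (k + 1) c κ') := fun c => by
    rw [hE, dA_add, dA_smul, dA_mul, dA_mul, hκ.eq, hμ.eq]
  have hm : Dm = (-1 / 2 : ℝ) • (T (κ' * μ) - ((k : ℝ) + l + 1) • (κ' * μ)) +
      (sg k / 2) • (T (κ * μ') - ((k : ℝ) + l + 1) • (κ * μ')) + sg (k * l) •
      ((-1 / 2 : ℝ) • (T (μ' * κ) - ((k : ℝ) + l + 1) • (μ' * κ)) +
        (sg l / 2) • (T (μ * κ') - ((k : ℝ) + l + 1) • (μ * κ'))) := by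
    have e1 := sum_hk_mul_left (k + 1) l S.cliff κ' μ
    have e2 := sum_hk_mul_right k (l + 1) S.cliff κ μ'
    have e3 := sum_hk_mul_left (l + 1) k S.cliff μ' κ
    have e4 := sum_hk_mul_right l (k + 1) S.cliff μ κ'
    rw [sum_hk_mul_hk_of_deg hκ.deg' hμ.deg, add_sub_cancel_right, add_right_comm k 1 l] at e1
    rw [sum_hk_mul_hk_of_deg hκ.deg hμ.deg', add_sub_cancel_right, ← add_assoc k l 1] at e2
    rw [sum_hk_mul_hk_of_deg hμ.deg' hκ.deg, add_sub_cancel_right, add_right_comm l 1 k,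
      add_comm l k] at e3
    rw [sum_hk_mul_hk_of_deg hμ.deg hκ.deg', add_sub_cancel_right, ← add_assoc l k 1,
      add_comm l k] at e4
    have hk2 := sg_mul_self (k + 1)
    have hl2 := sg_mul_self (l + 1)
    rw [smul_smul, show -sg (k + 1) * (sg (k + 1) / 2) = -1 / 2 by
      linear_combination (-1 / 2) * hk2] at e1
    rw [smul_smul, show -sg (l + 1) * (sg (l + 1) / 2) = -1 / 2 by
      linear_combination (-1 / 2) * hl2] at e3
    rw [hDm]
    simp only [hEc, hk_add, hk_smul, smul_add, Finset.sum_add_distrib,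
      smul_comm _ (sg (k * l))]
    rw [← Finset.smul_sum, ← Finset.smul_sum, e1, e2, e3, e4, hT]
    simp only [pkL_apply]
    push_cast
    module
  have hp : Dm + Dp = ((k : ℝ) + 1) • (κ' * μ) + sg k • (T (κ * μ') - (k : ℝ) • (κ * μ')) +
      sg (k * l) • (((l : ℝ) + 1) • (μ' * κ) + sg l • (T (μ * κ') - (l : ℝ) • (μ * κ'))) := by
    have e1 := sum_gamma_hk_mul_of_deg hκ.deg' μ
    have e2 := sum_gamma_mul_hk_of_deg hκ.deg hμ.deg'
    have e3 := sum_gamma_hk_mul_of_deg hμ.deg' κ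
    have e4 := sum_gamma_mul_hk_of_deg hμ.deg hκ.deg'
    rw [← add_assoc k l 1] at e2
    rw [← add_assoc l k 1, add_comm l k] at e4
    have e5 : Dm + Dp = ∑ c, S.ε c • (S.γ c * S.dA c E) := by
      rw [hDm, hDp, ← Finset.sum_add_distrib]
      refine Finset.sum_congr rfl fun c _ => ?_
      rw [gamma_mul_eq (k + l), smul_add, add_comm]
    rw [e5]
    simp only [hEc, mul_add, smul_add, mul_smul_comm, Finset.sum_add_distrib,
      smul_comm _ (sg (k * l))]
    rw [← Finset.smul_sum, ← Finset.smul_sum, e1, e2, e3, e4, hT]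
    simp only [pkL_apply]
    push_cast
    module
  have hDmT : T Dm = ((k : ℝ) + l - 1) • Dm := by
    have : IsDeg R S.ε S.γ (k + l - 1) Dm := IsDeg.sum fun c _ => ((hEd c).hk S.cliff c).smul _
    rw [hT, pkL_apply, this.pk_eq ⟨1, by ring⟩]; push_cast; rfl
  have hDpT : T Dp = ((k : ℝ) + l + 1) • Dp := by
    have : IsDeg R S.ε S.γ (k + l + 1) Dp := IsDeg.sum fun c _ => ((hEd c).ew S.cliff c).smul _
    rw [hT, pkL_apply, this.pk_eq ⟨0, by ring⟩]; push_cast; rfl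
  set Θ := snElt k l κ κ' μ μ' with hΘdef
  have hΘ2 : Θ = κ' * μ - (sg (k * l) * sg l) • (μ * κ') -
      sg k • (κ * μ' - (sg (k * l) * sg k) • (μ' * κ)) := by
    rw [hΘdef, snElt, add_mul, mul_add, sg_add, sg_add, sg_sub, sg_one, one_mul, mul_one]
    module
  have hΘmem : Θ ∈ filt R S.γ (k + l - 1) := by
    refine add_mem ?_ (real_smul_mem _ ?_)
    · convert comm_mem_filt S.cliff hκ.deg'.1 hμ.deg.1 using 1; ring_nf
    · convert comm_mem_filt S.cliff hκ.deg.1 hμ.deg'.1 using 1; ring_nf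
  have hΘm : Dm = (-1 / 2 : ℝ) • (T Θ - ((k : ℝ) + l + 1) • Θ) := by
    rw [hm, hΘ2]
    simp only [map_sub, map_smul]
    rcases sg_eq_or k with ha | ha <;> rw [ha] <;> module
  -- Homogeneity of Dm makes TΘ - (k + l - 1)Θ an eigenvector for k + l + 1. As a combination of
  -- graded commutators, however, Θ lies in step k + l - 1, where this eigenvalue does not occur.
  have hΘT : T Θ = ((k : ℝ) + l - 1) • Θ := by
    rw [← sub_eq_zero]
    refine eq_zero_of_pk_eq S.cliff (R := R) (k := k + l - 1) (j := k + l + 1)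
      (z := (k : ℝ) + l + 1) ?_ ⟨1, by ring⟩ ?_ (fun i _ hi _ h => ?_)
    · exact sub_mem (pk_mem_filt S.cliff hΘmem ⟨1, by ring⟩) (real_smul_mem _ hΘmem)
    · rw [← pkL_apply, ← hT]
      rw [hΘm, map_smul, map_sub, map_smul] at hDmT
      rw [map_sub, map_smul]
      have h := congrArg (fun z => (-2 : ℝ) • z) hDmT
      simp only [smul_smul] at h
      norm_num at h
      rw [sub_eq_iff_eq_add] at h
      rw [h]; module
    · have : k + l + 1 = i := by exact_mod_cast h
      omega
  have hDmΘ : Dm = Θ := by rw [hΘm, hΘT]; module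
  refine ⟨⟨hΘmem, ?_⟩, fun G hG => ?_⟩
  · rw [pk_congr (j := k + l + 1) ⟨-1, by ring⟩, ← pkL_apply, ← hT, hΘT]; push_cast; rfl
  · have hGD : G = Dp := by
      have h1 : Dp = (Dm + Dp) - Θ + (1 / 2 : ℝ) • (T Θ - ((k : ℝ) + l - 1) • Θ) := by
        rw [hΘT, hDmΘ]; module
      rw [h1, hp, hG, hΘ2]
      simp only [map_sub, map_smul, map_add]
      rcases sg_eq_or k with ha | ha <;> rw [ha] <;> module
    rw [hGD, hDpT]

/-- The graded commutator of two Killing-Yano operators is a Killing-Yano operator up to a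
function. -/
theorem exists_kyComm_eq {k l : ℤ} (hk1 : 1 ≤ k) (hl1 : 1 ≤ l) {κ κ' μ μ' : Module.End R Ψ}
    (hκ : S.IsKY k κ κ') (hμ : S.IsKY l μ μ')
    (hcomm : ∀ a b, (hk S.γ k a κ * hk S.γ l b μ -
        sg ((k - 1) * (l - 1)) • (hk S.γ l b μ * hk S.γ k a κ)) +
      (hk S.γ k b κ * hk S.γ l a μ -
        sg ((k - 1) * (l - 1)) • (hk S.γ l a μ * hk S.γ k b κ)) = 0)
    (hdeg : IsDeg R S.ε S.γ (k + l) (κ * μ + sg (k * l) • (μ * κ))) :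
    ∃ (β' : Module.End R Ψ) (r : R),
      S.IsKY (k + l - 1) ((sg (k - 1) * (k * l) / (2 * (k + l - 1))) • snElt k l κ κ' μ μ') β' ∧
      S.commZero k l κ κ' μ μ' = (((k + l - 1 : ℤ) : ℝ) / 2) • β' + r • (1 : Module.End R Ψ) ∧
      (Odd (k + l) → r • (1 : Module.End R Ψ) = 0) ∧
      (∀ a, S.der a r • (1 : Module.End R Ψ) = 0 ∨ r • (1 : Module.End R Ψ) = 0) ∧
      ∀ ψ, S.kyComm k l κ κ' μ μ' ψ = S.kyOp (k + l - 1)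
        ((sg (k - 1) * (k * l) / (2 * (k + l - 1))) • snElt k l κ κ' μ μ') β' ψ + r • ψ := by
  have hkR : (1 : ℝ) ≤ k := by exact_mod_cast hk1
  have hlR : (1 : ℝ) ≤ l := by exact_mod_cast hl1
  obtain ⟨hΘ, hG⟩ := snElt_deg hκ hμ hdeg
  set Θ := snElt k l κ κ' μ μ' with hΘdef
  set β := (sg (k - 1) * (k * l) / (2 * (k + l - 1))) • Θ with hβ
  set B := S.commSymbol k l κ κ' μ μ' with hB
  set C := S.commZero k l κ κ' μ μ' with hC
  have hop : ∀ ψ, S.kyComm k l κ κ' μ μ' ψ = S.op B C ψ := kyComm_eq hκ hμ hcomm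
  have hD : ∀ ψ, S.dirac (S.op B C ψ) = sg (k + l) • S.op B C (S.dirac ψ) := fun ψ => by
    have := dirac_kyComm hκ hμ (by omega) (by omega) ψ
    rwa [hop, hop] at this
  obtain ⟨hs1, hs2⟩ := symbol_of_dirac_comm hD
  have hβd : IsDeg R S.ε S.γ (k + l - 1) β := hΘ.smul _
  -- The constant in β is chosen so that the trace of the symbol is (k + l - 1)β, which is the trace
  -- of X_b ⌟ β.
  have htr : ∑ b, S.ε b • (S.γ b * B b) = ((k : ℝ) + l - 1) • β := by
    have e : ∑ b, S.ε b • (S.γ b * B b) = (-((k : ℝ) * l / 2 * sg k)) • Θ := by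
      have e1 := sum_gamma_prodSymbol hκ hμ
      have e2 := sum_gamma_prodSymbol hμ hκ
      rw [add_comm l k] at e2
      have hss : sg ((k - 1) * (l - 1)) = -(sg (k * l) * sg k * sg l) := by
        rw [show (k - 1) * (l - 1) = k * l - k - l + 1 by ring, sg_add, sg_one, sg_sub, sg_sub]
        ring
      have hΘ2 : Θ = κ' * μ - (sg (k * l) * sg l) • (μ * κ') -
          sg k • (κ * μ' - (sg (k * l) * sg k) • (μ' * κ)) := by
        rw [hΘdef, snElt, add_mul, mul_add, sg_add, sg_add, sg_sub, sg_one, one_mul, mul_one]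
        module
      have e3 := symbol_trace_identity (pkL S.ε S.γ (k + l + 1)) (sg_eq_or k) (sg_eq_or l)
        (sg_eq_or (k * l)) hss hΘ2 rfl (by
          rw [pkL_apply, hΘ.pk_eq ⟨1, by ring⟩]; push_cast; rfl) (hG _ rfl)
      rw [← e3]
      simp only [pkL_apply]
      rw [← e1, ← e2, Finset.smul_sum, ← Finset.sum_sub_distrib]
      refine Finset.sum_congr rfl fun b _ => ?_
      rw [hB, commSymbol, mul_sub, smul_sub, mul_smul_comm, smul_comm (S.ε b)]
    rw [e, hβ, smul_smul, sg_sub, sg_one]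
    congr 1
    have : (k : ℝ) + l - 1 ≠ 0 := by linarith
    field_simp
  -- Antisymmetry of X_a ⌟ B_b turns the contracted trace into (1 + pk)B_b. The difference of B_b
  -- and X_b ⌟ β then satisfies the eigenvalue equation of `pk` for -1, which has no nonzero
  -- solution.
  have hBβ : ∀ b, B b = hk S.γ (k + l - 1) b β := by
    intro b
    have e1 : hk S.γ (k + l + 1) b (∑ a, S.ε a • (S.γ a * B a)) = B b + pk S.ε S.γ (k + l) (B b) := by
      simp only [hk_sum, hk_smul, hk_gamma_mul S.cliff, smul_sub, Finset.sum_sub_distrib]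
      rw [sum_ite_smul S.cliff B b, pk, sub_eq_add_neg, ← Finset.sum_neg_distrib]
      congr 1
      refine Finset.sum_congr rfl fun a _ => ?_
      rw [eq_neg_of_add_eq_zero_left (hs1 b a)]
      simp
    have e2 := (hβd.hk S.cliff b).pk_eq (j := k + l) ⟨1, by ring⟩
    rw [htr, hk_smul, hk_congr (i := k + l + 1) (j := k + l - 1) ⟨1, by ring⟩] at e1
    rw [← sub_eq_zero]
    refine eq_zero_of_pk_eq_of_neg S.cliff (R := R) (k := k + l) (j := k + l) (z := -1)
      (sub_mem (commSymbol_mem hκ hμ b) ?_) ⟨0, by ring⟩ (by norm_num) ?_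
    · exact filt_mono (by omega) ⟨1, by ring⟩ (hβd.hk S.cliff b).1
    · rw [pk_sub, e2, ← sub_eq_iff_eq_add'.2 e1]
      push_cast
      module
  have hs3 : ∀ b, ∑ a, S.ε a • (S.γ a * S.dF a (fun c => hk S.γ (k + l - 1) c β) b)
      + (2 : ℝ) • hk S.γ (k + l + 2) b C = 0 := by
    intro b
    have : B = fun c => hk S.γ (k + l - 1) c β := funext hBβ
    rw [← this, hk_congr (i := k + l + 2) (j := k + l) ⟨1, by ring⟩]
    exact hs2 b
  obtain ⟨β', r, hKY, hCe, hodd⟩ := exists_isKY_of_symbol (m := k + l - 1) (by omega)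
    (j := k + l + 2) ⟨1, by ring⟩ hβd (commZero_mem hκ hμ) (by omega) hs3
  have hfin : ∀ ψ, S.kyComm k l κ κ' μ μ' ψ = S.kyOp (k + l - 1) β β' ψ + r • ψ := by
    intro ψ
    rw [hop, kyOp, op, op, hC, hCe]
    simp only [hBβ, LinearMap.add_apply, LinearMap.smul_apply, Module.End.one_apply]
    abel
  refine ⟨β', r, hKY, hCe, fun ho => hodd (ho.add_even ⟨1, by ring⟩), fun a => ?_, hfin⟩
  -- For even k + l both the commutator and K_β commute with the Dirac operator without sign, so
  -- multiplication by r does too. For odd k + l parity has already excluded r.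
  rcases Int.even_or_odd (k + l) with he | ho
  · refine Or.inl (der_eq_zero_of_dirac_comm (fun ψ => ?_) a)
    have h1 := dirac_kyComm hκ hμ (by omega) (by omega) ψ
    have h2 := hKY.dirac_kyOp (by omega) ψ
    have e1 : sg (k + l) = 1 := sg_even he
    have e2 : sg (k + l - 1 - 1) = 1 := by rw [← e1]; exact sg_eq_of_even_sub ⟨-1, by ring⟩
    rw [e1, one_smul, hfin, hfin] at h1
    rw [e2, one_smul] at h2
    have h3 : S.dirac (S.kyOp (k + l - 1) β β' ψ + r • ψ) =
        S.dirac (S.kyOp (k + l - 1) β β' ψ) + S.dirac (r • ψ) := by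
      simp only [dirac, op, map_add, smul_add, Finset.sum_add_distrib, LinearMap.zero_apply,
        add_zero]
    rw [h3, h2] at h1
    exact add_left_cancel h1
  · exact Or.inr (hodd (ho.add_even ⟨1, by ring⟩))

end SpinData

/-! ### Orthogonality of degrees for the trace form. -/

section Trace

variable {n : ℕ} {R A : Type*} [CommRing R] [Algebra ℝ R] [Ring A] [Algebra ℝ A] [Algebra R A]
  [IsScalarTower ℝ R A] {ε : Fin n → ℝ} {γ : Fin n → A} {tr : A →ₗ[R] R}

theorem map_rsmul (tr : A →ₗ[R] R) (r : ℝ) (α : A) : tr (r • α) = r • tr α :=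
  tr.map_smul_of_tower r α

/-- Cyclicity of the trace makes contraction skew-adjoint up to the parity sign. -/
theorem trace_hk_mul (htr : ∀ α β, tr (α * β) = tr (β * α)) (k : ℤ) (a : Fin n) (α β : A) :
    tr (hk γ k a α * β) = (-sg k) • tr (α * hk γ k a β) := by
  have h1 : tr (γ a * (α * β)) = tr (α * (β * γ a)) := by rw [htr, mul_assoc]
  simp only [hk, sub_mul, mul_sub, smul_mul_assoc, mul_smul_comm, map_rsmul, map_sub, mul_assoc, h1]
  rcases sg_eq_or k with h | h <;> rw [h] <;> module

/-- Self-adjointness of the degree operator is what makes different eigenvalues orthogonal. -/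
theorem trace_pk_mul (htr : ∀ α β, tr (α * β) = tr (β * α)) (hC : CliffordFrame ε γ) (k : ℤ)
    (α β : A) : tr (pk ε γ k α * β) = tr (α * pk ε γ k β) := by
  simp only [pk, hk, Finset.sum_mul, Finset.mul_sum, map_sum, smul_mul_assoc, mul_smul_comm,
    mul_sub, sub_mul, map_rsmul, map_sub, mul_assoc]
  refine Finset.sum_congr rfl fun a _ => ?_
  have h3 : tr (γ a * (α * (γ a * β))) = tr (α * (γ a * (β * γ a))) := by
    rw [htr]; simp only [mul_assoc]
  have e : γ a * γ a = ε a • (1 : A) := by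
    have := hC.rel a a
    rw [if_pos rfl] at this
    have h4 : (2 : ℝ) • (γ a * γ a) = (2 : ℝ) • ε a • (1 : A) := by
      rw [two_smul, this]; module
    exact smul_right_injective A two_ne_zero h4
  rw [h3, ← mul_assoc (γ a) (γ a) (α * β), ← mul_assoc (γ a) (γ a) β, e]
  simp only [smul_mul_assoc, mul_smul_comm, one_mul, map_rsmul]

/-- Homogeneous elements of different degrees of the same parity are orthogonal. -/
theorem trace_mul_eq_zero (htr : ∀ α β, tr (α * β) = tr (β * α)) (hC : CliffordFrame ε γ) {i j : ℤ}
    {α β : A} (hα : IsDeg R ε γ i α) (hβ : IsDeg R ε γ j β) (he : Even (i - j)) (hne : i ≠ j) :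
    tr (α * β) = 0 := by
  have h := trace_pk_mul (ε := ε) (γ := γ) htr hC i α β
  rw [hα.2, hβ.pk_eq he, smul_mul_assoc, mul_smul_comm, map_rsmul, map_rsmul, ← sub_eq_zero,
    ← sub_smul] at h
  refine (smul_eq_zero.1 h).resolve_left (sub_ne_zero.2 ?_)
  exact_mod_cast hne

theorem one_deg : IsDeg R ε γ 0 (1 : A) := by
  refine ⟨one_mem_filt, ?_⟩
  simp [pk, hk, sg_zero]

theorem trace_eq_zero (htr : ∀ α β, tr (α * β) = tr (β * α)) (hC : CliffordFrame ε γ) {i : ℤ}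
    {α : A} (hα : IsDeg R ε γ i α) (he : Even i) (hne : i ≠ 0) : tr α = 0 := by
  have := trace_mul_eq_zero htr hC hα one_deg (by simpa using he) hne
  rwa [mul_one] at this

theorem trace_mul_filt_eq_zero (htr : ∀ α β, tr (α * β) = tr (β * α)) (hC : CliffordFrame ε γ)
    {k l : ℤ} {α β : A} (hα : IsDeg R ε γ k α) (hβ : β ∈ filt R γ l) (he : Even (k - l))
    (hlt : l < k) : tr (α * β) = 0 := by
  obtain ⟨P, hP⟩ := exists_isDec hC hβ
  rw [hP.2 (l.toNat + 1) (by omega), Finset.mul_sum, map_sum]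
  refine Finset.sum_eq_zero fun m _ => trace_mul_eq_zero htr hC hα (hP.1 m) ?_ (by omega)
  obtain ⟨t, ht⟩ := he
  exact ⟨t + m, by omega⟩

/-- The graded commutator of two even elements of the same degree has no part of degree two. -/
theorem trace_anticomm_mul_eq_zero (htr : ∀ α β, tr (α * β) = tr (β * α)) (hC : CliffordFrame ε γ)
    {k : ℤ} (hk : Even k) {α β ρ : A} (hα : IsDeg R ε γ k α) (hβ : IsDeg R ε γ k β)
    (hρ : IsDeg R ε γ 2 ρ) : tr ((α * β + β * α) * ρ) = 0 := by
  have h1 := prod_isDec hC hα hβ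
  have h2 := prod_isDec hC hβ hα
  have h3 := h1.add h2
  obtain ⟨t, ht⟩ := hk
  rw [h3.2 ((k + k).toNat + 1) (by omega), Finset.sum_mul, map_sum]
  refine Finset.sum_eq_zero fun m _ => ?_
  by_cases hm : k + k - 2 * (m : ℤ) = 2
  -- Degree 2 occurs at order m = k - 1, which is odd as k is even; there the two products have
  -- opposite parts.
  · rw [comp_swap hC hα hβ m, sg_odd, neg_one_smul, add_neg_cancel, zero_mul, map_zero]
    have e : (m : ℤ) = k - 1 := by omega
    rw [e, ht]
    exact ⟨2 * t * t + t - 1, by ring⟩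
  · exact trace_mul_eq_zero htr hC (h3.1 m) hρ ⟨k - m - 1, by ring⟩ hm

end Trace

/-! ### Vanishing of the scalar term by taking traces. -/

namespace SpinData

variable {n : ℕ} {R Ψ : Type*} [CommRing R] [Algebra ℝ R] [AddCommGroup Ψ] [Module ℝ Ψ]
    [Module R Ψ] [IsScalarTower ℝ R Ψ] {S : SpinData n R Ψ} {tr : Module.End R Ψ →ₗ[R] R}

theorem commZero_swap (k l : ℤ) (κ κ' μ μ' : Module.End R Ψ) :
    S.commZero l k μ μ' κ κ' = (-sg ((k - 1) * (l - 1))) • S.commZero k l κ κ' μ μ' := by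
  have hs := sg_eq_or ((k - 1) * (l - 1))
  rw [commZero, commZero, mul_comm (l - 1)]
  set s := sg ((k - 1) * (l - 1))
  have e : ∑ a, ∑ b, (S.ε a * S.ε b) • ((hk S.γ l a μ * hk S.γ k b κ -
      s • (hk S.γ k a κ * hk S.γ l b μ)) * S.Rm a b) =
      (-s) • ∑ a, ∑ b, (S.ε a * S.ε b) • ((hk S.γ k a κ * hk S.γ l b μ -
      s • (hk S.γ l a μ * hk S.γ k b κ)) * S.Rm a b) := by
    simp only [Finset.smul_sum]
    refine Finset.sum_congr rfl fun a _ => Finset.sum_congr rfl fun b _ => ?_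
    rw [sub_mul, sub_mul, smul_mul_assoc, smul_mul_assoc]
    rcases hs with hs | hs <;> rw [hs] <;> module
  rw [e]
  rcases hs with hs | hs <;> rw [hs] <;> module

/-- For odd index `hk` is exterior multiplication on the curvature, so this is again the Bianchi
identity. -/
theorem sum_hk_Rm (b : Fin n) {j : ℤ} (hj : Odd j) : ∑ a, S.ε a • hk S.γ j a (S.Rm a b) = 0 := by
  have h := S.sum_ew_Rm b
  have e : ∀ a, hk S.γ j a (S.Rm a b) = -ew S.γ 2 a (S.Rm b a) := fun a => by
    rw [S.Rm_skew b a, hk_neg, ew, hk_congr (i := j) (j := 2 + 1)]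
    exact hj.sub_odd ⟨1, by ring⟩
  simp only [e, smul_neg, Finset.sum_neg_distrib, h, neg_zero]

/-- The contraction is moved from κ to the other factors. Where it hits the curvature the sum
vanishes by the Bianchi identity; otherwise the factor multiplying κ lies in step l < k and is
orthogonal to κ. -/
theorem trace_curv_of_lt (htr : ∀ α β, tr (α * β) = tr (β * α)) {k l : ℤ} {κ μ : Module.End R Ψ}
    (hκ : IsDeg R S.ε S.γ k κ) (hμ : IsDeg R S.ε S.γ l μ) (he : Even (k - l)) (hlt : l < k) :
    ∑ a, ∑ b, (S.ε a * S.ε b) • tr (hk S.γ k a κ * hk S.γ l b μ * S.Rm a b) = 0 ∧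
    ∑ a, ∑ b, (S.ε a * S.ε b) • tr (hk S.γ l b μ * hk S.γ k a κ * S.Rm a b) = 0 := by
  have hM := fun b => hμ.hk S.cliff b
  constructor
  · have e : ∀ a b, tr (hk S.γ k a κ * hk S.γ l b μ * S.Rm a b) = (-sg k) •
        tr (κ * (hk S.γ (l - 1) a (hk S.γ l b μ) * S.Rm a b + sg (l - 1) •
          (hk S.γ l b μ * hk S.γ 3 a (S.Rm a b)))) := fun a b => by
      rw [mul_assoc, trace_hk_mul htr, ← hk_mul, hk_congr (i := k) (j := l - 1 + 3)]
      obtain ⟨t, ht⟩ := he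
      exact ⟨t - 1, by omega⟩
    have e2 : ∑ a, ∑ b, (S.ε a * S.ε b) • (hk S.γ l b μ * hk S.γ 3 a (S.Rm a b)) = 0 := by
      rw [Finset.sum_comm]
      refine Finset.sum_eq_zero fun b _ => ?_
      have : ∀ a, (S.ε a * S.ε b) • (hk S.γ l b μ * hk S.γ 3 a (S.Rm a b)) =
          S.ε b • (hk S.γ l b μ * (S.ε a • hk S.γ 3 a (S.Rm a b))) := fun a => by
        rw [mul_smul_comm, smul_smul, mul_comm]
      simp only [this]
      rw [← Finset.smul_sum, ← Finset.mul_sum, sum_hk_Rm b ⟨1, by ring⟩, mul_zero, smul_zero]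
    have e3 : ∑ a, ∑ b, (S.ε a * S.ε b) • tr (hk S.γ k a κ * hk S.γ l b μ * S.Rm a b) =
        (-sg k) • (tr (κ * ∑ a, ∑ b, (S.ε a * S.ε b) •
            (hk S.γ (l - 1) a (hk S.γ l b μ) * S.Rm a b)) +
          sg (l - 1) • tr (κ * ∑ a, ∑ b, (S.ε a * S.ε b) •
            (hk S.γ l b μ * hk S.γ 3 a (S.Rm a b)))) := by
      simp only [e, Finset.mul_sum, map_sum, mul_add, map_add, mul_smul_comm, map_rsmul,
        smul_add, Finset.smul_sum, Finset.sum_add_distrib, smul_comm (_ * _) (-sg k),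
        smul_comm (_ * _) (sg _)]
    rw [e3, e2, trace_mul_filt_eq_zero htr S.cliff (l := l) hκ _ he hlt]
    · simp
    · refine sum_mem fun a _ => sum_mem fun b _ => real_smul_mem _ ?_
      convert filt_mul ((hM b).hk S.cliff a).1 (S.Rm_deg a b).1 using 1; ring_nf
  · have e : ∀ a b, tr (hk S.γ l b μ * hk S.γ k a κ * S.Rm a b) = (-sg k) •
        tr (κ * (hk S.γ 3 a (S.Rm a b) * hk S.γ l b μ + sg 3 •
          (S.Rm a b * hk S.γ (l - 1) a (hk S.γ l b μ)))) := fun a b => by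
      rw [mul_assoc, htr, mul_assoc, trace_hk_mul htr, ← hk_mul,
        hk_congr (i := k) (j := 3 + (l - 1))]
      obtain ⟨t, ht⟩ := he
      exact ⟨t - 1, by omega⟩
    have e2 : ∑ a, ∑ b, (S.ε a * S.ε b) • (hk S.γ 3 a (S.Rm a b) * hk S.γ l b μ) = 0 := by
      rw [Finset.sum_comm]
      refine Finset.sum_eq_zero fun b _ => ?_
      have : ∀ a, (S.ε a * S.ε b) • (hk S.γ 3 a (S.Rm a b) * hk S.γ l b μ) =
          S.ε b • ((S.ε a • hk S.γ 3 a (S.Rm a b)) * hk S.γ l b μ) := fun a => by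
        rw [smul_mul_assoc, smul_smul, mul_comm (S.ε a)]
      simp only [this]
      rw [← Finset.smul_sum, ← Finset.sum_mul, sum_hk_Rm b ⟨1, by ring⟩, zero_mul, smul_zero]
    have e3 : ∑ a, ∑ b, (S.ε a * S.ε b) • tr (hk S.γ l b μ * hk S.γ k a κ * S.Rm a b) =
        (-sg k) • (tr (κ * ∑ a, ∑ b, (S.ε a * S.ε b) • (hk S.γ 3 a (S.Rm a b) * hk S.γ l b μ)) +
          sg 3 • tr (κ * ∑ a, ∑ b, (S.ε a * S.ε b) •
            (S.Rm a b * hk S.γ (l - 1) a (hk S.γ l b μ)))) := by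
      simp only [e, Finset.mul_sum, map_sum, mul_add, map_add, mul_smul_comm, map_rsmul,
        smul_add, Finset.smul_sum, Finset.sum_add_distrib, smul_comm (_ * _) (-sg k),
        smul_comm (_ * _) (sg _)]
    rw [e3, e2, mul_zero, map_zero, trace_mul_filt_eq_zero htr S.cliff (l := l) hκ _ he hlt]
    · simp
    · refine sum_mem fun a _ => sum_mem fun b _ => real_smul_mem _ ?_
      convert filt_mul (S.Rm_deg a b).1 ((hM b).hk S.cliff a).1 using 1; ring_nf

/-- Because k - l is even, the contraction moved off κ acts on ∇_a μ' as exterior multiplication,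
and e^a ∧ ∇_a μ' = 0 for a Killing-Yano form. -/
theorem trace_sum_hk_dA (htr : ∀ α β, tr (α * β) = tr (β * α)) {k l : ℤ}
    {κ μ μ' : Module.End R Ψ} (hμ : S.IsKY l μ μ') (hl : 0 ≤ l) (he : Even (k - l)) :
    tr (∑ a, S.ε a • (hk S.γ k a κ * S.dA a μ')) = 0 := by
  have h := (hμ.dirac_eq.1).resolve_right (by omega)
  have e : ∀ a, tr (hk S.γ k a κ * S.dA a μ') = (-sg k) • tr (κ * ew S.γ (l + 1) a (S.dA a μ')) :=
    fun a => by
      rw [trace_hk_mul htr, ew, hk_congr (i := k) (j := l + 1 + 1)]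
      obtain ⟨t, ht⟩ := he
      exact ⟨t - 1, by omega⟩
  have e3 : tr (∑ a, S.ε a • (hk S.γ k a κ * S.dA a μ')) =
      (-sg k) • tr (κ * ∑ a, S.ε a • ew S.γ (l + 1) a (S.dA a μ')) := by
    simp only [map_sum, map_rsmul, e, Finset.mul_sum, Finset.smul_sum, mul_smul_comm,
      smul_comm (-sg k)]
  rw [e3, h, mul_zero, map_zero, smul_zero]

/-- The trace of the zeroth-order part of the graded commutator vanishes. -/
theorem trace_commZero (htr : ∀ α β, tr (α * β) = tr (β * α)) {k l : ℤ} (hk1 : 1 ≤ k) (hl1 : 1 ≤ l)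
    {κ κ' μ μ' : Module.End R Ψ} (hκ : S.IsKY k κ κ') (hμ : S.IsKY l μ μ') (he : Even (k - l))
    (hne : ¬ (k = l ∧ Even k)) : tr (S.commZero k l κ κ' μ μ') = 0 := by
  wlog hle : l ≤ k generalizing k l κ κ' μ μ'
  · have := this hl1 hk1 hμ hκ (by
      rw [← neg_sub]; exact he.neg) (fun h => hne ⟨h.1.symm, h.1 ▸ h.2⟩) (by omega)
    rw [commZero_swap, map_rsmul] at this
    rcases smul_eq_zero.1 this with h | h
    · rcases sg_eq_or ((k - 1) * (l - 1)) with h2 | h2 <;> rw [h2] at h <;> norm_num at h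
    · exact h
  set s := sg ((k - 1) * (l - 1)) with hs
  -- Different degrees are orthogonal, and equal odd degrees give s = 1 and cyclicity. For equal
  -- even degrees s = -1 and the two traces would add up: the excluded case.
  have h0 : tr (κ' * μ') - s • tr (μ' * κ') = 0 := by
    rcases eq_or_ne k l with h | h
    · have : s = 1 := by
        have ho : Odd k := Int.not_even_iff_odd.1 fun h' => hne ⟨h, h'⟩
        rw [hs, ← h]
        exact sg_even ((ho.sub_odd odd_one).mul_right _)
      rw [this, one_smul, htr μ' κ', sub_self]
    · rw [htr μ' κ', trace_mul_eq_zero htr S.cliff hκ.deg' hμ.deg' (by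
        rwa [add_sub_add_right_eq_sub]) (by omega)]
      simp
  have h1 := trace_sum_hk_dA (κ := κ) htr hμ (by omega) he
  have h2 := trace_sum_hk_dA (κ := μ) htr hκ (by omega) (k := l) (by rw [← neg_sub]; exact he.neg)
  have h3 : ∑ a, ∑ b, (S.ε a * S.ε b) • tr ((hk S.γ k a κ * hk S.γ l b μ -
      s • (hk S.γ l a μ * hk S.γ k b κ)) * S.Rm a b) = 0 := by
    have e : ∑ a, ∑ b, (S.ε a * S.ε b) • tr ((hk S.γ k a κ * hk S.γ l b μ -
        s • (hk S.γ l a μ * hk S.γ k b κ)) * S.Rm a b) =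
        ∑ a, ∑ b, (S.ε a * S.ε b) • (tr (hk S.γ k a κ * hk S.γ l b μ * S.Rm a b) +
        s • tr (hk S.γ l b μ * hk S.γ k a κ * S.Rm a b)) := by
      refine sum_sum_eq_of_symm fun a b => ?_
      rw [S.Rm_skew a b]
      simp only [sub_mul, smul_mul_assoc, map_sub, map_rsmul, mul_neg, map_neg]
      module
    rw [e]
    rcases eq_or_ne k l with h | h
    · subst h
      have ho : Odd k := Int.not_even_iff_odd.1 fun h' => hne ⟨rfl, h'⟩
      have : s = 1 := sg_even ((ho.sub_odd odd_one).mul_right _)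
      refine Finset.sum_eq_zero fun a _ => Finset.sum_eq_zero fun b _ => ?_
      rw [this, one_smul, ← map_add, ← add_mul, trace_anticomm_mul_eq_zero htr S.cliff
        (ho.sub_odd odd_one) (hκ.deg.hk S.cliff a) (hμ.deg.hk S.cliff b) (S.Rm_deg a b), smul_zero]
    · obtain ⟨e1, e2⟩ := trace_curv_of_lt htr hκ.deg hμ.deg he (by omega)
      simp only [smul_add, Finset.sum_add_distrib, smul_comm _ s, ← Finset.smul_sum]
      rw [e1, e2, smul_zero, add_zero]
  have h4 : ∀ z : ℝ, z • (tr (κ' * μ') - s • tr (μ' * κ')) = 0 := fun z => by rw [h0, smul_zero]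
  rw [commZero, prodZero, prodZero, ← hs]
  simp only [map_add, map_sub, map_rsmul, h1, h2]
  simp only [map_sum, map_rsmul]
  rw [h3]
  refine Eq.trans ?_ (h4 ((k : ℝ) * l / 4))
  module

/-- The function by which the graded commutator differs from a Killing-Yano operator vanishes,
unless the two forms are of the same even degree in the Clifford grading. -/
theorem smul_one_eq_zero_of_trace (htr : ∀ α β, tr (α * β) = tr (β * α))
    {d : ℝ} (hd : d ≠ 0) (htr1 : tr 1 = algebraMap ℝ R d) {k l : ℤ} (hk1 : 1 ≤ k) (hl1 : 1 ≤ l)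
    {κ κ' μ μ' β β' : Module.End R Ψ} (hκ : S.IsKY k κ κ') (hμ : S.IsKY l μ μ')
    (hne : ¬ (k = l ∧ Even k)) (hβ : S.IsKY (k + l - 1) β β') {r : R} {z : ℝ}
    (hC : S.commZero k l κ κ' μ μ' = z • β' + r • (1 : Module.End R Ψ)) (he : Even (k + l)) :
    r = 0 := by
  have he' : Even (k - l) := by
    rw [Int.even_sub]; rwa [Int.even_add] at he
  have h1 := trace_commZero htr hk1 hl1 hκ hμ he' hne
  have h2 : tr β' = 0 := trace_eq_zero htr S.cliff hβ.deg' (by simpa using he) (by omega)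
  rw [hC, map_add, map_rsmul, h2, smul_zero, zero_add, map_smul, htr1, smul_eq_mul, mul_comm,
    ← Algebra.smul_def] at h1
  exact (smul_eq_zero.1 h1).resolve_left hd

end SpinData

/-! ### The spin representation of skew matrices. -/

section SpinRep

variable {n : ℕ} {R A : Type*} [CommRing R] [Algebra ℝ R] [Ring A] [Algebra ℝ A] [Algebra R A]
  [IsScalarTower ℝ R A] {ε : Fin n → ℝ} {γ : Fin n → A}

/-- The spin representation of a matrix that is skew with respect to the metric. -/
def spinRep (ε : Fin n → ℝ) (γ : Fin n → A) (X : Fin n → Fin n → R) : A :=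
  (1 / 4 : ℝ) • ∑ c, ∑ d, ε c • X c d • (γ d * γ c)

theorem spinRep_add (X Y : Fin n → Fin n → R) :
    spinRep ε γ (fun c d => X c d + Y c d) = spinRep ε γ X + spinRep ε γ Y := by
  simp only [spinRep, add_smul, smul_add, Finset.sum_add_distrib]

theorem spinRep_sub (X Y : Fin n → Fin n → R) :
    spinRep ε γ (fun c d => X c d - Y c d) = spinRep ε γ X - spinRep ε γ Y := by
  simp only [spinRep, sub_smul, smul_sub, Finset.sum_sub_distrib]

theorem spinRep_smul (r : R) (X : Fin n → Fin n → R) :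
    spinRep ε γ (fun c d => r * X c d) = r • spinRep ε γ X := by
  simp only [spinRep, Finset.smul_sum, mul_smul, smul_comm r]

theorem spinRep_sum {ι : Type*} (s : Finset ι) (X : ι → Fin n → Fin n → R) :
    spinRep ε γ (fun c d => ∑ i ∈ s, X i c d) = ∑ i ∈ s, spinRep ε γ (X i) := by
  classical
  induction s using Finset.induction_on with
  | empty => simp [spinRep]
  | insert i s hi ih => simp only [Finset.sum_insert hi, spinRep_add, ih]

theorem eps_ite_smul (hC : CliffordFrame ε γ) (f : Fin n → R) (a : Fin n) :
    ∑ b, ε b • (if a = b then ε a else 0) • f b = f a := by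
  rw [Finset.sum_eq_single a]
  · rw [if_pos rfl, smul_smul, hC.sq, one_smul]
  · intro b _ hb; rw [if_neg (Ne.symm hb), zero_smul, smul_zero]
  · simp

/-- The spin representation covers the vector representation: the commutator with a product of two
gamma matrices comes from the Clifford relation, and skewness of X merges the two resulting sums. -/
theorem spinRep_comm (hC : CliffordFrame ε γ) {X : Fin n → Fin n → R}
    (hX : ∀ c d, ε c • X c d = -(ε d • X d c)) (a : Fin n) :
    spinRep ε γ X * γ a - γ a * spinRep ε γ X = ∑ d, X a d • γ d := by
  have h1 : ∀ c d, γ d * γ c * γ a - γ a * (γ d * γ c) =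
      (if a = c then 2 * ε a else 0) • γ d - (if a = d then 2 * ε a else 0) • γ c := by
    intro c d
    have e1 := congrArg (γ d * ·) (hC.rel a c)
    have e2 := congrArg (· * γ c) (hC.rel a d)
    simp only [mul_add, add_mul, mul_smul_comm, smul_mul_assoc, mul_one, one_mul] at e1 e2
    rw [← e1, ← e2]; noncomm_ring
  have h2 : spinRep ε γ X * γ a - γ a * spinRep ε γ X =
      (1 / 2 : ℝ) • (∑ c, ∑ d, ε c • X c d • (if a = c then ε a else 0) • γ d -
        ∑ c, ∑ d, ε c • X c d • (if a = d then ε a else 0) • γ c) := by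
    simp only [spinRep, Finset.mul_sum, Finset.sum_mul, smul_mul_assoc, mul_smul_comm,
      ← smul_sub, ← Finset.sum_sub_distrib, h1]
    simp only [Finset.smul_sum]
    refine Finset.sum_congr rfl fun c _ => Finset.sum_congr rfl fun d _ => ?_
    have e : (if a = c then 2 * ε a else 0) • γ d - (if a = d then 2 * ε a else 0) • γ c =
        (2 : ℝ) • ((if a = c then ε a else 0) • γ d - (if a = d then ε a else 0) • γ c) := by
      split_ifs <;> module
    rw [e, smul_comm (X c d) (2 : ℝ), smul_sub (X c d)]
    generalize X c d • (if a = c then ε a else 0) • γ d = u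
    generalize X c d • (if a = d then ε a else 0) • γ c = v
    module
  have h3 : ∑ c, ∑ d, ε c • X c d • (if a = c then ε a else 0) • γ d = ∑ d, X a d • γ d := by
    rw [Finset.sum_comm]
    refine Finset.sum_congr rfl fun d _ => ?_
    have := congrArg (· • γ d) (eps_ite_smul hC (fun c => X c d) a)
    simp only [Finset.sum_smul, smul_assoc] at this
    rw [← this]
    exact Finset.sum_congr rfl fun c _ => by rw [smul_comm (X c d)]
  have h4 : ∑ c, ∑ d, ε c • X c d • (if a = d then ε a else 0) • γ c = -∑ d, X a d • γ d := by
    rw [← h3, Finset.sum_comm, ← Finset.sum_neg_distrib]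
    refine Finset.sum_congr rfl fun c _ => ?_
    rw [← Finset.sum_neg_distrib]
    refine Finset.sum_congr rfl fun d _ => ?_
    rw [← smul_assoc, hX, neg_smul, smul_assoc]
  rw [h2, h3, h4]; module

/-- The commutator with the spin representation of X is a derivation acting on gamma matrices by X,
so on γγ it acts in both slots. -/
theorem spinRep_lie (hC : CliffordFrame ε γ) {X Y : Fin n → Fin n → R}
    (hX : ∀ c d, ε c • X c d = -(ε d • X d c)) :
    spinRep ε γ X * spinRep ε γ Y - spinRep ε γ Y * spinRep ε γ X =
      spinRep ε γ (fun c d => ∑ e, (Y c e * X e d - X c e * Y e d)) := by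
  have h1 : ∀ c d, spinRep ε γ X * (γ d * γ c) - γ d * γ c * spinRep ε γ X =
      ∑ e, X d e • (γ e * γ c) + ∑ e, X c e • (γ d * γ e) := by
    intro c d
    have e1 := congrArg (· * γ c) (spinRep_comm hC hX d)
    have e2 := congrArg (γ d * ·) (spinRep_comm hC hX c)
    simp only [sub_mul, mul_sub, Finset.sum_mul, Finset.mul_sum, smul_mul_assoc,
      mul_smul_comm] at e1 e2
    rw [← e1, ← e2]; noncomm_ring
  have h2 : spinRep ε γ X * spinRep ε γ Y - spinRep ε γ Y * spinRep ε γ X =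
      (1 / 4 : ℝ) • (∑ c, ∑ d, ∑ e, ε c • (Y c d * X d e) • (γ e * γ c) +
        ∑ c, ∑ d, ∑ e, ε c • (Y c d * X c e) • (γ d * γ e)) := by
    rw [show spinRep ε γ Y = (1 / 4 : ℝ) • ∑ c, ∑ d, ε c • Y c d • (γ d * γ c) from rfl,
      mul_smul_comm, smul_mul_assoc, ← smul_sub]
    simp only [Finset.mul_sum, Finset.sum_mul, smul_mul_assoc, mul_smul_comm,
      ← smul_sub, ← Finset.sum_sub_distrib, h1]
    simp only [smul_add, Finset.smul_sum, Finset.sum_add_distrib, mul_smul]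
  rw [h2, spinRep]
  congr 1
  have h3 : ∑ c, ∑ d, ∑ e, ε c • (Y c d * X c e) • (γ d * γ e) =
      -∑ c, ∑ d, ∑ e, ε c • (X c e * Y e d) • (γ d * γ c) := by
    have : ∑ c, ∑ d, ∑ e, ε c • (X c e * Y e d) • (γ d * γ c) =
        ∑ e, ∑ d, ∑ c, ε c • (X c e * Y e d) • (γ d * γ c) := by
      rw [Finset.sum_comm]
      rw [Finset.sum_comm (f := fun e d => ∑ c, ε c • (X c e * Y e d) • (γ d * γ c))]
      exact Finset.sum_congr rfl fun d _ => Finset.sum_comm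
    rw [this]
    simp only [← Finset.sum_neg_distrib]
    refine Finset.sum_congr rfl fun c _ => Finset.sum_congr rfl fun d _ =>
      Finset.sum_congr rfl fun e _ => ?_
    have h := congrArg (fun z => (z * Y c d) • (γ d * γ e)) (hX c e)
    simp only [neg_mul, neg_smul, smul_mul_assoc, smul_assoc] at h
    rw [← h, mul_comm (Y c d)]
  rw [h3, ← sub_eq_add_neg, ← Finset.sum_sub_distrib]
  refine Finset.sum_congr rfl fun c _ => ?_
  rw [Finset.sum_comm]
  simp only [sub_smul, Finset.sum_smul, Finset.smul_sum, ← Finset.sum_sub_distrib, ← smul_sub]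

theorem hk_spinRep (hC : CliffordFrame ε γ) {X : Fin n → Fin n → R}
    (hX : ∀ c d, ε c • X c d = -(ε d • X d c)) (a : Fin n) :
    hk γ 2 a (spinRep ε γ X) = (-1 / 2 : ℝ) • ∑ d, X a d • γ d := by
  rw [hk, sg_two, one_smul, ← spinRep_comm hC hX]; module

theorem spinRep_deg (hC : CliffordFrame ε γ) {X : Fin n → Fin n → R}
    (hX : ∀ c d, ε c • X c d = -(ε d • X d c)) : IsDeg R ε γ 2 (spinRep ε γ X) := by
  constructor
  · refine real_smul_mem _ (sum_mem fun c _ => sum_mem fun d _ => real_smul_mem _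
      (Submodule.smul_mem _ _ ?_))
    exact filt_mul (i := 1) (j := 1) (gamma_mem_filt d) (gamma_mem_filt c)
  · simp only [pk, hk_spinRep hC hX, mul_smul_comm, Finset.mul_sum]
    have : ∀ c d, ε c • X c d • (γ c * γ d) = -(ε d • X d c • (γ c * γ d)) := fun c d => by
      have h := congrArg (· • (γ c * γ d)) (hX c d)
      simpa only [neg_smul, smul_assoc] using h
    simp only [Finset.smul_sum, smul_comm _ (-1 / 2 : ℝ), this]
    rw [spinRep, Finset.sum_comm]
    simp only [Finset.smul_sum]
    refine Finset.sum_congr rfl fun c _ => Finset.sum_congr rfl fun d _ => ?_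
    push_cast
    generalize ε c • X c d • (γ d * γ c) = u
    module

end SpinRep

/-! ### Curvature of the connection coefficients and the spin geometry of a frame. -/

namespace SpinData

variable {n : ℕ} {R Ψ : Type*} [CommRing R] [Algebra ℝ R] [AddCommGroup Ψ] [Module ℝ Ψ]
    [Module R Ψ] [IsScalarTower ℝ R Ψ]

/-- The components of the curvature of the connection with coefficients `Γ`. -/
def curvCoeff (der : Fin n → Derivation ℝ R R) (Γ : Fin n → Fin n → Fin n → R) (a b c d : Fin n) :
    R :=
  der a (Γ b c d) - der b (Γ a c d) + ∑ e, (Γ b c e * Γ a e d - Γ a c e * Γ b e d)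
    - ∑ e, (Γ a b e - Γ b a e) * Γ e c d

theorem curvCoeff_skew {ε : Fin n → ℝ} (der : Fin n → Derivation ℝ R R)
    {Γ : Fin n → Fin n → Fin n → R} (hΓ : ∀ a c d, ε c • Γ a c d = -(ε d • Γ a d c))
    (a b c d : Fin n) :
    ε c • curvCoeff der Γ a b c d = -(ε d • curvCoeff der Γ a b d c) := by
  have h1 : ∀ a b, ε c • der a (Γ b c d) = -(ε d • der a (Γ b d c)) := fun a b => by
    rw [← Derivation.map_smul_of_tower, hΓ, map_neg, Derivation.map_smul_of_tower]
  have h2 : ∀ a b, ε c • ∑ e, Γ b c e * Γ a e d = ε d • ∑ e, Γ a d e * Γ b e c := by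
    intro a b
    simp only [Finset.smul_sum]
    refine Finset.sum_congr rfl fun e _ => ?_
    have e1 := hΓ b c e
    have e2 := hΓ a e d
    rw [← smul_mul_assoc, e1, neg_mul, smul_mul_assoc, ← mul_smul_comm, e2, mul_neg, neg_neg,
      mul_smul_comm, mul_comm]
  have h3 : ε c • ∑ e, (Γ a b e - Γ b a e) * Γ e c d =
      -(ε d • ∑ e, (Γ a b e - Γ b a e) * Γ e d c) := by
    simp only [Finset.smul_sum, ← Finset.sum_neg_distrib]
    refine Finset.sum_congr rfl fun e _ => ?_
    rw [← mul_smul_comm, hΓ, mul_neg, mul_smul_comm]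
  rw [curvCoeff, curvCoeff, Finset.sum_sub_distrib, Finset.sum_sub_distrib, smul_sub, smul_add,
    smul_sub, smul_sub, h1, h1, h2, h2, h3]
  simp only [smul_sub, smul_add]
  abel

/-- The first Bianchi identity, from the Jacobi identity of the derivations. -/
theorem curvCoeff_cyc {der : Fin n → Derivation ℝ R R} {Γ : Fin n → Fin n → Fin n → R}
    (hder : ∀ a b f, der a (der b f) - der b (der a f) = ∑ c, (Γ a b c - Γ b a c) * der c f)
    {t : Fin n → R} {w : Fin n → Fin n → R}
    (coord : ∀ a b, ∑ i, w i a * der b (t i) = if a = b then 1 else 0) (a b c d : Fin n) :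
    curvCoeff der Γ a b c d + curvCoeff der Γ b c a d + curvCoeff der Γ c a b d = 0 := by
  -- By `hder`, T gives the structure functions of the derivations. Their Jacobi identity, freed of
  -- the test function by means of the coordinates, becomes the cyclic identity once T is written
  -- through Γ.
  set T := fun a b c => Γ a b c - Γ b a c with hT
  have h1 : ∀ a b c f, der a (der b (der c f)) - der a (der c (der b f)) =
      ∑ d, (der a (T b c d) * der d f + T b c d * der a (der d f)) := by
    intro a b c f
    rw [← map_sub, hder, map_sum]
    refine Finset.sum_congr rfl fun d _ => ?_
    rw [Derivation.leibniz, smul_eq_mul, smul_eq_mul]; ring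
  have h2 : ∀ a b c f, der b (der c (der a f)) - der c (der b (der a f)) =
      ∑ d, T b c d * der d (der a f) := fun a b c f => hder b c _
  have h3 : ∀ a b c f, ∑ d, (der a (T b c d) + ∑ e, T b c e * T a e d) * der d f =
      der a (der b (der c f)) - der a (der c (der b f)) -
        (der b (der c (der a f)) - der c (der b (der a f))) := by
    intro a b c f
    rw [h1, h2, ← Finset.sum_sub_distrib]
    have : ∀ d, der a (T b c d) * der d f + T b c d * der a (der d f) - T b c d * der d (der a f)
        = der a (T b c d) * der d f + T b c d * ∑ e, T a d e * der e f := fun d => by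
      rw [← hder]; ring
    simp only [this, add_mul, Finset.sum_add_distrib, Finset.sum_mul, Finset.mul_sum]
    congr 1
    rw [Finset.sum_comm]
    exact Finset.sum_congr rfl fun d _ => Finset.sum_congr rfl fun e _ => by ring
  have h4 : ∀ f, ∑ d, ((der a (T b c d) + ∑ e, T b c e * T a e d) +
      (der b (T c a d) + ∑ e, T c a e * T b e d) +
      (der c (T a b d) + ∑ e, T a b e * T c e d)) * der d f = 0 := by
    intro f
    simp only [add_mul _ _ (der _ f), Finset.sum_add_distrib]
    have k1 := h3 a b c f
    have k2 := h3 b c a f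
    have k3 := h3 c a b f
    simp only [add_mul, Finset.sum_add_distrib] at k1 k2 k3
    linear_combination k1 + k2 + k3
  have h5 : (der a (T b c d) + ∑ e, T b c e * T a e d) +
      (der b (T c a d) + ∑ e, T c a e * T b e d) +
      (der c (T a b d) + ∑ e, T a b e * T c e d) = 0 := by
    set F := fun d => (der a (T b c d) + ∑ e, T b c e * T a e d) +
      (der b (T c a d) + ∑ e, T c a e * T b e d) +
      (der c (T a b d) + ∑ e, T a b e * T c e d) with hF
    have k1 : ∑ i, w i d * ∑ d', F d' * der d' (t i) = 0 := by simp [hF, h4]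
    simp only [Finset.mul_sum] at k1
    rw [Finset.sum_comm] at k1
    have k2 : ∀ d', ∑ i, w i d * (F d' * der d' (t i)) = F d' * if d = d' then 1 else 0 := by
      intro d'
      rw [← coord d d', Finset.mul_sum]
      exact Finset.sum_congr rfl fun i _ => by ring
    simp only [k2] at k1
    simpa using k1
  have h6 : ∀ a b c d, curvCoeff der Γ a b c d = der a (Γ b c d) - der b (Γ a c d) +
      ∑ e, (Γ b c e * Γ a e d - Γ a c e * Γ b e d - T a b e * Γ e c d) := fun a b c d => by
    rw [curvCoeff, Finset.sum_sub_distrib (g := fun e => T a b e * Γ e c d)]; ring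
  rw [← h5, h6, h6, h6]
  have h7 : ∑ e, (Γ b c e * Γ a e d - Γ a c e * Γ b e d - T a b e * Γ e c d) +
      ∑ e, (Γ c a e * Γ b e d - Γ b a e * Γ c e d - T b c e * Γ e a d) +
      ∑ e, (Γ a b e * Γ c e d - Γ c b e * Γ a e d - T c a e * Γ e b d) =
      ∑ e, T b c e * T a e d + ∑ e, T c a e * T b e d + ∑ e, T a b e * T c e d := by
    simp only [← Finset.sum_add_distrib]
    refine Finset.sum_congr rfl fun e _ => ?_
    simp only [hT]; ring
  have h8 : ∀ a b c, der a (T b c d) = der a (Γ b c d) - der a (Γ c b d) := fun a b c => by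
    rw [hT, map_sub]
  rw [h8, h8, h8]
  linear_combination h7

/-- The spin geometry of an orthonormal frame, given the connection coefficients `Γ` and the
componentwise derivatives `D a` of the spinors. -/
def ofFrame (ε : Fin n → ℝ) (γ : Fin n → Module.End R Ψ) (cliff : CliffordFrame ε γ)
    (der : Fin n → Derivation ℝ R R) (D : Fin n → Ψ →ₗ[ℝ] Ψ)
    (D_smul : ∀ a (r : R) (ψ : Ψ), D a (r • ψ) = der a r • ψ + r • D a ψ)
    (D_gamma : ∀ a b ψ, D a (γ b ψ) = γ b (D a ψ))
    (Γ : Fin n → Fin n → Fin n → R) (skew : ∀ a c d, ε c • Γ a c d = -(ε d • Γ a d c))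
    (hder : ∀ a b f, der a (der b f) - der b (der a f) = ∑ c, (Γ a b c - Γ b a c) * der c f)
    (hD : ∀ a b ψ, D a (D b ψ) - D b (D a ψ) = ∑ c, (Γ a b c - Γ b a c) • D c ψ)
    (t : Fin n → R) (w : Fin n → Fin n → R)
    (coord : ∀ a b, ∑ i, w i a * der b (t i) = if a = b then 1 else 0) : SpinData n R Ψ where
  ε := ε
  γ := γ
  cliff := cliff
  der := fun a r => der a r
  nab := fun a => D a + (spinRep ε γ (Γ a)).restrictScalars ℝ
  nab_smul a r ψ := by
    simp only [LinearMap.add_apply, LinearMap.restrictScalars_apply, map_smul, D_smul, smul_add]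
    abel
  Γ := Γ
  skew a b c := by
    have h := skew a b c
    have h2 := congrArg (fun z => (ε b * ε c) • z) h
    simp only [smul_neg, smul_smul] at h2
    rw [mul_right_comm, cliff.sq, one_mul, mul_assoc, cliff.sq, mul_one] at h2
    exact h2
  nab_gamma a b ψ := by
    have h := congrArg (fun z => z ψ) (spinRep_comm cliff (skew a) b)
    simp only [LinearMap.sub_apply, Module.End.mul_apply, LinearMap.sum_apply,
      LinearMap.smul_apply] at h
    simp only [LinearMap.add_apply, LinearMap.restrictScalars_apply, D_gamma, map_add]
    rw [← h]; abel
  Rm := fun a b => spinRep ε γ (curvCoeff der Γ a b)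
  curv a b ψ := by
    have h1 : ∀ a b, D a (spinRep ε γ (Γ b) ψ) =
        spinRep ε γ (fun c d => der a (Γ b c d)) ψ + spinRep ε γ (Γ b) (D a ψ) := by
      intro a b
      simp only [spinRep, LinearMap.sum_apply, LinearMap.smul_apply, map_smul,
        map_sum, D_smul, Module.End.mul_apply, D_gamma, smul_add, Finset.sum_add_distrib]
    have h2 := congrArg (fun z => z ψ) (spinRep_lie (Y := Γ b) cliff (skew a))
    simp only [LinearMap.sub_apply, Module.End.mul_apply] at h2
    have h3 : spinRep ε γ (curvCoeff der Γ a b) = spinRep ε γ (fun c d => der a (Γ b c d)) -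
        spinRep ε γ (fun c d => der b (Γ a c d)) +
        spinRep ε γ (fun c d => ∑ e, (Γ b c e * Γ a e d - Γ a c e * Γ b e d)) -
        ∑ e, (Γ a b e - Γ b a e) • spinRep ε γ (Γ e) := by
      simp only [← spinRep_smul, ← spinRep_sum, ← spinRep_sub, ← spinRep_add]
      rfl
    rw [h3]
    simp only [LinearMap.add_apply, LinearMap.sub_apply, LinearMap.restrictScalars_apply, map_add,
      h1, LinearMap.sum_apply, LinearMap.smul_apply, smul_add, Finset.sum_add_distrib]
    rw [← h2, ← hD]
    abel
  Rm_deg a b := spinRep_deg cliff (curvCoeff_skew der skew a b)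
  bianchi a b c := by
    have hs := fun a b => curvCoeff_skew der skew a b
    rw [hk_spinRep cliff (hs b c), hk_spinRep cliff (hs c a), hk_spinRep cliff (hs a b),
      ← smul_add, ← smul_add, ← Finset.sum_add_distrib, ← Finset.sum_add_distrib]
    rw [Finset.sum_eq_zero, smul_zero]
    intro d _
    rw [← add_smul, ← add_smul]
    have := curvCoeff_cyc hder coord b c a d
    rw [this, zero_smul]
  t := t
  w := w
  coord := coord

end SpinData

/-! ### Components of forms in a frame and their Clifford elements -/

section Arrays

variable {n : ℕ} {R A : Type*} [CommRing R] [Algebra ℝ R] [Ring A] [Algebra ℝ A] [Algebra R A]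
  [IsScalarTower ℝ R A] {ε : Fin n → ℝ} {γ : Fin n → A}

/-- The sign of a permutation as a real number. -/
def sgnR {k : ℕ} (σ : Equiv.Perm (Fin k)) : ℝ := ((Equiv.Perm.sign σ : ℤ) : ℝ)

theorem sgnR_mul {k : ℕ} (σ τ : Equiv.Perm (Fin k)) : sgnR (σ * τ) = sgnR σ * sgnR τ := by
  simp [sgnR, Equiv.Perm.sign_mul]

theorem sgnR_one {k : ℕ} : sgnR (1 : Equiv.Perm (Fin k)) = 1 := by simp [sgnR]

theorem sgnR_mul_self {k : ℕ} (σ : Equiv.Perm (Fin k)) : sgnR σ * sgnR σ = 1 := by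
  rcases Int.units_eq_one_or (Equiv.Perm.sign σ) with h | h <;> simp [sgnR, h]

theorem sgnR_inv {k : ℕ} (σ : Equiv.Perm (Fin k)) : sgnR σ⁻¹ = sgnR σ := by
  simp [sgnR]

theorem sgnR_swap {k : ℕ} {i j : Fin k} (h : i ≠ j) : sgnR (Equiv.swap i j) = -1 := by
  simp [sgnR, Equiv.Perm.sign_swap h]

/-- Components that are antisymmetric in all indices. -/
def Skew {k : ℕ} (α : (Fin k → Fin n) → R) : Prop :=
  ∀ (σ : Equiv.Perm (Fin k)) (C : Fin k → Fin n), α (C ∘ σ) = sgnR σ • α C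

/-- The components of the inner derivative. -/
def ahook {k : ℕ} (a : Fin n) (α : (Fin (k + 1) → Fin n) → R) : (Fin k → Fin n) → R :=
  fun C => α (Fin.cons a C)

theorem Skew.ahook {k : ℕ} {α : (Fin (k + 1) → Fin n) → R} (h : Skew α) (a : Fin n) :
    Skew (ahook a α) := by
  intro σ C
  have h1 := h (Equiv.Perm.decomposeFin.symm (0, σ)) (Fin.cons a C)
  have h2 : (Fin.cons a C : Fin (k + 1) → Fin n) ∘ Equiv.Perm.decomposeFin.symm (0, σ) =
      Fin.cons a (C ∘ σ) := by
    funext i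
    refine Fin.cases ?_ (fun i => ?_) i
    · simp
    · simp [Equiv.Perm.decomposeFin_symm_apply_succ]
  rw [h2] at h1
  rw [KYForms.ahook, h1]
  simp [sgnR, Equiv.Perm.decomposeFin.symm_sign, KYForms.ahook]

theorem Skew.ahook_ahook {k : ℕ} {α : (Fin (k + 2) → Fin n) → R} (h : Skew α) (a b : Fin n) :
    KYForms.ahook a (KYForms.ahook b α) = -KYForms.ahook b (KYForms.ahook a α) := by
  funext C
  have h1 := h (Equiv.swap 0 1) (Fin.cons a (Fin.cons b C))
  have h2 : (Fin.cons a (Fin.cons b C) : Fin (k + 2) → Fin n) ∘ Equiv.swap 0 1 =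
      Fin.cons b (Fin.cons a C) := by
    funext i
    refine Fin.cases ?_ (fun i => Fin.cases ?_ (fun i => ?_) i) i
    · simp
    · simp
    · have : Equiv.swap (0 : Fin (k + 2)) 1 i.succ.succ = i.succ.succ :=
        Equiv.swap_apply_of_ne_of_ne (Fin.succ_ne_zero _) (by
          rw [Ne, Fin.ext_iff]; simp)
      simp [this]
  rw [h2, sgnR_swap (by simp)] at h1
  simp only [KYForms.ahook, Pi.neg_apply, h1, neg_one_smul]

theorem Skew.add {k : ℕ} {α β : (Fin k → Fin n) → R} (hα : Skew α) (hβ : Skew β) :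
    Skew (α + β) := fun σ C => by
  simp only [Pi.add_apply, hα σ C, hβ σ C, smul_add]

theorem Skew.smul {k : ℕ} {α : (Fin k → Fin n) → R} (hα : Skew α) (r : ℝ) :
    Skew (r • α) := fun σ C => by
  simp only [Pi.smul_apply, hα σ C, smul_comm r]

theorem Skew.sum {ι : Type*} (s : Finset ι) {k : ℕ} {α : ι → (Fin k → Fin n) → R}
    (h : ∀ i ∈ s, Skew (α i)) : Skew (∑ i ∈ s, α i) := fun σ C => by
  simp only [Finset.sum_apply, Finset.smul_sum]
  exact Finset.sum_congr rfl fun i hi => h i hi σ C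

/-- The product of the gamma matrices with indices `C`. -/
def word (γ : Fin n → A) {k : ℕ} (C : Fin k → Fin n) : A := (List.ofFn fun i => γ (C i)).prod

theorem word_zero (C : Fin 0 → Fin n) : word γ C = 1 := by simp [word]

theorem word_cons {k : ℕ} (a : Fin n) (C : Fin k → Fin n) :
    word γ (Fin.cons a C : Fin (k + 1) → Fin n) = γ a * word γ C := by
  simp [word, List.ofFn_succ]

theorem word_append {r s : ℕ} (C : Fin r → Fin n) (E : Fin s → Fin n) :
    word γ (Fin.append C E) = word γ C * word γ E := by
  rw [word, word, word, ← List.prod_append, ← List.ofFn_fin_append]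
  congr 2
  funext i
  refine Fin.addCases (fun i => ?_) (fun i => ?_) i <;> simp

theorem word_mem {k : ℕ} (C : Fin k → Fin n) : word γ C ∈ filt R γ k := by
  have := word_mem_filt (R := R) (γ := γ) (List.ofFn C)
  rwa [List.map_ofFn, List.length_ofFn] at this

/-- Products of gamma matrices are antisymmetric up to products of fewer gamma matrices. -/
theorem word_perm (hC : CliffordFrame ε γ) {k : ℕ} (σ : Equiv.Perm (Fin k)) (C : Fin k → Fin n) :
    word γ (C ∘ σ) - sgnR σ • word γ C ∈ filt R γ ((k : ℤ) - 2) := by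
  -- Adjacent transpositions generate the symmetric group, and for one of them the Clifford relation
  -- gives the error: a word with two letters fewer.
  have hadj : ∀ (k : ℕ) (i : Fin k) (C : Fin (k + 1) → Fin n),
      word γ (C ∘ Equiv.swap i.castSucc i.succ) + word γ C ∈ filt R γ (((k + 1 : ℕ) : ℤ) - 2) := by
    intro k
    induction k with
    | zero => intro i; exact i.elim0
    | succ k ih =>
      intro i C
      refine Fin.cases ?_ (fun i => ?_) i
      · obtain ⟨a, C', rfl⟩ : ∃ a C', C = Fin.cons a C' := ⟨C 0, Fin.tail C, by simp⟩
        obtain ⟨b, E, rfl⟩ : ∃ b E, C' = Fin.cons b E := ⟨C' 0, Fin.tail C', by simp⟩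
        have : (Fin.cons a (Fin.cons b E) : Fin (k + 2) → Fin n) ∘
            Equiv.swap (Fin.castSucc 0) (Fin.succ 0) = Fin.cons b (Fin.cons a E) := by
          funext i
          refine Fin.cases ?_ (fun i => Fin.cases ?_ (fun i => ?_) i) i
          · simp
          · simp
          · have : Equiv.swap (0 : Fin (k + 2)) 1 i.succ.succ = i.succ.succ :=
              Equiv.swap_apply_of_ne_of_ne (Fin.succ_ne_zero _) (by
                rw [Ne, Fin.ext_iff]; simp)
            simp [this]
        rw [this, word_cons, word_cons, word_cons, word_cons, ← mul_assoc, ← mul_assoc, ← add_mul,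
          hC.rel, smul_mul_assoc, one_mul]
        refine real_smul_mem _ ?_
        have h := word_mem (R := R) (γ := γ) E
        convert h using 2
        push_cast; ring
      · obtain ⟨a, C', rfl⟩ : ∃ a C', C = Fin.cons a C' := ⟨C 0, Fin.tail C, by simp⟩
        have : (Fin.cons a C' : Fin (k + 2) → Fin n) ∘
            Equiv.swap (Fin.castSucc i.succ) (Fin.succ i.succ) =
            Fin.cons a (C' ∘ Equiv.swap i.castSucc i.succ) := by
          funext j
          refine Fin.cases ?_ (fun j => ?_) j
          · rw [Function.comp_apply, Equiv.swap_apply_of_ne_of_ne]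
            · simp
            · simp [Fin.ext_iff]
            · simp [Fin.ext_iff]
          · simp only [Function.comp_apply, Fin.cons_succ]
            have h := (Fin.succ_injective _).swap_apply i.castSucc i.succ j
            rw [Fin.castSucc_succ, h, Fin.cons_succ]
        rw [this, word_cons, word_cons, ← mul_add]
        have h := filt_mul (gamma_mem_filt (R := R) (γ := γ) a) (ih i C')
        convert h using 2
        push_cast; ring
  rcases k with _ | k
  · have : σ = 1 := Subsingleton.elim _ _
    rw [this, sgnR_one, one_smul]
    simp
  · have hσ : σ ∈ Submonoid.closure (Set.range fun i : Fin k => Equiv.swap i.castSucc i.succ) := by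
      rw [Equiv.Perm.mclosure_swap_castSucc_succ]; trivial
    induction hσ using Submonoid.closure_induction generalizing C with
    | mem x hx =>
      obtain ⟨i, rfl⟩ := hx
      have h := hadj k i C
      simp only
      rw [sgnR_swap (by simp [Fin.ext_iff]), neg_one_smul, sub_neg_eq_add]
      exact h
    | one => rw [sgnR_one, one_smul]; simp
    | mul x y _ _ hx hy =>
      have h1 := hx C
      have h2 := hy (C ∘ x)
      have e : word γ (C ∘ ⇑(x * y)) - sgnR (x * y) • word γ C =
          (word γ ((C ∘ x) ∘ y) - sgnR y • word γ (C ∘ x)) +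
            sgnR y • (word γ (C ∘ x) - sgnR x • word γ C) := by
        rw [sgnR_mul, Equiv.Perm.coe_mul, Function.comp_assoc]; module
      rw [e]
      exact add_mem h2 (real_smul_mem _ h1)

variable (ε) in
/-- The product of the signs of the indices. -/
def epsProd {k : ℕ} (C : Fin k → Fin n) : ℝ := ∏ i, ε (C i)

/-- `∑ α_{a₁…a_k} γ^{a₁} ⋯ γ^{a_k}`. -/
def cq (ε : Fin n → ℝ) (γ : Fin n → A) {k : ℕ} (α : (Fin k → Fin n) → R) : A :=
  ∑ C, epsProd ε C • α C • word γ C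

/-- The Clifford element `(1/k!) ∑ α_{a₁…a_k} γ^{a₁} ⋯ γ^{a_k}`. -/
def clf (ε : Fin n → ℝ) (γ : Fin n → A) {k : ℕ} (α : (Fin k → Fin n) → R) : A :=
  (1 / (k ! : ℝ)) • cq ε γ α

theorem cq_zero (α : (Fin 0 → Fin n) → R) : cq ε γ α = α Fin.elim0 • (1 : A) := by
  rw [cq, Fintype.sum_unique, word_zero]
  have : (default : Fin 0 → Fin n) = Fin.elim0 := Subsingleton.elim _ _
  rw [this]; simp [epsProd]

theorem sum_cons {k : ℕ} {E : Type*} [AddCommMonoid E] (f : (Fin (k + 1) → Fin n) → E) :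
    ∑ C, f C = ∑ a, ∑ C : Fin k → Fin n, f (Fin.cons a C) := by
  rw [← (Fin.consEquiv (fun _ => Fin n)).sum_comp, Fintype.sum_prod_type]
  rfl

theorem cq_succ {k : ℕ} (α : (Fin (k + 1) → Fin n) → R) :
    cq ε γ α = ∑ a, ε a • (γ a * cq ε γ (ahook a α)) := by
  rw [cq, sum_cons]
  refine Finset.sum_congr rfl fun a _ => ?_
  rw [cq, Finset.mul_sum, Finset.smul_sum]
  refine Finset.sum_congr rfl fun C _ => ?_
  rw [word_cons, epsProd, Fin.prod_univ_succ, mul_smul_comm, mul_smul_comm, smul_smul]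
  simp [epsProd, ahook]

theorem cq_add {k : ℕ} (α β : (Fin k → Fin n) → R) : cq ε γ (α + β) = cq ε γ α + cq ε γ β := by
  simp only [cq, Pi.add_apply, add_smul, smul_add, Finset.sum_add_distrib]

theorem cq_neg {k : ℕ} (α : (Fin k → Fin n) → R) : cq ε γ (-α) = -cq ε γ α := by
  simp only [cq, Pi.neg_apply, neg_smul, smul_neg, Finset.sum_neg_distrib]

theorem cq_sub {k : ℕ} (α β : (Fin k → Fin n) → R) : cq ε γ (α - β) = cq ε γ α - cq ε γ β := by
  rw [sub_eq_add_neg, cq_add, cq_neg, sub_eq_add_neg]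

theorem cq_rsmul {k : ℕ} (r : R) (α : (Fin k → Fin n) → R) :
    cq ε γ (r • α) = r • cq ε γ α := by
  simp only [cq, Pi.smul_apply, Finset.smul_sum, smul_eq_mul, mul_smul, smul_comm r]

theorem cq_smul {k : ℕ} (r : ℝ) (α : (Fin k → Fin n) → R) :
    cq ε γ (r • α) = r • cq ε γ α := by
  simp only [cq, Pi.smul_apply, Finset.smul_sum, smul_assoc, smul_comm r]

theorem cq_sum {ι : Type*} (s : Finset ι) {k : ℕ} (α : ι → (Fin k → Fin n) → R) :
    cq ε γ (∑ i ∈ s, α i) = ∑ i ∈ s, cq ε γ (α i) := by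
  classical
  induction s using Finset.induction_on with
  | empty => simp [cq]
  | insert i s hi ih => rw [Finset.sum_insert hi, Finset.sum_insert hi, cq_add, ih]

theorem clf_add {k : ℕ} (α β : (Fin k → Fin n) → R) :
    clf ε γ (α + β) = clf ε γ α + clf ε γ β := by simp only [clf, cq_add, smul_add]

theorem clf_neg {k : ℕ} (α : (Fin k → Fin n) → R) : clf ε γ (-α) = -clf ε γ α := by
  simp only [clf, cq_neg, smul_neg]

theorem clf_smul {k : ℕ} (r : ℝ) (α : (Fin k → Fin n) → R) :
    clf ε γ (r • α) = r • clf ε γ α := by simp only [clf, cq_smul, smul_comm r]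

theorem clf_sum {ι : Type*} (s : Finset ι) {k : ℕ} (α : ι → (Fin k → Fin n) → R) :
    clf ε γ (∑ i ∈ s, α i) = ∑ i ∈ s, clf ε γ (α i) := by
  simp only [clf, cq_sum, Finset.smul_sum]

theorem cq_eq {k : ℕ} (α : (Fin k → Fin n) → R) : cq ε γ α = (k ! : ℝ) • clf ε γ α := by
  have : (k ! : ℝ) ≠ 0 := by exact_mod_cast k.factorial_ne_zero
  rw [clf, smul_smul, mul_one_div_cancel this, one_smul]

theorem cq_mem {k : ℕ} (α : (Fin k → Fin n) → R) : cq ε γ α ∈ filt R γ k :=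
  sum_mem fun C _ => real_smul_mem _ (Submodule.smul_mem _ _ (word_mem C))

/-- Contraction hits each of the k + 1 antisymmetric slots alike; the factor is absorbed by the
factorial in `clf`. -/
theorem hk_cq (hC : CliffordFrame ε γ) : ∀ {k : ℕ} {α : (Fin (k + 1) → Fin n) → R}, Skew α →
    ∀ a, hk γ ((k : ℤ) + 1) a (cq ε γ α) = ((k : ℝ) + 1) • cq ε γ (ahook a α) := by
  intro k
  induction k with
  | zero =>
    intro α _ a
    rw [cq_succ]
    simp only [hk_sum, hk_smul]
    have : ∀ b, hk γ (((0 : ℕ) : ℤ) + 1) a (γ b * cq ε γ (ahook b α)) =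
        (if a = b then ε a else 0) • cq ε γ (ahook b α) := fun b => by
      rw [hk_gamma_mul hC, cq_zero, hk_rsmul, hk_one (by simp), smul_zero, mul_zero, sub_zero]
    simp only [this]
    rw [sum_ite_smul hC (fun b => cq ε γ (ahook b α)) a]
    simp
  | succ k ih =>
    intro α hα a
    have : ∀ b, hk γ (((k + 1 : ℕ) : ℤ) + 1) a (γ b * cq ε γ (ahook b α)) =
        (if a = b then ε a else 0) • cq ε γ (ahook b α) +
          ((k : ℝ) + 1) • (γ b * cq ε γ (ahook b (ahook a α))) := fun b => by
      rw [hk_gamma_mul hC]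
      push_cast
      rw [ih (hα.ahook b) a, hα.ahook_ahook a b, cq_neg, mul_smul_comm, mul_neg, smul_neg,
        sub_neg_eq_add]
    rw [cq_succ]
    simp only [hk_sum, hk_smul, this, smul_add, Finset.sum_add_distrib]
    rw [sum_ite_smul hC (fun b => cq ε γ (ahook b α)) a]
    simp only [smul_comm _ ((k : ℝ) + 1)]
    rw [← Finset.smul_sum, ← cq_succ]
    push_cast; module

theorem hk_clf (hC : CliffordFrame ε γ) {k : ℕ} {α : (Fin (k + 1) → Fin n) → R} (hα : Skew α)
    (a : Fin n) : hk γ ((k : ℤ) + 1) a (clf ε γ α) = clf ε γ (ahook a α) := by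
  rw [clf, hk_smul, hk_cq hC hα, clf, smul_smul, Nat.factorial_succ]
  congr 1
  have : (k ! : ℝ) ≠ 0 := by exact_mod_cast k.factorial_ne_zero
  push_cast
  field_simp

theorem clf_deg (hC : CliffordFrame ε γ) {k : ℕ} {α : (Fin k → Fin n) → R} (hα : Skew α) :
    IsDeg R ε γ k (clf ε γ α) := by
  refine ⟨real_smul_mem _ (cq_mem α), ?_⟩
  rw [clf, pk_smul, smul_comm]
  congr 1
  rcases k with _ | k
  · rw [cq_zero]
    simp [pk, hk_rsmul, hk_one]
  · rw [pk]
    push_cast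
    simp only [hk_cq hC hα, mul_smul_comm, smul_comm _ ((k : ℝ) + 1)]
    rw [← Finset.smul_sum, ← cq_succ]

/-- Forms are determined by their Clifford elements. -/
theorem eq_zero_of_clf (hC : CliffordFrame ε γ) (h1 : ∀ r : R, r • (1 : A) = 0 → r = 0) :
    ∀ {k : ℕ} {α : (Fin k → Fin n) → R}, Skew α → clf ε γ α = 0 → α = 0 := by
  intro k
  induction k with
  | zero =>
    intro α _ h
    have h2 : cq ε γ α = 0 := by rw [cq_eq, h, smul_zero]
    rw [cq_zero] at h2
    funext C
    rw [Subsingleton.elim C Fin.elim0, h1 _ h2, Pi.zero_apply]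
  | succ k ih =>
    intro α hα h
    funext C
    obtain ⟨a, C', rfl⟩ : ∃ a C', C = Fin.cons a C' := ⟨C 0, Fin.tail C, by simp⟩
    have h2 := hk_clf hC hα a
    rw [h, hk_zero] at h2
    exact congrFun (ih (hα.ahook a) h2.symm) C'

/-- The top part depends only on the class modulo step K - 2. -/
theorem comp_zero_eq (hC : CliffordFrame ε γ) {K : ℤ} {x y : A} (hx : x ∈ filt R γ K)
    (hy : IsDeg R ε γ K y) (h : x - y ∈ filt R γ (K - 2)) : comp R ε γ K x 0 = y := by
  have hP := comp_isDec hC hx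
  have h0 : IsDeg R ε γ K (comp R ε γ K x 0) := by simpa using hP.1 0
  rw [← sub_eq_zero]
  refine (h0.sub hy).eq_zero_of_mem hC ?_
  have e : comp R ε γ K x 0 - y = (x - y) -
      ∑ m ∈ Finset.range K.toNat, comp R ε γ K x (m + 1) := by
    have := hP.2 (K.toNat + 1) (by omega)
    rw [Finset.sum_range_succ'] at this
    nth_rewrite 2 [this]
    abel
  rw [e]
  refine sub_mem h (sum_mem fun m _ => ?_)
  refine filt_mono (i := K - 2 * ((m + 1 : ℕ) : ℤ)) (by push_cast; omega) ⟨m, by push_cast; ring⟩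
    (hP.1 (m + 1)).1

/-- The components of the exterior product. -/
def awedge {r s : ℕ} (α : (Fin r → Fin n) → R) (β : (Fin s → Fin n) → R) :
    (Fin (r + s) → Fin n) → R :=
  fun C => (1 / ((r ! : ℝ) * (s ! : ℝ))) • ∑ σ : Equiv.Perm (Fin (r + s)),
    sgnR σ • (α (fun i => C (σ (Fin.castAdd s i))) * β (fun j => C (σ (Fin.natAdd r j))))

theorem awedge_skew {r s : ℕ} (α : (Fin r → Fin n) → R) (β : (Fin s → Fin n) → R) :
    Skew (awedge α β) := by
  intro τ C
  simp only [awedge, Finset.smul_sum]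
  rw [← Equiv.sum_comp (Equiv.mulLeft τ⁻¹)]
  refine Finset.sum_congr rfl fun σ _ => ?_
  simp only [Equiv.coe_mulLeft, sgnR_mul, sgnR_inv]
  simp only [Equiv.Perm.coe_mul, Function.comp_apply, Equiv.Perm.coe_inv, Equiv.apply_symm_apply]
  module

theorem sum_append {r s : ℕ} {E : Type*} [AddCommMonoid E] (f : (Fin (r + s) → Fin n) → E) :
    ∑ C, f C = ∑ C : Fin r → Fin n, ∑ D : Fin s → Fin n, f (Fin.append C D) := by
  rw [← (Fin.appendEquiv r s).sum_comp, Fintype.sum_prod_type]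
  rfl

theorem epsProd_comp {k : ℕ} (C : Fin k → Fin n) (σ : Equiv.Perm (Fin k)) :
    epsProd ε (C ∘ σ) = epsProd ε C :=
  Equiv.prod_comp σ (fun i => ε (C i))

theorem cq_mul_cq {r s : ℕ} (α : (Fin r → Fin n) → R) (β : (Fin s → Fin n) → R) :
    cq ε γ α * cq ε γ β = ∑ C : Fin (r + s) → Fin n, epsProd ε C •
      (α (fun i => C (Fin.castAdd s i)) * β (fun j => C (Fin.natAdd r j))) • word γ C := by
  rw [sum_append, cq, Finset.sum_mul]
  refine Finset.sum_congr rfl fun C _ => ?_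
  rw [cq, Finset.mul_sum]
  refine Finset.sum_congr rfl fun E _ => ?_
  have : epsProd ε (Fin.append C E) = epsProd ε C * epsProd ε E := by
    simp [epsProd, Fin.prod_univ_add]
  simp only [this, Fin.append_left, Fin.append_right, word_append, smul_mul_assoc, mul_smul_comm,
    mul_smul]
  module

/-- Antisymmetrising the words of the product changes it only by shorter words (`word_perm`), and
the antisymmetrised product is the exterior product. -/
theorem clf_awedge (hC : CliffordFrame ε γ) {r s : ℕ} (α : (Fin r → Fin n) → R)
    (β : (Fin s → Fin n) → R) :
    clf ε γ (awedge α β) = comp R ε γ ((r : ℤ) + s) (clf ε γ α * clf ε γ β) 0 := by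
  have hr : (r ! : ℝ) ≠ 0 := by exact_mod_cast r.factorial_ne_zero
  have hs : (s ! : ℝ) ≠ 0 := by exact_mod_cast s.factorial_ne_zero
  have hrs : ((r + s)! : ℝ) ≠ 0 := by exact_mod_cast (r + s).factorial_ne_zero
  have hdeg : IsDeg R ε γ ((r : ℤ) + s) (clf ε γ (awedge α β)) := by
    have := clf_deg hC (awedge_skew α β); push_cast at this; exact this
  refine (comp_zero_eq hC ?_ hdeg ?_).symm
  · exact filt_mul (real_smul_mem _ (cq_mem α)) (real_smul_mem _ (cq_mem β))
  · set f : (Fin (r + s) → Fin n) → R :=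
      fun C => α (fun i => C (Fin.castAdd s i)) * β (fun j => C (Fin.natAdd r j)) with hf
    have h1 : clf ε γ α * clf ε γ β =
        (1 / ((r ! : ℝ) * (s ! : ℝ))) • ∑ C, epsProd ε C • f C • word γ C := by
      rw [clf, clf, smul_mul_assoc, mul_smul_comm, cq_mul_cq, smul_smul]
      congr 1; field_simp
    have h2 : clf ε γ (awedge α β) = (1 / ((r ! : ℝ) * (s ! : ℝ))) • (1 / ((r + s)! : ℝ)) •
        ∑ σ : Equiv.Perm (Fin (r + s)), ∑ C, epsProd ε C • f C • sgnR σ • word γ (C ∘ ⇑σ⁻¹) := by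
      have e : ∀ σ : Equiv.Perm (Fin (r + s)),
          ∑ C, epsProd ε C • f C • sgnR σ • word γ (C ∘ ⇑σ⁻¹) =
          ∑ C, epsProd ε C • (sgnR σ • f (C ∘ ⇑σ)) • word γ C := by
        intro σ
        rw [← (Equiv.arrowCongr σ (Equiv.refl (Fin n))).symm.sum_comp]
        refine Finset.sum_congr rfl fun C _ => ?_
        have e1 : (Equiv.arrowCongr σ (Equiv.refl (Fin n))).symm C = C ∘ ⇑σ := by
          funext i; simp [Equiv.arrowCongr]
        have e2 : (C ∘ ⇑σ) ∘ ⇑σ⁻¹ = C := by funext i; simp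
        rw [e1, epsProd_comp, e2, smul_comm (f _), smul_assoc (sgnR σ) (f _)]
      simp only [e]
      rw [clf, smul_comm]
      congr 1
      rw [cq, Finset.sum_comm, Finset.smul_sum]
      refine Finset.sum_congr rfl fun C _ => ?_
      simp only [awedge, Finset.smul_sum, Finset.sum_smul]
      refine Finset.sum_congr rfl fun σ _ => ?_
      simp only [hf, Function.comp_apply]
      rw [smul_assoc (1 / ((r ! : ℝ) * (s ! : ℝ))), smul_comm]
    rw [h1, h2, ← smul_sub]
    refine real_smul_mem _ ?_
    have h3 : ∑ C, epsProd ε C • f C • word γ C - (1 / ((r + s)! : ℝ)) •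
        ∑ σ : Equiv.Perm (Fin (r + s)), ∑ C, epsProd ε C • f C • sgnR σ • word γ (C ∘ ⇑σ⁻¹) =
        (1 / ((r + s)! : ℝ)) • ∑ σ : Equiv.Perm (Fin (r + s)), ∑ C, epsProd ε C • f C •
          (word γ C - sgnR σ • word γ (C ∘ ⇑σ⁻¹)) := by
      simp only [smul_sub, Finset.sum_sub_distrib]
      rw [Finset.sum_const, Finset.card_univ, Fintype.card_perm, Fintype.card_fin,
        ← Nat.cast_smul_eq_nsmul ℝ, smul_smul, one_div_mul_cancel hrs, one_smul]
    rw [h3]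
    refine real_smul_mem _ (sum_mem fun σ _ => sum_mem fun C _ => real_smul_mem _
      (Submodule.smul_mem _ _ ?_))
    have h4 := word_perm (R := R) hC σ⁻¹ C
    have e : word γ C - sgnR σ • word γ (C ∘ ⇑σ⁻¹) =
        (-sgnR σ) • (word γ (C ∘ ⇑σ⁻¹) - sgnR σ⁻¹ • word γ C) := by
      rw [sgnR_inv, smul_sub, smul_smul, neg_mul, sgnR_mul_self]; module
    rw [e]
    refine real_smul_mem _ ?_
    exact_mod_cast h4

end Arrays

/-! ### Contracted products, the algebraic conditions and the bracket as Clifford elements. -/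

section Contracted

variable {n : ℕ} {R A : Type*} [CommRing R] [Algebra ℝ R] [Ring A] [Algebra ℝ A] [Algebra R A]
  [IsScalarTower ℝ R A] {ε : Fin n → ℝ} {γ : Fin n → A}

/-- Components of a form whose degree is rewritten. -/
def acast {k l : ℕ} (h : k = l) (α : (Fin k → Fin n) → R) : (Fin l → Fin n) → R :=
  fun C => α (fun i => C (Fin.cast h i))

theorem Skew.acast {k l : ℕ} (h : k = l) {α : (Fin k → Fin n) → R} (hα : Skew α) :
    Skew (acast h α) := by subst h; exact hα

theorem clf_acast {k l : ℕ} (h : k = l) (α : (Fin k → Fin n) → R) :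
    clf ε γ (acast h α) = clf ε γ α := by subst h; rfl

variable (ε) in
/-- The components of the contracted exterior product. -/
def acwedge : (m : ℕ) → {r s : ℕ} → ((Fin (r + m) → Fin n) → R) → ((Fin (s + m) → Fin n) → R) →
    ((Fin (r + s) → Fin n) → R)
  | 0, _, _, α, β => awedge α β
  | m + 1, _, _, α, β => ∑ a, ε a • acwedge m (ahook a α) (ahook a β)

theorem acwedge_skew (m : ℕ) {r s : ℕ} (α : (Fin (r + m) → Fin n) → R)
    (β : (Fin (s + m) → Fin n) → R) : Skew (acwedge ε m α β) := by
  induction m with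
  | zero => exact awedge_skew α β
  | succ m ih => exact Skew.sum _ fun a _ => (ih _ _).smul _

/-- The factor between contracted exterior products and Clifford products. -/
def acwConst : ℕ → ℕ → ℝ
  | 0, _ => 1
  | m + 1, r => -(acwConst m r * (sg ((r : ℤ) + m + 1) * ((m : ℝ) + 1)))

theorem acwConst_ne_zero (m r : ℕ) : acwConst m r ≠ 0 := by
  induction m with
  | zero => exact one_ne_zero
  | succ m ih =>
    refine neg_ne_zero.2 (mul_ne_zero ih (mul_ne_zero ?_ ?_))
    · rcases sg_eq_or ((r : ℤ) + m + 1) with h | h <;> rw [h] <;> norm_num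
    · positivity

/-- Both sides obey the same recursion in m, by the definition of `acwedge` and by `sum_comp_hk`;
`acwConst` collects the factors. -/
theorem clf_acwedge (hC : CliffordFrame ε γ) (m : ℕ) {r s : ℕ} {α : (Fin (r + m) → Fin n) → R}
    {β : (Fin (s + m) → Fin n) → R} (hα : Skew α) (hβ : Skew β) :
    clf ε γ (acwedge ε m α β) =
      acwConst m r • comp R ε γ ((r : ℤ) + m + ((s : ℤ) + m)) (clf ε γ α * clf ε γ β) m := by
  induction m with
  | zero =>
    rw [acwedge, clf_awedge hC, acwConst, one_smul]
    simp
  | succ m ih =>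
    have h1 := sum_comp_hk hC (clf_deg hC hα) (clf_deg hC hβ) m
    have e1 : (((r + (m + 1) : ℕ) : ℤ)) = (r : ℤ) + m + 1 := by push_cast; ring
    have e2 : (((s + (m + 1) : ℕ) : ℤ)) = (s : ℤ) + m + 1 := by push_cast; ring
    have h2 : ∀ a, hk γ ((r : ℤ) + m + 1) a (clf ε γ α) = clf ε γ (ahook a α) := fun a => by
      have := hk_clf hC (k := r + m) hα a; push_cast at this; exact this
    have h3 : ∀ a, hk γ ((s : ℤ) + m + 1) a (clf ε γ β) = clf ε γ (ahook a β) := fun a => by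
      have := hk_clf hC (k := s + m) hβ a; push_cast at this; exact this
    rw [e1, e2] at h1
    simp only [h2, h3, add_sub_cancel_right] at h1
    rw [acwedge, clf_sum]
    have h4 : ∀ a, clf ε γ (ε a • acwedge ε m (ahook a α) (ahook a β)) = acwConst m r • ε a •
        comp R ε γ ((r : ℤ) + m + ((s : ℤ) + m)) (clf ε γ (ahook a α) * clf ε γ (ahook a β)) m :=
      fun a => by
        rw [clf_smul, ih (Skew.ahook (k := r + m) hα a) (Skew.ahook (k := s + m) hβ a), smul_comm]
    simp only [h4]
    rw [← Finset.smul_sum, h1, smul_smul, acwConst, ← neg_mul_eq_mul_neg]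
    push_cast
    simp only [← add_assoc]

/-- More contractions than the degree of a factor leave nothing: `sum_comp_hk` descends to negative
degree. -/
theorem comp_eq_zero_of_lt (hC : CliffordFrame ε γ) (m : ℕ) {i j : ℤ} {α β : A}
    (hα : IsDeg R ε γ i α) (hβ : IsDeg R ε γ j β) (h : i < m ∨ j < m) :
    comp R ε γ (i + j) (α * β) m = 0 := by
  induction m generalizing i j α β with
  | zero =>
    have : α * β = 0 := by
      rcases h with h | h
      · rw [hα.eq_zero (by simpa using h), zero_mul]
      · rw [hβ.eq_zero (by simpa using h), mul_zero]
    rw [this]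
    exact (IsDec.zero _).comp_eq hC 0
  | succ m ih =>
    have h1 := sum_comp_hk hC hα hβ m
    rw [Finset.sum_eq_zero (fun a _ => by
      rw [ih (hα.hk hC a) (hβ.hk hC a) (by push_cast at h; omega), smul_zero])] at h1
    refine (smul_eq_zero.1 h1.symm).resolve_left (neg_ne_zero.2 (mul_ne_zero ?_ ?_))
    · rcases sg_eq_or i with h | h <;> rw [h] <;> norm_num
    · positivity

variable (ε) in
/-- The algebraic conditions on two forms, in components. -/
def ArrCond {p q : ℕ} (κ : (Fin (p + 1) → Fin n) → R) (μ : (Fin (q + 1) → Fin n) → R) : Prop :=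
  ∀ (k r s : ℕ) (hp : p = r + (2 * k + 1)) (hq : q = s + (2 * k + 1)) (a b : Fin n),
    acwedge ε (2 * k + 1) (acast hp (ahook a κ)) (acast hq (ahook b μ)) +
      acwedge ε (2 * k + 1) (acast hp (ahook b κ)) (acast hq (ahook a μ)) = 0

variable {p q : ℕ} {κ : (Fin (p + 1) → Fin n) → R} {μ : (Fin (q + 1) → Fin n) → R}

/-- The conditions cover the odd orders up to p and q, and the larger orders vanish for reasons of
degree. They pass to Clifford components because `acwConst` is nonzero. -/
theorem ArrCond.comp_add (hC : CliffordFrame ε γ) (hκ : Skew κ) (hμ : Skew μ) (h : ArrCond ε κ μ)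
    {m : ℕ} (hm : Odd m) (a b : Fin n) :
    comp R ε γ ((p : ℤ) + q) (clf ε γ (ahook a κ) * clf ε γ (ahook b μ)) m +
      comp R ε γ ((p : ℤ) + q) (clf ε γ (ahook b κ) * clf ε γ (ahook a μ)) m = 0 := by
  by_cases hlt : p < m ∨ q < m
  · have hlt' : (p : ℤ) < m ∨ (q : ℤ) < m := by omega
    rw [comp_eq_zero_of_lt hC m (clf_deg hC (hκ.ahook a)) (clf_deg hC (hμ.ahook b)) hlt',
      comp_eq_zero_of_lt hC m (clf_deg hC (hκ.ahook b)) (clf_deg hC (hμ.ahook a)) hlt', add_zero]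
  · obtain ⟨k, rfl⟩ := hm
    have hp : p = (p - (2 * k + 1)) + (2 * k + 1) := by omega
    have hq : q = (q - (2 * k + 1)) + (2 * k + 1) := by omega
    have h1 := congrArg (clf ε γ) (h k _ _ hp hq a b)
    rw [clf_add, clf_acwedge hC _ ((hκ.ahook a).acast hp) ((hμ.ahook b).acast hq),
      clf_acwedge hC _ ((hκ.ahook b).acast hp) ((hμ.ahook a).acast hq), clf_acast, clf_acast,
      clf_acast, clf_acast, ← smul_add] at h1
    have h2 : clf ε γ (0 : (Fin (p - (2 * k + 1) + (q - (2 * k + 1))) → Fin n) → R) = 0 := by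
      simp [clf, cq]
    rw [h2] at h1
    have h3 := (smul_eq_zero.1 h1).resolve_left (acwConst_ne_zero _ _)
    have e : (((p - (2 * k + 1) : ℕ) : ℤ) + ((2 * k + 1 : ℕ) : ℤ) +
        (((q - (2 * k + 1) : ℕ) : ℤ) + ((2 * k + 1 : ℕ) : ℤ))) = (p : ℤ) + q := by
      omega
    rwa [e] at h3

/-- The algebraic conditions imply that the second-order part of the graded commutator vanishes. -/
theorem ArrCond.comm (hC : CliffordFrame ε γ) (hκ : Skew κ) (hμ : Skew μ) (h : ArrCond ε κ μ)
    (a b : Fin n) :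
    (hk γ ((p : ℤ) + 1) a (clf ε γ κ) * hk γ ((q : ℤ) + 1) b (clf ε γ μ) -
        sg ((p : ℤ) * q) • (hk γ ((q : ℤ) + 1) b (clf ε γ μ) * hk γ ((p : ℤ) + 1) a (clf ε γ κ))) +
      (hk γ ((p : ℤ) + 1) b (clf ε γ κ) * hk γ ((q : ℤ) + 1) a (clf ε γ μ) -
        sg ((p : ℤ) * q) •
          (hk γ ((q : ℤ) + 1) a (clf ε γ μ) * hk γ ((p : ℤ) + 1) b (clf ε γ κ))) = 0 := by
  simp only [hk_clf hC hκ, hk_clf hC hμ]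
  exact comm_add_comm_eq_zero hC (clf_deg hC (hκ.ahook a)) (clf_deg hC (hμ.ahook b))
    (clf_deg hC (hκ.ahook b)) (clf_deg hC (hμ.ahook a)) fun m hm => h.comp_add hC hκ hμ hm a b

/-- The algebraic conditions imply that the graded anticommutator is the exterior product. -/
theorem ArrCond.anticomm_deg (hC : CliffordFrame ε γ) (hκ : Skew κ) (hμ : Skew μ)
    (h : ArrCond ε κ μ) :
    IsDeg R ε γ ((p : ℤ) + 1 + ((q : ℤ) + 1)) (clf ε γ κ * clf ε γ μ +
      sg (((p : ℤ) + 1) * ((q : ℤ) + 1)) • (clf ε γ μ * clf ε γ κ)) := by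
  have h1 := clf_deg (R := R) hC hκ
  have h2 := clf_deg (R := R) hC hμ
  push_cast at h1 h2
  refine anticomm_isDeg hC h1 h2 fun m hm hm0 => ?_
  obtain ⟨m, rfl⟩ := Nat.exists_eq_succ_of_ne_zero hm0
  have ho : Odd m := by
    rw [← Nat.not_even_iff_odd]; intro h; exact (Nat.even_add_one.1 hm) h
  -- A part of even positive order is, up to a nonzero factor, a sum over a of odd-order parts of
  -- products of contractions; the conditions apply with both indices equal to a.
  have h3 := sum_comp_hk hC h1 h2 m
  simp only [hk_clf hC hκ, hk_clf hC hμ, add_sub_cancel_right] at h3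
  rw [Finset.sum_eq_zero (fun a _ => ?_)] at h3
  · refine (smul_eq_zero.1 h3.symm).resolve_left (neg_ne_zero.2 (mul_ne_zero ?_ ?_))
    · rcases sg_eq_or ((p : ℤ) + 1) with h | h <;> rw [h] <;> norm_num
    · positivity
  · have h4 := h.comp_add hC hκ hμ ho a a
    rw [← two_smul ℝ] at h4
    rw [(smul_eq_zero.1 h4).resolve_left two_ne_zero, smul_zero]

/-- The components of the Schouten-Nijenhuis bracket, given those of the covariant derivatives. -/
def snArr (ε : Fin n → ℝ) (κ : (Fin (p + 1) → Fin n) → R) (Nκ : Fin n → (Fin (p + 1) → Fin n) → R)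
    (μ : (Fin (q + 1) → Fin n) → R) (Nμ : Fin n → (Fin (q + 1) → Fin n) → R) :
    (Fin (p + q + 1) → Fin n) → R :=
  fun C => (1 / ((p + q + 1)! : ℝ)) • ∑ σ : Equiv.Perm (Fin (p + q + 1)), sgnR σ •
    (((p : ℝ) + 1) • ∑ a, ε a • (ahook a κ (fun i => C (σ ⟨i, by omega⟩)) *
        Nμ a (fun j => C (σ ⟨p + j, by omega⟩))) +
      (-1 : ℝ) ^ ((p + 1) * (q + 1)) • ((q : ℝ) + 1) • ∑ a, ε a •
        (ahook a μ (fun i => C (σ ⟨i, by omega⟩)) * Nκ a (fun j => C (σ ⟨q + j, by omega⟩))))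

theorem acast_awedge {r s N : ℕ} (h : r + s = N) (α : (Fin r → Fin n) → R)
    (β : (Fin s → Fin n) → R) (C : Fin N → Fin n) :
    acast h (awedge α β) C = (1 / ((r ! : ℝ) * (s ! : ℝ))) • ∑ σ : Equiv.Perm (Fin N),
      sgnR σ • (α (fun i => C (σ ⟨i, by omega⟩)) * β (fun j => C (σ ⟨r + j, by omega⟩))) := by
  subst h; rfl

theorem acast_sum {ι : Type*} (s : Finset ι) {k l : ℕ} (h : k = l) (α : ι → (Fin k → Fin n) → R) :
    acast h (∑ i ∈ s, α i) = ∑ i ∈ s, acast h (α i) := by subst h; rfl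

theorem acast_smul {k l : ℕ} (h : k = l) (r : ℝ) (α : (Fin k → Fin n) → R) :
    acast h (r • α) = r • acast h α := by subst h; rfl

theorem sum_smul_sum_smul {ι σ E : Type*} [Fintype ι] [Fintype σ] [AddCommGroup E] [Module ℝ E]
    (s : σ → ℝ) (e : ι → ℝ) (X Y : σ → ι → E) (u v c t x y : ℝ) (h1 : t * u = x)
    (h2 : t * v = y) :
    t • ∑ i, s i • (u • ∑ a, e a • X i a + c • v • ∑ a, e a • Y i a) =
      x • ∑ a, e a • ∑ i, s i • X i a + c • y • ∑ a, e a • ∑ i, s i • Y i a := by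
  have h : ∀ X : σ → ι → E, ∑ a, e a • ∑ i, s i • X i a = ∑ i, s i • ∑ a, e a • X i a := fun X => by
    simp only [Finset.smul_sum]
    rw [Finset.sum_comm]
    exact Finset.sum_congr rfl fun i _ => Finset.sum_congr rfl fun a _ => smul_comm _ _ _
  rw [h, h]
  rw [← h1, ← h2]
  have h' : ∀ i, s i • (u • ∑ a, e a • X i a + c • v • ∑ a, e a • Y i a) =
      u • (s i • ∑ a, e a • X i a) + (c * v) • (s i • ∑ a, e a • Y i a) := fun i => by module
  simp only [h', Finset.sum_add_distrib, ← Finset.smul_sum (r := u),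
    ← Finset.smul_sum (r := c * v)]
  module

/-- With ∇_a κ = X_a ⌟ κ' the sum over a in the bracket is a once-contracted exterior product; the
factorials convert the average over permutations into the normalisation of the wedge. -/
theorem snArr_eq {κ' : (Fin (p + 2) → Fin n) → R} {μ' : (Fin (q + 2) → Fin n) → R} :
    snArr ε κ (fun a => ahook a κ') μ (fun a => ahook a μ') =
      (((p + 1)! * (q + 1)! : ℝ) / (p + q + 1)!) • (acast rfl (acwedge ε 1 (r := p) (s := q + 1) κ μ')
        + (-1 : ℝ) ^ ((p + 1) * (q + 1)) •
          acast (by omega) (acwedge ε 1 (r := q) (s := p + 1) μ κ')) := by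
  have hp : (p ! : ℝ) ≠ 0 := by exact_mod_cast p.factorial_ne_zero
  have hq : (q ! : ℝ) ≠ 0 := by exact_mod_cast q.factorial_ne_zero
  have hp1 : ((p + 1)! : ℝ) = ((p : ℝ) + 1) * p ! := by rw [Nat.factorial_succ]; push_cast; ring
  have hq1 : ((q + 1)! : ℝ) = ((q : ℝ) + 1) * q ! := by rw [Nat.factorial_succ]; push_cast; ring
  have hp2 : (p : ℝ) + 1 ≠ 0 := by positivity
  have hq2 : (q : ℝ) + 1 ≠ 0 := by positivity
  funext C
  simp only [snArr, acwedge, acast_sum, acast_smul, Pi.smul_apply, Pi.add_apply, Finset.sum_apply]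
  have e1 : ∀ a, acast (n := n) (R := R) (rfl : p + (q + 1) = p + q + 1)
      (awedge (ahook a κ) (ahook a μ')) C = _ := fun a => acast_awedge _ _ _ _
  have e2 : ∀ a, acast (n := n) (R := R) (by omega : q + (p + 1) = p + q + 1)
      (awedge (ahook a μ) (ahook a κ')) C = _ := fun a => acast_awedge _ _ _ _
  simp only [e1, e2]
  simp only [smul_comm (_ : ℝ) (1 / (_ : ℝ)), ← Finset.smul_sum]
  refine (sum_smul_sum_smul _ _ _ _ _ _ _ _ (((p + 1)! * (q + 1)! : ℝ) / (p + q + 1)! *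
    (1 / ((p ! : ℝ) * ((q + 1)! : ℝ)))) (((p + 1)! * (q + 1)! : ℝ) / (p + q + 1)! *
    (1 / ((q ! : ℝ) * ((p + 1)! : ℝ)))) ?_ ?_).trans ?_
  · rw [hp1, hq1]; field_simp
  · rw [hp1, hq1]; field_simp
  · simp only [mul_smul, smul_add]
    rw [smul_comm ((-1 : ℝ) ^ ((p + 1) * (q + 1))), smul_comm ((-1 : ℝ) ^ ((p + 1) * (q + 1)))]
    rfl

end Contracted

namespace SpinData

variable {n : ℕ} {R Ψ : Type*} [CommRing R] [Algebra ℝ R] [AddCommGroup Ψ] [Module ℝ Ψ]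
    [Module R Ψ] [IsScalarTower ℝ R Ψ] {S : SpinData n R Ψ}

/-- A homogeneous element of degree k + l - 1 is its own part of order m = 1, and at odd order both
terms of each graded commutator agree, whence the factor 2. -/
theorem snElt_eq_comp {k l : ℤ} {κ κ' μ μ' : Module.End R Ψ} (hκ : S.IsKY k κ κ')
    (hμ : S.IsKY l μ μ') (hΘ : IsDeg R S.ε S.γ (k + l - 1) (snElt k l κ κ' μ μ')) :
    snElt k l κ κ' μ μ' = (2 : ℝ) • (sg (k - 1) • comp R S.ε S.γ (k + (l + 1)) (κ * μ') 1 -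
      sg ((k + 1) * l) • comp R S.ε S.γ (l + (k + 1)) (μ * κ') 1) := by
  have hx := prod_isDec S.cliff hκ.deg' hμ.deg
  have hu := prod_isDec S.cliff hμ.deg hκ.deg'
  have hy := prod_isDec S.cliff hκ.deg hμ.deg'
  have hv := prod_isDec S.cliff hμ.deg' hκ.deg
  have s1 := comp_swap S.cliff hμ.deg hκ.deg' 1
  have s2 := comp_swap S.cliff hκ.deg hμ.deg' 1
  rw [show k + 1 + l = k + l + 1 by ring] at hx
  rw [show l + (k + 1) = k + l + 1 by ring] at hu s1 ⊢
  rw [show k + (l + 1) = k + l + 1 by ring] at hy s2 ⊢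
  rw [show l + 1 + k = k + l + 1 by ring] at hv
  have h1 := (hx.add (hu.smul (-sg ((k + 1) * l)))).add
    ((hy.add (hv.smul (-sg (k * (l + 1))))).smul (sg (k - 1)))
  have h2 : IsDec R S.ε S.γ (k + l + 1 - 2) (snElt k l κ κ' μ μ') _ := IsDec.of_deg (by
    rw [show k + l + 1 - 2 = k + l - 1 by ring]; exact hΘ)
  have h3 := h2.unshift
  have h4 : snElt k l κ κ' μ μ' = κ' * μ + (-sg ((k + 1) * l)) • (μ * κ') +
      sg (k - 1) • (κ * μ' + (-sg (k * (l + 1))) • (μ' * κ)) := by rw [snElt]; module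
  rw [← h4] at h1
  have h5 := h3.unique S.cliff h1 1
  simp only [one_ne_zero, if_false, Nat.sub_self, if_true] at h5
  rw [h5, s1, s2]
  have e1 : sg (l * (k + 1) + ((1 : ℕ) : ℤ)) = -sg ((k + 1) * l) := by
    rw [sg_add, mul_comm l]; simp [sg_one]
  have e2 : sg (k * (l + 1) + ((1 : ℕ) : ℤ)) = -sg (k * (l + 1)) := by
    rw [sg_add]; simp [sg_one]
  rw [e1, e2]
  rcases sg_eq_or (k * (l + 1)) with h | h <;> rw [h] <;> module

end SpinData

/-! ### Recognising alternating tensors by their contractions. -/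

section Skew

variable {n : ℕ} {R : Type*} [CommRing R] [Algebra ℝ R]

theorem skew_comp_iff {k : ℕ} {α : (Fin k → Fin n) → R} (s : Set (Equiv.Perm (Fin k)))
    (hs : Submonoid.closure s = ⊤) (h : ∀ σ ∈ s, ∀ C, α (C ∘ σ) = sgnR σ • α C) : Skew α := by
  intro σ
  have hσ : σ ∈ Submonoid.closure s := by rw [hs]; trivial
  induction hσ using Submonoid.closure_induction with
  | mem σ hσ => exact h σ hσ
  | one => intro C; simp [sgnR_one]
  | mul σ τ _ _ h1 h2 =>
    intro C
    have : C ∘ ⇑(σ * τ) = (C ∘ σ) ∘ τ := rfl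
    rw [this, h2, h1, smul_smul, sgnR_mul, mul_comm]

/-- A tensor is alternating if its contractions are, and it is so in the first two slots. -/
theorem skew_of_ahook_ahook {k : ℕ} {F : (Fin (k + 2) → Fin n) → R} (h1 : ∀ a, Skew (ahook a F))
    (h2 : ∀ a b, ahook a (ahook b F) = -ahook b (ahook a F)) : Skew F := by
  refine skew_comp_iff _ (Equiv.Perm.mclosure_swap_castSucc_succ (k + 1)) ?_
  rintro _ ⟨i, rfl⟩ C
  rw [sgnR_swap (by simp [Fin.ext_iff]), neg_one_smul]
  obtain ⟨a, C, rfl⟩ : ∃ a C', C = Fin.cons a C' := ⟨C 0, Fin.tail C, by simp⟩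
  refine Fin.cases ?_ (fun i => ?_) i
  · obtain ⟨b, C, rfl⟩ : ∃ a C', C = Fin.cons a C' := ⟨C 0, Fin.tail C, by simp⟩
    have h3 : (Fin.cons a (Fin.cons b C) : Fin (k + 2) → Fin n) ∘
        Equiv.swap (Fin.castSucc 0) (Fin.succ 0) = Fin.cons b (Fin.cons a C) := by
      funext i
      refine Fin.cases ?_ (fun i => Fin.cases ?_ (fun i => ?_) i) i
      · simp
      · simp
      · have : Equiv.swap (0 : Fin (k + 2)) 1 i.succ.succ = i.succ.succ :=
          Equiv.swap_apply_of_ne_of_ne (Fin.succ_ne_zero _) (by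
            rw [Ne, Fin.ext_iff]; simp)
        rw [Function.comp_apply]
        exact congrArg _ this
    rw [h3]
    exact congrFun (h2 a b) C
  · have h3 : (Fin.cons a C : Fin (k + 2) → Fin n) ∘
        Equiv.swap (Fin.castSucc i.succ) (Fin.succ i.succ) =
        Fin.cons a (C ∘ Equiv.swap i.castSucc i.succ) := by
      funext j
      refine Fin.cases ?_ (fun j => ?_) j
      · have : Equiv.swap (Fin.castSucc i.succ) (Fin.succ i.succ) (0 : Fin (k + 2)) = 0 :=
          Equiv.swap_apply_of_ne_of_ne (by simp [Fin.ext_iff]) (by simp [Fin.ext_iff])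
        rw [Function.comp_apply]
        exact congrArg (Fin.cons a C : Fin (k + 2) → Fin n) this
      · simp only [Function.comp_apply, Fin.cons_succ]
        have : Equiv.swap (Fin.castSucc i.succ) (Fin.succ i.succ) j.succ =
            (Equiv.swap i.castSucc i.succ j).succ := by
          rw [← Fin.succ_castSucc]
          exact ((Fin.succ_injective _).map_swap _ _ _).symm
        rw [this, Fin.cons_succ]
    rw [h3]
    have := h1 a (Equiv.swap i.castSucc i.succ) C
    rw [sgnR_swap (by simp [Fin.ext_iff]), neg_one_smul] at this
    exact this

/-- The components of `eᵃ ∧ Gₐ`. -/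
def extArr {k : ℕ} (G : Fin n → (Fin k → Fin n) → R) : (Fin (k + 1) → Fin n) → R :=
  fun C => ∑ i : Fin (k + 1), (-1 : ℝ) ^ (i : ℕ) • G (C i) (fun j => C (i.succAbove j))

theorem extArr_cons_cons {k : ℕ} {G : Fin n → (Fin (k + 1) → Fin n) → R} (a b : Fin n)
    (C : Fin k → Fin n) : extArr G (Fin.cons a (Fin.cons b C)) =
      G a (Fin.cons b C) - G b (Fin.cons a C) + ∑ i : Fin k, (-1 : ℝ) ^ (i : ℕ) •
        G (C i) (fun j => (Fin.cons a (Fin.cons b C) : Fin (k + 2) → Fin n)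
          (i.succ.succ.succAbove j)) := by
  rw [extArr, Fin.sum_univ_succ, Fin.sum_univ_succ]
  have e : (fun j => (Fin.cons a (Fin.cons b C) : Fin (k + 2) → Fin n)
      ((Fin.succ 0).succAbove j)) = Fin.cons a C := by
    funext j
    refine Fin.cases ?_ (fun j => ?_) j <;> simp
  rw [e]
  simp [pow_add, sub_eq_add_neg, add_assoc]

theorem ahook_extArr_anticomm {k : ℕ} {G : Fin n → (Fin (k + 1) → Fin n) → R}
    (hG : ∀ a, Skew (G a)) (a b : Fin n) :
    ahook a (ahook b (extArr G)) = -ahook b (ahook a (extArr G)) := by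
  funext C
  rw [Pi.neg_apply]
  simp only [ahook]
  rw [extArr_cons_cons, extArr_cons_cons, eq_neg_iff_add_eq_zero]
  have h : ∀ i : Fin k, G (C i) (fun j => (Fin.cons b (Fin.cons a C) : Fin (k + 2) → Fin n)
          (i.succ.succ.succAbove j)) = -G (C i) (fun j =>
          (Fin.cons a (Fin.cons b C) : Fin (k + 2) → Fin n) (i.succ.succ.succAbove j)) := by
    rcases k with _ | k
    · exact fun i => i.elim0
    intro i
    have e : ∀ a b, (fun j => (Fin.cons a (Fin.cons b C) : Fin (k + 3) → Fin n)
        (i.succ.succ.succAbove j)) = Fin.cons a (Fin.cons b fun j => C (i.succAbove j)) := by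
      intro a b
      funext j
      refine Fin.cases ?_ (fun j => Fin.cases ?_ (fun j => ?_) j) j <;> simp
    rw [e, e]
    exact congrFun ((hG (C i)).ahook_ahook a b) _
  simp only [h, smul_neg, Finset.sum_neg_distrib]
  abel

/-- If `Gₐ` is proportional to `Xₐ ⌟ (eᵇ ∧ G_b)`, then `eᵇ ∧ G_b` is alternating. -/
theorem skew_extArr {k : ℕ} {G : Fin n → (Fin (k + 1) → Fin n) → R} (hG : ∀ a, Skew (G a))
    {c : ℝ} (hc : c ≠ 0) (h : ∀ a, G a = c • ahook a (extArr G)) : Skew (extArr G) := by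
  refine skew_of_ahook_ahook (fun a => ?_) (ahook_extArr_anticomm hG)
  have : ahook a (extArr G) = c⁻¹ • G a := by rw [h a, smul_smul, inv_mul_cancel₀ hc, one_smul]
  rw [this]
  exact (hG a).smul _

/-- If `X_b ⌟ Gₐ` is antisymmetric, then `Gₐ = Xₐ ⌟ F` with `F` alternating. -/
theorem exists_skew_of_anticomm {k : ℕ} {G : Fin n → (Fin (k + 1) → Fin n) → R}
    (hG : ∀ a, Skew (G a)) (h : ∀ a b, ahook a (G b) = -ahook b (G a)) :
    ∃ F, Skew F ∧ (∀ a, ahook a F = G a) ∧ extArr G = ((k : ℝ) + 2) • F := by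
  have hF : ∀ a, ahook a (fun C : Fin (k + 2) → Fin n => G (C 0) (Fin.tail C)) = G a := fun a => by
    funext C; simp [ahook]
  have hs : Skew (fun C : Fin (k + 2) → Fin n => G (C 0) (Fin.tail C)) :=
    skew_of_ahook_ahook (fun a => by rw [hF]; exact hG a) fun a b => by rw [hF, hF]; exact h a b
  refine ⟨_, hs, hF, ?_⟩
  funext C
  -- Moving slot i to the front is a cycle whose sign cancels (-1)^i, so all k + 2 summands agree.
  have h1 : ∀ i : Fin (k + 2), (-1 : ℝ) ^ (i : ℕ) • G (C i) (fun j => C (i.succAbove j)) =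
      G (C 0) (Fin.tail C) := fun i => by
    have h2 := hs i.cycleRange.symm C
    rw [← Fin.cons_removeNth_eq_comp_cycleRange_symm] at h2
    have h3 : sgnR i.cycleRange.symm = (-1) ^ (i : ℕ) := by
      rw [sgnR, Equiv.Perm.sign_symm, Fin.sign_cycleRange]; simp
    rw [h3] at h2
    simp only [Fin.cons_zero, Fin.tail_cons] at h2
    have h4 : (fun j => C (i.succAbove j)) = i.removeNth C := rfl
    rw [h4, h2, smul_smul, ← mul_pow]
    simp
  rw [extArr, Finset.sum_congr rfl fun i _ => h1 i, Finset.sum_const, Finset.card_univ,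
    Fintype.card_fin, Pi.smul_apply, ← Nat.cast_smul_eq_nsmul ℝ]
  push_cast; rfl

end Skew

/-! ### Killing-Yano forms and their operators in components. -/

namespace SpinData

variable {n : ℕ} {R Ψ : Type*} [CommRing R] [Algebra ℝ R] [AddCommGroup Ψ] [Module ℝ Ψ]
    [Module R Ψ] [IsScalarTower ℝ R Ψ] (S : SpinData n R Ψ)

/-- The components of the covariant derivative of a tensor. -/
def nabArr {k : ℕ} (a : Fin n) (α : (Fin k → Fin n) → R) : (Fin k → Fin n) → R :=
  fun C => S.der a (α C) - ∑ j, ∑ c, S.Γ a (C j) c * α (Function.update C j c)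

theorem ahook_nabArr {k : ℕ} (a b : Fin n) (α : (Fin (k + 1) → Fin n) → R) :
    ahook b (S.nabArr a α) = S.nabArr a (ahook b α) - ∑ c, S.Γ a b c • ahook c α := by
  funext C
  simp only [ahook, nabArr, Fin.sum_univ_succ, Pi.sub_apply, Finset.sum_apply, Pi.smul_apply,
    Fin.cons_zero, Fin.cons_succ, Fin.update_cons_zero, ← Fin.cons_update, smul_eq_mul]
  ring

/-- Differentiating the gamma matrices produces Γ-terms which, the connection being metric, are
those in the covariant derivative of the components. -/
theorem dA_cq {k : ℕ} (a : Fin n) (α : (Fin k → Fin n) → R) :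
    S.dA a (cq S.ε S.γ α) = cq S.ε S.γ (S.nabArr a α) := by
  induction k with
  | zero =>
    rw [cq_zero, cq_zero, dA_rsmul, dA_one, smul_zero, add_zero, nabArr]
    simp
  | succ k ih =>
    rw [cq_succ, cq_succ, dA_sum]
    have h : ∀ b, cq S.ε S.γ (S.nabArr a (ahook b α)) = cq S.ε S.γ (ahook b (S.nabArr a α)) +
        ∑ c, S.Γ a b c • cq S.ε S.γ (ahook c α) := fun b => by
      rw [ahook_nabArr, cq_sub, cq_sum]
      simp only [cq_rsmul, sub_add_cancel]
    simp only [dA_smul, dA_mul, dA_gamma, ih, h, mul_add, smul_add, Finset.sum_add_distrib,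
      Finset.sum_mul, Finset.mul_sum, Finset.smul_sum, smul_mul_assoc, mul_smul_comm]
    rw [S.skew_sum a (fun b c => S.γ c * cq S.ε S.γ (ahook b α))]
    abel

theorem dA_clf {k : ℕ} (a : Fin n) (α : (Fin k → Fin n) → R) :
    S.dA a (clf S.ε S.γ α) = clf S.ε S.γ (S.nabArr a α) := by
  rw [clf, dA_smul, dA_cq, clf]

variable {S}

/-- Real linearity of `der` is not part of `SpinData`; on a faithful module it follows by
differentiating scalar endomorphisms. -/
theorem der_smul (hinj : ∀ r : R, r • (1 : Module.End R Ψ) = 0 → r = 0) (a : Fin n) (r : ℝ)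
    (f : R) : S.der a (r • f) = r • S.der a f := by
  rw [← sub_eq_zero]
  refine hinj _ ?_
  have h1 := S.dA_rsmul a (r • f) 1
  have h2 := S.dA_rsmul a f 1
  rw [dA_one, smul_zero, add_zero] at h1 h2
  rw [sub_smul, ← h1, smul_assoc, smul_assoc, dA_smul, h2, sub_self]

theorem nabArr_skew (hinj : ∀ r : R, r • (1 : Module.End R Ψ) = 0 → r = 0) {k : ℕ} (a : Fin n)
    {α : (Fin k → Fin n) → R} (hα : Skew α) : Skew (S.nabArr a α) := by
  intro σ C
  rw [nabArr, hα, der_smul hinj, nabArr, smul_sub]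
  congr 1
  rw [← Equiv.sum_comp σ (fun j => ∑ c, S.Γ a (C j) c * α (Function.update C j c)), Finset.smul_sum]
  refine Finset.sum_congr rfl fun j _ => ?_
  rw [Finset.smul_sum]
  refine Finset.sum_congr rfl fun c _ => ?_
  have : Function.update (C ∘ σ) j c = Function.update C (σ j) c ∘ σ := by
    rw [Function.update_comp_equiv]; simp
  rw [this, hα, mul_smul_comm]
  rfl

variable (S) in
/-- The components of a Killing-Yano form. -/
structure ArrKY {k : ℕ} (α : (Fin (k + 1) → Fin n) → R) : Prop where
  skew : Skew α
  eq : ∀ a, S.nabArr a α = (1 / ((k : ℝ) + 2)) • ahook a (extArr fun b => S.nabArr b α)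

variable (S) in
/-- The operator of a Killing-Yano form, in components. -/
def arrOp {k : ℕ} (α : (Fin (k + 1) → Fin n) → R) (ψ : Ψ) : Ψ :=
  ∑ a, S.ε a • clf S.ε S.γ (ahook a α) (S.nab a ψ) +
    (((k : ℝ) + 1) / (2 * ((k : ℝ) + 2))) • clf S.ε S.γ (extArr fun b => S.nabArr b α) ψ

theorem ArrKY.isKY (hinj : ∀ r : R, r • (1 : Module.End R Ψ) = 0 → r = 0) {k : ℕ}
    {α : (Fin (k + 1) → Fin n) → R} (h : S.ArrKY α) :
    S.IsKY ((k : ℤ) + 1) (clf S.ε S.γ α)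
      (clf S.ε S.γ ((1 / ((k : ℝ) + 2)) • extArr fun b => S.nabArr b α)) := by
  have hk : 1 / ((k : ℝ) + 2) ≠ 0 := by positivity
  have hs := (skew_extArr (fun a => nabArr_skew hinj a h.skew) hk h.eq).smul (1 / ((k : ℝ) + 2))
  refine ⟨?_, ?_, fun a => ?_⟩
  · have := clf_deg S.cliff h.skew; push_cast at this; exact this
  · have := clf_deg S.cliff hs; push_cast at this; exact this
  · have := hk_clf S.cliff hs a
    push_cast at this
    rw [dA_clf, this, h.eq]
    rfl

theorem ArrKY.arrOp_eq {k : ℕ} {α : (Fin (k + 1) → Fin n) → R} (h : Skew α) (ψ : Ψ) :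
    S.arrOp α ψ = S.kyOp ((k : ℤ) + 1) (clf S.ε S.γ α)
      (clf S.ε S.γ ((1 / ((k : ℝ) + 2)) • extArr fun b => S.nabArr b α)) ψ := by
  rw [arrOp, kyOp, op]
  simp only [hk_clf S.cliff h, clf_smul, smul_smul]
  congr 2
  push_cast
  field_simp

/-- The Clifford element of ∇_a α is a contraction of β', and forms are determined by their Clifford
elements, so X_b ⌟ ∇_a α is antisymmetric and ∇_a α = X_a ⌟ F for a form F. Then β' and the element
of F have equal contractions and equal positive degree, so they agree. -/
theorem ArrKY.of_isKY (hinj : ∀ r : R, r • (1 : Module.End R Ψ) = 0 → r = 0) {k : ℕ}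
    {α : (Fin (k + 1) → Fin n) → R} (hα : Skew α) {β' : Module.End R Ψ}
    (h : S.IsKY ((k : ℤ) + 1) (clf S.ε S.γ α) β') :
    S.ArrKY α ∧ β' = clf S.ε S.γ ((1 / ((k : ℝ) + 2)) • extArr fun b => S.nabArr b α) := by
  have hG : ∀ a, Skew (S.nabArr a α) := fun a => nabArr_skew hinj a hα
  have h1 : ∀ a, clf S.ε S.γ (S.nabArr a α) = hk S.γ ((k : ℤ) + 2) a β' := fun a => by
    rw [← dA_clf, h.eq, add_assoc]; rfl
  have h2 : ∀ a b, ahook a (S.nabArr b α) = -ahook b (S.nabArr a α) := fun a b => by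
    rw [← sub_eq_zero]
    refine eq_zero_of_clf S.cliff hinj (by
      rw [sub_neg_eq_add]; exact ((hG b).ahook a).add ((hG a).ahook b)) ?_
    rw [sub_neg_eq_add, clf_add, ← hk_clf S.cliff (hG b), ← hk_clf S.cliff (hG a), h1, h1]
    rw [hk_anticomm (hC := S.cliff) (γ := S.γ) (i := (k : ℤ) + 2) (j := (k : ℤ) + 1)
      (hij := by ring_nf; exact odd_one),
      neg_add_cancel]
  obtain ⟨F, hF, hF1, hF2⟩ := exists_skew_of_anticomm hG h2
  have hk : (k : ℝ) + 2 ≠ 0 := by positivity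
  have e : (1 / ((k : ℝ) + 2)) • (extArr fun b => S.nabArr b α) = F := by
    rw [hF2, smul_smul, one_div_mul_cancel hk, one_smul]
  refine ⟨⟨hα, fun a => ?_⟩, ?_⟩
  · rw [← hF1 a, ← e]; rfl
  · rw [e, ← sub_eq_zero]
    have hd := clf_deg (R := R) S.cliff hF
    have hd' := h.deg'
    rw [add_assoc, one_add_one_eq_two] at hd'
    push_cast at hd
    rw [add_assoc, one_add_one_eq_two] at hd
    refine (hd'.sub hd).eq_zero_of_hk (by omega) fun a => ?_
    have h3 := hk_clf S.cliff hF a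
    push_cast at h3
    rw [add_assoc, one_add_one_eq_two] at h3
    rw [hk_sub, h3, hF1, h1, sub_self]

theorem clf_sub {k : ℕ} (α β : (Fin k → Fin n) → R) :
    clf S.ε S.γ (α - β) = clf S.ε S.γ α - clf S.ε S.γ β := by
  rw [sub_eq_add_neg, clf_add, clf_neg, sub_eq_add_neg]

/-- Both sides are combinations of the order-one parts of κμ' and μκ'; it remains to match signs and
factorials. -/
theorem clf_snArr {p q : ℕ}
    {κ : (Fin (p + 1) → Fin n) → R} {μ : (Fin (q + 1) → Fin n) → R} {κ' : (Fin (p + 2) → Fin n) → R}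
    {μ' : (Fin (q + 2) → Fin n) → R} (hκs : Skew κ) (hμs : Skew μ) (hκs' : Skew κ') (hμs' : Skew μ')
    (hκ : S.IsKY ((p : ℤ) + 1) (clf S.ε S.γ κ) (clf S.ε S.γ κ'))
    (hμ : S.IsKY ((q : ℤ) + 1) (clf S.ε S.γ μ) (clf S.ε S.γ μ'))
    (hdeg : IsDeg R S.ε S.γ ((p : ℤ) + 1 + ((q : ℤ) + 1)) (clf S.ε S.γ κ * clf S.ε S.γ μ +
      sg (((p : ℤ) + 1) * ((q : ℤ) + 1)) • (clf S.ε S.γ μ * clf S.ε S.γ κ))) :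
    clf S.ε S.γ (snArr S.ε κ (fun a => ahook a κ') μ (fun a => ahook a μ')) =
      (((p + 1)! * (q + 1)! : ℝ) / (2 * (p + q + 1)!)) • snElt ((p : ℤ) + 1) ((q : ℤ) + 1)
        (clf S.ε S.γ κ) (clf S.ε S.γ κ') (clf S.ε S.γ μ) (clf S.ε S.γ μ') := by
  rw [snElt_eq_comp hκ hμ (snElt_deg hκ hμ hdeg).1, snArr_eq, clf_smul, clf_add, clf_smul,
    clf_acast, clf_acast, clf_acwedge (r := p) (s := q + 1) S.cliff 1 hκs hμs',
    clf_acwedge (r := q) (s := p + 1) S.cliff 1 hμs hκs']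
  push_cast
  have e1 : sg (((p : ℤ) + 1 + 1) * ((q : ℤ) + 1)) = sg ((p : ℤ) * ((q : ℤ) + 1)) :=
    sg_eq_of_even_sub (by ring_nf; exact ⟨q + 1, by ring⟩)
  have e2 : (-1 : ℝ) ^ ((p + 1) * (q + 1)) = sg (((p : ℤ) + 1) * ((q : ℤ) + 1)) := by
    rw [← sg_natCast]; push_cast; rfl
  have e3 : sg (((p : ℤ) + 1) * ((q : ℤ) + 1)) = sg ((p : ℤ) * ((q : ℤ) + 1)) * sg ((q : ℤ) + 1) := by
    rw [← sg_add]; congr 1; ring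
  rw [e1, e2, e3]
  have e5 : acwConst 1 p = sg (p : ℤ) := by simp [acwConst, sg_add, sg_one]
  have e6 : acwConst 1 q = -sg ((q : ℤ) + 1) := by simp [acwConst]
  rw [e5, e6, add_sub_cancel_right]
  generalize comp R S.ε S.γ _ _ 1 = X
  generalize comp R S.ε S.γ _ _ 1 = Y
  have e7 : (((p + 1)! * (q + 1)! : ℝ) / (2 * (p + q + 1)!)) =
    (((p + 1)! * (q + 1)! : ℝ) / (p + q + 1)!) * (1 / 2) := by
    have : ((p + q + 1)! : ℝ) ≠ 0 := by exact_mod_cast (p + q + 1).factorial_ne_zero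
    field_simp
  rw [e7]
  rcases sg_eq_or ((q : ℤ) + 1) with h | h <;> rw [h] <;> module

theorem ArrKY.smul (hinj : ∀ r : R, r • (1 : Module.End R Ψ) = 0 → r = 0) {k : ℕ}
    {α : (Fin (k + 1) → Fin n) → R} (h : S.ArrKY α) (z : ℝ) : S.ArrKY (z • α) := by
  have h1 : ∀ a, S.nabArr a (z • α) = z • S.nabArr a α := fun a => by
    funext C
    simp only [nabArr, Pi.smul_apply, der_smul hinj, mul_smul_comm, smul_sub, Finset.smul_sum]
  have h2 : extArr (fun b => S.nabArr b (z • α)) = z • extArr fun b => S.nabArr b α := by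
    funext C
    simp only [extArr, h1, Pi.smul_apply, Finset.smul_sum, smul_comm z]
  refine ⟨h.skew.smul z, fun a => ?_⟩
  rw [h1, h2, h.eq, smul_comm]
  rfl

/-- ∇_a α is a contraction of an alternating form. The diagonal case a = b gives co-closedness. -/
theorem ArrKY.codiff {k : ℕ} {α : (Fin (k + 1) → Fin n) → R}
    (hinj : ∀ r : R, r • (1 : Module.End R Ψ) = 0 → r = 0) (h : S.ArrKY α) (a b : Fin n) :
    ahook a (S.nabArr b α) = -ahook b (S.nabArr a α) := by
  have hs := skew_extArr (fun a => nabArr_skew hinj a h.skew)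
    (c := 1 / ((k : ℝ) + 2)) (by positivity) h.eq
  rw [h.eq a, h.eq b]
  have := hs.ahook_ahook a b
  funext C
  have h1 := congrFun this C
  simp only [KYForms.ahook, Pi.smul_apply, Pi.neg_apply] at h1 ⊢
  rw [h1, smul_neg]

/-- The graded commutator of two Killing-Yano operators, in components. -/
theorem ArrKY.exists_bracket (hinj : ∀ r : R, r • (1 : Module.End R Ψ) = 0 → r = 0)
    (tr : Module.End R Ψ →ₗ[R] R) (htr : ∀ α β, tr (α * β) = tr (β * α))
    {d : ℝ} (hd0 : d ≠ 0) (htr1 : tr 1 = algebraMap ℝ R d) {p q : ℕ}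
    {κ : (Fin (p + 1) → Fin n) → R} {μ : (Fin (q + 1) → Fin n) → R} (hκ : S.ArrKY κ)
    (hμ : S.ArrKY μ) (hc : ArrCond S.ε κ μ) :
    S.ArrKY (snArr S.ε κ (fun a => S.nabArr a κ) μ fun a => S.nabArr a μ) ∧
    ∃ r : R, (∀ a, S.der a r = 0) ∧ (¬ (p = q ∧ Odd p) → r = 0) ∧
      ∀ ψ, S.arrOp κ (S.arrOp μ ψ) - (-1 : ℝ) ^ (p * q) • S.arrOp μ (S.arrOp κ ψ) =
        S.arrOp (((-1 : ℝ) ^ p * (((p + q)! : ℝ) / (p ! * q !))) •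
          snArr S.ε κ (fun a => S.nabArr a κ) μ fun a => S.nabArr a μ) ψ + r • ψ := by
  have hp : 1 / ((p : ℝ) + 2) ≠ 0 := by positivity
  have hq : 1 / ((q : ℝ) + 2) ≠ 0 := by positivity
  have hκs' := (skew_extArr (fun a => nabArr_skew hinj a hκ.skew) hp hκ.eq).smul (1 / ((p : ℝ) + 2))
  have hμs' := (skew_extArr (fun a => nabArr_skew hinj a hμ.skew) hq hμ.eq).smul (1 / ((q : ℝ) + 2))
  have hκ1 := hκ.isKY hinj
  have hμ1 := hμ.isKY hinj
  have eκ := fun ψ => ArrKY.arrOp_eq (S := S) hκ.skew ψ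
  have eμ := fun ψ => ArrKY.arrOp_eq (S := S) hμ.skew ψ
  have nκ : ∀ a, S.nabArr a κ = ahook a ((1 / ((p : ℝ) + 2)) • extArr fun b => S.nabArr b κ) :=
    hκ.eq
  have nμ : ∀ a, S.nabArr a μ = ahook a ((1 / ((q : ℝ) + 2)) • extArr fun b => S.nabArr b μ) :=
    hμ.eq
  have esn : (snArr S.ε κ (fun a => S.nabArr a κ) μ fun a => S.nabArr a μ) =
      snArr S.ε κ (fun a => ahook a ((1 / ((p : ℝ) + 2)) • extArr fun b => S.nabArr b κ)) μ
        (fun a => ahook a ((1 / ((q : ℝ) + 2)) • extArr fun b => S.nabArr b μ)) := by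
    simp only [← nκ, ← nμ]
  rw [esn]
  generalize (1 / ((p : ℝ) + 2)) • (extArr fun b => S.nabArr b κ) = κ' at *
  generalize (1 / ((q : ℝ) + 2)) • (extArr fun b => S.nabArr b μ) = μ' at *
  have hdeg := hc.anticomm_deg S.cliff hκ.skew hμ.skew
  have hcomm := hc.comm S.cliff hκ.skew hμ.skew
  have hsn := clf_snArr hκ.skew hμ.skew hκs' hμs' hκ1 hμ1 hdeg
  have hsk : Skew (snArr S.ε κ (fun a => ahook a κ') μ (fun a => ahook a μ')) := by
    rw [snArr_eq]
    exact ((acwedge_skew _ _ _).acast _ |>.add (((acwedge_skew _ _ _).acast _).smul _)).smul _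
  set N := snArr S.ε κ (fun a => ahook a κ') μ (fun a => ahook a μ') with hN
  obtain ⟨β', r, hβ, hC, hodd, hder, hop⟩ := exists_kyComm_eq (k := (p : ℤ) + 1) (l := (q : ℤ) + 1)
    (by omega) (by omega) hκ1 hμ1 (by simpa only [add_sub_cancel_right] using hcomm) hdeg
  -- This is the coefficient of ν: the sign (-1)^p combines the overall minus sign with the parity
  -- operator on degree p + 1.
  set c : ℝ := (-1 : ℝ) ^ p * (((p + q)! : ℝ) / (p ! * q !)) with hcdef
  have hfp : (p ! : ℝ) ≠ 0 := by exact_mod_cast p.factorial_ne_zero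
  have hfq : (q ! : ℝ) ≠ 0 := by exact_mod_cast q.factorial_ne_zero
  have hfpq : ((p + q)! : ℝ) ≠ 0 := by exact_mod_cast (p + q).factorial_ne_zero
  have hc0 : c ≠ 0 := by
    rw [hcdef]; exact mul_ne_zero (pow_ne_zero _ (by norm_num))
      (div_ne_zero hfpq (mul_ne_zero hfp hfq))
  have hνeq : (sg ((p : ℤ) + 1 - 1) * ((((p : ℤ) + 1 : ℤ) : ℝ) * (((q : ℤ) + 1 : ℤ) : ℝ)) /
      (2 * ((((p : ℤ) + 1 : ℤ) : ℝ) + (((q : ℤ) + 1 : ℤ) : ℝ) - 1))) •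
      snElt ((p : ℤ) + 1) ((q : ℤ) + 1) (clf S.ε S.γ κ) (clf S.ε S.γ κ') (clf S.ε S.γ μ)
        (clf S.ε S.γ μ') = clf S.ε S.γ (c • N) := by
    rw [clf_smul, hsn, smul_smul, add_sub_cancel_right, sg_natCast, hcdef, Nat.factorial_succ p,
      Nat.factorial_succ q, Nat.factorial_succ (p + q)]
    congr 1
    push_cast
    have : (p : ℝ) + q + 1 ≠ 0 := by positivity
    have : (p : ℝ) + 1 + (q + 1) - 1 ≠ 0 := by
      rw [show (p : ℝ) + 1 + (q + 1) - 1 = p + q + 1 by ring]; exact this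
    field_simp
    ring
  have hd : (p : ℤ) + 1 + ((q : ℤ) + 1) - 1 = ((p + q : ℕ) : ℤ) + 1 := by push_cast; ring
  simp only [hνeq, hd] at hβ hop
  have hKY := ArrKY.of_isKY hinj (hsk.smul c) hβ
  have hKN : S.ArrKY N := by
    have := hKY.1.smul hinj c⁻¹
    rwa [smul_smul, inv_mul_cancel₀ hc0, one_smul] at this
  refine ⟨hKN, r, fun a => ?_, fun hne => ?_, fun ψ => ?_⟩
  · rcases hder a with h | h
    · exact hinj _ h
    · rw [hinj _ h]
      have := der_smul (S := S) hinj a 0 (0 : R)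
      simpa using this
  · rcases Int.even_or_odd ((p : ℤ) + 1 + ((q : ℤ) + 1)) with he | ho
    -- The degrees are p + 1 and q + 1, so equal even degrees mean p = q with p odd.
    · refine smul_one_eq_zero_of_trace (β := clf S.ε S.γ (c • N)) htr hd0 htr1
        (by omega) (by omega) hκ1 hμ1 ?_ ?_ hC he
      · rintro ⟨h1, h2⟩
        refine hne ⟨by omega, ?_⟩
        rw [← Nat.not_even_iff_odd]
        intro h3
        have h4 : Even (p : ℤ) := by exact_mod_cast h3
        exact (Int.even_add_one.1 h2) h4
      · rw [hd]; exact hβ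
    · exact hinj _ (hodd ho)
  · rw [ArrKY.arrOp_eq (hsk.smul c), ← hKY.2, ← hop, kyComm]
    simp only [eκ, eμ]
    congr 2
    rw [← sg_natCast]
    push_cast
    congr 1
    ring

/-- The symbol determines all contractions of the form, hence the form, since its degree is
positive. Zeroth-order terms such as r play no role. -/
theorem eq_of_arrOp (hinj : ∀ r : R, r • (1 : Module.End R Ψ) = 0 → r = 0) {k : ℕ}
    {α β : (Fin (k + 1) → Fin n) → R} (hα : Skew α) (hβ : Skew β) (r : R)
    (h : ∀ ψ, S.arrOp α ψ = S.arrOp β ψ + r • ψ) : α = β := by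
  have hε : ∀ a, S.ε a ≠ 0 := fun a h0 => by simpa [h0] using S.cliff.sq a
  have h1 := S.op_eq_zero (Q := fun a => S.ε a • clf S.ε S.γ (ahook a α - ahook a β))
    (C := (((k : ℝ) + 1) / (2 * ((k : ℝ) + 2))) • clf S.ε S.γ (extArr fun b => S.nabArr b α) -
      (((k : ℝ) + 1) / (2 * ((k : ℝ) + 2))) • clf S.ε S.γ (extArr fun b => S.nabArr b β) -
      r • (1 : Module.End R Ψ)) fun ψ => by
    have h2 := h ψ
    rw [arrOp, arrOp, ← sub_eq_zero] at h2
    refine Eq.trans ?_ h2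
    simp only [clf_sub, smul_sub, LinearMap.sub_apply, Finset.sum_sub_distrib,
      LinearMap.smul_apply, Module.End.one_apply]
    abel
  funext C
  obtain ⟨a, C, rfl⟩ : ∃ a C', C = Fin.cons a C' := ⟨C 0, Fin.tail C, by simp⟩
  have h2 := (smul_eq_zero.1 (h1.1 a)).resolve_left (hε a)
  have h3 := eq_zero_of_clf S.cliff hinj (by
    rw [sub_eq_add_neg, ← neg_one_smul ℝ]
    exact (hα.ahook a).add ((hβ.ahook a).smul _)) h2
  exact sub_eq_zero.1 (congrFun h3 C)

end SpinData


/-! ### Covariant derivatives of tensor fields -/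

section Tensor

variable {n : ℕ} {M : Type*} [TopologicalSpace M] [ChartedSpace (EuclideanSpace ℝ (Fin n)) M]
  [IsManifold (𝓡 n) ∞ M]

/-- Differentiability of a vector field at a point. -/
abbrev VFDiffAt (X : ∀ x : M, TangentSpace (𝓡 n) x) (x : M) : Prop :=
  MDifferentiableAt (𝓡 n) (𝓡 n).tangent (fun y => (⟨y, X y⟩ : TangentBundle (𝓡 n) M)) x

/-- Smoothness of a vector field on a set. -/
abbrev VFSmoothOn (X : ∀ x : M, TangentSpace (𝓡 n) x) (U : Set M) : Prop :=
  ContMDiffOn (𝓡 n) (𝓡 n).tangent ∞ (fun y => (⟨y, X y⟩ : TangentBundle (𝓡 n) M)) U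

theorem mdifferentiableAt_fun_sum {ι : Type} (s : Finset ι) {f : ι → M → ℝ} {x : M}
    (h : ∀ i ∈ s, MDifferentiableAt (𝓡 n) 𝓘(ℝ, ℝ) (f i) x) :
    MDifferentiableAt (𝓡 n) 𝓘(ℝ, ℝ) (fun y => ∑ i ∈ s, f i y) x := by
  have := MDifferentiableAt.sum (I := 𝓡 n) (E' := ℝ) (t := s) (f := f) h
  convert this using 1
  funext y
  simp

theorem mdifferentiableAt_fun_prod {ι : Type*} (s : Finset ι) {f : ι → M → ℝ} {x : M}
    (h : ∀ i ∈ s, MDifferentiableAt (𝓡 n) 𝓘(ℝ, ℝ) (f i) x) :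
    MDifferentiableAt (𝓡 n) 𝓘(ℝ, ℝ) (fun y => ∏ i ∈ s, f i y) x := by
  classical
  induction s using Finset.induction_on with
  | empty => simpa using mdifferentiableAt_const
  | insert i s hi ih =>
    simp only [Finset.prod_insert hi]
    exact (h i (by simp)).mul (ih fun j hj => h j (by simp [hj]))

theorem update_field {k : ℕ} (X : Fin k → ∀ x : M, TangentSpace (𝓡 n) x) (j : Fin k)
    (σ : ∀ x : M, TangentSpace (𝓡 n) x) (y : M) :
    (fun i => Function.update X j σ i y) = Function.update (fun i => X i y) j (σ y) := by
  funext i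
  by_cases h : i = j
  · subst h; simp
  · simp [h]

/-- The alternating form at a point. -/
def IsDiffForm.alt {k : ℕ} {θ : TField n M k} (h : IsDiffForm θ) (x : M) :
    TangentSpace (𝓡 n) x [⋀^Fin k]→ₗ[ℝ] ℝ := (h.1 x).choose

theorem IsDiffForm.alt_eq {k : ℕ} {θ : TField n M k} (h : IsDiffForm θ) (x : M) : θ x = h.alt x :=
  funext fun w => (h.1 x).choose_spec w

theorem IsDiffForm.mdifferentiableAt {k : ℕ} {θ : TField n M k} (h : IsDiffForm θ) {x : M}
    {X : Fin k → ∀ x : M, TangentSpace (𝓡 n) x} (hX : ∀ i, VFDiffAt (X i) x) :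
    MDifferentiableAt (𝓡 n) 𝓘(ℝ, ℝ) (fun y => θ y (fun i => X i y)) x := by
  classical
  let t := trivializationAt (EuclideanSpace ℝ (Fin n)) (TangentSpace (𝓡 n) : M → Type _) x
  have hx : x ∈ t.baseSet := FiberBundle.mem_baseSet_trivializationAt' x
  let b : Basis (Fin n) ℝ (EuclideanSpace ℝ (Fin n)) := (EuclideanSpace.basisFun (Fin n) ℝ).toBasis
  have h1 : ∀ C : Fin k → Fin n, MDifferentiableAt (𝓡 n) 𝓘(ℝ, ℝ)
      (fun y => θ y (fun i => t.localFrame b (C i) y)) x := fun C =>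
    ((h.2 t.baseSet (fun i => t.localFrame b (C i)) t.open_baseSet
      fun i => t.contMDiffOn_localFrame_baseSet ∞ b (C i)).contMDiffAt
        (t.open_baseSet.mem_nhds hx)).mdifferentiableAt (by simp)
  have h2 : ∀ i a, MDifferentiableAt (𝓡 n) 𝓘(ℝ, ℝ)
      (fun y => t.localFrameCoeff (𝓡 n) b a y (X i y)) x := fun i a =>
    mdifferentiableAt_localFrameCoeff b hx (hX i) a
  have h3 : MDifferentiableAt (𝓡 n) 𝓘(ℝ, ℝ) (fun y => ∑ C : Fin k → Fin n,
      (∏ i, t.localFrameCoeff (𝓡 n) b (C i) y (X i y)) *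
        θ y (fun i => t.localFrame b (C i) y)) x :=
    mdifferentiableAt_fun_sum _ fun C _ =>
      (mdifferentiableAt_fun_prod _ fun i _ => h2 i (C i)).mul (h1 C)
  refine h3.congr_of_eventuallyEq ?_
  filter_upwards [t.open_baseSet.mem_nhds hx] with y hy
  have h4 : (fun i => X i y) = fun i => ∑ a, t.localFrameCoeff (𝓡 n) b a y (X i y) •
      t.localFrame b a y := funext fun i => t.eq_sum_localFrameCoeff_smul (s := X i) hy
  rw [h.alt_eq y]
  conv_lhs => rw [h4]
  rw [← AlternatingMap.coe_multilinearMap, MultilinearMap.map_sum]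
  refine Finset.sum_congr rfl fun C _ => ?_
  rw [MultilinearMap.map_smul_univ, smul_eq_mul]

variable (D : CovariantDerivative (𝓡 n) (EuclideanSpace ℝ (Fin n))
  (TangentSpace (𝓡 n) : M → Type _))

/-- The covariant derivative of a tensor field, evaluated on vector fields. -/
def covDerivF {k : ℕ} (θ : TField n M k) (x : M) (v : TangentSpace (𝓡 n) x)
    (X : Fin k → ∀ x : M, TangentSpace (𝓡 n) x) : ℝ :=
  mvfderiv (𝓡 n) (fun y => θ y (fun i => X i y)) x v -
    ∑ i, θ x (Function.update (fun i => X i x) i (D (X i) x v))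

/-- In the varied slot the derivative of a function factor cancels against the Leibniz term of the
connection. -/
theorem covDerivF_tensorial {k : ℕ} {θ : TField n M k} (h : IsDiffForm θ) (x : M)
    (v : TangentSpace (𝓡 n) x) {X : Fin k → ∀ x : M, TangentSpace (𝓡 n) x}
    (hX : ∀ i, VFDiffAt (X i) x) (j : Fin k) :
    TensorialAt (𝓡 n) (EuclideanSpace ℝ (Fin n))
      (fun σ => covDerivF D θ x v (Function.update X j σ)) x := by
  have hup : ∀ σ, VFDiffAt σ x → ∀ i, VFDiffAt (Function.update X j σ i) x := fun σ hσ i => by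
    by_cases hi : i = j
    · subst hi; simpa using hσ
    · simpa [hi] using hX i
  constructor
  · intro f σ hf hσ
    have e1 : (fun y => θ y (fun i => Function.update X j (f • σ) i y)) =
        fun y => f y * θ y (fun i => Function.update X j σ i y) := by
      funext y
      rw [update_field, update_field, h.alt_eq]
      exact (h.alt y).map_update_smul _ _ _ _
    have e2 : ∀ i, θ x (Function.update (fun i => Function.update X j (f • σ) i x) i
        (D (Function.update X j (f • σ) i) x v)) =
        f x * θ x (Function.update (fun i => Function.update X j σ i x) i
          (D (Function.update X j σ i) x v)) +
        if i = j then mvfderiv (𝓡 n) f x v * θ x (fun i => Function.update X j σ i x) else 0 := by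
      intro i
      rw [update_field, update_field, h.alt_eq]
      by_cases hi : i = j
      · subst hi
        simp only [Function.update_self, Function.update_idem, if_true]
        rw [D.isCovariantDerivativeOnUniv.leibniz hσ hf]
        simp only [add_apply, smul_apply,
          ContinuousLinearMap.smulRight_apply]
        rw [(h.alt x).map_update_add, (h.alt x).map_update_smul, (h.alt x).map_update_smul]
        rfl
      · rw [Function.update_of_ne hi, Function.update_of_ne hi, if_neg hi, add_zero,
          Function.update_comm (Ne.symm hi), Function.update_comm (Ne.symm hi)]
        exact (h.alt x).map_update_smul _ _ _ _
    simp only [covDerivF, e1, e2]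
    rw [mvfderiv_fun_mul hf (h.mdifferentiableAt (hup σ hσ)), Finset.sum_add_distrib,
      ← Finset.mul_sum]
    simp
    ring
  · intro σ τ hσ hτ
    have e1 : (fun y => θ y (fun i => Function.update X j (σ + τ) i y)) =
        fun y => θ y (fun i => Function.update X j σ i y) +
          θ y (fun i => Function.update X j τ i y) := by
      funext y
      rw [update_field, update_field, update_field, h.alt_eq]
      exact (h.alt y).map_update_add _ _ _ _
    have e2 : ∀ i, θ x (Function.update (fun i => Function.update X j (σ + τ) i x) i
        (D (Function.update X j (σ + τ) i) x v)) =
        θ x (Function.update (fun i => Function.update X j σ i x) i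
          (D (Function.update X j σ i) x v)) +
        θ x (Function.update (fun i => Function.update X j τ i x) i
          (D (Function.update X j τ i) x v)) := by
      intro i
      rw [update_field, update_field, update_field, h.alt_eq]
      by_cases hi : i = j
      · subst hi
        simp only [Function.update_self, Function.update_idem]
        rw [D.isCovariantDerivativeOnUniv.add hσ hτ]
        exact (h.alt x).map_update_add _ _ _ _
      · simp only [Function.update_of_ne hi]
        rw [Function.update_comm (Ne.symm hi), Function.update_comm (Ne.symm hi),
          Function.update_comm (Ne.symm hi)]
        exact (h.alt x).map_update_add _ _ _ _
    simp only [covDerivF, e1, e2]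
    rw [mvfderiv_fun_add (h.mdifferentiableAt (hup σ hσ)) (h.mdifferentiableAt (hup τ hτ)),
      Finset.sum_add_distrib]
    simp
    ring

/-- The fields are exchanged one slot at a time. -/
theorem covDerivF_congr {k : ℕ} {θ : TField n M k} (h : IsDiffForm θ) (x : M)
    (v : TangentSpace (𝓡 n) x) {X Y : Fin k → ∀ x : M, TangentSpace (𝓡 n) x}
    (hX : ∀ i, VFDiffAt (X i) x) (hY : ∀ i, VFDiffAt (Y i) x) (hXY : ∀ i, X i x = Y i x) :
    covDerivF D θ x v X = covDerivF D θ x v Y := by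
  classical
  have key : ∀ s : Finset (Fin k), covDerivF D θ x v (s.piecewise Y X) = covDerivF D θ x v X := by
    intro s
    induction s using Finset.induction_on with
    | empty => simp
    | insert j s hj ih =>
      rw [← ih, Finset.piecewise_insert]
      have hs : ∀ i, VFDiffAt (s.piecewise Y X i) x := fun i => by
        by_cases hi : i ∈ s
        · simpa [hi] using hY i
        · simpa [hi] using hX i
      have := (covDerivF_tensorial D h x v hs j).pointwise (hY j) (hX j) (hXY j).symm
      rw [this]
      congr 1
      conv_rhs => rw [← Function.update_eq_self j (s.piecewise Y X)]
      simp [hj]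
  rw [← key Finset.univ]
  simp

/-- The covariant derivative of a form does not depend on the extensions of the vectors. -/
theorem covDeriv_eq {k : ℕ} {θ : TField n M k} (h : IsDiffForm θ) (x : M)
    (v : TangentSpace (𝓡 n) x) {X : Fin k → ∀ x : M, TangentSpace (𝓡 n) x}
    (hX : ∀ i, VFDiffAt (X i) x) :
    covDeriv D θ x v (fun i => X i x) = covDerivF D θ x v X := by
  rw [← covDerivF_congr D h x v (X := fun i =>
    FiberBundle.extend (EuclideanSpace ℝ (Fin n)) (X i x))
    (fun i => FiberBundle.mdifferentiableAt_extend _ _ _) hX (fun i => by simp)]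
  simp [covDeriv, covDerivF]

/-- Linearity is read off from the field E a + r E b instead of the chosen extension of a + r b,
which independence of the extension permits. -/
theorem covDeriv_update {k : ℕ} {θ : TField n M k} (h : IsDiffForm θ) (x : M)
    (v : TangentSpace (𝓡 n) x) (w : Fin k → TangentSpace (𝓡 n) x) (i : Fin k)
    (a b : TangentSpace (𝓡 n) x) (r : ℝ) :
    covDeriv D θ x v (Function.update w i (a + r • b)) =
      covDeriv D θ x v (Function.update w i a) + r * covDeriv D θ x v (Function.update w i b) := by
  let E : ∀ _ : TangentSpace (𝓡 n) x, ∀ y : M, TangentSpace (𝓡 n) y :=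
    fun u => FiberBundle.extend (EuclideanSpace ℝ (Fin n)) u
  have hE : ∀ u, VFDiffAt (E u) x := fun u => FiberBundle.mdifferentiableAt_extend _ _ _
  have hEx : ∀ u, E u x = u := fun u => FiberBundle.extend_apply_self _ _
  have hr : MDifferentiableAt (𝓡 n) 𝓘(ℝ, ℝ) (fun _ : M => r) x := mdifferentiableAt_const
  have hT := covDerivF_tensorial D h x v (X := fun j => E (w j)) (fun j => hE _) i
  have h2 : VFDiffAt ((fun _ : M => r) • E b) x := hr.smul_section (hE b)
  have h1 : VFDiffAt (E a + (fun _ : M => r) • E b) x := mdifferentiableAt_add_section (hE a) h2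
  have key : ∀ σ, VFDiffAt σ x → covDeriv D θ x v (Function.update w i (σ x)) =
      covDerivF D θ x v (Function.update (fun j => E (w j)) i σ) := fun σ hσ => by
    rw [← covDeriv_eq D h x v, update_field]
    · congr 1
      funext j
      simp only [hEx]
    · intro j
      by_cases hj : j = i
      · subst hj; simpa using hσ
      · simpa [hj] using hE _
  have e1 := key _ h1
  have e2 := key _ (hE a)
  have e3 := key _ (hE b)
  rw [hEx] at e2 e3
  have e4 : (E a + (fun _ : M => r) • E b) x = a + r • b := by
    simp only [Pi.add_apply, Pi.smul_apply', hEx]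
  rw [e4] at e1
  rw [e1, e2, e3, hT.add (hE a) h2, hT.smul hr (hE b)]
  rfl

/-- The covariant derivative of a form in a fixed direction, as a multilinear map. -/
def covM {k : ℕ} {θ : TField n M k} (h : IsDiffForm θ) (x : M) (v : TangentSpace (𝓡 n) x) :
    MultilinearMap ℝ (fun _ : Fin k => TangentSpace (𝓡 n) x) ℝ where
  toFun := covDeriv D θ x v
  map_update_add' := by
    intro inst w i a b
    rw [Subsingleton.elim inst (instDecidableEqFin k)]
    have h1 := covDeriv_update D h x v w i a b 1
    rwa [one_smul, one_mul] at h1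
  map_update_smul' := by
    intro inst w i r a
    rw [Subsingleton.elim inst (instDecidableEqFin k)]
    have h0 := covDeriv_update D h x v w i 0 0 1
    have h1 := covDeriv_update D h x v w i 0 a r
    simp only [one_smul, add_zero, zero_add, one_mul, smul_eq_mul] at h0 h1 ⊢
    linarith

theorem covM_apply {k : ℕ} {θ : TField n M k} (h : IsDiffForm θ) (x : M)
    (v : TangentSpace (𝓡 n) x) (w : Fin k → TangentSpace (𝓡 n) x) :
    covM D h x v w = covDeriv D θ x v w := rfl

/-- The covariant derivative of a form, as a multilinear map whose first slot is the direction. -/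
def covL {k : ℕ} {θ : TField n M k} (h : IsDiffForm θ) (x : M) :
    MultilinearMap ℝ (fun _ : Fin (k + 1) => TangentSpace (𝓡 n) x) ℝ :=
  LinearMap.uncurryLeft (M := fun _ => TangentSpace (𝓡 n) x)
    { toFun := covM D h x
      map_add' := fun u v => by
        ext w
        simp only [covM_apply, covDeriv, map_add, add_apply, h.alt_eq x,
          AlternatingMap.map_update_add, Finset.sum_add_distrib]
        ring
      map_smul' := fun r v => by
        ext w
        simp only [covM_apply, covDeriv, map_smul, smul_apply, h.alt_eq x,
          AlternatingMap.map_update_smul, RingHom.id_apply, smul_eq_mul, ← Finset.mul_sum, mul_sub] }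

theorem covL_cons {k : ℕ} {θ : TField n M k} (h : IsDiffForm θ) (x : M)
    (v : TangentSpace (𝓡 n) x) (w : Fin k → TangentSpace (𝓡 n) x) :
    covL D h x (Fin.cons v w) = covDeriv D θ x v w := by
  simp [covL, covM_apply]

/-- The exterior derivative of a form at a point, as a multilinear map. -/
def extM {k : ℕ} {θ : TField n M k} (h : IsDiffForm θ) (x : M) :
    MultilinearMap ℝ (fun _ : Fin (k + 1) => TangentSpace (𝓡 n) x) ℝ :=
  ∑ i : Fin (k + 1), (-1 : ℝ) ^ (i : ℕ) • (covL D h x).domDomCongr i.cycleRange.symm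

theorem extM_apply {k : ℕ} {θ : TField n M k} (h : IsDiffForm θ) (x : M)
    (w : Fin (k + 1) → TangentSpace (𝓡 n) x) : extM D h x w = extD D θ x w := by
  simp only [extM, extD, sum_apply, smul_apply,
    MultilinearMap.domDomCongr_apply, smul_eq_mul]
  refine Finset.sum_congr rfl fun i _ => ?_
  rw [← covL_cons D h]
  congr 2
  have := Fin.cons_removeNth_eq_comp_cycleRange_symm w i
  exact this.symm

end Tensor


/-! ### Contractions, and the ring of smooth functions on an open set -/

section Contract

variable {n : ℕ} {M : Type*} [TopologicalSpace M] [ChartedSpace (EuclideanSpace ℝ (Fin n)) M]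
  [IsManifold (𝓡 n) ∞ M] (g : PseudoMetric n M)

theorem PseudoMetric.bilin_coframe_frame (x : M) (a b : Fin n) :
    g.bilin x (g.coframe x a) (frame n x b) = if b = a then 1 else 0 :=
  LinearMap.BilinForm.apply_dualBasis_left _ _ _ _

theorem PseudoMetric.sum_coframe_smul_frame (x : M) (v : TangentSpace (𝓡 n) x) :
    ∑ a, g.val x (g.coframe x a) v • frame n x a = v := by
  have h : ∀ a, g.val x (g.coframe x a) v = (frame n x).repr v a := fun a => by
    change g.bilin x (g.coframe x a) v = _
    conv_lhs => rw [← (frame n x).sum_repr v]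
    simp only [map_sum, map_smul, g.bilin_coframe_frame, smul_eq_mul]
    simp
  simp only [h]
  exact (frame n x).sum_repr v

/-- An orthonormal basis of a tangent space. -/
structure IsOrtho (x : M) (ε : Fin n → ℝ) (b : Basis (Fin n) ℝ (TangentSpace (𝓡 n) x)) : Prop where
  sq : ∀ a, ε a * ε a = 1
  orth : ∀ a c, g.val x (b a) (b c) = if a = c then ε a else 0

variable {g}

theorem IsOrtho.repr {x : M} {ε : Fin n → ℝ} {b : Basis (Fin n) ℝ (TangentSpace (𝓡 n) x)}
    (h : IsOrtho g x ε b) (v : TangentSpace (𝓡 n) x) (a : Fin n) :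
    b.repr v a = ε a * g.val x v (b a) := by
  change _ = ε a * g.bilin x v (b a)
  conv_rhs => rw [← b.sum_repr v]
  simp only [map_sum, map_smul, LinearMap.sum_apply, LinearMap.smul_apply, smul_eq_mul]
  have : ∀ c, g.bilin x (b c) (b a) = if c = a then ε c else 0 := fun c => h.orth c a
  simp only [this]
  simp only [mul_ite, mul_zero, Finset.sum_ite_eq', Finset.mem_univ, if_true]
  linear_combination (-(b.repr v a)) * h.sq a

theorem IsOrtho.sum {x : M} {ε : Fin n → ℝ} {b : Basis (Fin n) ℝ (TangentSpace (𝓡 n) x)}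
    (h : IsOrtho g x ε b) (v : TangentSpace (𝓡 n) x) :
    ∑ a, (ε a * g.val x v (b a)) • b a = v := by
  simp only [← h.repr]
  exact b.sum_repr v

/-- A contraction with a frame and its dual coframe, in terms of an orthonormal basis. -/
theorem IsOrtho.contract {x : M} {ε : Fin n → ℝ} {b : Basis (Fin n) ℝ (TangentSpace (𝓡 n) x)}
    (h : IsOrtho g x ε b) {E : Type*} [AddCommGroup E] [Module ℝ E]
    (B : TangentSpace (𝓡 n) x → TangentSpace (𝓡 n) x → E)
    (hl : ∀ v, IsLinearMap ℝ fun u => B u v) (hr : ∀ u, IsLinearMap ℝ (B u)) :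
    ∑ a, B (g.coframe x a) (frame n x a) = ∑ c, ε c • B (b c) (b c) := by
  have h1 : ∀ a, B (g.coframe x a) (frame n x a) =
      ∑ c, ε c • B (b c) (g.val x (g.coframe x a) (b c) • frame n x a) := fun a => by
    conv_lhs => rw [← h.sum (g.coframe x a)]
    have h2 := map_sum ((hl (frame n x a)).mk' _)
      (fun c => (ε c * g.val x (g.coframe x a) (b c)) • b c) Finset.univ
    refine h2.trans (Finset.sum_congr rfl fun c _ => ?_)
    rw [map_smul, mul_smul, (hr (b c)).map_smul]
    rfl
  simp only [h1]
  rw [Finset.sum_comm]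
  refine Finset.sum_congr rfl fun c _ => ?_
  rw [← Finset.smul_sum]
  congr 1
  have h2 := map_sum ((hr (b c)).mk' _)
    (fun a => g.val x (g.coframe x a) (b c) • frame n x a) Finset.univ
  refine h2.symm.trans ?_
  rw [g.sum_coframe_smul_frame x (b c)]
  rfl

theorem IsOrtho.contract' {x : M} {ε : Fin n → ℝ} {b : Basis (Fin n) ℝ (TangentSpace (𝓡 n) x)}
    (h : IsOrtho g x ε b) {E : Type*} [AddCommGroup E] [Module ℝ E]
    (B : TangentSpace (𝓡 n) x → TangentSpace (𝓡 n) x → E)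
    (hl : ∀ v, IsLinearMap ℝ fun u => B u v) (hr : ∀ u, IsLinearMap ℝ (B u)) :
    ∑ a, B (frame n x a) (g.coframe x a) = ∑ c, ε c • B (b c) (b c) :=
  h.contract (fun u v => B v u) hr hl

end Contract

section Functions

variable {n : ℕ} {M : Type*} [TopologicalSpace M] [ChartedSpace (EuclideanSpace ℝ (Fin n)) M]
  [IsManifold (𝓡 n) ∞ M] {W : Set M}

/-- Smoothness of a function on a set. -/
abbrev FunSmoothOn (f : M → ℝ) (W : Set M) : Prop := ContMDiffOn (𝓡 n) 𝓘(ℝ, ℝ) ∞ f W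

variable (n W) in
/-- The smooth functions on `W`, as a subalgebra of all functions. -/
def smoothSubalgebra : Subalgebra ℝ (W → ℝ) where
  carrier := {f | ∃ F : M → ℝ, FunSmoothOn (n := n) F W ∧ ∀ x : W, f x = F x}
  mul_mem' := by
    rintro f f' ⟨F, hF, h⟩ ⟨F', hF', h'⟩
    exact ⟨F * F', hF.mul hF', fun x => by simp [h, h']⟩
  add_mem' := by
    rintro f f' ⟨F, hF, h⟩ ⟨F', hF', h'⟩
    exact ⟨F + F', hF.add hF', fun x => by simp [h, h']⟩
  algebraMap_mem' r := ⟨fun _ => r, contMDiffOn_const, fun x => rfl⟩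

variable (n W) in
/-- The algebra of smooth functions on `W`. -/
def smoothAlg : Type _ := smoothSubalgebra n W

instance : CommRing (smoothAlg n W) := inferInstanceAs (CommRing (smoothSubalgebra n W))

instance : Algebra ℝ (smoothAlg n W) := inferInstanceAs (Algebra ℝ (smoothSubalgebra n W))

@[simp] theorem smoothAlg_add_apply (f f' : smoothAlg n W) (x : W) :
    (f + f').1 x = f.1 x + f'.1 x := rfl

@[simp] theorem smoothAlg_mul_apply (f f' : smoothAlg n W) (x : W) :
    (f * f').1 x = f.1 x * f'.1 x := rfl

@[simp] theorem smoothAlg_smul_apply (r : ℝ) (f : smoothAlg n W) (x : W) :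
    (r • f).1 x = r * f.1 x := rfl

/-- A smooth function on `W`, from a function on the manifold. -/
def smk (f : M → ℝ) (hf : FunSmoothOn (n := n) f W) : smoothAlg n W :=
  ⟨fun x => f x, f, hf, fun _ => rfl⟩

@[simp] theorem smk_apply (f : M → ℝ) (hf : FunSmoothOn (n := n) f W) (x : W) :
    (smk f hf).1 x = f x := rfl

open Classical in
/-- The extension by zero of a smooth function on `W`. -/
def sext (f : smoothAlg n W) : M → ℝ := fun x => if h : x ∈ W then f.1 ⟨x, h⟩ else 0

theorem sext_apply (f : smoothAlg n W) (x : W) : sext f x = f.1 x := by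
  simp [sext]

theorem sext_of_mem (f : smoothAlg n W) {x : M} (hx : x ∈ W) : sext f x = f.1 ⟨x, hx⟩ := by
  simp [sext, hx]

theorem sext_smooth (f : smoothAlg n W) : FunSmoothOn (n := n) (sext f) W := by
  obtain ⟨F, hF, h⟩ := f.2
  exact hF.congr fun x hx => by rw [sext_of_mem f hx, h]

theorem smoothAlg_ext {f f' : smoothAlg n W} (h : ∀ x : W, f.1 x = f'.1 x) : f = f' :=
  Subtype.ext (funext h)

/-- Evaluation at a point. -/
def sev (x : W) : smoothAlg n W →ₐ[ℝ] ℝ :=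
  (Pi.evalAlgHom ℝ (fun _ : W => ℝ) x).comp (smoothSubalgebra n W).val

theorem sev_apply (x : W) (f : smoothAlg n W) : sev x f = f.1 x := rfl

theorem mvfderiv_congr {f f' : M → ℝ} {x : M} (h : f =ᶠ[nhds x] f') :
    mvfderiv (𝓡 n) f x = mvfderiv (𝓡 n) f' x := by
  ext v
  exact congrArg (fun L : TangentSpace (𝓡 n) x →L[ℝ] ℝ => L v) h.mfderiv_eq

theorem mvfderiv_congr_of_eqOn {f f' : M → ℝ} (hW : IsOpen W) {x : M} (hx : x ∈ W)
    (h : ∀ y ∈ W, f y = f' y) : mvfderiv (𝓡 n) f x = mvfderiv (𝓡 n) f' x :=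
  mvfderiv_congr (Filter.eventuallyEq_of_mem (hW.mem_nhds hx) h)

theorem smooth_mvfderiv_apply (hW : IsOpen W) {f : M → ℝ} (hf : FunSmoothOn (n := n) f W)
    {X : ∀ x : M, TangentSpace (𝓡 n) x} (hX : VFSmoothOn X W) :
    FunSmoothOn (n := n) (fun x => mvfderiv (𝓡 n) f x (X x)) W := by
  have h1 := hf.contMDiffOn_tangentMapWithin (m := ∞) (by simp) hW.uniqueMDiffOn
  have h2 := h1.comp hX fun x hx => hx
  have h3 := (contMDiff_snd_tangentBundle_modelSpace ℝ 𝓘(ℝ, ℝ) (n := ∞)).comp_contMDiffOn h2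
  refine h3.congr fun x hx => ?_
  have h4 := mfderivWithin_of_isOpen (I := 𝓡 n) (I' := 𝓘(ℝ, ℝ)) (f := f) hW hx
  exact (congrArg (fun L : TangentSpace (𝓡 n) x →L[ℝ] ℝ => L (X x)) h4).symm

theorem FunSmoothOn.mdifferentiableAt (hW : IsOpen W) {f : M → ℝ}
    (hf : FunSmoothOn (n := n) f W) {x : M} (hx : x ∈ W) :
    MDifferentiableAt (𝓡 n) 𝓘(ℝ, ℝ) f x :=
  (hf.contMDiffAt (hW.mem_nhds hx)).mdifferentiableAt (by simp)

theorem VFSmoothOn.vfDiffAt (hW : IsOpen W) {X : ∀ x : M, TangentSpace (𝓡 n) x}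
    (hX : VFSmoothOn X W) {x : M} (hx : x ∈ W) : VFDiffAt X x :=
  (hX.contMDiffAt (hW.mem_nhds hx)).mdifferentiableAt (by simp)

/-- The derivation of the smooth functions given by a vector field. -/
def sder (hW : IsOpen W) (X : ∀ x : M, TangentSpace (𝓡 n) x) (hX : VFSmoothOn X W) :
    Derivation ℝ (smoothAlg n W) (smoothAlg n W) :=
  Derivation.mk'
    { toFun := fun f => smk (fun x => mvfderiv (𝓡 n) (sext f) x (X x))
        (smooth_mvfderiv_apply hW (sext_smooth f) hX)
      map_add' := fun f f' => smoothAlg_ext fun x => by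
        have h := mvfderiv_fun_add (FunSmoothOn.mdifferentiableAt hW (sext_smooth f) x.2)
          (FunSmoothOn.mdifferentiableAt hW (sext_smooth f') x.2)
        rw [smk_apply, mvfderiv_congr_of_eqOn hW x.2 (f' := fun y => sext f y + sext f' y)
          (fun y hy => by simp [sext_of_mem _ hy]), h]
        rfl
      map_smul' := fun r f => smoothAlg_ext fun x => by
        have hr : MDifferentiableAt (𝓡 n) 𝓘(ℝ, ℝ) (fun _ : M => r) x.1 := mdifferentiableAt_const
        have h := mvfderiv_fun_mul hr (FunSmoothOn.mdifferentiableAt hW (sext_smooth f) x.2)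
        rw [smk_apply, mvfderiv_congr_of_eqOn hW x.2 (f' := fun y => r * sext f y)
          (fun y hy => by simp [sext_of_mem _ hy]), h, mvfderiv_const]
        simp }
    (fun f f' => smoothAlg_ext fun x => by
        have h := mvfderiv_fun_mul (FunSmoothOn.mdifferentiableAt hW (sext_smooth f) x.2)
          (FunSmoothOn.mdifferentiableAt hW (sext_smooth f') x.2)
        change mvfderiv (𝓡 n) (sext (f * f')) x (X x) = _
        rw [mvfderiv_congr_of_eqOn hW x.2 (f' := fun y => sext f y * sext f' y)
          (fun y hy => by simp [sext_of_mem _ hy]), h]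
        simp [sext_apply])

theorem sder_apply (hW : IsOpen W) (X : ∀ x : M, TangentSpace (𝓡 n) x) (hX : VFSmoothOn X W)
    (f : smoothAlg n W) (x : W) :
    (sder hW X hX f).1 x = mvfderiv (𝓡 n) (sext f) x (X x) := rfl

theorem sder_apply_of_eq (hW : IsOpen W) (X : ∀ x : M, TangentSpace (𝓡 n) x) (hX : VFSmoothOn X W)
    (f : smoothAlg n W) (x : W) {f' : M → ℝ} (h : ∀ y : W, f.1 y = f' y) :
    (sder hW X hX f).1 x = mvfderiv (𝓡 n) f' x (X x) := by
  rw [sder_apply, mvfderiv_congr_of_eqOn hW x.2 (f' := f') fun y hy => by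
    rw [sext_of_mem _ hy, h]]

/-- A function on `W` with invertible values is invertible. -/
theorem isUnit_smoothAlg (f : smoothAlg n W) (h : ∀ x : W, f.1 x ≠ 0) : IsUnit f := by
  have h1 : FunSmoothOn (n := n) (fun x => (sext f x)⁻¹) W :=
    (sext_smooth f).inv₀ fun x hx => by rw [sext_of_mem f hx]; exact h _
  refine IsUnit.of_mul_eq_one (smk _ h1) (smoothAlg_ext fun x => ?_)
  change f.1 x * (sext f x)⁻¹ = 1
  rw [sext_apply, mul_inv_cancel₀ (h x)]

/-- The Lie bracket of vector fields acts on functions as a commutator. -/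
theorem mvfderiv_mlieBracket (hW : IsOpen W) {f : M → ℝ} (hf : FunSmoothOn (n := n) f W)
    {X Y : ∀ x : M, TangentSpace (𝓡 n) x} (hX : VFSmoothOn X W) (hY : VFSmoothOn Y W) {x : M}
    (hx : x ∈ W) :
    mvfderiv (𝓡 n) f x (VectorField.mlieBracket (𝓡 n) X Y x) =
      mvfderiv (𝓡 n) (fun y => mvfderiv (𝓡 n) f y (Y y)) x (X x) -
        mvfderiv (𝓡 n) (fun y => mvfderiv (𝓡 n) f y (X y)) x (Y x) := by
  -- If the tangent space is zero there is no nonvanishing field to test against, and both sides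
  -- vanish.
  by_cases h0 : ∀ z : TangentSpace (𝓡 n) x, z = 0
  · rw [h0 (VectorField.mlieBracket (𝓡 n) X Y x), h0 (X x), h0 (Y x)]
    simp
  push Not at h0
  obtain ⟨z, hz⟩ := h0
  let Z : ∀ y : M, TangentSpace (𝓡 n) y := FiberBundle.extend (EuclideanSpace ℝ (Fin n)) z
  have hZx : Z x = z := FiberBundle.extend_apply_self _ _
  obtain ⟨u, hu, hZu⟩ := FiberBundle.exists_contMDiffOn_extend (k := ∞) (𝓡 n)
    (EuclideanSpace ℝ (Fin n)) z
  have hZ : ∀ᶠ y in nhds x, VFDiffAt Z y := by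
    filter_upwards [eventually_mem_nhds_iff.2 hu] with y hy
    exact ((hZu y (mem_of_mem_nhds hy)).contMDiffAt hy).mdifferentiableAt (by simp)
  have c2 : ∀ {V : ∀ y : M, TangentSpace (𝓡 n) y}, VFSmoothOn V W →
      ContMDiffAt (𝓡 n) (𝓡 n).tangent ((2 : ℕ∞) : WithTop ℕ∞)
        (fun y => (⟨y, V y⟩ : TangentBundle (𝓡 n) M)) x := fun hV =>
    (hV.contMDiffAt (hW.mem_nhds hx)).of_le (by norm_cast)
  have cZ : ContMDiffAt (𝓡 n) (𝓡 n).tangent ((2 : ℕ∞) : WithTop ℕ∞)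
        (fun y => (⟨y, Z y⟩ : TangentBundle (𝓡 n) M)) x := FiberBundle.contMDiffAt_extend _ _ _
  have hms : minSmoothness ℝ (2 : WithTop ℕ∞) = ((2 : ℕ∞) : WithTop ℕ∞) := by simp
  have hfx := FunSmoothOn.mdifferentiableAt hW hf hx
  have cf : ContMDiffAt (𝓡 n) 𝓘(ℝ, ℝ) ((2 : ℕ∞) : WithTop ℕ∞) f x :=
    (hf.contMDiffAt (hW.mem_nhds hx)).of_le (by norm_cast)
  have cfZ : ContMDiffAt (𝓡 n) (𝓡 n).tangent ((2 : ℕ∞) : WithTop ℕ∞)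
        (fun y => (⟨y, (f • Z) y⟩ : TangentBundle (𝓡 n) M)) x := cf.smul_section cZ
  have : IsManifold (𝓡 n) (((2 : ℕ∞) : WithTop ℕ∞) + 1) M :=
    IsManifold.of_le (n := ∞) (by norm_cast)
  have : IsManifold (𝓡 n) (minSmoothness ℝ 2) M :=
    IsManifold.of_le (n := ∞) (by rw [hms]; norm_cast)
  have : IsManifold (𝓡 n) (minSmoothness ℝ 3) M :=
    IsManifold.of_le (n := ∞) (by
      rw [minSmoothness_of_isRCLikeNormedField]; norm_cast)
  have dL : ∀ {V : ∀ y : M, TangentSpace (𝓡 n) y}, VFSmoothOn V W →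
      VFDiffAt (VectorField.mlieBracket (𝓡 n) V Z) x := fun hV =>
    (ContMDiffAt.mlieBracket_vectorField (m := 1) (n := 2) (c2 hV) cZ
      (by simp; norm_num)).mdifferentiableAt (by simp)
  have hVf : ∀ {V : ∀ y : M, TangentSpace (𝓡 n) y}, VFSmoothOn V W →
      MDifferentiableAt (𝓡 n) 𝓘(ℝ, ℝ) (fun y => mvfderiv (𝓡 n) f y (V y)) x := fun hV =>
    FunSmoothOn.mdifferentiableAt hW (smooth_mvfderiv_apply hW hf hV) hx
  -- The bracket of V with fZ is (Vf)Z + f[V, Z]. Comparing the Jacobi identity for X, Y, fZ with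
  -- that for X, Y, Z isolates a multiple of Z, and Z is nonzero at x.
  have key : ∀ {U V : ∀ y : M, TangentSpace (𝓡 n) y}, VFSmoothOn U W → VFSmoothOn V W →
      VectorField.mlieBracket (𝓡 n) U (VectorField.mlieBracket (𝓡 n) V (f • Z)) x =
        mvfderiv (𝓡 n) (fun y => mvfderiv (𝓡 n) f y (V y)) x (U x) • Z x +
        mvfderiv (𝓡 n) f x (V x) • VectorField.mlieBracket (𝓡 n) U Z x +
        (mvfderiv (𝓡 n) f x (U x) • VectorField.mlieBracket (𝓡 n) V Z x +
        f x • VectorField.mlieBracket (𝓡 n) U (VectorField.mlieBracket (𝓡 n) V Z) x) := by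
    intro U V hU hV
    have e : VectorField.mlieBracket (𝓡 n) V (f • Z) =ᶠ[nhds x]
        (fun y => mvfderiv (𝓡 n) f y (V y)) • Z + f • VectorField.mlieBracket (𝓡 n) V Z := by
      filter_upwards [hZ, hW.mem_nhds hx] with y hy hyW
      exact VectorField.mlieBracket_smul_right (FunSmoothOn.mdifferentiableAt hW hf hyW) hy
    have e1 := Filter.EventuallyEq.mlieBracket_vectorField_eq (I := 𝓡 n)
      (Filter.EventuallyEq.refl (nhds x) U) e
    rw [e1,
      VectorField.mlieBracket_add_right ((hVf hV).smul_section hZ.self_of_nhds)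
        (hfx.smul_section (dL hV)),
      VectorField.mlieBracket_smul_right (hVf hV) hZ.self_of_nhds,
      VectorField.mlieBracket_smul_right hfx (dL hV)]
  have J1 := VectorField.leibniz_identity_mlieBracket_apply (I := 𝓡 n) (U := X) (V := Y)
    (W := f • Z) (by rw [hms]; exact c2 hX) (by rw [hms]; exact c2 hY) (by rw [hms]; exact cfZ)
  have J2 := VectorField.leibniz_identity_mlieBracket_apply (I := 𝓡 n) (U := X) (V := Y)
    (W := Z) (by rw [hms]; exact c2 hX) (by rw [hms]; exact c2 hY) (by rw [hms]; exact cZ)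
  rw [key hX hY, key hY hX, VectorField.mlieBracket_smul_right hfx hZ.self_of_nhds, J2] at J1
  rw [← sub_eq_zero]
  refine (smul_eq_zero.1 (?_ : _ • Z x = 0)).resolve_right (by rw [hZx]; exact hz)
  rw [← sub_eq_zero] at J1
  rw [← neg_eq_zero]
  refine Eq.trans ?_ J1
  module

end Functions


/-! ### Spinor charts -/

section Frames

variable {n : ℕ} {M : Type*} [TopologicalSpace M] [ChartedSpace (EuclideanSpace ℝ (Fin n)) M]
  [IsManifold (𝓡 n) ∞ M]
  {F : Type*} [NormedAddCommGroup F] [NormedSpace ℝ F] [FiniteDimensional ℝ F]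
  {S : M → Type*} [TopologicalSpace (TotalSpace F S)]
  [∀ x, AddCommGroup (S x)] [∀ x, Module ℝ (S x)] [∀ x, TopologicalSpace (S x)]
  [∀ x, IsTopologicalAddGroup (S x)] [∀ x, ContinuousSMul ℝ (S x)]
  [FiberBundle F S] [VectorBundle ℝ F S]

/-- Smoothness of a section on a set. -/
abbrev SecSmoothOn (F : Type*) [NormedAddCommGroup F] [NormedSpace ℝ F] {S : M → Type*}
    [TopologicalSpace (TotalSpace F S)] [∀ x, TopologicalSpace (S x)] [FiberBundle F S]
    (ψ : ∀ x : M, S x) (W : Set M) : Prop :=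
  ContMDiffOn (𝓡 n) ((𝓡 n).prod 𝓘(ℝ, F)) ∞ (fun x => TotalSpace.mk' F x (ψ x)) W

/-- The coefficients of a smooth section in a smooth local frame are smooth. -/
theorem smooth_coeff [ContMDiffVectorBundle ∞ F S (𝓡 n)] {W : Set M} (hW : IsOpen W)
    {s : Fin (finrank ℝ F) → ∀ x : M, S x} (hs : IsLocalFrameOn (𝓡 n) F ∞ s W)
    {ψ : ∀ x : M, S x} (hψ : SecSmoothOn (n := n) F ψ W) (A : Fin (finrank ℝ F)) :
    FunSmoothOn (n := n) (fun x => hs.coeff A x (ψ x)) W := by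
  intro x hx
  let t := trivializationAt F S x
  have hxt : x ∈ t.baseSet := FiberBundle.mem_baseSet_trivializationAt' x
  let b : Basis (Fin (finrank ℝ F)) ℝ F := finBasis ℝ F
  let V : Set M := W ∩ t.baseSet
  have hV : IsOpen V := hW.inter t.open_baseSet
  have hc : ∀ {χ : ∀ x : M, S x}, SecSmoothOn (n := n) F χ W → ∀ B,
      FunSmoothOn (n := n) (fun x => t.localFrameCoeff (𝓡 n) b B x (χ x)) V := fun hχ B =>
    contMDiffOn_localFrameCoeff b hV Set.inter_subset_right (hχ.mono Set.inter_subset_left) B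
  -- P expresses the frame s in a local trivialisation. Its determinant vanishes nowhere, so P is
  -- invertible over the smooth functions, and the coefficients are P⁻¹v.
  let P : Matrix (Fin (finrank ℝ F)) (Fin (finrank ℝ F)) (smoothAlg n V) :=
    fun B C => smk _ (hc (hs.contMDiffOn C) B)
  let v : Fin (finrank ℝ F) → smoothAlg n V := fun B => smk _ (hc hψ B)
  have hP : IsUnit P.det := by
    refine isUnit_smoothAlg _ fun y => ?_
    rw [← sev_apply, AlgHom.map_det]
    have h1 : (sev y).mapMatrix P = (t.basisAt b y.2.2).toMatrix (hs.toBasisAt y.2.1) := by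
      ext B C
      simp only [P, Basis.toMatrix_apply, IsLocalFrameOn.toBasisAt_coe]
      exact t.localFrameCoeff_apply_of_mem_baseSet b y.2.2 (s C) B
    rw [h1]
    exact (Basis.isUnit_det _ _).ne_zero
  let u := P⁻¹.mulVec v
  have hu : P.mulVec u = v := by
    simp only [u, Matrix.mulVec_mulVec, Matrix.mul_nonsing_inv P hP, Matrix.one_mulVec]
  have key : ∀ y (hy : y ∈ V), hs.coeff A y (ψ y) = sext (u A) y := by
    intro y hy
    have h1 : ψ y = ∑ C, (u C).1 ⟨y, hy⟩ • s C y := by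
      refine (t.basisAt b hy.2).repr.injective (Finsupp.ext fun B => ?_)
      have h2 := congrArg (sev ⟨y, hy⟩) (congrFun hu B)
      simp only [Matrix.mulVec, dotProduct, map_sum, map_mul, sev_apply, P, v, smk_apply] at h2
      rw [t.localFrameCoeff_apply_of_mem_baseSet b hy.2] at h2
      rw [← h2, map_sum, Finsupp.finsetSum_apply]
      refine Finset.sum_congr rfl fun C _ => ?_
      rw [t.localFrameCoeff_apply_of_mem_baseSet b hy.2, map_smul, Finsupp.smul_apply, mul_comm]
      rfl
    rw [hs.coeff_apply_of_mem hy.1, h1, sext_of_mem _ hy]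
    simp only [← hs.toBasisAt_coe hy.1, map_sum, map_smul, Basis.repr_self]
    rw [Finsupp.finsetSum_apply]
    simp [Finsupp.single_apply]
  have h3 := (sext_smooth (u A)).contMDiffAt (hV.mem_nhds ⟨hx, hxt⟩)
  exact (h3.congr_of_eventuallyEq (Filter.eventuallyEq_of_mem (hV.mem_nhds ⟨hx, hxt⟩)
    key)).contMDiffWithinAt

end Frames

section Charts

variable {n : ℕ} {M : Type*} [TopologicalSpace M] [ChartedSpace (EuclideanSpace ℝ (Fin n)) M]
  [IsManifold (𝓡 n) ∞ M]
  {F : Type*} [NormedAddCommGroup F] [NormedSpace ℝ F] [FiniteDimensional ℝ F]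
  {S : M → Type*} [TopologicalSpace (TotalSpace F S)]
  [∀ x, AddCommGroup (S x)] [∀ x, Module ℝ (S x)] [∀ x, TopologicalSpace (S x)]
  [∀ x, IsTopologicalAddGroup (S x)] [∀ x, ContinuousSMul ℝ (S x)]
  [FiberBundle F S] [VectorBundle ℝ F S]

/-- An open set with an orthonormal frame, a spin frame and coordinates. -/
structure SpinChart (g : PseudoMetric n M)
    (D : CovariantDerivative (𝓡 n) (EuclideanSpace ℝ (Fin n)) (TangentSpace (𝓡 n) : M → Type _))
    (c : ∀ x : M, TangentSpace (𝓡 n) x →ₗ[ℝ] Module.End ℝ (S x))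
    (DS : CovariantDerivative (𝓡 n) F S) (W : Set M) where
  isOpen : IsOpen W
  e : Fin n → ∀ x : M, TangentSpace (𝓡 n) x
  ε : Fin n → ℝ
  s : Fin (finrank ℝ F) → ∀ x : M, S x
  γ : Fin n → Matrix (Fin (finrank ℝ F)) (Fin (finrank ℝ F)) ℝ
  e_frame : IsLocalFrameOn (𝓡 n) (EuclideanSpace ℝ (Fin n)) ∞ e W
  s_frame : IsLocalFrameOn (𝓡 n) F ∞ s W
  sq : ∀ a, ε a * ε a = 1
  orth : ∀ x ∈ W, ∀ a b, g.val x (e a x) (e b x) = if a = b then ε a else 0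
  c_e : ∀ x ∈ W, ∀ a B, c x (e a x) (s B x) = ∑ A, γ a A B • s A x
  DS_s : ∀ x ∈ W, ∀ (v : TangentSpace (𝓡 n) x) (B : Fin (finrank ℝ F)), DS (s B) x v =
    (1 / 4 : ℝ) • ∑ a, ∑ b, (ε a * ε b * g.val x (e a x) (D (e b) x v)) •
      c x (e a x) (c x (e b x) (s B x))
  t : Fin n → M → ℝ
  t_smooth : ∀ i, FunSmoothOn (n := n) (t i) W
  t_inj : ∀ x ∈ W, ∀ v, (∀ i, mvfderiv (𝓡 n) (t i) x v = 0) → v = 0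

variable {g : PseudoMetric n M}
  {D : CovariantDerivative (𝓡 n) (EuclideanSpace ℝ (Fin n)) (TangentSpace (𝓡 n) : M → Type _)}
  {c : ∀ x : M, TangentSpace (𝓡 n) x →ₗ[ℝ] Module.End ℝ (S x)}
  {DS : CovariantDerivative (𝓡 n) F S}

/-- Around each point there is a spinor chart. -/
theorem IsSpinorBundle.exists_chart (hS : IsSpinorBundle g D c DS) (x₀ : M) :
    ∃ W, x₀ ∈ W ∧ Nonempty (SpinChart g D c DS W) := by
  obtain ⟨U, e, ε, s, γ, hU, hx, he, hs, hε, h⟩ := hS.spinFrame x₀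
  let V := (extChartAt (𝓡 n) x₀).source
  have hV : IsOpen V := isOpen_extChartAt_source x₀
  have ht : ∀ i : Fin n, FunSmoothOn (n := n) (fun y => extChartAt (𝓡 n) x₀ y i) V := fun i => by
    have h1 : ContMDiffOn (𝓡 n) 𝓘(ℝ, EuclideanSpace ℝ (Fin n)) ∞ (extChartAt (𝓡 n) x₀) V := by
      simp only [V, extChartAt_source]
      exact contMDiffOn_extChartAt
    have h2 : ContMDiff 𝓘(ℝ, EuclideanSpace ℝ (Fin n)) 𝓘(ℝ, ℝ) ∞
        (EuclideanSpace.proj i : EuclideanSpace ℝ (Fin n) →L[ℝ] ℝ) :=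
      (EuclideanSpace.proj i : EuclideanSpace ℝ (Fin n) →L[ℝ] ℝ).contMDiff
    exact h2.comp_contMDiffOn h1
  refine ⟨U ∩ V, ⟨hx, mem_extChartAt_source x₀⟩, ⟨{
    isOpen := hU.inter hV
    e := e
    ε := ε
    s := s
    γ := γ
    e_frame := he.mono Set.inter_subset_left
    s_frame := hs.mono Set.inter_subset_left
    sq := fun a => by rcases hε a with h | h <;> simp [h]
    orth := fun x hx => (h x hx.1).1
    c_e := fun x hx => (h x hx.1).2.1
    DS_s := fun x hx => (h x hx.1).2.2
    t := fun i y => extChartAt (𝓡 n) x₀ y i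
    t_smooth := fun i => (ht i).mono Set.inter_subset_right
    t_inj := fun x hx v hv => ?_ }⟩⟩
  have hinv := isInvertible_mfderiv_extChartAt (I := 𝓡 n) hx.2
  have h1 : MDifferentiableAt (𝓡 n) 𝓘(ℝ, EuclideanSpace ℝ (Fin n)) (extChartAt (𝓡 n) x₀) x := by
    have := hx.2
    simp only [V, extChartAt_source] at this
    exact mdifferentiableAt_extChartAt this
  have h2 : mfderiv (𝓡 n) 𝓘(ℝ, EuclideanSpace ℝ (Fin n)) (extChartAt (𝓡 n) x₀) x v = 0 := by
    have h3 : ∀ i, (EuclideanSpace.proj i : EuclideanSpace ℝ (Fin n) →L[ℝ] ℝ)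
        (mfderiv (𝓡 n) 𝓘(ℝ, EuclideanSpace ℝ (Fin n)) (extChartAt (𝓡 n) x₀) x v) = 0 := fun i => by
      have h4 : MDifferentiableAt 𝓘(ℝ, EuclideanSpace ℝ (Fin n)) 𝓘(ℝ, ℝ)
        (EuclideanSpace.proj i : EuclideanSpace ℝ (Fin n) →L[ℝ] ℝ) (extChartAt (𝓡 n) x₀ x) :=
        (EuclideanSpace.proj i : EuclideanSpace ℝ (Fin n) →L[ℝ] ℝ).mdifferentiableAt
      have h5 := mfderiv_comp x h4 h1
      have h6 := hv i
      have h7 := congrArg (fun L : TangentSpace (𝓡 n) x →L[ℝ] ℝ => L v) h5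
      rw [ContinuousLinearMap.mfderiv_eq] at h7
      exact h7.symm.trans h6
    exact PiLp.ext h3
  exact hinv.injective (h2.trans (map_zero _).symm)

namespace SpinChart

variable {W : Set M} (K : SpinChart g D c DS W)

/-- The restriction of a spinor chart to a smaller open set. -/
def restrict {V : Set M} (hV : IsOpen V) (h : V ⊆ W) : SpinChart g D c DS V where
  isOpen := hV
  e := K.e
  ε := K.ε
  s := K.s
  γ := K.γ
  e_frame := K.e_frame.mono h
  s_frame := K.s_frame.mono h
  sq := K.sq
  orth x hx := K.orth x (h hx)
  c_e x hx := K.c_e x (h hx)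
  DS_s x hx := K.DS_s x (h hx)
  t := K.t
  t_smooth i := (K.t_smooth i).mono h
  t_inj x hx := K.t_inj x (h hx)

/-- The orthonormal basis at a point. -/
def basis {x : M} (hx : x ∈ W) : Basis (Fin n) ℝ (TangentSpace (𝓡 n) x) := K.e_frame.toBasisAt hx

@[simp] theorem basis_apply {x : M} (hx : x ∈ W) (a : Fin n) : K.basis hx a = K.e a x :=
  K.e_frame.toBasisAt_coe hx a

theorem isOrtho {x : M} (hx : x ∈ W) : IsOrtho g x K.ε (K.basis hx) :=
  ⟨K.sq, fun a b => by simpa using K.orth x hx a b⟩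

theorem e_smooth (a : Fin n) : VFSmoothOn (K.e a) W := K.e_frame.contMDiffOn a

theorem e_diff {x : M} (hx : x ∈ W) (a : Fin n) : VFDiffAt (K.e a) x :=
  VFSmoothOn.vfDiffAt K.isOpen (K.e_smooth a) hx

theorem metric_smooth {X Y : ∀ x : M, TangentSpace (𝓡 n) x} (hX : VFSmoothOn X W)
    (hY : VFSmoothOn Y W) : FunSmoothOn (n := n) (fun x => g.val x (X x) (Y x)) W := by
  have h := ContMDiffOn.clm_bundle_apply₂ (n := ∞) (E₃ := fun _ : M => ℝ) (F₃ := ℝ)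
    (b := fun x : M => x) (ψ := g.val) g.smooth.contMDiffOn hX hY
  intro x hx
  have := h x hx
  rw [contMDiffWithinAt_section] at this
  exact this

theorem metric_connection_skew (hD : IsLeviCivita g D) {x : M} (hx : x ∈ W)
    (v : TangentSpace (𝓡 n) x) (b d : Fin n) :
    g.val x (D (K.e b) x v) (K.e d x) = -g.val x (D (K.e d) x v) (K.e b x) := by
  have h1 := hD.2 (K.e b) (K.e d) x v (K.e_diff hx b) (K.e_diff hx d)
  rw [mvfderiv_congr_of_eqOn K.isOpen hx (f' := fun _ => if b = d then K.ε b else 0)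
    fun y hy => K.orth y hy b d, mvfderiv_const] at h1
  rw [g.symm x (K.e b x)] at h1
  have h2 : (0 : TangentSpace (𝓡 n) x →L[ℝ] ℝ) v = 0 := rfl
  linarith

theorem bracket_smooth {X Y : ∀ x : M, TangentSpace (𝓡 n) x} (hX : VFSmoothOn X W)
    (hY : VFSmoothOn Y W) (hW : IsOpen W) :
    VFSmoothOn (VectorField.mlieBracket (𝓡 n) X Y) W := by
  intro x hx
  have : IsManifold (𝓡 n) (((⊤ : ℕ∞) : WithTop ℕ∞) + 1) M :=
    inferInstanceAs (IsManifold (𝓡 n) ∞ M)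
  have : IsManifold (𝓡 n) (minSmoothness ℝ 2) M :=
    IsManifold.of_le (n := ∞) (by rw [minSmoothness_of_isRCLikeNormedField]; norm_cast)
  have : IsManifold (𝓡 n) (minSmoothness ℝ 3) M :=
    IsManifold.of_le (n := ∞) (by rw [minSmoothness_of_isRCLikeNormedField]; norm_cast)
  exact (ContMDiffAt.mlieBracket_vectorField (m := ⊤) (n := ⊤) (hX.contMDiffAt (hW.mem_nhds hx))
    (hY.contMDiffAt (hW.mem_nhds hx)) (by simp)).contMDiffWithinAt

/-- The Koszul formula, whose derivatives of the metric vanish in an orthonormal frame, expresses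
the coefficients through Lie brackets of the smooth frame fields, so no regularity of D enters. -/
theorem connection_smooth (hD : IsLeviCivita g D) (a b d : Fin n) :
    FunSmoothOn (n := n) (fun x => g.val x (D (K.e b) x (K.e a x)) (K.e d x)) W := by
  let L : Fin n → Fin n → Fin n → M → ℝ := fun a b d x =>
    g.val x (VectorField.mlieBracket (𝓡 n) (K.e a) (K.e b) x) (K.e d x)
  have hL : ∀ a b d, FunSmoothOn (n := n) (L a b d) W := fun a b d =>
    metric_smooth (bracket_smooth (K.e_smooth a) (K.e_smooth b) K.isOpen) (K.e_smooth d)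
  have h2 : FunSmoothOn (n := n) (fun x => (1 / 2 : ℝ) * (L a b d x - L b d a x + L d a b x)) W :=
    contMDiffOn_const.mul (((hL a b d).sub (hL b d a)).add (hL d a b))
  refine h2.congr fun x hx => ?_
  have h3 : ∀ a b d, L a b d x = g.val x (D (K.e b) x (K.e a x)) (K.e d x) -
      g.val x (D (K.e a) x (K.e b x)) (K.e d x) := fun a b d => by
    simp only [L]
    rw [← hD.1 _ _ _ (K.e_diff hx a) (K.e_diff hx b), map_sub]
    rfl
  rw [h3, h3, h3]
  have s1 := K.metric_connection_skew hD hx (K.e b x) a d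
  have s2 := K.metric_connection_skew hD hx (K.e d x) a b
  have s3 := K.metric_connection_skew hD hx (K.e a x) b d
  linarith

end SpinChart

end Charts


section Sext

variable {n : ℕ} {M : Type*} [TopologicalSpace M] [ChartedSpace (EuclideanSpace ℝ (Fin n)) M]
  [IsManifold (𝓡 n) ∞ M] {W : Set M}

theorem sext_of_notMem (f : smoothAlg n W) {x : M} (hx : x ∉ W) : sext f x = 0 := by
  simp [sext, hx]

theorem sext_add (f f' : smoothAlg n W) (x : M) : sext (f + f') x = sext f x + sext f' x := by
  by_cases hx : x ∈ W
  · simp only [sext_of_mem _ hx]; rfl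
  · simp [sext_of_notMem _ hx]

theorem sext_mul (f f' : smoothAlg n W) (x : M) : sext (f * f') x = sext f x * sext f' x := by
  by_cases hx : x ∈ W
  · simp only [sext_of_mem _ hx]; rfl
  · simp [sext_of_notMem _ hx]

theorem sext_real_smul (r : ℝ) (f : smoothAlg n W) (x : M) : sext (r • f) x = r * sext f x := by
  by_cases hx : x ∈ W
  · simp only [sext_of_mem _ hx]; rfl
  · simp [sext_of_notMem _ hx]

theorem sext_algebraMap_mul (r : ℝ) (f : smoothAlg n W) (x : M) :
    sext (algebraMap ℝ (smoothAlg n W) r * f) x = r * sext f x := by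
  rw [← Algebra.smul_def, sext_real_smul]

theorem sext_sum {ι : Type*} (s : Finset ι) (f : ι → smoothAlg n W) (x : M) :
    sext (∑ i ∈ s, f i) x = ∑ i ∈ s, sext (f i) x := by
  classical
  induction s using Finset.induction_on with
  | empty =>
    have := sext_real_smul (0 : ℝ) (0 : smoothAlg n W) x
    simpa using this
  | insert i s hi ih => rw [Finset.sum_insert hi, Finset.sum_insert hi, sext_add, ih]

end Sext

/-! ### The spin geometry of a spinor chart over its ring of smooth functions. -/

section Charts

variable {n : ℕ} {M : Type*} [TopologicalSpace M] [ChartedSpace (EuclideanSpace ℝ (Fin n)) M]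
  [IsManifold (𝓡 n) ∞ M]
  {F : Type*} [NormedAddCommGroup F] [NormedSpace ℝ F] [FiniteDimensional ℝ F]
  {S : M → Type*} [TopologicalSpace (TotalSpace F S)]
  [∀ x, AddCommGroup (S x)] [∀ x, Module ℝ (S x)] [∀ x, TopologicalSpace (S x)]
  [∀ x, IsTopologicalAddGroup (S x)] [∀ x, ContinuousSMul ℝ (S x)]
  [FiberBundle F S] [VectorBundle ℝ F S]
  {g : PseudoMetric n M}
  {D : CovariantDerivative (𝓡 n) (EuclideanSpace ℝ (Fin n)) (TangentSpace (𝓡 n) : M → Type _)}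
  {c : ∀ x : M, TangentSpace (𝓡 n) x →ₗ[ℝ] Module.End ℝ (S x)}
  {DS : CovariantDerivative (𝓡 n) F S}

namespace SpinChart

variable {W : Set M} (K : SpinChart g D c DS W)

variable (n F W) in
/-- Spinor fields on `W` in a spin frame. -/
abbrev Spinors : Type _ := Fin (finrank ℝ F) → smoothAlg n W

/-- The derivative in a frame direction. -/
def der (a : Fin n) : Derivation ℝ (smoothAlg n W) (smoothAlg n W) :=
  sder K.isOpen (K.e a) (K.e_smooth a)

/-- The connection coefficients. -/
def christoffel (hD : IsLeviCivita g D) (a b d : Fin n) : smoothAlg n W :=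
  smk (fun x => K.ε d * g.val x (D (K.e b) x (K.e a x)) (K.e d x))
    (contMDiffOn_const.mul (K.connection_smooth hD a b d))

theorem D_e (hD : IsLeviCivita g D) (x : W) (a b : Fin n) :
    D (K.e b) x (K.e a x) = ∑ d, (K.christoffel hD a b d).1 x • K.e d x := by
  conv_lhs => rw [← (K.isOrtho x.2).sum (D (K.e b) x (K.e a x))]
  simp [christoffel]

theorem christoffel_skew (hD : IsLeviCivita g D) (a b d : Fin n) :
    K.ε b • K.christoffel hD a b d = -(K.ε d • K.christoffel hD a d b) :=
  smoothAlg_ext fun x => by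
    change K.ε b * (K.ε d * _) = -(K.ε d * (K.ε b * _))
    rw [K.metric_connection_skew hD x.2]
    ring

theorem der_comm (hD : IsLeviCivita g D) (a b : Fin n) (f : smoothAlg n W) :
    K.der a (K.der b f) - K.der b (K.der a f) =
      ∑ d, (K.christoffel hD a b d - K.christoffel hD b a d) * K.der d f := by
  refine smoothAlg_ext fun x => ?_
  have h1 := mvfderiv_mlieBracket K.isOpen (sext_smooth f) (K.e_smooth a) (K.e_smooth b) x.2
  have h2 : ∀ a b, (K.der a (K.der b f)).1 x = mvfderiv (𝓡 n)
      (fun y => mvfderiv (𝓡 n) (sext f) y (K.e b y)) x (K.e a x) := fun a b =>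
    sder_apply_of_eq _ _ _ _ _ fun y => rfl
  have h3 : (K.der a (K.der b f) - K.der b (K.der a f)).1 x =
    (K.der a (K.der b f)).1 x - (K.der b (K.der a f)).1 x := rfl
  rw [h3, h2, h2, ← h1, ← hD.1 _ _ _ (K.e_diff x.2 a) (K.e_diff x.2 b), K.D_e hD, K.D_e hD,
    ← Finset.sum_sub_distrib]
  simp only [← sub_smul, map_sum, map_smul]
  rw [← sev_apply, map_sum]
  rfl

/-- The componentwise derivative of spinor fields. -/
def derS (a : Fin n) : Spinors n F W →ₗ[ℝ] Spinors n F W where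
  toFun χ A := K.der a (χ A)
  map_add' χ χ' := by funext A; simp
  map_smul' r χ := by funext A; simp

/-- The gamma matrices. -/
def gam (a : Fin n) : Module.End (smoothAlg n W) (Spinors n F W) :=
  Matrix.toLin' ((K.γ a).map (algebraMap ℝ (smoothAlg n W)))

theorem gam_apply (a : Fin n) (χ : Spinors n F W) (A : Fin (finrank ℝ F)) :
    K.gam a χ A = ∑ B, algebraMap ℝ (smoothAlg n W) (K.γ a A B) * χ B := by
  simp [gam, Matrix.toLin'_apply, Matrix.mulVec, dotProduct]

/-- The section with given components. -/
def sec (x : M) : Spinors n F W →ₗ[ℝ] S x where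
  toFun χ := ∑ A, sext (χ A) x • K.s A x
  map_add' χ χ' := by simp [sext_add, add_smul, Finset.sum_add_distrib]
  map_smul' r χ := by simp [sext_real_smul, mul_smul, Finset.smul_sum]

theorem sec_apply (x : M) (χ : Spinors n F W) : K.sec x χ = ∑ A, sext (χ A) x • K.s A x := rfl

theorem sec_smul (x : M) (r : smoothAlg n W) (χ : Spinors n F W) :
    K.sec x (r • χ) = sext r x • K.sec x χ := by
  simp [sec_apply, sext_mul, mul_smul, Finset.smul_sum]

theorem sec_ext {χ χ' : Spinors n F W} (h : ∀ x ∈ W, K.sec x χ = K.sec x χ') : χ = χ' := by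
  funext A
  refine smoothAlg_ext fun x => ?_
  have h1 := congrArg (fun v => (K.s_frame.toBasisAt x.2).repr v A) (h x x.2)
  simp only [sec_apply, ← K.s_frame.toBasisAt_coe x.2, map_sum, map_smul, Basis.repr_self] at h1
  rw [Finsupp.finsetSum_apply, Finsupp.finsetSum_apply] at h1
  simpa [Finsupp.single_apply, sext_apply] using h1

theorem sec_gam {x : M} (hx : x ∈ W) (a : Fin n) (χ : Spinors n F W) :
    K.sec x (K.gam a χ) = c x (K.e a x) (K.sec x χ) := by
  simp only [sec_apply, map_sum, map_smul, K.c_e x hx, gam_apply, sext_sum, sext_algebraMap_mul,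
    Finset.sum_smul, Finset.smul_sum, smul_smul]
  rw [Finset.sum_comm]
  simp only [mul_comm]

theorem _root_.KYForms.IsSpinorBundle.clifford_polar (hS : IsSpinorBundle g D c DS) (x : M)
    (u v : TangentSpace (𝓡 n) x) :
    c x u * c x v + c x v * c x u = (2 * g.val x u v) • (1 : Module.End ℝ (S x)) := by
  have h := hS.clifford x (u + v)
  have h1 := hS.clifford x u
  have h2 := hS.clifford x v
  simp only [map_add, add_apply, add_mul, mul_add, h1, h2, g.symm x v u] at h
  rw [add_smul, add_smul, add_smul] at h
  rw [two_mul, add_smul]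
  rw [← sub_eq_zero] at h ⊢
  rw [← h]
  abel

theorem cliffordFrame (hS : IsSpinorBundle g D c DS) : CliffordFrame K.ε K.gam := by
  refine ⟨K.sq, fun a b => LinearMap.ext fun χ => K.sec_ext fun x hx => ?_⟩
  have h := congrArg (fun L : Module.End ℝ (S x) => L (K.sec x χ))
    (hS.clifford_polar x (K.e a x) (K.e b x))
  simp only [LinearMap.add_apply, Module.End.mul_apply, LinearMap.smul_apply, map_add, map_smul,
    K.sec_gam hx, Module.End.one_apply, K.orth x hx] at h ⊢
  rw [h]
  split_ifs <;> simp

theorem derS_smul (a : Fin n) (r : smoothAlg n W) (χ : Spinors n F W) :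
    K.derS a (r • χ) = K.der a r • χ + r • K.derS a χ := by
  funext A
  simp only [derS, LinearMap.coe_mk, AddHom.coe_mk, Pi.smul_apply, Pi.add_apply, smul_eq_mul,
    Derivation.leibniz]
  ring

theorem derS_gam (a b : Fin n) (χ : Spinors n F W) :
    K.derS a (K.gam b χ) = K.gam b (K.derS a χ) := by
  funext A
  rw [gam_apply]
  change K.der a (K.gam b χ A) = ∑ B, _ * K.der a (χ B)
  rw [gam_apply]
  simp [Derivation.leibniz]

/-- The differentials of the coordinates in the frame. -/
def jac : Matrix (Fin n) (Fin n) (smoothAlg n W) :=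
  fun i b => K.der b (smk (K.t i) (K.t_smooth i))

/-- A kernel vector of the Jacobian at a point would be a tangent vector killed by all coordinate
differentials. -/
theorem isUnit_det_jac : IsUnit K.jac.det := by
  refine isUnit_smoothAlg _ fun x => ?_
  rw [← sev_apply, AlgHom.map_det]
  intro h
  obtain ⟨v, hv, h1⟩ := Matrix.exists_mulVec_eq_zero_iff.2 h
  refine hv ?_
  have h2 : ∑ b, v b • K.e b x = 0 := K.t_inj x x.2 _ fun i => by
    have h3 := congrFun h1 i
    simp only [Matrix.mulVec, dotProduct] at h3
    rw [map_sum]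
    refine Eq.trans (Finset.sum_congr rfl fun b _ => ?_) h3
    rw [map_smul]
    change v b * _ = (K.der b (smk (K.t i) (K.t_smooth i))).1 x * _
    rw [der, sder_apply_of_eq _ _ _ _ _ fun y => smk_apply _ _ _, mul_comm]
  funext b
  exact Fintype.linearIndependent_iff.1 (K.e_frame.linearIndependent x.2) v h2 b

/-- The geometry of a spinor chart, in components. -/
def spinData (hD : IsLeviCivita g D) (hS : IsSpinorBundle g D c DS) :
    SpinData n (smoothAlg n W) (Spinors n F W) :=
  SpinData.ofFrame K.ε K.gam (K.cliffordFrame hS) K.der K.derS K.derS_smul K.derS_gam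
    (K.christoffel hD) (K.christoffel_skew hD) (K.der_comm hD)
    (fun a b χ => by
      funext A
      have := K.der_comm hD a b (χ A)
      simpa [derS] using this)
    (fun i => smk (K.t i) (K.t_smooth i)) (fun i a => K.jac⁻¹ a i)
    (fun a b => by
      have h := congrFun (congrFun (Matrix.nonsing_inv_mul K.jac K.isUnit_det_jac) a) b
      rw [Matrix.mul_apply, Matrix.one_apply] at h
      exact h)

variable (n F W) in
-- Nontriviality of the fibre enters here: a scalar is read off from its action on a constant
-- spinor.
theorem spinors_faithful [Nontrivial F] (r : smoothAlg n W)
    (h : r • (1 : Module.End (smoothAlg n W) (Spinors n F W)) = 0) : r = 0 := by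
  have h1 := congrFun (congrArg (fun L : Module.End (smoothAlg n W) (Spinors n F W) =>
    L (fun _ => 1)) h) ⟨0, finrank_pos⟩
  simpa using h1

variable (n F W) in
/-- The trace on endomorphisms of spinors. -/
def spinTrace : Module.End (smoothAlg n W) (Spinors n F W) →ₗ[smoothAlg n W] smoothAlg n W :=
  Matrix.traceLinearMap _ _ _ ∘ₗ LinearMap.toMatrix'.toLinearMap

theorem spinTrace_mul (α β : Module.End (smoothAlg n W) (Spinors n F W)) :
    spinTrace n F W (α * β) = spinTrace n F W (β * α) := by
  simp only [spinTrace, LinearMap.comp_apply, LinearEquiv.coe_coe, LinearMap.toMatrix'_mul,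
    Matrix.traceLinearMap_apply]
  exact Matrix.trace_mul_comm _ _

theorem spinTrace_one : spinTrace n F W 1 = algebraMap ℝ _ (finrank ℝ F : ℝ) := by
  simp only [spinTrace, LinearMap.comp_apply, LinearEquiv.coe_coe, LinearMap.toMatrix'_one,
    Matrix.traceLinearMap_apply, Matrix.trace_one, Fintype.card_fin, map_natCast]

theorem sec_smooth (χ : Spinors n F W) : SecSmoothOn (n := n) F (fun x => K.sec x χ) W := by
  have h := ContMDiffOn.sum_section (I := 𝓡 n) (n := ∞) (F := F) (V := S)
    (s := (Finset.univ : Finset (Fin (finrank ℝ F)))) (u := W)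
    (t := fun A x => sext (χ A) x • K.s A x) fun A _ =>
    ContMDiffOn.smul_section (sext_smooth (χ A)) (K.s_frame.contMDiffOn A)
  exact h

theorem s_diff {x : M} (hx : x ∈ W) (A : Fin (finrank ℝ F)) :
    MDifferentiableAt (𝓡 n) ((𝓡 n).prod 𝓘(ℝ, F)) (fun y => TotalSpace.mk' F y (K.s A y)) x :=
  ((K.s_frame.contMDiffOn A).contMDiffAt (K.isOpen.mem_nhds hx)).mdifferentiableAt (by simp)

/-- Every smooth section comes from components. -/
theorem exists_sec [ContMDiffVectorBundle ∞ F S (𝓡 n)] {ψ : ∀ x : M, S x}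
    (hψ : SecSmoothOn (n := n) F ψ W) : ∃ χ : Spinors n F W, ∀ x ∈ W, ψ x = K.sec x χ := by
  refine ⟨fun A => smk _ (smooth_coeff K.isOpen K.s_frame hψ A), fun x hx => ?_⟩
  rw [K.s_frame.coeff_sum_eq ψ hx, sec_apply]
  refine Finset.sum_congr rfl fun A _ => ?_
  rw [sext_of_mem _ hx]
  rfl

theorem covariantDerivative_sum {x : M} (σ : Fin (finrank ℝ F) → ∀ y : M, S y)
    (hσ : ∀ A, MDifferentiableAt (𝓡 n) ((𝓡 n).prod 𝓘(ℝ, F))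
      (fun y => TotalSpace.mk' F y (σ A y)) x) (T : Finset (Fin (finrank ℝ F))) :
    DS (∑ A ∈ T, σ A) x = ∑ A ∈ T, DS (σ A) x := by
  classical
  induction T using Finset.induction_on with
  | empty => simp [DS.zero]
  | insert A T hA ih =>
    rw [Finset.sum_insert hA, Finset.sum_insert hA, ← ih]
    refine DS.isCovariantDerivativeOnUniv.add (hσ A) ?_
    have h := MDifferentiableAt.sum_section (s := T) (t := σ) (x₀ := x) fun A _ => hσ A
    convert h using 3
    simp

/-- The spin connection on a spinor field in components. -/
theorem DS_sec (hD : IsLeviCivita g D) (hS : IsSpinorBundle g D c DS) {x : M} (hx : x ∈ W)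
    (a : Fin n) (χ : Spinors n F W) :
    DS (fun y => K.sec y χ) x (K.e a x) = K.sec x ((K.spinData hD hS).nab a χ) := by
  have hf : ∀ A, MDifferentiableAt (𝓡 n) 𝓘(ℝ, ℝ) (sext (χ A)) x := fun A =>
    FunSmoothOn.mdifferentiableAt K.isOpen (sext_smooth (χ A)) hx
  have e0 : (fun y => K.sec y χ) = ∑ A, sext (χ A) • K.s A := by
    funext y
    simp [sec_apply]
  have e1 : ∀ A, DS (sext (χ A) • K.s A) x =
      sext (χ A) x • DS (K.s A) x + (mvfderiv (𝓡 n) (sext (χ A)) x).smulRight (K.s A x) :=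
    fun A => DS.isCovariantDerivativeOnUniv.leibniz (K.s_diff hx A) (hf A)
  rw [e0, covariantDerivative_sum _ fun A => (hf A).smul_section (K.s_diff hx A)]
  simp only [e1, sum_apply, add_apply, smul_apply, ContinuousLinearMap.smulRight_apply,
    K.DS_s x hx]
  have e2 : (K.spinData hD hS).nab a χ =
    K.derS a χ + spinRep K.ε K.gam (K.christoffel hD a) χ := rfl
  rw [e2, map_add, Finset.sum_add_distrib, add_comm]
  congr 1
  · rw [sec_apply]
    refine Finset.sum_congr rfl fun A _ => ?_
    rw [sext_of_mem _ hx]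
    rfl
  · simp only [spinRep, LinearMap.smul_apply, LinearMap.sum_apply, map_smul, map_sum, sec_smul,
      Module.End.mul_apply, K.sec_gam hx]
    -- With the index lowered in this way, `spinRep` of the connection coefficients is the ¼ω term
    -- of the spin connection.
    have e3 : ∀ a' b', sext (K.christoffel hD a b' a') x =
        K.ε a' * g.val x (K.e a' x) (D (K.e b') x (K.e a x)) := fun a' b' => by
      rw [sext_of_mem _ hx, g.symm]
      rfl
    simp only [e3, sec_apply, map_sum, map_smul, Finset.smul_sum, smul_smul]
    rw [Finset.sum_comm]
    conv_rhs => rw [Finset.sum_comm]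
    refine Finset.sum_congr rfl fun a' _ => ?_
    rw [Finset.sum_comm]
    refine Finset.sum_congr rfl fun b' _ => Finset.sum_congr rfl fun A _ => ?_
    congr 1
    ring

end SpinChart

end Charts


/-! ### Tensor fields in components -/

section Components

variable {n : ℕ} {M : Type*} [TopologicalSpace M] [ChartedSpace (EuclideanSpace ℝ (Fin n)) M]
  [IsManifold (𝓡 n) ∞ M]
  {F : Type*} [NormedAddCommGroup F] [NormedSpace ℝ F] [FiniteDimensional ℝ F]
  {S : M → Type*} [TopologicalSpace (TotalSpace F S)]
  [∀ x, AddCommGroup (S x)] [∀ x, Module ℝ (S x)] [∀ x, TopologicalSpace (S x)]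
  [∀ x, IsTopologicalAddGroup (S x)] [∀ x, ContinuousSMul ℝ (S x)]
  [FiberBundle F S] [VectorBundle ℝ F S]
  {g : PseudoMetric n M}
  {D : CovariantDerivative (𝓡 n) (EuclideanSpace ℝ (Fin n)) (TangentSpace (𝓡 n) : M → Type _)}
  {c : ∀ x : M, TangentSpace (𝓡 n) x →ₗ[ℝ] Module.End ℝ (S x)}
  {DS : CovariantDerivative (𝓡 n) F S}

namespace SpinChart

variable {W : Set M} (K : SpinChart g D c DS W)

/-- `α` are the components of `T` at `x`. -/
def IsComp {k : ℕ} (x : W) (T : (Fin k → TangentSpace (𝓡 n) x.1) → ℝ)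
    (α : (Fin k → Fin n) → smoothAlg n W) : Prop :=
  ∀ C, (α C).1 x = T fun i => K.e (C i) x

/-- The components of a form. -/
def comps {k : ℕ} {θ : TField n M k} (h : IsDiffForm θ) : (Fin k → Fin n) → smoothAlg n W :=
  fun C => smk (fun x => θ x fun i => K.e (C i) x) (h.2 W _ K.isOpen fun i => K.e_smooth (C i))

theorem comps_isComp {k : ℕ} {θ : TField n M k} (h : IsDiffForm θ) (x : W) :
    K.IsComp x (θ x) (K.comps h) := fun _ => rfl

theorem comps_skew {k : ℕ} {θ : TField n M k} (h : IsDiffForm θ) : Skew (K.comps h) := by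
  intro σ C
  refine smoothAlg_ext fun x => ?_
  change θ x (fun i => K.e (C (σ i)) x) = sgnR σ * θ x fun i => K.e (C i) x
  rw [h.alt_eq x]
  have := (h.alt x).map_perm (fun i => K.e (C i) x) σ
  rw [Units.smul_def, zsmul_eq_mul] at this
  exact this

variable {K}

theorem IsComp.cons {x : W} {k : ℕ} {T : (Fin (k + 1) → TangentSpace (𝓡 n) x.1) → ℝ}
    {α : (Fin (k + 1) → Fin n) → smoothAlg n W} (h : K.IsComp x T α) (a : Fin n)
    (C : Fin k → Fin n) :
    (α (Fin.cons a C)).1 x = T (Fin.cons (K.e a x) fun i => K.e (C i) x) := by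
  rw [h]
  congr 1
  funext i
  refine Fin.cases ?_ (fun j => ?_) i <;> simp

theorem IsComp.hook {x : W} {k : ℕ} {T : (Fin (k + 1) → TangentSpace (𝓡 n) x.1) → ℝ}
    {α : (Fin (k + 1) → Fin n) → smoothAlg n W} (h : K.IsComp x T α) (a : Fin n) :
    K.IsComp x (hook (K.e a x) T) (ahook a α) := fun C => h.cons a C

theorem eq_zero_of_frame {x : W} {k : ℕ}
    {T : MultilinearMap ℝ (fun _ : Fin k => TangentSpace (𝓡 n) x.1) ℝ}
    (h : ∀ C : Fin k → Fin n, T (fun i => K.e (C i) x) = 0) : T = 0 :=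
  Basis.ext_multilinear (fun _ => K.basis x.2) fun C => by simpa using h C

variable (K) (hD : IsLeviCivita g D) (hS : IsSpinorBundle g D c DS)

theorem nabArr_isComp {k : ℕ} {θ : TField n M k} (h : IsDiffForm θ) (x : W) (a : Fin n) :
    K.IsComp x (covDeriv D θ x (K.e a x)) ((K.spinData hD hS).nabArr a (K.comps h)) := by
  intro C
  rw [covDeriv_eq D h x _ fun i => K.e_diff x.2 (C i)]
  have h1 : ((K.spinData hD hS).nabArr a (K.comps h) C).1 x =
      (K.der a (K.comps h C)).1 x - ∑ j, ∑ d, (K.christoffel hD a (C j) d).1 x *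
        (K.comps h (Function.update C j d)).1 x := by
    change sev x ((K.spinData hD hS).nabArr a (K.comps h) C) = _
    simp only [SpinData.nabArr, map_sub, map_sum, map_mul]
    rfl
  rw [h1, covDerivF]
  congr 1
  · exact congrArg (fun L : TangentSpace (𝓡 n) x.1 →L[ℝ] ℝ => L (K.e a x))
      (mvfderiv_congr_of_eqOn K.isOpen x.2 fun y hy => sext_of_mem _ hy)
  · refine Finset.sum_congr rfl fun j _ => ?_
    rw [K.D_e hD, h.alt_eq x]
    have h2 := map_sum ((h.alt x).toMultilinearMap.toLinearMap (fun i => K.e (C i) x) j)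
      (fun d => (K.christoffel hD a (C j) d).1 x • K.e d x) Finset.univ
    refine Eq.trans (Finset.sum_congr rfl fun d _ => ?_) h2.symm
    rw [map_smul, smul_eq_mul]
    congr 1
    change θ x _ = h.alt x _
    rw [h.alt_eq x]
    congr 1
    funext i
    by_cases hi : i = j
    · subst hi; simp
    · simp [hi]

theorem extArr_isComp {k : ℕ} {θ : TField n M k} (h : IsDiffForm θ) (x : W) :
    K.IsComp x (extD D θ x) (extArr fun b => (K.spinData hD hS).nabArr b (K.comps h)) := by
  intro C
  rw [← sev_apply]
  simp only [extArr, map_sum, map_smul, extD, smul_eq_mul]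
  refine Finset.sum_congr rfl fun i _ => ?_
  congr 1
  exact K.nabArr_isComp hD hS h x (C i) fun j => C (i.succAbove j)

theorem arrKY_of_isKY {k : ℕ} {θ : TField n M (k + 1)} (h0 : IsDiffForm θ)
    (h : IsKY g D θ) : (K.spinData hD hS).ArrKY (K.comps h0) := by
  refine ⟨K.comps_skew _, fun a => funext fun C => smoothAlg_ext fun x => ?_⟩
  have h1 := h.1.2 x (K.e a x) fun i => K.e (C i) x
  simp only [h.2, mul_zero, Finset.sum_const_zero, add_zero] at h1
  have h2 : (k : ℝ) + 1 + 1 = k + 2 := by ring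
  rw [← K.nabArr_isComp hD hS h0 x a C,
    ← (K.extArr_isComp hD hS h0 x).hook a C, sub_eq_zero, h2] at h1
  exact h1

theorem cky_at [Nontrivial F] {k : ℕ} {θ : TField n M (k + 1)} (h : IsDiffForm θ)
    (hα : (K.spinData hD hS).ArrKY (K.comps h)) (x : W) (v : TangentSpace (𝓡 n) x.1)
    (w : Fin (k + 1) → TangentSpace (𝓡 n) x.1) :
    covDeriv D θ x v w - (1 / ((k : ℝ) + 1 + 1)) * hook v (extD D θ x) w = 0 := by
  have h0 : covL D h x.1 - (1 / ((k : ℝ) + 1 + 1)) • extM D h x.1 = 0 := by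
    refine eq_zero_of_frame (K := K) fun C => ?_
    rw [sub_apply, smul_apply, extM_apply]
    have e : (fun i => K.e (C i) x) = Fin.cons (K.e (C 0) x) fun i : Fin (k + 1) =>
        K.e (C i.succ) x := by
      funext i
      refine Fin.cases ?_ (fun j => ?_) i <;> simp
    rw [e, covL_cons, ← K.nabArr_isComp hD hS h x (C 0) (fun i => C i.succ), hα.eq]
    have h2 := (K.extArr_isComp hD hS h x).hook (C 0) (fun i => C i.succ)
    have : (k : ℝ) + 1 + 1 = k + 2 := by ring
    rw [this, sub_eq_zero]
    exact congrArg ((1 / ((k : ℝ) + 2)) * ·) h2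
  have h1 := congrArg (fun T : MultilinearMap ℝ (fun _ : Fin (k + 2) => TangentSpace (𝓡 n) x.1) ℝ =>
    T (Fin.cons v w)) h0
  simp only [sub_apply, smul_apply, extM_apply, covL_cons] at h1
  exact h1

/-- The contraction is rewritten in the orthonormal frame, where each diagonal term vanishes by
antisymmetry. -/
theorem codiff_at [Nontrivial F] {k : ℕ} {θ : TField n M (k + 1)} (h : IsDiffForm θ)
    (hα : (K.spinData hD hS).ArrKY (K.comps h)) (x : W) (w : Fin k → TangentSpace (𝓡 n) x.1) :
    codiff g D θ x w = 0 := by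
  rw [codiff, neg_eq_zero]
  have h1 := (K.isOrtho x.2).contract
    (fun u v => hook u (covDeriv D θ x v) w)
    (fun v => ⟨fun u u' => (covM D h x.1 v).cons_add w u u', fun r u =>
      (covM D h x.1 v).cons_smul w r u⟩)
    (fun u => ⟨fun v v' => by
      have := (covL D h x.1).cons_add (Fin.cons u w) v v'
      rwa [covL_cons, covL_cons, covL_cons] at this, fun r v => by
      have := (covL D h x.1).cons_smul (Fin.cons u w) r v
      rwa [covL_cons, covL_cons] at this⟩)
  refine h1.trans (Finset.sum_eq_zero fun a _ => ?_)
  have h2 : (covM D h x.1 (K.e a x)).curryLeft (K.e a x) = 0 := by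
    refine eq_zero_of_frame (K := K) fun C => ?_
    have h3 := congrArg (fun f => f C) (hα.codiff (spinors_faithful n F W) a a)
    have h4 := congrArg (sev x) h3
    rw [Pi.neg_apply, map_neg, sev_apply] at h4
    have h5 := (K.nabArr_isComp hD hS h x a).hook a C
    rw [h5] at h4
    change covDeriv D θ x (K.e a x) (Fin.cons (K.e a x) fun i => K.e (C i) x) = 0
    rw [hook] at h4
    linarith
  have h3 := congrArg (fun T : MultilinearMap ℝ (fun _ : Fin k => TangentSpace (𝓡 n) x.1) ℝ =>
    T w) h2
  simp only [basis_apply]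
  rw [hook]
  change K.ε a * covM D h x.1 (K.e a x) (Fin.cons (K.e a x) w) = 0
  rw [← MultilinearMap.curryLeft_apply, h2]
  simp

end SpinChart

end Components


/-! ### Clifford action, contracted products and brackets in components -/

section PointwiseLinear

variable {V : Type*} [AddCommGroup V] [Module ℝ V]

theorem wedge_add_left {r s : ℕ} (α α' : (Fin r → V) → ℝ) (β : (Fin s → V) → ℝ) :
    wedge (α + α') β = wedge α β + wedge α' β := by
  funext w
  simp only [wedge, Pi.add_apply, add_mul, mul_add, Finset.sum_add_distrib]

theorem wedge_smul_left {r s : ℕ} (z : ℝ) (α : (Fin r → V) → ℝ) (β : (Fin s → V) → ℝ) :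
    wedge (z • α) β = z • wedge α β := by
  funext w
  simp only [wedge, Pi.smul_apply, smul_eq_mul, Finset.mul_sum]
  exact Finset.sum_congr rfl fun σ _ => by ring

theorem wedge_add_right {r s : ℕ} (α : (Fin r → V) → ℝ) (β β' : (Fin s → V) → ℝ) :
    wedge α (β + β') = wedge α β + wedge α β' := by
  funext w
  simp only [wedge, Pi.add_apply, mul_add, Finset.sum_add_distrib]

theorem wedge_smul_right {r s : ℕ} (z : ℝ) (α : (Fin r → V) → ℝ) (β : (Fin s → V) → ℝ) :
    wedge α (z • β) = z • wedge α β := by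
  funext w
  simp only [wedge, Pi.smul_apply, smul_eq_mul, Finset.mul_sum]
  exact Finset.sum_congr rfl fun σ _ => by ring

variable {n : ℕ} (e e' : Fin n → V)

theorem cwedge_add_left (m : ℕ) {r s : ℕ} (α α' : (Fin (r + m) → V) → ℝ)
    (β : (Fin (s + m) → V) → ℝ) :
    cwedge e e' m (α + α') β = cwedge e e' m α β + cwedge e e' m α' β := by
  induction m with
  | zero => exact wedge_add_left α α' β
  | succ m ih =>
    simp only [cwedge, ← Finset.sum_add_distrib]
    exact Finset.sum_congr rfl fun a _ => ih (hook (e a) α) (hook (e a) α') _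

theorem cwedge_smul_left (m : ℕ) {r s : ℕ} (z : ℝ) (α : (Fin (r + m) → V) → ℝ)
    (β : (Fin (s + m) → V) → ℝ) : cwedge e e' m (z • α) β = z • cwedge e e' m α β := by
  induction m with
  | zero => exact wedge_smul_left z α β
  | succ m ih =>
    simp only [cwedge, Finset.smul_sum]
    exact Finset.sum_congr rfl fun a _ => ih (hook (e a) α) _

theorem cwedge_add_right (m : ℕ) {r s : ℕ} (α : (Fin (r + m) → V) → ℝ)
    (β β' : (Fin (s + m) → V) → ℝ) :
    cwedge e e' m α (β + β') = cwedge e e' m α β + cwedge e e' m α β' := by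
  induction m with
  | zero => exact wedge_add_right α β β'
  | succ m ih =>
    simp only [cwedge, ← Finset.sum_add_distrib]
    exact Finset.sum_congr rfl fun a _ => ih _ (hook (e' a) β) (hook (e' a) β')

theorem cwedge_smul_right (m : ℕ) {r s : ℕ} (z : ℝ) (α : (Fin (r + m) → V) → ℝ)
    (β : (Fin (s + m) → V) → ℝ) : cwedge e e' m α (z • β) = z • cwedge e e' m α β := by
  induction m with
  | zero => exact wedge_smul_right z α β
  | succ m ih =>
    simp only [cwedge, Finset.smul_sum]
    exact Finset.sum_congr rfl fun a _ => ih _ (hook (e' a) β)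

theorem hook_add {k : ℕ} (T : MultilinearMap ℝ (fun _ : Fin (k + 1) => V) ℝ) (u v : V) :
    hook (u + v) T = hook u T + hook v T := funext fun w => T.cons_add w u v

theorem hook_smul {k : ℕ} (T : MultilinearMap ℝ (fun _ : Fin (k + 1) => V) ℝ) (r : ℝ) (u : V) :
    hook (r • u) T = r • hook u T := funext fun w => T.cons_smul w r u

/-- The product of two multilinear forms in disjoint blocks of variables. -/
def blockMul {r s N : ℕ} (e : Fin r ⊕ Fin s ≃ Fin N) (f : MultilinearMap ℝ (fun _ : Fin r => V) ℝ)
    (h : MultilinearMap ℝ (fun _ : Fin s => V) ℝ) : MultilinearMap ℝ (fun _ : Fin N => V) ℝ :=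
  ((LinearMap.mul' ℝ ℝ).compMultilinearMap (f.domCoprod h)).domDomCongr e

theorem blockMul_apply {r s N : ℕ} (e : Fin r ⊕ Fin s ≃ Fin N)
    (f : MultilinearMap ℝ (fun _ : Fin r => V) ℝ) (h : MultilinearMap ℝ (fun _ : Fin s => V) ℝ)
    (w : Fin N → V) :
    blockMul e f h w = f (fun i => w (e (Sum.inl i))) * h (fun j => w (e (Sum.inr j))) := by
  simp [blockMul]

theorem antisymmetrize_eq {m : ℕ} (T : MultilinearMap ℝ (fun _ : Fin m => V) ℝ) (w : Fin m → V) :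
    antisymmetrize T w = ((1 / (m ! : ℝ)) • MultilinearMap.alternatization T) w := by
  rw [AlternatingMap.smul_apply, MultilinearMap.alternatization_apply, antisymmetrize, smul_eq_mul]
  congr 1
  refine Finset.sum_congr rfl fun σ _ => ?_
  rw [Units.smul_def, zsmul_eq_mul]
  rfl

end PointwiseLinear

section Components

variable {n : ℕ} {M : Type*} [TopologicalSpace M] [ChartedSpace (EuclideanSpace ℝ (Fin n)) M]
  [IsManifold (𝓡 n) ∞ M]
  {F : Type*} [NormedAddCommGroup F] [NormedSpace ℝ F] [FiniteDimensional ℝ F]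
  {S : M → Type*} [TopologicalSpace (TotalSpace F S)]
  [∀ x, AddCommGroup (S x)] [∀ x, Module ℝ (S x)] [∀ x, TopologicalSpace (S x)]
  [∀ x, IsTopologicalAddGroup (S x)] [∀ x, ContinuousSMul ℝ (S x)]
  [FiberBundle F S] [VectorBundle ℝ F S]
  {g : PseudoMetric n M}
  {D : CovariantDerivative (𝓡 n) (EuclideanSpace ℝ (Fin n)) (TangentSpace (𝓡 n) : M → Type _)}
  {c : ∀ x : M, TangentSpace (𝓡 n) x →ₗ[ℝ] Module.End ℝ (S x)}
  {DS : CovariantDerivative (𝓡 n) F S}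

namespace SpinChart

variable {W : Set M} {K : SpinChart g D c DS W}

/-- The basis and dual basis of the definition are exchanged for the orthonormal frame, which needs
bilinearity in the contracted pair. -/
theorem IsComp.cwedge {x : W} (m : ℕ) {r s : ℕ}
    {T : MultilinearMap ℝ (fun _ : Fin (r + m) => TangentSpace (𝓡 n) x.1) ℝ}
    {T' : MultilinearMap ℝ (fun _ : Fin (s + m) => TangentSpace (𝓡 n) x.1) ℝ}
    {α : (Fin (r + m) → Fin n) → smoothAlg n W} {β : (Fin (s + m) → Fin n) → smoothAlg n W}
    (hα : K.IsComp x T α) (hβ : K.IsComp x T' β) :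
    K.IsComp x (cwedge (frame n x.1) (g.coframe x.1) m T T') (acwedge K.ε m α β) := by
  induction m with
  | zero =>
    intro C
    rw [← sev_apply]
    simp only [KYForms.cwedge, wedge, acwedge, awedge, map_smul, map_sum, map_mul, smul_eq_mul]
    congr 1
    refine Finset.sum_congr rfl fun σ _ => ?_
    rw [sev_apply, sev_apply, hα, hβ]
    rfl
  | succ m ih =>
    intro C
    rw [← sev_apply]
    simp only [KYForms.cwedge, acwedge, Finset.sum_apply, map_sum, Pi.smul_apply, map_smul,
      smul_eq_mul]
    have h1 := (K.isOrtho x.2).contract'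
      (fun u v => KYForms.cwedge (frame n x.1) (g.coframe x.1) m
        (KYForms.hook (k := r + m) u T) (KYForms.hook (k := s + m) v T')
        fun i => K.e (C i) x)
      (fun v => ⟨fun u u' => by
        rw [KYForms.hook_add, cwedge_add_left]; rfl, fun z u => by
        rw [KYForms.hook_smul, cwedge_smul_left]; rfl⟩)
      (fun u => ⟨fun v v' => by
        rw [KYForms.hook_add, cwedge_add_right]; rfl, fun z v => by
        rw [KYForms.hook_smul, cwedge_smul_right]; rfl⟩)
    refine Eq.trans (Finset.sum_congr rfl fun a _ => ?_) h1.symm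
    have h2 := ih (T := MultilinearMap.curryLeft (n := r + m) T (K.e a x))
      (T' := MultilinearMap.curryLeft (n := s + m) T' (K.e a x))
      (hα.hook (k := r + m) a) (hβ.hook (k := s + m) a) C
    rw [sev_apply, h2, basis_apply]
    rfl

theorem arrCond_of_algebraicConditions {p q : ℕ} {κ : TField n M (p + 1)} {μ : TField n M (q + 1)}
    (hκ : IsDiffForm κ) (hμ : IsDiffForm μ) (h : AlgebraicConditions g κ μ) :
    ArrCond K.ε (K.comps hκ) (K.comps hμ) := by
  intro k r s hp hq a b
  subst hp hq
  funext C
  refine smoothAlg_ext fun x => ?_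
  have h1 := congrFun (h k r s rfl rfl x.1 (K.e a x) (K.e b x)) fun i => K.e (C i) x
  have h2 : ∀ a b, (acwedge K.ε (2 * k + 1) (ahook a (K.comps hκ)) (ahook b (K.comps hμ)) C).1 x =
      KYForms.cwedge (frame n x.1) (g.coframe x.1) (2 * k + 1) (KYForms.hook (K.e a x) (κ x))
        (KYForms.hook (K.e b x) (μ x)) fun i => K.e (C i) x := fun a b => by
    have := IsComp.cwedge (K := K) (x := x) (2 * k + 1)
      (T := (hκ.alt x).toMultilinearMap.curryLeft (K.e a x))
      (T' := (hμ.alt x).toMultilinearMap.curryLeft (K.e b x))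
      (α := ahook a (K.comps hκ)) (β := ahook b (K.comps hμ))
      (by
        have := (K.comps_isComp hκ x).hook a
        rw [hκ.alt_eq x] at this
        exact this)
      (by
        have := (K.comps_isComp hμ x).hook b
        rw [hμ.alt_eq x] at this
        exact this)
    rw [this C, hκ.alt_eq, hμ.alt_eq]
    rfl
  change (acwedge K.ε (2 * k + 1) (ahook a (K.comps hκ)) (ahook b (K.comps hμ)) C).1 x +
    (acwedge K.ε (2 * k + 1) (ahook b (K.comps hκ)) (ahook a (K.comps hμ)) C).1 x = 0
  rw [h2, h2]
  exact h1

variable (K) in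
/-- The unnormalised Clifford action of a multilinear form. -/
theorem sum_prod_sec {x : W} (k : ℕ)
    (T : MultilinearMap ℝ (fun _ : Fin k => TangentSpace (𝓡 n) x.1) ℝ)
    {α : (Fin k → Fin n) → smoothAlg n W} (hα : K.IsComp x T α) (χ : Spinors n F W) :
    ∑ A : Fin k → Fin n, T (fun i => frame n x.1 (A i)) •
      (List.ofFn fun i => c x (g.coframe x.1 (A i))).prod (K.sec x χ) =
      K.sec x (cq K.ε K.gam α χ) := by
  induction k with
  | zero =>
    rw [Fintype.sum_unique, cq_zero, LinearMap.smul_apply, Module.End.one_apply, sec_smul,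
      sext_of_mem _ x.2, hα]
    simp only [List.ofFn_zero, List.prod_nil, Module.End.one_apply]
    congr 2
    exact Subsingleton.elim _ _
  | succ k ih =>
    rw [sum_cons, cq_succ]
    let Q : MultilinearMap ℝ (fun _ : Fin k => TangentSpace (𝓡 n) x.1) ℝ → S x.1 := fun T' =>
      ∑ A : Fin k → Fin n, T' (fun i => frame n x.1 (A i)) •
        (List.ofFn fun i => c x (g.coframe x.1 (A i))).prod (K.sec x χ)
    have h1 := (K.isOrtho x.2).contract
      (fun u v => c x u (Q (T.curryLeft v)))
      (fun v => ⟨fun u u' => by rw [map_add]; rfl, fun z u => by rw [map_smul]; rfl⟩)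
      (fun u => ⟨fun v v' => by
        rw [← map_add]
        congr 1
        simp only [Q, map_add, add_apply, add_smul, Finset.sum_add_distrib], fun z v => by
        rw [← map_smul]
        congr 1
        simp only [Q, map_smul, smul_apply, smul_eq_mul, mul_smul, Finset.smul_sum]⟩)
    refine Eq.trans (Finset.sum_congr rfl fun a _ => ?_) (h1.trans ?_)
    · simp only [Q, map_sum, map_smul]
      refine Finset.sum_congr rfl fun A _ => ?_
      rw [List.ofFn_succ, List.prod_cons, Module.End.mul_apply]
      simp only [Fin.cons_zero, Fin.cons_succ, MultilinearMap.curryLeft_apply]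
      congr 2
      funext i
      refine Fin.cases ?_ (fun j => ?_) i <;> simp
    · rw [LinearMap.sum_apply, map_sum]
      refine Finset.sum_congr rfl fun a _ => ?_
      rw [LinearMap.smul_apply, map_smul, Module.End.mul_apply, K.sec_gam x.2, basis_apply]
      congr 2
      exact ih (T.curryLeft (K.e a x)) (hα.hook a)

variable (K) in
theorem slash_sec {x : W} {k : ℕ}
    (T : MultilinearMap ℝ (fun _ : Fin k => TangentSpace (𝓡 n) x.1) ℝ)
    {α : (Fin k → Fin n) → smoothAlg n W} (hα : K.IsComp x T α) (χ : Spinors n F W) :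
    slash g c x.1 T (K.sec x χ) = K.sec x (clf K.ε K.gam α χ) := by
  rw [clf, LinearMap.smul_apply, map_smul, ← K.sum_prod_sec k T hα χ, slash, LinearMap.smul_apply,
    LinearMap.sum_apply]
  rfl

theorem slash_add (x : M) {k : ℕ} (T T' : (Fin k → TangentSpace (𝓡 n) x) → ℝ) :
    slash g c x (T + T') = slash g c x T + slash g c x T' := by
  simp only [slash, Pi.add_apply, add_smul, Finset.sum_add_distrib, smul_add]

theorem slash_smul (x : M) {k : ℕ} (z : ℝ) (T : (Fin k → TangentSpace (𝓡 n) x) → ℝ) :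
    slash g c x (z • T) = z • slash g c x T := by
  simp only [slash, Pi.smul_apply, smul_eq_mul, mul_smul, ← Finset.smul_sum]
  rw [smul_comm]

variable (K) in
/-- The operator of a form in components. -/
theorem opK_eq (hD : IsLeviCivita g D) (hS : IsSpinorBundle g D c DS) {k : ℕ}
    {θ : TField n M (k + 1)} (h : IsDiffForm θ) {ψ : ∀ x : M, S x} {χ : Spinors n F W}
    (hψ : ∀ x ∈ W, ψ x = K.sec x χ) {x : M} (hx : x ∈ W) :
    opK g D c DS θ ψ x = K.sec x ((K.spinData hD hS).arrOp (K.comps h) χ) := by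
  have hd : MDifferentiableAt (𝓡 n) ((𝓡 n).prod 𝓘(ℝ, F))
      (fun y => TotalSpace.mk' F y (K.sec y χ)) x :=
    ((K.sec_smooth χ).contMDiffAt (K.isOpen.mem_nhds hx)).mdifferentiableAt (by simp)
  have hev : ∀ᶠ y in nhds x, K.sec y χ = ψ y :=
    Filter.eventually_of_mem (K.isOpen.mem_nhds hx) fun y hy => (hψ y hy).symm
  have hd' : MDifferentiableAt (𝓡 n) ((𝓡 n).prod 𝓘(ℝ, F))
      (fun y => TotalSpace.mk' F y (ψ y)) x :=
    hd.congr_of_eventuallyEq (hev.mono fun y hy => by simp only [hy])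
  -- The connection is local, so ψ may be replaced by the section with components χ, which agrees
  -- with it near x.
  have hDS : DS ψ x = DS (fun y => K.sec y χ) x :=
    (DS.isCovariantDerivativeOnUniv.congr_of_eventuallyEq hd hd' Filter.univ_mem hev).symm
  have h1 := (K.isOrtho hx).contract (fun u v => slash g c x (hook u (θ x)) (DS ψ x v))
    (fun v => ⟨fun u u' => by
      rw [h.alt_eq x]
      have := KYForms.hook_add (h.alt x).toMultilinearMap u u'
      exact (congrArg (fun T => slash g c x T (DS ψ x v)) this).trans
        (by rw [slash_add]; rfl), fun z u => by
      rw [h.alt_eq x]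
      have := KYForms.hook_smul (h.alt x).toMultilinearMap z u
      exact (congrArg (fun T => slash g c x T (DS ψ x v)) this).trans
        (by rw [slash_smul]; rfl)⟩)
    (fun u => ⟨fun v v' => by simp, fun z v => by simp⟩)
  rw [opK, h1, SpinData.arrOp, map_add, map_sum, map_smul]
  congr 1
  · refine Finset.sum_congr rfl fun a _ => ?_
    rw [map_smul, basis_apply, hDS, K.DS_sec hD hS hx, h.alt_eq x]
    congr 1
    refine K.slash_sec (x := ⟨x, hx⟩) ((h.alt x).toMultilinearMap.curryLeft (K.e a x)) ?_ _
    have := (K.comps_isComp h ⟨x, hx⟩).hook a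
    rw [h.alt_eq x] at this
    exact this
  · congr 1
    rw [hψ x hx]
    have e : extD D θ x = extM D h x := funext fun w => (extM_apply D h x w).symm
    rw [e]
    refine K.slash_sec (x := ⟨x, hx⟩) (extM D h x) ?_ _
    have := K.extArr_isComp hD hS h ⟨x, hx⟩
    rwa [e] at this

end SpinChart

end Components


/-! ### The Schouten-Nijenhuis bracket of forms -/

section Components

variable {n : ℕ} {M : Type*} [TopologicalSpace M] [ChartedSpace (EuclideanSpace ℝ (Fin n)) M]
  [IsManifold (𝓡 n) ∞ M]
  {F : Type*} [NormedAddCommGroup F] [NormedSpace ℝ F] [FiniteDimensional ℝ F]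
  {S : M → Type*} [TopologicalSpace (TotalSpace F S)]
  [∀ x, AddCommGroup (S x)] [∀ x, Module ℝ (S x)] [∀ x, TopologicalSpace (S x)]
  [∀ x, IsTopologicalAddGroup (S x)] [∀ x, ContinuousSMul ℝ (S x)]
  [FiberBundle F S] [VectorBundle ℝ F S]
  {g : PseudoMetric n M}
  {D : CovariantDerivative (𝓡 n) (EuclideanSpace ℝ (Fin n)) (TangentSpace (𝓡 n) : M → Type _)}
  {c : ∀ x : M, TangentSpace (𝓡 n) x →ₗ[ℝ] Module.End ℝ (S x)}
  {DS : CovariantDerivative (𝓡 n) F S}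

variable (g D) in
theorem covDeriv_const_mul {k : ℕ} {θ : TField n M k} (h : IsDiffForm θ) (r : ℝ) (x : M)
    (v : TangentSpace (𝓡 n) x) (w : Fin k → TangentSpace (𝓡 n) x) :
    covDeriv D (fun x w => r * θ x w) x v w = r * covDeriv D θ x v w := by
  have hr : MDifferentiableAt (𝓡 n) 𝓘(ℝ, ℝ) (fun _ : M => r) x := mdifferentiableAt_const
  have h1 := h.mdifferentiableAt (x := x)
    (X := fun i => FiberBundle.extend (EuclideanSpace ℝ (Fin n)) (w i))
    fun i => FiberBundle.mdifferentiableAt_extend _ _ _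
  simp only [covDeriv]
  rw [mvfderiv_fun_mul hr h1, mvfderiv_const, ← Finset.mul_sum, mul_sub]
  simp

variable (g D) in
theorem snBracket_parity {p q : ℕ} {κ : TField n M (p + 1)} (hκ : IsDiffForm κ)
    (μ : TField n M (q + 1)) (x : M) (w : Fin (p + q + 1) → TangentSpace (𝓡 n) x) :
    snBracket g D (parity κ) μ x w = (-1) ^ (p + 1) * snBracket g D κ μ x w := by
  have h1 : ∀ v u, covDeriv D (parity κ) x v u = (-1) ^ (p + 1) * covDeriv D κ x v u := fun v u =>
    covDeriv_const_mul D hκ _ x v u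
  have h2 : ∀ v u, hook v (parity κ x) u = (-1) ^ (p + 1) * hook v (κ x) u := fun _ _ => rfl
  simp only [snBracket, antisymmetrize, h1, h2]
  refine Eq.trans (congrArg (HMul.hMul _) ?_) (mul_left_comm _ _ _)
  rw [Finset.mul_sum]
  refine Finset.sum_congr rfl fun σ _ => ?_
  refine Eq.trans (congrArg (HMul.hMul _) ?_) (mul_left_comm _ _ _)
  simp only [mul_add, Finset.mul_sum]
  congr 1 <;> exact Finset.sum_congr rfl fun a _ => by ring

variable (g D) in
/-- The tensor whose antisymmetrisation is the Schouten-Nijenhuis bracket. -/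
def snTensor {p q : ℕ} {κ : TField n M (p + 1)} {μ : TField n M (q + 1)} (hκ : IsDiffForm κ)
    (hμ : IsDiffForm μ) (x : M) :
    MultilinearMap ℝ (fun _ : Fin (p + q + 1) => TangentSpace (𝓡 n) x) ℝ :=
  ((p : ℝ) + 1) • ∑ a, blockMul (finSumFinEquiv (m := p) (n := q + 1))
      ((hκ.alt x).toMultilinearMap.curryLeft (g.coframe x a)) (covM D hμ x (frame n x a)) +
    ((-1 : ℝ) ^ ((p + 1) * (q + 1)) * ((q : ℝ) + 1)) •
      ∑ a, blockMul ((finSumFinEquiv (m := q) (n := p + 1)).trans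
        (finCongr (show q + (p + 1) = p + q + 1 by omega)))
        ((hμ.alt x).toMultilinearMap.curryLeft (g.coframe x a)) (covM D hκ x (frame n x a))

theorem snTensor_apply {p q : ℕ} {κ : TField n M (p + 1)} {μ : TField n M (q + 1)}
    (hκ : IsDiffForm κ) (hμ : IsDiffForm μ) (x : M) (w : Fin (p + q + 1) → TangentSpace (𝓡 n) x) :
    snTensor g D hκ hμ x w = ((p : ℝ) + 1) *
        ∑ a, hook (g.coframe x a) (κ x) (fun i => w ⟨i, by omega⟩) *
          covDeriv D μ x (frame n x a) (fun j => w ⟨p + j, by omega⟩) +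
      (-1) ^ ((p + 1) * (q + 1)) * (((q : ℝ) + 1) *
        ∑ a, hook (g.coframe x a) (μ x) (fun i => w ⟨i, by omega⟩) *
          covDeriv D κ x (frame n x a) (fun j => w ⟨q + j, by omega⟩)) := by
  simp only [snTensor, add_apply, smul_apply, sum_apply, blockMul_apply, smul_eq_mul, mul_assoc]
  rw [hκ.alt_eq x, hμ.alt_eq x]
  rfl

theorem snBracket_eq {p q : ℕ} {κ : TField n M (p + 1)} {μ : TField n M (q + 1)}
    (hκ : IsDiffForm κ) (hμ : IsDiffForm μ) (x : M) :
    snBracket g D κ μ x = antisymmetrize (snTensor g D hκ hμ x) :=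
  congrArg antisymmetrize (funext fun w => (snTensor_apply hκ hμ x w).symm)

namespace SpinChart

variable {W : Set M} (K : SpinChart g D c DS W)

theorem sum_hook_mul_covDeriv (hD : IsLeviCivita g D) (hS : IsSpinorBundle g D c DS) {p q : ℕ}
    {κ : TField n M (p + 1)} {μ : TField n M q} (hκ : IsDiffForm κ) (hμ : IsDiffForm μ) (x : W)
    (A : Fin p → Fin n) (B : Fin q → Fin n) :
    ∑ a, hook (g.coframe x.1 a) (κ x) (fun i => K.e (A i) x) *
        covDeriv D μ x (frame n x.1 a) (fun j => K.e (B j) x) =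
      ∑ a, K.ε a * ((ahook a (K.comps hκ) A).1 x *
        ((K.spinData hD hS).nabArr a (K.comps hμ) B).1 x) := by
  have h1 := (K.isOrtho x.2).contract
    (fun u v => hook u (κ x) (fun i => K.e (A i) x) * covDeriv D μ x v (fun j => K.e (B j) x))
    (fun v => ⟨fun u u' => by
      rw [hκ.alt_eq x]
      have := congrFun (hook_add (hκ.alt x).toMultilinearMap u u') fun i => K.e (A i) x
      exact (congrArg (· * _) this).trans (add_mul _ _ _), fun z u => by
      rw [hκ.alt_eq x]
      have := congrFun (hook_smul (hκ.alt x).toMultilinearMap z u) fun i => K.e (A i) x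
      exact (congrArg (· * _) this).trans (mul_assoc _ _ _)⟩)
    (fun u => ⟨fun v v' => by
      have := (covL D hμ x.1).cons_add (fun j => K.e (B j) x) v v'
      rw [covL_cons, covL_cons, covL_cons] at this
      rw [this, mul_add], fun z v => by
      have := (covL D hμ x.1).cons_smul (fun j => K.e (B j) x) z v
      rw [covL_cons, covL_cons] at this
      rw [this, smul_eq_mul, smul_eq_mul, mul_left_comm]⟩)
  rw [h1]
  refine Finset.sum_congr rfl fun a _ => ?_
  rw [basis_apply, (K.comps_isComp hκ x).hook a, K.nabArr_isComp hD hS hμ x a]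
  rfl

theorem snBracket_isComp (hD : IsLeviCivita g D) (hS : IsSpinorBundle g D c DS) {p q : ℕ}
    {κ : TField n M (p + 1)} {μ : TField n M (q + 1)} (hκ : IsDiffForm κ) (hμ : IsDiffForm μ)
    (x : W) : K.IsComp x (snBracket g D κ μ x)
      (snArr (K.spinData hD hS).ε (K.comps hκ) (fun a => (K.spinData hD hS).nabArr a (K.comps hκ))
        (K.comps hμ) fun a => (K.spinData hD hS).nabArr a (K.comps hμ)) := by
  intro C
  rw [← sev_apply]
  simp only [snArr, snBracket, antisymmetrize, map_smul, map_sum, map_add, map_mul, smul_eq_mul]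
  congr 1
  refine Finset.sum_congr rfl fun σ _ => ?_
  rw [sgnR, K.sum_hook_mul_covDeriv hD hS hκ hμ x (fun i => C (σ ⟨i, _⟩))
    fun j => C (σ ⟨p + j, _⟩), K.sum_hook_mul_covDeriv hD hS hμ hκ x (fun i => C (σ ⟨i, _⟩))
    fun j => C (σ ⟨q + j, _⟩)]
  rfl

end SpinChart

/-- A field of alternating forms with smooth components is a differential form. -/
theorem isDiffForm_of_isComp (hS : IsSpinorBundle g D c DS) {k : ℕ} {θ : TField n M k}
    (halt : ∀ x : M, ∃ A : TangentSpace (𝓡 n) x [⋀^Fin k]→ₗ[ℝ] ℝ, ∀ w, θ x w = A w)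
    (h : ∀ (W : Set M) (K : SpinChart g D c DS W), ∃ α, ∀ x : W, K.IsComp x (θ x) α) :
    IsDiffForm θ := by
  refine ⟨halt, fun U X hU hX x hx => ?_⟩
  obtain ⟨W', hxW, ⟨K'⟩⟩ := hS.exists_chart x
  have hV : IsOpen (U ∩ W') := hU.inter K'.isOpen
  -- The fields are smooth only on U, hence the restriction of the chart; expanding them in the
  -- orthonormal frame writes the value as a polynomial in smooth functions.
  let K := K'.restrict hV Set.inter_subset_right
  obtain ⟨α, hα⟩ := h _ K
  have hX' : ∀ i, VFSmoothOn (X i) (U ∩ W') := fun i => (hX i).mono Set.inter_subset_left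
  have h2 : ∀ i a, FunSmoothOn (n := n) (fun y => K.ε a * g.val y (X i y) (K.e a y)) (U ∩ W') :=
    fun i a => contMDiffOn_const.mul (SpinChart.metric_smooth (hX' i) (K.e_smooth a))
  have h3 : FunSmoothOn (n := n) (fun y => ∑ C : Fin k → Fin n,
      (∏ i, (K.ε (C i) * g.val y (X i y) (K.e (C i) y))) * sext (α C) y) (U ∩ W') := by
    have h4 : ∀ C : Fin k → Fin n, FunSmoothOn (n := n) (fun y =>
      (∏ i, (K.ε (C i) * g.val y (X i y) (K.e (C i) y))) * sext (α C) y) (U ∩ W') := fun C =>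
      (contMDiffOn_finsetProd fun i _ => h2 i (C i)).mul (sext_smooth (α C))
    exact contMDiffOn_finsetSum fun C _ => h4 C
  have h5 : ∀ y ∈ U ∩ W', θ y (fun i => X i y) = ∑ C : Fin k → Fin n,
      (∏ i, (K.ε (C i) * g.val y (X i y) (K.e (C i) y))) * sext (α C) y := by
    intro y hy
    obtain ⟨A, hA⟩ := halt y
    have e : (fun i => X i y) = fun i => ∑ a, (K.ε a * g.val y (X i y) (K.e a y)) • K.e a y :=
      funext fun i => by
        have := (K.isOrtho hy).sum (X i y)
        simp only [SpinChart.basis_apply] at this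
        exact this.symm
    rw [hA]
    conv_lhs => rw [e]
    rw [← AlternatingMap.coe_multilinearMap, MultilinearMap.map_sum]
    refine Finset.sum_congr rfl fun C _ => ?_
    rw [MultilinearMap.map_smul_univ, smul_eq_mul, sext_of_mem _ hy, hα ⟨y, hy⟩ C, hA]
    rfl
  exact ((h3.congr h5).contMDiffAt (hV.mem_nhds ⟨hx, hxW⟩)).contMDiffWithinAt

theorem isDiffForm_snBracket (hD : IsLeviCivita g D) (hS : IsSpinorBundle g D c DS) {p q : ℕ}
    {κ : TField n M (p + 1)} {μ : TField n M (q + 1)} (hκ : IsDiffForm κ) (hμ : IsDiffForm μ) :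
    IsDiffForm (snBracket g D κ μ) :=
  isDiffForm_of_isComp hS
    (fun x => ⟨_, fun w => by rw [snBracket_eq hκ hμ]; exact antisymmetrize_eq _ w⟩)
    fun _ K => ⟨_, fun x => K.snBracket_isComp hD hS hκ hμ x⟩

theorem IsDiffForm.const_mul {k : ℕ} {θ : TField n M k} (h : IsDiffForm θ) (r : ℝ) :
    IsDiffForm fun x w => r * θ x w :=
  ⟨fun x => ⟨r • h.alt x, fun w => by simp only [h.alt_eq x]; rfl⟩, fun U X hU hX =>
    contMDiffOn_const.mul (h.2 U X hU hX)⟩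

/-- A form that is Killing-Yano in components in all spinor charts is Killing-Yano. -/
theorem isKY_of_arrKY [Nontrivial F] (hD : IsLeviCivita g D) (hS : IsSpinorBundle g D c DS) {k : ℕ}
    {θ : TField n M (k + 1)} (h : IsDiffForm θ)
    (hk : ∀ (W : Set M) (K : SpinChart g D c DS W), (K.spinData hD hS).ArrKY (K.comps h)) :
    IsKY g D θ := by
  have h1 : ∀ x w, codiff g D θ x w = 0 := fun x w => by
    obtain ⟨W, hx, ⟨K⟩⟩ := hS.exists_chart x
    exact K.codiff_at hD hS h (hk W K) ⟨x, hx⟩ w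
  refine ⟨⟨h, fun x v w => ?_⟩, h1⟩
  obtain ⟨W, hx, ⟨K⟩⟩ := hS.exists_chart x
  rw [K.cky_at hD hS h (hk W K) ⟨x, hx⟩ v w]
  simp [h1]

end Components


/-! ### The graded commutator of Killing-Yano operators -/

section Components

variable {n : ℕ} {M : Type*} [TopologicalSpace M] [ChartedSpace (EuclideanSpace ℝ (Fin n)) M]
  [IsManifold (𝓡 n) ∞ M]
  {F : Type*} [NormedAddCommGroup F] [NormedSpace ℝ F] [FiniteDimensional ℝ F]
  {S : M → Type*} [TopologicalSpace (TotalSpace F S)]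
  [∀ x, AddCommGroup (S x)] [∀ x, Module ℝ (S x)] [∀ x, TopologicalSpace (S x)]
  [∀ x, IsTopologicalAddGroup (S x)] [∀ x, ContinuousSMul ℝ (S x)]
  [FiberBundle F S] [VectorBundle ℝ F S]
  {g : PseudoMetric n M}
  {D : CovariantDerivative (𝓡 n) (EuclideanSpace ℝ (Fin n)) (TangentSpace (𝓡 n) : M → Type _)}
  {c : ∀ x : M, TangentSpace (𝓡 n) x →ₗ[ℝ] Module.End ℝ (S x)}
  {DS : CovariantDerivative (𝓡 n) F S}

/-- A smooth function with vanishing differential is locally constant. -/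
theorem eventually_eq_of_mvfderiv_eq_zero {W : Set M} (hW : IsOpen W) {f : M → ℝ}
    (hf : FunSmoothOn (n := n) f W) (h : ∀ y ∈ W, mvfderiv (𝓡 n) f y = 0) {x : M} (hx : x ∈ W) :
    ∀ᶠ y in nhds x, f y = f x := by
  let T : Set (EuclideanSpace ℝ (Fin n)) :=
    (extChartAt (𝓡 n) x).target ∩ (extChartAt (𝓡 n) x).symm ⁻¹' W
  have hT : IsOpen T := (continuousOn_extChartAt_symm x).isOpen_inter_preimage
    (isOpen_extChartAt_target x) hW
  have hxT : extChartAt (𝓡 n) x x ∈ T :=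
    ⟨mem_extChartAt_target x, by simpa using hx⟩
  obtain ⟨ρ, hρ, hB⟩ := Metric.isOpen_iff.1 hT _ hxT
  -- In the chart the derivative of f vanishes, so f is constant on a ball, which is convex.
  have hd : ∀ z ∈ T, HasFDerivAt (f ∘ (extChartAt (𝓡 n) x).symm)
      (0 : EuclideanSpace ℝ (Fin n) →L[ℝ] ℝ) z := by
    intro z hz
    have h1 : MDifferentiableAt 𝓘(ℝ, EuclideanSpace ℝ (Fin n)) (𝓡 n) (extChartAt (𝓡 n) x).symm z :=
      ((contMDiffOn_extChartAt_symm (n := ∞) x).contMDiffAt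
        ((isOpen_extChartAt_target x).mem_nhds hz.1)).mdifferentiableAt (by simp)
    have h2 := FunSmoothOn.mdifferentiableAt hW hf hz.2
    have h3 := h2.hasMFDerivAt.comp z h1.hasMFDerivAt
    have h4 : mfderiv (𝓡 n) 𝓘(ℝ, ℝ) f ((extChartAt (𝓡 n) x).symm z) = 0 := h _ hz.2
    rw [h4] at h3
    exact h3.hasFDerivAt.congr_fderiv (ContinuousLinearMap.zero_comp _)
  have hc : ∀ z ∈ Metric.ball (extChartAt (𝓡 n) x x) ρ,
      f ((extChartAt (𝓡 n) x).symm z) = f x := by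
    intro z hz
    have h1 := (convex_ball (extChartAt (𝓡 n) x x) ρ).is_const_of_fderivWithin_eq_zero
      (𝕜 := ℝ) (f := f ∘ (extChartAt (𝓡 n) x).symm)
      (fun z hz => (hd z (hB hz)).differentiableAt.differentiableWithinAt)
      (fun z hz => ((hd z (hB hz)).hasFDerivWithinAt).fderivWithin
        (Metric.isOpen_ball.uniqueDiffWithinAt hz)) hz (Metric.mem_ball_self hρ)
    simpa using h1
  filter_upwards [(continuousAt_extChartAt (I := 𝓡 n) x).preimage_mem_nhds
    (Metric.ball_mem_nhds _ hρ), extChartAt_source_mem_nhds (I := 𝓡 n) x] with y hy hys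
  rw [← hc _ hy, (extChartAt (𝓡 n) x).left_inv hys]

/-- The graded commutator differs at `x` from the operator of `ν` by the scalar `z`. -/
def BracketDefect (g : PseudoMetric n M)
    (D : CovariantDerivative (𝓡 n) (EuclideanSpace ℝ (Fin n)) (TangentSpace (𝓡 n) : M → Type _))
    (c : ∀ x : M, TangentSpace (𝓡 n) x →ₗ[ℝ] Module.End ℝ (S x))
    (DS : CovariantDerivative (𝓡 n) F S) {p q : ℕ} (κ : TField n M (p + 1))
    (μ : TField n M (q + 1)) (ν : TField n M (p + q + 1)) (x : M) (z : ℝ) : Prop :=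
  ∀ (U : Set M) (ψ : ∀ x : M, S x), IsOpen U → SecSmoothOn (n := n) F ψ U → x ∈ U →
    gradedComm g D c DS κ μ ψ x = opK g D c DS ν ψ x + z • ψ x

/-- The defect is tested on a member of the spin frame, which does not vanish at x. -/
theorem BracketDefect.unique [Nontrivial F] (hS : IsSpinorBundle g D c DS) {p q : ℕ}
    {κ : TField n M (p + 1)} {μ : TField n M (q + 1)} {ν : TField n M (p + q + 1)} {x : M}
    {z z' : ℝ} (h : BracketDefect g D c DS κ μ ν x z) (h' : BracketDefect g D c DS κ μ ν x z') :
    z = z' := by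
  obtain ⟨W, hx, ⟨K⟩⟩ := hS.exists_chart x
  have h1 := h W (K.s ⟨0, finrank_pos⟩) K.isOpen (K.s_frame.contMDiffOn _) hx
  have h2 := h' W (K.s ⟨0, finrank_pos⟩) K.isOpen (K.s_frame.contMDiffOn _) hx
  rw [h1] at h2
  have h3 : (z - z') • K.s ⟨0, finrank_pos⟩ x = 0 := by
    rw [sub_smul, sub_eq_zero]
    exact add_left_cancel h2
  have h4 := (K.s_frame.linearIndependent hx).ne_zero (⟨0, finrank_pos⟩ : Fin (finrank ℝ F))
  exact sub_eq_zero.1 ((smul_eq_zero.1 h3).resolve_right h4)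

/-- The Killing-Yano form whose operator is, up to scalars, the graded commutator. -/
def bracketForm (g : PseudoMetric n M)
    (D : CovariantDerivative (𝓡 n) (EuclideanSpace ℝ (Fin n)) (TangentSpace (𝓡 n) : M → Type _))
    {p q : ℕ} (κ : TField n M (p + 1)) (μ : TField n M (q + 1)) : TField n M (p + q + 1) :=
  fun x w => ((-1) ^ p * (((p + q)! : ℝ) / (p ! * q !))) * snBracket g D κ μ x w

theorem isDiffForm_bracketForm (hD : IsLeviCivita g D) (hS : IsSpinorBundle g D c DS) {p q : ℕ}
    {κ : TField n M (p + 1)} {μ : TField n M (q + 1)} (hκ : IsDiffForm κ) (hμ : IsDiffForm μ) :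
    IsDiffForm (bracketForm g D κ μ) :=
  (isDiffForm_snBracket hD hS hκ hμ).const_mul _

namespace SpinChart

variable {W : Set M} (K : SpinChart g D c DS W) {p q : ℕ} {κ : TField n M (p + 1)}
  {μ : TField n M (q + 1)}

theorem comps_snBracket (hD : IsLeviCivita g D) (hS : IsSpinorBundle g D c DS)
    (hκ : IsDiffForm κ) (hμ : IsDiffForm μ)
    (h : IsDiffForm (snBracket g D κ μ)) :
    K.comps h = snArr (K.spinData hD hS).ε (K.comps hκ)
      (fun a => (K.spinData hD hS).nabArr a (K.comps hκ)) (K.comps hμ)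
      fun a => (K.spinData hD hS).nabArr a (K.comps hμ) :=
  funext fun C => smoothAlg_ext fun x => (K.snBracket_isComp hD hS hκ hμ x C).symm

theorem comps_bracketForm (h : IsDiffForm (snBracket g D κ μ))
    (h' : IsDiffForm (bracketForm g D κ μ)) :
    K.comps h' = ((-1 : ℝ) ^ p * (((p + q)! : ℝ) / (p ! * q !))) • K.comps h := rfl

theorem gradedComm_eq (hD : IsLeviCivita g D) (hS : IsSpinorBundle g D c DS)
    (hκ : IsDiffForm κ) (hμ : IsDiffForm μ) {ψ : ∀ x : M, S x}
    {χ : Spinors n F W} (hψ : ∀ x ∈ W, ψ x = K.sec x χ) {x : M} (hx : x ∈ W) :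
    gradedComm g D c DS κ μ ψ x = K.sec x
      ((K.spinData hD hS).arrOp (K.comps hκ) ((K.spinData hD hS).arrOp (K.comps hμ) χ) -
        (-1 : ℝ) ^ (p * q) •
          (K.spinData hD hS).arrOp (K.comps hμ) ((K.spinData hD hS).arrOp (K.comps hκ) χ)) := by
  rw [gradedComm, map_sub, map_smul,
    K.opK_eq hD hS hκ (fun y hy => K.opK_eq hD hS hμ hψ hy) hx,
    K.opK_eq hD hS hμ (fun y hy => K.opK_eq hD hS hκ hψ hy) hx]

theorem exists_bracket [Nontrivial F] (hD : IsLeviCivita g D) (hS : IsSpinorBundle g D c DS)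
    (hκ0 : IsDiffForm κ) (hμ0 : IsDiffForm μ)
    (hκ : IsKY g D κ) (hμ : IsKY g D μ) (hcond : AlgebraicConditions g κ μ)
    (hs : IsDiffForm (snBracket g D κ μ)) (hb : IsDiffForm (bracketForm g D κ μ)) :
    (K.spinData hD hS).ArrKY (K.comps hs) ∧ ∃ r : smoothAlg n W, (∀ a, K.der a r = 0) ∧
      (¬ (p = q ∧ Odd p) → r = 0) ∧ ∀ χ,
      (K.spinData hD hS).arrOp (K.comps hκ0) ((K.spinData hD hS).arrOp (K.comps hμ0) χ) -
        (-1 : ℝ) ^ (p * q) •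
          (K.spinData hD hS).arrOp (K.comps hμ0) ((K.spinData hD hS).arrOp (K.comps hκ0) χ) =
        (K.spinData hD hS).arrOp (K.comps hb) χ + r • χ := by
  rw [K.comps_bracketForm hs hb, K.comps_snBracket hD hS hκ0 hμ0 hs]
  exact SpinData.ArrKY.exists_bracket (S := K.spinData hD hS) (spinors_faithful n F W)
    (spinTrace n F W) spinTrace_mul (d := (finrank ℝ F : ℝ))
    (Nat.cast_ne_zero.2 finrank_pos.ne') spinTrace_one (K.arrKY_of_isKY hD hS hκ0 hκ)
    (K.arrKY_of_isKY hD hS hμ0 hμ) (arrCond_of_algebraicConditions hκ0 hμ0 hcond)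

end SpinChart

/-- The defect of the bracket exists and is locally constant. -/
theorem exists_bracketDefect [Nontrivial F] [ContMDiffVectorBundle ∞ F S (𝓡 n)]
    (hD : IsLeviCivita g D) (hS : IsSpinorBundle g D c DS) {p q : ℕ} {κ : TField n M (p + 1)}
    {μ : TField n M (q + 1)} (hκ : IsKY g D κ) (hμ : IsKY g D μ)
    (hcond : AlgebraicConditions g κ μ) (x : M) :
    ∃ z, (¬ (p = q ∧ Odd p) → z = 0) ∧
      ∀ᶠ y in nhds x, BracketDefect g D c DS κ μ (bracketForm g D κ μ) y z := by
  obtain ⟨W, hx, ⟨K⟩⟩ := hS.exists_chart x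
  have hs := isDiffForm_snBracket (g := g) hD hS hκ.1.1 hμ.1.1
  have hb := isDiffForm_bracketForm (g := g) hD hS hκ.1.1 hμ.1.1
  obtain ⟨-, r, hr, hr0, h⟩ := K.exists_bracket hD hS hκ.1.1 hμ.1.1 hκ hμ hcond hs hb
  have hder : ∀ y ∈ W, mvfderiv (𝓡 n) (sext r) y = 0 := fun y hy => by
    refine ContinuousLinearMap.coe_injective ((K.basis hy).ext fun a => ?_)
    rw [K.basis_apply]
    exact congrArg (fun f : smoothAlg n W => f.1 ⟨y, hy⟩) (hr a)
  refine ⟨sext r x, fun hpq => ?_, ?_⟩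
  · rw [hr0 hpq, sext_of_mem _ hx]
    rfl
  filter_upwards [eventually_eq_of_mvfderiv_eq_zero K.isOpen (sext_smooth r) hder hx,
    K.isOpen.mem_nhds hx] with y hyx hy U ψ hU hψ hyU
  -- ψ is smooth only on U, so it has components only in the chart restricted to U ∩ W. The scalar
  -- r' found there must still be compared with r.
  let K' := K.restrict (hU.inter K.isOpen) Set.inter_subset_right
  obtain ⟨-, r', -, -, h'⟩ := K'.exists_bracket hD hS hκ.1.1 hμ.1.1 hκ hμ hcond hs hb
  obtain ⟨χ, hχ⟩ := K'.exists_sec (hψ.mono Set.inter_subset_left)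
  have hyW : y ∈ U ∩ W := ⟨hyU, hy⟩
  have key : ∀ (V : Set M) (L : SpinChart g D c DS V) (ρ : smoothAlg n V)
      (_ : ∀ χ, (L.spinData hD hS).arrOp (L.comps hκ.1.1)
          ((L.spinData hD hS).arrOp (L.comps hμ.1.1) χ) - (-1 : ℝ) ^ (p * q) •
          (L.spinData hD hS).arrOp (L.comps hμ.1.1)
            ((L.spinData hD hS).arrOp (L.comps hκ.1.1) χ) =
        (L.spinData hD hS).arrOp (L.comps hb) χ + ρ • χ)
      (χ : SpinChart.Spinors n F V) (ψ : ∀ x : M, S x)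
      (_ : ∀ x ∈ V, ψ x = L.sec x χ) (_ : y ∈ V), gradedComm g D c DS κ μ ψ y =
        opK g D c DS (bracketForm g D κ μ) ψ y + sext ρ y • ψ y := by
    intro V L ρ hρ χ ψ hψ hyV
    rw [L.gradedComm_eq hD hS hκ.1.1 hμ.1.1 hψ hyV, hρ, map_add, L.opK_eq hD hS hb hψ hyV,
      L.sec_smul, hψ y hyV]
  have e1 := key _ K' r' h' χ ψ hχ hyW
  -- Both scalars measure the same defect on a nonvanishing frame spinor.
  have hsr : sext r' y = sext r y := by
    let A : Fin (finrank ℝ F) := ⟨0, finrank_pos⟩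
    obtain ⟨χ1, hχ1⟩ := K.exists_sec (K.s_frame.contMDiffOn A)
    obtain ⟨χ2, hχ2⟩ := K'.exists_sec (K'.s_frame.contMDiffOn A)
    have e2 := key _ K r h χ1 (K.s A) hχ1 hy
    have e3 := key _ K' r' h' χ2 (K.s A) hχ2 hyW
    rw [e2] at e3
    have h3 : (sext r y - sext r' y) • K.s A y = 0 := by
      rw [sub_smul, sub_eq_zero]
      exact add_left_cancel e3
    have h4 := (K.s_frame.linearIndependent hy).ne_zero A
    exact (sub_eq_zero.1 ((smul_eq_zero.1 h3).resolve_right h4)).symm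
  rw [e1, hsr, hyx]

theorem isKY_snBracket [Nontrivial F] (hD : IsLeviCivita g D) (hS : IsSpinorBundle g D c DS)
    {p q : ℕ} {κ : TField n M (p + 1)} {μ : TField n M (q + 1)} (hκ : IsKY g D κ)
    (hμ : IsKY g D μ) (hcond : AlgebraicConditions g κ μ) : IsKY g D (snBracket g D κ μ) :=
  have hs := isDiffForm_snBracket (g := g) hD hS hκ.1.1 hμ.1.1
  isKY_of_arrKY hD hS hs fun _ K => (K.exists_bracket hD hS hκ.1.1 hμ.1.1 hκ hμ hcond hs
    (isDiffForm_bracketForm hD hS hκ.1.1 hμ.1.1)).1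

theorem isKY_bracketForm [Nontrivial F] (hD : IsLeviCivita g D) (hS : IsSpinorBundle g D c DS)
    {p q : ℕ} {κ : TField n M (p + 1)} {μ : TField n M (q + 1)} (hκ : IsKY g D κ)
    (hμ : IsKY g D μ) (hcond : AlgebraicConditions g κ μ) : IsKY g D (bracketForm g D κ μ) :=
  have hs := isDiffForm_snBracket (g := g) hD hS hκ.1.1 hμ.1.1
  have hb := isDiffForm_bracketForm (g := g) hD hS hκ.1.1 hμ.1.1
  isKY_of_arrKY hD hS hb fun W K => by
    rw [K.comps_bracketForm hs hb]
    exact (K.exists_bracket hD hS hκ.1.1 hμ.1.1 hκ hμ hcond hs hb).1.smul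
      (SpinChart.spinors_faithful n F W) _

/-- A graded Killing-Yano bracket is determined by the Schouten-Nijenhuis bracket. -/
theorem IsGradedKYBracket.eq_bracketForm [Nontrivial F] (hD : IsLeviCivita g D)
    (hS : IsSpinorBundle g D c DS) {p q : ℕ} {κ : TField n M (p + 1)} {μ : TField n M (q + 1)}
    (hκ : IsKY g D κ) (hμ : IsKY g D μ) (hcond : AlgebraicConditions g κ μ)
    {θ : TField n M (p + q + 1)} (hθ : IsGradedKYBracket g D c DS κ μ θ) :
    θ = bracketForm g D κ μ := by
  have hs := isDiffForm_snBracket (g := g) hD hS hκ.1.1 hμ.1.1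
  have hb := isDiffForm_bracketForm (g := g) hD hS hκ.1.1 hμ.1.1
  funext x
  obtain ⟨W, hx, ⟨K⟩⟩ := hS.exists_chart x
  obtain ⟨-, r, -, -, h⟩ := K.exists_bracket hD hS hκ.1.1 hμ.1.1 hκ hμ hcond hs hb
  -- Only symbols are compared, so a nonzero scalar r would not obstruct the conclusion.
  have h1 : K.comps hθ.1.1.1 = K.comps hb := by
    refine SpinData.eq_of_arrOp (S := K.spinData hD hS) (SpinChart.spinors_faithful n F W)
      (K.comps_skew _) (K.comps_skew _) r fun χ => ?_
    rw [← h χ]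
    refine K.sec_ext fun y hy => ?_
    rw [← K.gradedComm_eq hD hS hκ.1.1 hμ.1.1 (ψ := fun y => K.sec y χ) (fun _ _ => rfl) hy,
      ← K.opK_eq hD hS hθ.1.1.1 (ψ := fun y => K.sec y χ) (fun _ _ => rfl) hy]
    exact (hθ.2 W _ K.isOpen (K.sec_smooth χ) y hy).symm
  have h2 : (hθ.1.1.1.alt x).toMultilinearMap - (hb.alt x).toMultilinearMap = 0 :=
    SpinChart.eq_zero_of_frame (K := K) (x := ⟨x, hx⟩) fun C => by
      have h3 := congrArg (fun α => (α C).1 ⟨x, hx⟩) h1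
      have h4 : θ x (fun i => K.e (C i) x) = bracketForm g D κ μ x fun i => K.e (C i) x := h3
      rw [hθ.1.1.1.alt_eq x, hb.alt_eq x] at h4
      exact sub_eq_zero.2 h4
  rw [hθ.1.1.1.alt_eq x, hb.alt_eq x]
  funext w
  exact sub_eq_zero.1 (congrArg (fun T : MultilinearMap ℝ
    (fun _ : Fin (p + q + 1) => TangentSpace (𝓡 n) x) ℝ => T w) h2)

theorem bracketForm_eq {p q : ℕ} {κ : TField n M (p + 1)} (hκ : IsDiffForm κ)
    (μ : TField n M (q + 1)) : (fun x w => -(((p + q)! : ℝ) / ((p ! : ℝ) * (q ! : ℝ))) *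
      snBracket g D (parity κ) μ x w) = bracketForm g D κ μ := by
  funext x w
  rw [snBracket_parity g D hκ, bracketForm]
  ring

end Components

end KYForms

end

/-! ### The theorem. -/

theorem mainTheorem9 {n : ℕ} {M : Type*} [TopologicalSpace M]
    [ChartedSpace (EuclideanSpace ℝ (Fin n)) M] [IsManifold (𝓡 n) ∞ M]
    (g : KYForms.PseudoMetric n M)
    (D : CovariantDerivative (𝓡 n) (EuclideanSpace ℝ (Fin n)) (TangentSpace (𝓡 n) : M → Type _))
    (hD : KYForms.IsLeviCivita g D)
    {F : Type*} [NormedAddCommGroup F] [NormedSpace ℝ F] [FiniteDimensional ℝ F] [Nontrivial F]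
    {S : M → Type*} [TopologicalSpace (TotalSpace F S)]
    [∀ x, AddCommGroup (S x)] [∀ x, Module ℝ (S x)] [∀ x, TopologicalSpace (S x)]
    [∀ x, IsTopologicalAddGroup (S x)] [∀ x, ContinuousSMul ℝ (S x)]
    [FiberBundle F S] [VectorBundle ℝ F S] [ContMDiffVectorBundle ∞ F S (𝓡 n)]
    (c : ∀ x : M, TangentSpace (𝓡 n) x →ₗ[ℝ] Module.End ℝ (S x))
    (DS : CovariantDerivative (𝓡 n) F S)
    (hS : KYForms.IsSpinorBundle g D c DS)
    {p q : ℕ} (κ : KYForms.TField n M (p + 1)) (μ : KYForms.TField n M (q + 1))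
    (hκ : KYForms.IsKY g D κ) (hμ : KYForms.IsKY g D μ)
    (hcond : KYForms.AlgebraicConditions g κ μ) :
    let ν : KYForms.TField n M (p + q + 1) := fun x w =>
      -(((p + q)! : ℝ) / ((p ! : ℝ) * (q ! : ℝ))) *
        KYForms.snBracket g D (KYForms.parity κ) μ x w
    KYForms.IsKY g D (KYForms.snBracket g D κ μ) ∧
    (¬ (p = q ∧ Odd p) → KYForms.IsGradedKYBracket g D c DS κ μ ν) ∧
    (∃ f : M → ℝ, IsLocallyConstant f ∧
      ∀ (U : Set M) (ψ : ∀ x : M, S x), IsOpen U →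
        ContMDiffOn (𝓡 n) ((𝓡 n).prod 𝓘(ℝ, F)) ∞ (fun x => TotalSpace.mk' F x (ψ x)) U →
        ∀ x ∈ U, KYForms.gradedComm g D c DS κ μ ψ x =
          KYForms.opK g D c DS ν ψ x + f x • ψ x) ∧
    (∀ θ : KYForms.TField n M (p + q + 1),
      KYForms.IsGradedKYBracket g D c DS κ μ θ → θ = ν) := by
  intro ν
  have hν : ν = KYForms.bracketForm g D κ μ := KYForms.bracketForm_eq hκ.1.1 μ
  -- Each point carries its own scalar, whose defect statement holds on a neighbourhood; uniqueness
  -- of the defect there makes f locally constant.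
  choose f hf0 hf using KYForms.exists_bracketDefect hD hS hκ hμ hcond
  have hfx : ∀ x, KYForms.BracketDefect g D c DS κ μ (KYForms.bracketForm g D κ μ) x (f x) :=
    fun x => (hf x).self_of_nhds
  rw [hν]
  refine ⟨KYForms.isKY_snBracket hD hS hκ hμ hcond,
    fun hpq => ⟨KYForms.isKY_bracketForm hD hS hκ hμ hcond, fun U ψ hU hψ x hx => ?_⟩,
    ⟨f, (IsLocallyConstant.iff_eventually_eq f).2 fun x => ?_, fun U ψ hU hψ x hx =>
      hfx x U ψ hU hψ hx⟩, fun θ hθ => hθ.eq_bracketForm hD hS hκ hμ hcond⟩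
  · have h := hfx x U ψ hU hψ hx
    rwa [hf0 x hpq, zero_smul, add_zero] at h
  · filter_upwards [hf x] with y hy
    exact (hfx y).unique hS hy
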